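/- Let $M$ be a smooth manifold (Hausdorff, second countable, without boundary) and $D=\{Z_i\}_{i\in I}$ a finite family of closed smooth hypersurfaces intersecting transversely (normal crossings). The log tangent bundle ${}^bTM$ is the vector bundle whose sections are the vector fields tangent to every $Z_i$; a log $k$-form is a smooth section of $\wedge^k({}^bTM)^*$. Let $\omega$ be a log symplectic form on $(M,D)$, i.e. a closed non-degenerate log $2$-form, and let $(a,(b_i),(c_{ij}))$, with $a\in H^2(M)$, $b_i\in H^1(Z_i)$, $c_{ij}=-c_{ji}\in H^0(Z_i\cap Z_j)$, be the decomposition of its class under the isomorphism ${}^bH^2(M)\simeq H^2(M)\oplus\bigoplus_iH^1(Z_i)\oplus\bigoplus_{\{i,j\}}H^0(Z_i\cap Z_j)$. Explicitly, on $M\setminus\bigcup_i Z_i$, $$\omega=a+\sum_i d\ell_i\wedge b_i+\sum_{\{i,j\}}c_{ij}\,d\ell_i\wedge d\ell_j+d\mu,$$ where $a$ is a closed $2$-form on $M$, $\ell_i$ is a function that is smooth off $Z_i$ and equals $\log|f|$ near each point of $Z_i$ for some local defining function $f$ of $Z_i$, $b_i$ is closed near $\operatorname{supp}\ell_i$, $c_{ij}$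 is locally constant near $\operatorname{supp}\ell_i\cap\operatorname{supp}\ell_j$, and $\mu$ is a log $1$-form. Assume that $\omega$ is partitionable: 1. if $b_s\ne0$ in $H^1(Z_s)$, then $c_{is}=0$ for all $i$; 2. if $c_{st}\neq 0$, then $b_s$ and $b_t$ restrict to $0$ in $H^1(Z_s\cap Z_t)$, and $c_{sj}=c_{it}=0$ for all $j\ne t$, $i\neq s$. Let $S\subseteq I$ be such that $X_S=\bigcap_{s\in S}Z_s$ is a maximal intersection: $X_S\ne\emptyset$, and $Z_i\cap X_S=\emptyset$ for $i\notin S$. Assume that * each $Z_s$, $s\in S$, has a defining function on an open set $W\supseteq X_S$ (for instance $W=M$), i.e. some $f\in C^\infty(W)$ with $Z_s\cap W=\{f=0\}$ and $df\ne0$ along $Z_s\cap W$; * for $s,t\in S$ the locally constant function $c_{st}|_{X_S}$ is either identically zero or nowhere zero (this is automatic if $X_S$ is connected or compact). Let $\Lambda_S$ be a labelling $Z_{x_1},Z_{y_1},\dots,Z_{x_k},Z_{y_k},Z_{z_1},\dots,Z_{z_m}$ of the members of $S$, each listed once, such that $c_{x_iy_i}|_{X_S}\neq0$ for all $i$ and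 $c_{z_jt}|_{X_S}=0$ for all $j$ and all $t\in S$. Then there exist defining functions $x_i,y_i,z_j\in C^\infty(W)$ of $Z_{x_i},Z_{y_i},Z_{z_j}$ on $W$; a tubular neighbourhood $U\subseteq W$ of $X_S$, with smooth projection $\pi:U\to X_S$, for which $(\pi,x,y,z)$ is a diffeomorphism of $U$ onto a neighbourhood $\{(q,t):|t_s|<\varepsilon(q)\text{ for all }s\in S\}$ of $X_S\times\{0\}$ in $X_S\times\mathbb R^S$, with $\varepsilon:X_S\to(0,\infty)$ continuous; closed forms $\alpha_j\in\Omega^1(X_S)$ representing $b_{z_j}|_{X_S}$ and a closed form $\delta\in\Omega^2(X_S)$ representing $a|_{X_S}$; and a diffeomorphism $\varphi$ of $U$ onto an open subset of $M$ with $\varphi|_{X_S}=\mathrm{id}$ and $\varphi^{-1}(Z_i)=U\cap Z_i$ for every $i\in I$, such that $$\varphi^*\omega=\sum_{i=1}^k c_{x_iy_i}\,\frac{dx_i}{x_i}\wedge\frac{dy_i}{y_i}+\sum_{j=1}^m\frac{dz_j}{z_j}\wedge\alpha_j+\delta\qquad\text{on }U\setminus\textstyle\bigcup_i Z_i,$$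 where $\alpha_j$, $\delta$ and the locally constant functions $c_{x_iy_i}|_{X_S}$ are pulled back to $U$ by $\pi$. -/

import Mathlib

open Set Filter Topology
open scoped Manifold ContDiff

namespace LogSymp

noncomputable section

/-- The model space `ℝᵈ`. Mathlib's tangent space `TangentSpace (𝓡 d) p` of a manifold modelled
on it is, by definition, this space. -/
abbrev Model (d : ℕ) := EuclideanSpace ℝ (Fin d)

/-! ### Differential forms on a manifold -/

/-- (Not necessarily smooth) differential `k`-forms on the `d`-manifold `M`: the value at `p` is an
alternating `k`-linear form on `T_p M`. -/
abbrev DForm (d : ℕ) (M : Type*) (k : ℕ) := M → Model d [⋀^Fin k]→L[ℝ] ℝ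

/-- The wedge product `α ∧ β` of a covector and an alternating `k`-form; for `k = 1` it is
`(v, w) ↦ α v * β w - α w * β v`. -/
def wedge {d k : ℕ} (α : Model d →L[ℝ] ℝ) (β : Model d [⋀^Fin k]→L[ℝ] ℝ) :
    Model d [⋀^Fin (k + 1)]→L[ℝ] ℝ :=
  ContinuousAlternatingMap.alternatizeUncurryFin (α.smulRight β)

/-- A covector as an alternating `1`-form. -/
def toOneForm {d : ℕ} (α : Model d →L[ℝ] ℝ) : Model d [⋀^Fin 1]→L[ℝ] ℝ :=
  ContinuousAlternatingMap.ofSubsingleton ℝ (Model d) ℝ (0 : Fin 1) α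

section Manifold

variable {d k : ℕ} {M : Type*} [TopologicalSpace M] [ChartedSpace (Model d) M]

/-- The differential `(df)_p` of a real function. -/
def dfun (f : M → ℝ) (p : M) : Model d →L[ℝ] ℝ := mfderiv (𝓡 d) 𝓘(ℝ, ℝ) f p

/-- The logarithmic differential `(df / f)_p`, used at points with `f p ≠ 0`. -/
def dlog (f : M → ℝ) (p : M) : Model d →L[ℝ] ℝ := (f p)⁻¹ • dfun f p

/-- The pullback `φ^* Ω` of a form by a self-map. -/
def pullback (φ : M → M) (Ω : DForm d M k) : DForm d M k := fun p =>
  (Ω (φ p)).compContinuousLinearMap (mfderiv (𝓡 d) (𝓡 d) φ p : Model d →L[ℝ] Model d)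

/-- The expression of a form in the coordinates of a chart `e`, a form on `e.target ⊆ ℝᵈ`. -/
def inChart (e : OpenPartialHomeomorph M (Model d)) (Ω : DForm d M k) :
    Model d → Model d [⋀^Fin k]→L[ℝ] ℝ := fun x =>
  (Ω (e.symm x)).compContinuousLinearMap
    (mfderiv (𝓡 d) (𝓡 d) e.symm x : Model d →L[ℝ] Model d)

/-- A form is smooth if its coordinate expressions are. -/
def IsSmoothForm (Ω : DForm d M k) : Prop :=
  ∀ p : M, ContDiffAt ℝ ∞ (inChart (chartAt (Model d) p) Ω) (chartAt (Model d) p p)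

/-- The exterior derivative, computed at `p` in the preferred chart at `p`. -/
def extD (Ω : DForm d M k) : DForm d M (k + 1) := fun p =>
  (extDeriv (inChart (chartAt (Model d) p) Ω) (chartAt (Model d) p p)).compContinuousLinearMap
    (mfderiv (𝓡 d) (𝓡 d) (chartAt (Model d) p) p : Model d →L[ℝ] Model d)

/-! ### Forms on closed submanifolds

A differential form on a closed submanifold `A` of `M` is the restriction to `A` of a smooth form
on `M`, so that `Ωᵏ(A)` is `Ωᵏ(M)` modulo forms with zero restriction; forms on `A` are therefore
represented by forms on `M`, of which only the restriction to `A` matters. -/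

/-- The tangent space at `p ∈ A` of a closed submanifold `A` of `M`: the tangent vectors of `M` that
are killed by the differentials of all smooth functions vanishing on `A`. -/
def tangentTo (d : ℕ) {M : Type*} [TopologicalSpace M] [ChartedSpace (Model d) M]
    (A : Set M) (p : M) : Set (Model d) :=
  {v | ∀ f : M → ℝ, ContMDiff (𝓡 d) 𝓘(ℝ, ℝ) ∞ f → (∀ q ∈ A, f q = 0) → dfun f p v = 0}

/-- `α` and `β` have the same restriction to the submanifold `A`. -/
def EqOnSubmanifold (A : Set M) (α β : DForm d M k) : Prop :=
  ∀ p ∈ A, ∀ v : Fin k → Model d, (∀ i, v i ∈ tangentTo d A p) → α p v = β p v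

/-- The restriction of `α` to `A` is a closed form on `A`. -/
def IsClosedOn (A : Set M) (α : DForm d M k) : Prop :=
  EqOnSubmanifold A (extD α) 0

/-- The `1`-forms `α`, `β` restrict to cohomologous forms on `A`: equal classes in `H¹(A)`. -/
def Cohomologous₁ (A : Set M) (α β : DForm d M 1) : Prop :=
  ∃ h : M → ℝ, ContMDiff (𝓡 d) 𝓘(ℝ, ℝ) ∞ h ∧
    EqOnSubmanifold A (α - β) (fun p => toOneForm (dfun h p))

/-- The `2`-forms `α`, `β` restrict to cohomologous forms on `A`: equal classes in `H²(A)`. -/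
def Cohomologous₂ (A : Set M) (α β : DForm d M 2) : Prop :=
  ∃ η : DForm d M 1, IsSmoothForm η ∧ EqOnSubmanifold A (α - β) (extD η)

/-! ### Normal crossing divisors and logarithmic forms -/

variable {ι : Type*}

/-- `f` is a smooth defining function, on the open set `W`, of the hypersurface `Y`. -/
structure IsDefiningFunctionOn (Y W : Set M) (f : M → ℝ) : Prop where
  smooth : ContMDiffOn (𝓡 d) 𝓘(ℝ, ℝ) ∞ f W
  zero_iff : ∀ q ∈ W, q ∈ Y ↔ f q = 0
  dfun_ne_zero : ∀ q ∈ W, q ∈ Y → dfun (d := d) f q ≠ 0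

/-- A chart around `p` in which the hypersurfaces `Z i` through `p` are distinct coordinate
hyperplanes `{x_(κ i) = 0}` and which does not meet the other `Z i`. -/
structure IsAdaptedChart (Z : ι → Set M) (p : M) (e : OpenPartialHomeomorph M (Model d))
    (κ : {i // p ∈ Z i} ↪ Fin d) : Prop where
  mem_atlas : e ∈ IsManifold.maximalAtlas (𝓡 d) ∞ M
  mem_source : p ∈ e.source
  mem_iff : ∀ q ∈ e.source, ∀ i : {i // p ∈ Z i}, q ∈ Z i.1 ↔ e q (κ i) = 0
  not_mem : ∀ q ∈ e.source, ∀ i, p ∉ Z i → q ∉ Z i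

/-- The `Z i` are closed smooth hypersurfaces that intersect transversely (normal crossings). -/
def IsNormalCrossing (d : ℕ) {M : Type*} [TopologicalSpace M] [ChartedSpace (Model d) M]
    (Z : ι → Set M) : Prop :=
  ∀ p : M, ∃ (e : OpenPartialHomeomorph M (Model d)) (κ : {i // p ∈ Z i} ↪ Fin d),
    IsAdaptedChart Z p e κ

open Classical in
/-- The anchor of the log tangent bundle in an adapted chart: at the point with coordinates `x`, the
`j`-th basis vector is sent to `x_j ∂_j` if `{x_j = 0}` is one of the hypersurfaces, and to `∂_j`
otherwise. -/
def logFrame {σ : Type*} (κ : σ ↪ Fin d) (x : Model d) : Model d →L[ℝ] Model d :=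
  Matrix.toEuclideanCLM (𝕜 := ℝ)
    (Matrix.diagonal fun j => if j ∈ range κ then x j else (1 : ℝ))

/-- `G` is the coordinate expression of `Ω` with respect to the log frame (`x_j ∂_j` or `∂_j`) of
the adapted chart `e`, and it is smooth up to and including the hypersurfaces. -/
def IsLogExpression (Z : ι → Set M) (Ω : DForm d M k) (e : OpenPartialHomeomorph M (Model d))
    {σ : Type*} (κ : σ ↪ Fin d) (G : Model d → Model d [⋀^Fin k]→L[ℝ] ℝ) : Prop :=
  ContDiffOn ℝ ∞ G e.target ∧
    ∀ x ∈ e.target, e.symm x ∉ ⋃ i, Z i →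
      (inChart e Ω x).compContinuousLinearMap (logFrame κ x) = G x

/-- `Ω` is a log `k`-form on `(M, D)`, i.e. a smooth section of the `k`-th exterior power of the
dual of the log tangent bundle. Only the values of `Ω` off the hypersurfaces matter. -/
def IsLogForm (Z : ι → Set M) (Ω : DForm d M k) : Prop :=
  ∀ p : M, ∃ (e : OpenPartialHomeomorph M (Model d)) (κ : {i // p ∈ Z i} ↪ Fin d)
    (G : Model d → Model d [⋀^Fin k]→L[ℝ] ℝ),
    IsAdaptedChart Z p e κ ∧ IsLogExpression Z Ω e κ G

/-- A log symplectic form: a log `2`-form that is closed and non-degenerate, at every point of `M`,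
as a form on the log tangent bundle. -/
structure IsLogSymplectic (Z : ι → Set M) (Ω : DForm d M 2) : Prop where
  log_nondegenerate : ∀ p : M, ∃ (e : OpenPartialHomeomorph M (Model d))
    (κ : {i // p ∈ Z i} ↪ Fin d) (G : Model d → Model d [⋀^Fin 2]→L[ℝ] ℝ),
    IsAdaptedChart Z p e κ ∧ IsLogExpression Z Ω e κ G ∧
      ∀ v : Model d, (∀ w : Model d, G (e p) ![v, w] = 0) → v = 0
  closed : ∀ p ∉ ⋃ i, Z i, extD Ω p = 0

/-! ### The decomposition of a class in log cohomology -/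

/-- `ℓ` is smooth off the hypersurface `Y` and near `Y` equals `log |f|` for local defining
functions `f`. So `dℓ` is a closed log `1`-form with residue `1` along `Y`. -/
structure IsLogPotential (d : ℕ) {M : Type*} [TopologicalSpace M] [ChartedSpace (Model d) M]
    (Y : Set M) (ℓ : M → ℝ) : Prop where
  smooth : ∀ p ∉ Y, ContMDiffAt (𝓡 d) 𝓘(ℝ, ℝ) ∞ ℓ p
  log_near : ∀ p ∈ Y, ∃ (V : Set M) (f : M → ℝ), IsOpen V ∧ p ∈ V ∧
    IsDefiningFunctionOn (d := d) Y V f ∧ ∀ q ∈ V, q ∉ Y → ℓ q = Real.log |f q|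

/-- The class `[Ω]` of the closed log `2`-form `Ω` corresponds to
`([a], [b_i], [c_ij]) ∈ H²(M) ⊕ ⨁ H¹(Z_i) ⊕ ⨁ H⁰(Z_i ∩ Z_j)` under the isomorphism between log
cohomology and this sum. The isomorphism takes a closed form `b_i` on `Z_i`, extended to a closed
form near the support of a log potential `ℓ_i` of `Z_i`, to the class of `dℓ_i ∧ b_i`, and a locally
constant function `c_ij` on `Z_i ∩ Z_j`, extended likewise, to the class of `c_ij dℓ_i ∧ dℓ_j`. The
convention `c_ji = -c_ij` is used, and the factor `1/2` makes the sum one over unordered pairs. -/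
def IsDecomposition [Fintype ι] (Z : ι → Set M) (Ω : DForm d M 2)
    (a : DForm d M 2) (b : ι → DForm d M 1) (c : ι → ι → M → ℝ) : Prop :=
  IsSmoothForm a ∧ (∀ p, extD a p = 0) ∧ (∀ i, IsSmoothForm (b i)) ∧
  (∀ i j p, c j i p = -c i j p) ∧
  ∃ (ℓ : ι → M → ℝ) (μ : DForm d M 1),
    (∀ i, IsLogPotential d (Z i) (ℓ i)) ∧
    (∀ i, ∀ p ∈ tsupport (ℓ i), ∀ᶠ q in 𝓝 p, extD (b i) q = 0) ∧
    (∀ i j, ∀ p ∈ tsupport (ℓ i) ∩ tsupport (ℓ j), ∀ᶠ q in 𝓝 p, c i j q = c i j p) ∧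
    IsLogForm Z μ ∧
    ∀ p ∉ ⋃ i, Z i,
      Ω p = a p + ∑ i, wedge (dfun (ℓ i) p) (b i p)
        + (1 / 2 : ℝ) • ∑ i, ∑ j, c i j p • wedge (dfun (ℓ i) p) (toOneForm (dfun (ℓ j) p))
        + extD μ p

/-- `c_ij = 0` in `H⁰(Z_i ∩ Z_j)`. -/
def VanishesOn (A : Set M) (c : M → ℝ) : Prop := ∀ p ∈ A, c p = 0

/-- A log symplectic form is partitionable if the decomposition of its class (whose components do
not depend on the choices made in it) satisfies the two conditions below. -/
def IsPartitionable [Fintype ι] (Z : ι → Set M) (Ω : DForm d M 2) : Prop :=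
  ∀ (a : DForm d M 2) (b : ι → DForm d M 1) (c : ι → ι → M → ℝ), IsDecomposition Z Ω a b c →
    (∀ s, ¬ Cohomologous₁ (Z s) (b s) 0 → ∀ i, VanishesOn (Z i ∩ Z s) (c i s)) ∧
    (∀ s t, ¬ VanishesOn (Z s ∩ Z t) (c s t) →
      Cohomologous₁ (Z s ∩ Z t) (b s) 0 ∧ Cohomologous₁ (Z s ∩ Z t) (b t) 0 ∧
      (∀ j, j ≠ t → VanishesOn (Z s ∩ Z j) (c s j)) ∧
      (∀ i, i ≠ s → VanishesOn (Z i ∩ Z t) (c i t)))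

/-! ### Maximal intersections and the normal form -/

/-- The intersection `X_S`. -/
def inter (Z : ι → Set M) (S : Set ι) : Set M := ⋂ s ∈ S, Z s

/-- `X_S` is non-empty and meets no hypersurface outside `S`. -/
def IsMaximalIntersection (Z : ι → Set M) (S : Set ι) : Prop :=
  (inter Z S).Nonempty ∧ ∀ i ∉ S, Z i ∩ inter Z S = ∅

/-- A labelling of `S` as `x_1, y_1, …, x_k, y_k, z_1, …, z_m` that is the partition determined by
the components `c` of the class restricted to `X_S`: the members of a pair `x_i, y_i` have
`c_(x_i, y_i) ≠ 0` on `X_S`, and those of type `z` are unpaired in `S`. -/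
structure IsSubpartition (Z : ι → Set M) (c : ι → ι → M → ℝ) (S : Set ι) {k m : ℕ}
    (x y : Fin k → ι) (z : Fin m → ι) : Prop where
  bij : BijOn (Sum.elim x (Sum.elim y z)) univ S
  pair : ∀ i, ¬ VanishesOn (inter Z S) (c (x i) (y i))
  unpaired : ∀ j, ∀ t ∈ S, VanishesOn (inter Z S) (c (z j) t)

/-- `U` is a tubular neighbourhood of `X` in `M` with projection `π`, trivialized by the functions
`f s`, `s ∈ S`: the map `(π, (f s)_s)` is a diffeomorphism of `U` onto the neighbourhood
`{(q, t) | |t_s| < ε q for all s ∈ S}` of `X × {0}` in `X × ℝ^S` and restricts to the identity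
of `X`. -/
structure IsTubularNeighborhood (X : Set M) (S : Set ι) (f : ι → M → ℝ) (U : Set M)
    (π : M → M) (ε : M → ℝ) : Prop where
  isOpen : IsOpen U
  subset : X ⊆ U
  smooth_proj : ContMDiffOn (𝓡 d) (𝓡 d) ∞ π U
  smooth_coord : ∀ s ∈ S, ContMDiffOn (𝓡 d) 𝓘(ℝ, ℝ) ∞ (f s) U
  proj_mem : ∀ u ∈ U, π u ∈ X
  proj_eq : ∀ q ∈ X, π q = q ∧ ∀ s ∈ S, f s q = 0
  radius : ContinuousOn ε X ∧ ∀ q ∈ X, 0 < ε q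
  coord_lt : ∀ u ∈ U, ∀ s ∈ S, |f s u| < ε (π u)
  injective : ∀ u ∈ U, ∀ u' ∈ U, π u = π u' → (∀ s ∈ S, f s u = f s u') → u = u'
  surjective : ∀ q ∈ X, ∀ t : ι → ℝ, (∀ s ∈ S, |t s| < ε q) →
    ∃ u ∈ U, π u = q ∧ ∀ s ∈ S, f s u = t s
  immersive : ∀ u ∈ U, ∀ w : Model d, (mfderiv (𝓡 d) (𝓡 d) π u : Model d →L[ℝ] Model d) w = 0 →
    (∀ s ∈ S, dfun (f s) u w = 0) → w = 0

/-- The form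
`∑ (c_i ∘ π) (dx_i / x_i) ∧ (dy_i / y_i) + ∑ (dz_j / z_j) ∧ π^* α_j + π^* δ`. -/
def normalForm {k m : ℕ} (π : M → M) (c : Fin k → M → ℝ) (x y : Fin k → M → ℝ)
    (z : Fin m → M → ℝ) (α : Fin m → DForm d M 1) (δ : DForm d M 2) : DForm d M 2 := fun u =>
  ∑ i, c i (π u) • wedge (dlog (x i) u) (toOneForm (dlog (y i) u))
    + ∑ j, wedge (dlog (z j) u) (pullback π (α j) u) + pullback π δ u

/-- `φ`, defined on the open set `φ.source`, is a diffeomorphism onto an open set that respects every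
hypersurface (hence a `b`-map, as is its inverse) and satisfies `φ^* Ω = Ω₀`. -/
structure IsLogSymplectomorphism (Z : ι → Set M) (φ : OpenPartialHomeomorph M M)
    (Ω Ω₀ : DForm d M 2) : Prop where
  smooth : ContMDiffOn (𝓡 d) (𝓡 d) ∞ φ φ.source
  smooth_symm : ContMDiffOn (𝓡 d) (𝓡 d) ∞ φ.symm φ.target
  mem_iff : ∀ u ∈ φ.source, ∀ i, φ u ∈ Z i ↔ u ∈ Z i
  pullback_eq : ∀ u ∈ φ.source, u ∉ ⋃ i, Z i → pullback φ Ω u = Ω₀ u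

end Manifold

end

end LogSymp

namespace LogSymp

noncomputable section

open scoped unitInterval

set_option linter.unusedSectionVars false

/-! ### Smooth dependence of solutions of differential equations on initial values -/


/-! A log form is read through its components in a log frame: the coordinate fields of an adapted
chart, with `∂_s` replaced by `x_s ∂_s` for each hyperplane `x_s = 0`. The components are smooth
across the hypersurfaces, and at the points of `X = X_S` those of `ω` form a family of nondegenerate
alternating forms. Two facts give the theorem. Near `X`, the form `ω` is determined by this family,
up to a diffeomorphism that fixes `X` and respects the hypersurfaces; and the family takes the
required shape after a good choice of defining functions.

The first fact is a Moser argument. The flow of vector fields dual to the defining functions `f_s`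
provides a projection `π` such that `(π, f)` trivializes a neighbourhood of `X` (`exists_tube`).
Fibrewise dilations act trivially on log frames, so extending the components of `ω` from `X`
constantly along the fibres gives another closed log form, the model. Its difference from `ω`
vanishes on `X`. Contraction with the Euler field `∑ x_s ∂_s`, whose log components are constant,
and integration over the dilations produce a log primitive (`fderiv_moserPrim`). The affine path
from the model to `ω` is nondegenerate near `X`. The resulting Moser field is a combination of log
frame vectors, so its flow respects the hypersurfaces; it vanishes on `X`, so its time-one map
exists near `X` without compactness; and it carries the model to `ω` (`moser_invariance`).
Transitions between tubular charts commute with all ingredients, so the local fields glue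
(`moserField_natural`, `exists_moser_equivalence`). Smooth dependence of flows on initial values
comes from the inverse function theorem for the integral equation on a Banach space of curves, whose
linearization is a Volterra operator (`isUnit_one_sub_volterra`).

The second fact is a computation on `X`. Near `X` write `ℓ_i = log |f_s| + H_i` if `i` is the label
of `s`, and `ℓ_i = H_i` otherwise; let `R_s` be the residue of `μ` along the hypersurface of `s`,
and put `F_s = ∑_j c_sj H_j - R_s`. Then (`IsReducedDecomp.normal_at`) the component of `ω` on two
normal frame vectors is `c_st`, on a normal frame vector and a tangent vector of `X` it is `b_s +
dF_s`, and on tangent vectors of `X` it is `a + dη` with `η = μ|_X + ∑ H_i b_i + ½ ∑ c_ij H_i dH_j`.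
Replacing `f_s` by `f_s e^{u_s}` changes `F_s` to `F_s - ∑_t c_st u_t`
(`IsDecomposition.exists_isReducedDecomp`). Partitionability makes `c` on `X` a sum of invertible `2
× 2` blocks on the pairs `x_i, y_i`, for which `b` is exact on `X`. Hence `u` can be chosen so that
`b + dF` vanishes for all paired labels; for the others it is the form `α_j`, and `δ = a + dη`
(`exists_normalForm`). -/

/-- Continuous curves on the unit interval, with the supremum norm. -/
def Curve (F : Type) [NormedAddCommGroup F] : Type := C(I, F)

namespace Curve

variable {F : Type} [NormedAddCommGroup F]

instance : NormedAddCommGroup (Curve F) := inferInstanceAs (NormedAddCommGroup C(I, F))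
instance [NormedSpace ℝ F] : NormedSpace ℝ (Curve F) := inferInstanceAs (NormedSpace ℝ C(I, F))
instance [CompleteSpace F] : CompleteSpace (Curve F) := inferInstanceAs (CompleteSpace C(I, F))
instance : FunLike (Curve F) I F := inferInstanceAs (FunLike C(I, F) I F)
instance : ContinuousMapClass (Curve F) I F := inferInstanceAs (ContinuousMapClass C(I, F) I F)

/-- The curve given by a continuous function. -/
def mk (f : I → F) (hf : Continuous f) : Curve F := (⟨f, hf⟩ : C(I, F))

@[simp] lemma mk_apply (f : I → F) (hf : Continuous f) (t : I) : mk f hf t = f t := rfl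
@[simp] lemma add_apply (γ η : Curve F) (t : I) : (γ + η) t = γ t + η t := rfl
@[simp] lemma sub_apply (γ η : Curve F) (t : I) : (γ - η) t = γ t - η t := rfl
@[simp] lemma zero_apply (t : I) : (0 : Curve F) t = 0 := rfl
@[simp] lemma smul_apply [NormedSpace ℝ F] (c : ℝ) (γ : Curve F) (t : I) : (c • γ) t = c • γ t := rfl

@[ext] lemma ext {γ η : Curve F} (h : ∀ t, γ t = η t) : γ = η := DFunLike.ext _ _ h

protected lemma continuous (γ : Curve F) : Continuous γ := map_continuous γ

lemma norm_coe_le_norm (γ : Curve F) (t : I) : ‖γ t‖ ≤ ‖γ‖ := ContinuousMap.norm_coe_le_norm _ t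

lemma norm_le (γ : Curve F) {C : ℝ} (hC : 0 ≤ C) : ‖γ‖ ≤ C ↔ ∀ t, ‖γ t‖ ≤ C :=
  ContinuousMap.norm_le _ hC

lemma dist_apply_le (γ η : Curve F) (t : I) : dist (γ t) (η t) ≤ dist γ η :=
  ContinuousMap.dist_apply_le_dist (f := (γ : C(I, F))) (g := η) t

/-- Superposition of a curve with a continuous map. -/
def map {G : Type} [NormedAddCommGroup G] (g : F → G) (hg : Continuous g) (γ : Curve F) : Curve G :=
  mk (fun t => g (γ t)) (hg.comp γ.continuous)

@[simp] lemma map_apply {G : Type} [NormedAddCommGroup G] (g : F → G) (hg : Continuous g)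
    (γ : Curve F) (t : I) : map g hg γ t = g (γ t) := rfl

lemma continuous_map {G : Type} [NormedAddCommGroup G] (g : F → G) (hg : Continuous g) :
    Continuous (map g hg) :=
  ContinuousMap.continuous_postcomp (⟨g, hg⟩ : C(F, G))

end Curve

/-! ### Smoothness of superposition operators on continuous curves -/

section Superposition

variable {F G : Type} [NormedAddCommGroup F] [NormedSpace ℝ F] [NormedAddCommGroup G]
  [NormedSpace ℝ G]

/-- Pointwise application of a curve of linear maps to a curve of vectors. -/
def applyCM (F G : Type) [NormedAddCommGroup F] [NormedSpace ℝ F] [NormedAddCommGroup G]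
    [NormedSpace ℝ G] : Curve (F →L[ℝ] G) →L[ℝ] Curve F →L[ℝ] Curve G :=
  LinearMap.mkContinuous₂
    (LinearMap.mk₂ ℝ (fun (A : Curve (F →L[ℝ] G)) (γ : Curve F) =>
      Curve.mk (fun t => A t (γ t)) (A.continuous.clm_apply γ.continuous))
      (fun _ _ _ => by ext; simp) (fun _ _ _ => by ext; simp) (fun _ _ _ => by ext; simp)
      (fun _ _ _ => by ext; simp)) 1 (fun A γ => by
        refine (Curve.norm_le _ (by positivity)).2 fun t => ?_
        simp only [LinearMap.mk₂_apply, one_mul]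
        exact (ContinuousLinearMap.le_opNorm _ _).trans
          (mul_le_mul (A.norm_coe_le_norm t) (γ.norm_coe_le_norm t) (norm_nonneg _) (norm_nonneg A)))

@[simp] lemma applyCM_apply (A : Curve (F →L[ℝ] G)) (γ : Curve F) (t : I) :
    applyCM F G A γ t = A t (γ t) := rfl

/-- The mean value inequality bounds the Taylor remainder uniformly in time once `fderiv ℝ g` varies
by at most `ε` on the `δ`-tube around `γ`. Such a `δ` comes from continuity of superposition with
`fderiv ℝ g` in the supremum norm. -/
lemma hasFDerivAt_comp_left {g : F → G} (hg : ContDiff ℝ 1 g) (γ : Curve F) :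
    HasFDerivAt (fun γ : Curve F => γ.map g hg.continuous)
      (applyCM F G (γ.map (fderiv ℝ g) (hg.continuous_fderiv (by simp)))) γ := by
  have hc : Continuous fun γ : Curve F =>
      γ.map (fderiv ℝ g) (hg.continuous_fderiv (by simp)) :=
    Curve.continuous_map _ _
  rw [hasFDerivAt_iff_isLittleO_nhds_zero, Asymptotics.isLittleO_iff]
  intro ε hε
  have hca := hc.continuousAt (x := γ)
  obtain ⟨δ, hδ, hδ'⟩ := (Metric.continuousAt_iff (α := Curve F) (β := Curve (F →L[ℝ] G))).1 hca ε hε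
  filter_upwards [Metric.ball_mem_nhds (0 : Curve F) hδ] with h hh
  rw [Curve.norm_le _ (by positivity)]
  intro t
  have key : ∀ y ∈ Metric.ball (γ t) δ, ‖fderiv ℝ g y - fderiv ℝ g (γ t)‖ ≤ ε := by
    intro y hy
    -- Adding the constant curve `y - γ t` gives a curve within `δ` of `γ` that passes through `y`
    -- at time `t`; this turns the estimate for curves into one for points.
    have h1 : dist (γ + Curve.mk (fun _ : I => y - γ t) continuous_const) γ < δ := by
      rw [dist_eq_norm, add_sub_cancel_left]
      refine lt_of_le_of_lt ((Curve.norm_le _ (norm_nonneg (y - γ t))).2 fun s => ?_)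
        (by simpa [dist_eq_norm] using hy)
      simp
    have h2 := hδ' h1
    have h3 := ((Curve.dist_apply_le _ _ t).trans_lt h2).le
    rw [dist_eq_norm] at h3
    simpa using h3
  have hcx : Convex ℝ (Metric.ball (γ t) δ) := convex_ball _ _
  have hht : ‖h t‖ < δ := lt_of_le_of_lt (h.norm_coe_le_norm t) (by simpa using hh)
  have := hcx.norm_image_sub_le_of_norm_hasFDerivWithin_le'
    (f := g) (f' := fderiv ℝ g) (φ := fderiv ℝ g (γ t)) (C := ε) (x := γ t) (y := γ t + h t)
    (fun y _ => ((hg.differentiable (by simp)) y).hasFDerivAt.hasFDerivWithinAt) key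
    (Metric.mem_ball_self hδ) (by simpa [dist_eq_norm] using hht)
  simp only [add_sub_cancel_left] at this
  refine le_trans (le_of_eq ?_) (this.trans
    (mul_le_mul_of_nonneg_left (h.norm_coe_le_norm t) hε.le))
  rfl

/-- Induction on the order: the derivative is pointwise application of the superposition with
`fderiv ℝ g`, again a superposition operator. The target is quantified inside the statement because
it changes from `G` to `F →L[ℝ] G`. -/
theorem contDiff_comp_left_nat (n : ℕ) : ∀ {G : Type} [NormedAddCommGroup G] [NormedSpace ℝ G]
    {g : F → G} (hg : ContDiff ℝ ∞ g),
    ContDiff ℝ n (fun γ : Curve F => γ.map g hg.continuous) := by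
  induction n with
  | zero =>
    intro G _ _ g hg
    exact contDiff_zero.2 (Curve.continuous_map _ _)
  | succ n ih =>
    intro G _ _ g hg
    rw [Nat.cast_add, Nat.cast_one, contDiff_succ_iff_hasFDerivAt]
    have hg' : ContDiff ℝ ∞ (fderiv ℝ g) := (contDiff_infty_iff_fderiv.1 hg).2
    have h1 : ContDiff ℝ n (fun A : Curve (F →L[ℝ] G) => applyCM F G A) :=
      ContinuousLinearMap.contDiff (applyCM F G)
    exact ⟨fun γ => applyCM F G (γ.map (fderiv ℝ g) hg'.continuous),
      h1.comp (ih hg'),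
      fun γ => hasFDerivAt_comp_left (hg.of_le (by simp)) γ⟩

/-- Superposition with a smooth map is a smooth operator on continuous curves. -/
theorem contDiff_comp_left {g : F → G} (hg : ContDiff ℝ ∞ g) :
    ContDiff ℝ ∞ (fun γ : Curve F => γ.map g hg.continuous) :=
  contDiff_infty.2 fun n => contDiff_comp_left_nat n hg

end Superposition

/-! ### Integration of curves and invertibility of Volterra operators -/

section Integration

variable {F G : Type} [NormedAddCommGroup F] [NormedSpace ℝ F] [NormedAddCommGroup G]
  [NormedSpace ℝ G]

/-- The extension of a curve on the unit interval by its end points. -/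
def extend (γ : Curve F) (s : ℝ) : F := γ (projIcc 0 1 zero_le_one s)

lemma continuous_extend (γ : Curve F) : Continuous (extend γ) :=
  γ.continuous.comp continuous_projIcc

lemma extend_coe (γ : Curve F) (t : I) : extend γ t = γ t := by
  simp [extend]

lemma extend_of_mem (γ : Curve F) {t : ℝ} (ht : t ∈ Icc (0 : ℝ) 1) : extend γ t = γ ⟨t, ht⟩ := by
  simp [extend, projIcc_of_mem zero_le_one ht]

lemma norm_extend_le (γ : Curve F) (s : ℝ) : ‖extend γ s‖ ≤ ‖γ‖ := γ.norm_coe_le_norm _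

/-- Integration of curves from the initial time. -/
def integCM (F : Type) [NormedAddCommGroup F] [NormedSpace ℝ F] : Curve F →L[ℝ] Curve F :=
  LinearMap.mkContinuous
    { toFun := fun γ => Curve.mk (fun t => ∫ s in (0 : ℝ)..t, extend γ s)
        ((intervalIntegral.continuous_primitive
          (fun a b => (continuous_extend γ).intervalIntegrable a b) 0).comp continuous_subtype_val)
      map_add' := fun γ η => by
        ext t
        exact intervalIntegral.integral_add ((continuous_extend γ).intervalIntegrable _ _)
          ((continuous_extend η).intervalIntegrable _ _)
      map_smul' := fun c γ => by
        ext t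
        exact intervalIntegral.integral_smul c _ } 1 (fun γ => by
    rw [one_mul, Curve.norm_le _ (norm_nonneg _)]
    intro t
    refine (intervalIntegral.norm_integral_le_of_norm_le_const (C := ‖γ‖)
      (fun s _ => norm_extend_le γ s)).trans ?_
    have := t.2.1
    have := t.2.2
    rw [sub_zero, abs_of_nonneg t.2.1]
    nlinarith [norm_nonneg γ])

lemma integCM_apply (γ : Curve F) (t : I) : integCM F γ t = ∫ s in (0 : ℝ)..t, extend γ s := rfl

/-- Each integration of `s ^ n` contributes a factor `1 / (n + 1)`, whence the factorial, which
beats any power of `‖A‖`. -/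
lemma volterra_pow_le (A : Curve (F →L[ℝ] F)) (n : ℕ) (γ : Curve F) (t : I) :
    ‖((integCM F ∘L applyCM F F A) ^ n) γ t‖ ≤ (‖A‖ * t) ^ n / n.factorial * ‖γ‖ := by
  induction n generalizing t with
  | zero => simpa using γ.norm_coe_le_norm t
  | succ n ih =>
    rw [pow_succ']
    change ‖∫ s in (0 : ℝ)..t, extend (applyCM F F A (((integCM F ∘L applyCM F F A) ^ n) γ)) s‖ ≤ _
    have h1 : ∀ s ∈ Ioc (0 : ℝ) t,
        ‖extend (applyCM F F A (((integCM F ∘L applyCM F F A) ^ n) γ)) s‖ ≤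
          ‖A‖ * ((‖A‖ * s) ^ n / n.factorial * ‖γ‖) := by
      intro s hs
      have hs' : s ∈ Icc (0 : ℝ) 1 := ⟨hs.1.le, hs.2.trans t.2.2⟩
      rw [extend_of_mem _ hs', applyCM_apply]
      exact (ContinuousLinearMap.le_opNorm _ _).trans
        (mul_le_mul (A.norm_coe_le_norm _) (ih ⟨s, hs'⟩) (norm_nonneg _) (norm_nonneg A))
    refine (intervalIntegral.norm_integral_le_of_norm_le t.2.1
      (Filter.Eventually.of_forall h1) ((by fun_prop : Continuous fun s : ℝ =>
        ‖A‖ * ((‖A‖ * s) ^ n / n.factorial * ‖γ‖)).intervalIntegrable _ _)).trans (le_of_eq ?_)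
    have : (fun s : ℝ => ‖A‖ * ((‖A‖ * s) ^ n / n.factorial * ‖γ‖)) =
        fun s => (‖A‖ ^ (n + 1) / n.factorial * ‖γ‖) * s ^ n := by
      ext s; rw [mul_pow]; ring
    rw [this, intervalIntegral.integral_const_mul, integral_pow, Nat.factorial_succ]
    push_cast
    rw [mul_pow]
    field_simp
    simp

/-- The Volterra operator `γ ↦ γ - ∫ A γ` is invertible. -/
theorem isUnit_one_sub_volterra [CompleteSpace F] (A : Curve (F →L[ℝ] F)) :
    IsUnit (1 - integCM F ∘L applyCM F F A) := by
  set K := integCM F ∘L applyCM F F A with hK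
  -- Some power `K ^ n` has norm less than one, so `1 - K ^ n` is a unit; it is a product of `1 - K`
  -- with a commuting geometric sum, so `1 - K` is a unit as well.
  obtain ⟨n, hn⟩ := ((FloorSemiring.tendsto_pow_div_factorial_atTop ‖A‖).eventually
    (gt_mem_nhds one_pos)).exists
  have hle : ‖K ^ n‖ ≤ ‖A‖ ^ n / n.factorial := by
    refine ContinuousLinearMap.opNorm_le_bound _ (by positivity) fun γ => ?_
    rw [Curve.norm_le _ (by positivity)]
    intro t
    refine (volterra_pow_le A n γ t).trans ?_
    have h0 := t.2.1
    have h1 : ‖A‖ * t ≤ ‖A‖ := mul_le_of_le_one_right (norm_nonneg A) t.2.2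
    gcongr
  have h1 : IsUnit (1 - K ^ n) := isUnit_one_sub_of_norm_lt_one (R := Curve F →L[ℝ] Curve F) (hle.trans_lt hn)
  have h2 : (1 - K) * (∑ i ∈ Finset.range n, K ^ i) = 1 - K ^ n := mul_neg_geom_sum K n
  have h3 : Commute (1 - K) (∑ i ∈ Finset.range n, K ^ i) := by
    refine Commute.sum_right _ _ _ fun i _ => ?_
    exact (Commute.sub_left (Commute.one_left _) (Commute.self_pow K i))
  rw [← h2, h3.isUnit_mul_iff] at h1
  exact h1.1

end Integration
end
end LogSymp

namespace LogSymp

noncomputable section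

open scoped unitInterval

set_option linter.unusedSectionVars false

/-! ### Local flows from the inverse function theorem -/

section Flow

variable {F G : Type} [NormedAddCommGroup F] [NormedSpace ℝ F] [NormedAddCommGroup G]
  [NormedSpace ℝ G]

/-- Constant curves. -/
def constCM (F : Type) [NormedAddCommGroup F] [NormedSpace ℝ F] : F →L[ℝ] Curve F :=
  LinearMap.mkContinuous
    { toFun := fun x => Curve.mk (fun _ => x) continuous_const
      map_add' := fun _ _ => by ext; simp
      map_smul' := fun _ _ => by ext; simp } 1 (fun x => by
    rw [Curve.norm_le _ (by positivity)]; simp)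

@[simp] lemma constCM_apply (x : F) (t : I) : constCM F x t = x := rfl

/-- The inclusion of curves in `F` into curves in `ℝ × F`. -/
def inrCM (F : Type) [NormedAddCommGroup F] [NormedSpace ℝ F] : Curve F →L[ℝ] Curve (ℝ × F) :=
  LinearMap.mkContinuous
    { toFun := fun γ => Curve.mk (fun t => (0, γ t)) (continuous_const.prodMk γ.continuous)
      map_add' := fun _ _ => by ext <;> simp
      map_smul' := fun _ _ => by ext <;> simp } 1 (fun γ => by
    rw [Curve.norm_le _ (by positivity)]
    intro t
    simpa [Prod.norm_def] using γ.norm_coe_le_norm t)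

@[simp] lemma inrCM_apply (γ : Curve F) (t : I) : inrCM F γ t = (0, γ t) := rfl

/-- The graph `t ↦ (t, γ t)` of a curve. -/
def graphCM (γ : Curve F) : Curve (ℝ × F) :=
  Curve.mk (fun t => ((t : ℝ), γ t)) (continuous_subtype_val.prodMk γ.continuous)

@[simp] lemma graphCM_apply (γ : Curve F) (t : I) : graphCM γ t = ((t : ℝ), γ t) := rfl

lemma graphCM_eq (γ : Curve F) : graphCM γ = graphCM 0 + inrCM F γ := by
  ext t <;> simp

lemma hasFDerivAt_graphCM (γ : Curve F) : HasFDerivAt (graphCM (F := F)) (inrCM F) γ := by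
  rw [funext (graphCM_eq (F := F))]
  exact (inrCM F).hasFDerivAt.const_add _

lemma contDiff_graphCM : ContDiff ℝ ∞ (graphCM (F := F)) := by
  rw [funext (graphCM_eq (F := F))]
  exact contDiff_const.add (inrCM F).contDiff

/-- The partial derivative of a time-dependent map in the direction of the space variable. -/
def spaceDeriv (g : ℝ × F → G) (z : ℝ × F) : F →L[ℝ] G :=
  (fderiv ℝ g z) ∘L ContinuousLinearMap.inr ℝ ℝ F

lemma contDiff_spaceDeriv {g : ℝ × F → G} (hg : ContDiff ℝ ∞ g) : ContDiff ℝ ∞ (spaceDeriv g) :=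
  (contDiff_infty_iff_fderiv.1 hg).2.clm_comp contDiff_const

lemma hasFDerivAt_map_graph {g : ℝ × F → G} (hg : ContDiff ℝ ∞ g) (γ : Curve F) :
    HasFDerivAt (fun γ => (graphCM γ).map g hg.continuous)
      (applyCM F G ((graphCM γ).map (spaceDeriv g) (contDiff_spaceDeriv hg).continuous)) γ := by
  have := (hasFDerivAt_comp_left (hg.of_le (by simp)) (graphCM γ)).comp γ (hasFDerivAt_graphCM γ)
  refine this.congr_fderiv ?_
  ext η t
  simp [spaceDeriv]

/-- The map whose zero set in the second component are the solutions of `γ' = g(t, γ)`. -/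
def flowMap (g : ℝ × F → F) (hg : Continuous g) (z : F × Curve F) : F × Curve F :=
  (z.1, z.2 - constCM F z.1 - integCM F ((graphCM z.2).map g hg))

lemma contDiff_flowMap {g : ℝ × F → F} (hg : ContDiff ℝ ∞ g) :
    ContDiff ℝ ∞ (flowMap g hg.continuous) := by
  refine contDiff_fst.prodMk ((contDiff_snd.sub ((constCM F).contDiff.comp contDiff_fst)).sub ?_)
  exact (integCM F).contDiff.comp ((contDiff_comp_left hg).comp (contDiff_graphCM.comp contDiff_snd))

/-- The derivative is block triangular, with the identity on initial values and one minus a Volterra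
operator on curves. It is invertible at every point, not only at solutions, so the local inverse is
smooth on its whole domain. -/
lemma exists_hasFDerivAt_flowMap [CompleteSpace F] {g : ℝ × F → F} (hg : ContDiff ℝ ∞ g)
    (z : F × Curve F) : ∃ e : (F × Curve F) ≃L[ℝ] (F × Curve F),
      HasFDerivAt (flowMap g hg.continuous) (e : (F × Curve F) →L[ℝ] (F × Curve F)) z := by
  set A := (graphCM z.2).map (spaceDeriv g) (contDiff_spaceDeriv hg).continuous
  obtain ⟨u, hu⟩ := isUnit_one_sub_volterra A
  have h1 : HasFDerivAt (flowMap g hg.continuous)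
      ((ContinuousLinearMap.fst ℝ F (Curve F)).prod
        (ContinuousLinearMap.snd ℝ F (Curve F) - (constCM F) ∘L (ContinuousLinearMap.fst ℝ F (Curve F))
        - (integCM F) ∘L (applyCM F F A) ∘L (ContinuousLinearMap.snd ℝ F (Curve F)))) z := by
    refine hasFDerivAt_fst.prodMk ((hasFDerivAt_snd.sub
      ((constCM F).hasFDerivAt.comp z hasFDerivAt_fst)).sub ?_)
    exact (integCM F).hasFDerivAt.comp z
      (HasFDerivAt.comp z (hasFDerivAt_map_graph hg z.2) hasFDerivAt_snd)
  have huv : ∀ η, (u⁻¹.1) (u.1 η) = η := fun η => by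
    change (u⁻¹.1 * u.1) η = η
    rw [Units.inv_mul]; rfl
  have hvu : ∀ η, (u.1) (u⁻¹.1 η) = η := fun η => by
    change (u.1 * u⁻¹.1) η = η
    rw [Units.mul_inv]; rfl
  refine ⟨ContinuousLinearEquiv.equivOfInverse
    ((ContinuousLinearMap.fst ℝ F (Curve F)).prod
      (ContinuousLinearMap.snd ℝ F (Curve F) - (constCM F) ∘L (ContinuousLinearMap.fst ℝ F (Curve F))
      - (integCM F) ∘L (applyCM F F A) ∘L (ContinuousLinearMap.snd ℝ F (Curve F))))
    ((ContinuousLinearMap.fst ℝ F (Curve F)).prod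
      ((u⁻¹.1 : Curve F →L[ℝ] Curve F) ∘L (ContinuousLinearMap.snd ℝ F (Curve F) +
        (constCM F) ∘L (ContinuousLinearMap.fst ℝ F (Curve F))))) ?_ ?_, h1⟩
  · rintro ⟨x, η⟩
    have h2 : η - constCM F x - integCM F (applyCM F F A η) = u.1 η - constCM F x := by
      rw [hu]; simp only [sub_apply, one_apply_eq_self,
        ContinuousLinearMap.comp_apply]; abel
    simp only [ContinuousLinearMap.prod_apply, ContinuousLinearMap.coe_fst',
      sub_apply, ContinuousLinearMap.coe_snd', ContinuousLinearMap.comp_apply,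
      add_apply, h2, sub_add_cancel, huv]
  · rintro ⟨x, η⟩
    have h2 : ∀ ζ, ζ - constCM F x - integCM F (applyCM F F A ζ) = u.1 ζ - constCM F x := by
      intro ζ
      rw [hu]; simp only [sub_apply, one_apply_eq_self,
        ContinuousLinearMap.comp_apply]; abel
    simp only [ContinuousLinearMap.prod_apply, ContinuousLinearMap.coe_fst',
      sub_apply, ContinuousLinearMap.coe_snd', ContinuousLinearMap.comp_apply,
      add_apply, h2, hvu, add_sub_cancel_right]

/-- A solution starting at `x` is a preimage of `(x, 0)` under `flowMap`. At `x₀` the constant curve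
is one, because the field vanishes there; the local inverse around it gives all nearby solutions for
the full unit of time. -/
lemma exists_flow_aux [CompleteSpace F] {g : ℝ × F → F} (hg : ContDiff ℝ ∞ g) {x₀ : F}
    (h0 : ∀ t ∈ Icc (0 : ℝ) 1, g (t, x₀) = 0) :
    ∃ (N : Set F) (Γ : F → Curve F), IsOpen N ∧ x₀ ∈ N ∧ ContDiffOn ℝ ∞ Γ N ∧
      Γ x₀ = constCM F x₀ ∧
      ∀ x ∈ N, Γ x = constCM F x + integCM F ((graphCM (Γ x)).map g hg.continuous) := by
  obtain ⟨e, he⟩ := exists_hasFDerivAt_flowMap hg (x₀, constCM F x₀)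
  set f := (contDiff_flowMap hg).contDiffAt.toOpenPartialHomeomorph (flowMap g hg.continuous) he
    (by simp)
  have hfa : (x₀, constCM F x₀) ∈ f.source :=
    (contDiff_flowMap hg).contDiffAt.mem_toOpenPartialHomeomorph_source he (by simp)
  have hf : ⇑f = flowMap g hg.continuous := rfl
  have hz : flowMap g hg.continuous (x₀, constCM F x₀) = (x₀, 0) := by
    ext t
    · rfl
    · have : (graphCM (constCM F x₀)).map g hg.continuous = 0 := by
        ext t; simp [h0 t t.2]
      simp [flowMap, this]
  have hcont : Continuous fun x : F => (x, (0 : Curve F)) := by fun_prop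
  refine ⟨(fun x => (x, (0 : Curve F))) ⁻¹' f.target, fun x => (f.symm (x, 0)).2,
    f.open_target.preimage hcont, ?_, ?_, ?_, ?_⟩
  · rw [mem_preimage, ← hz, ← hf]; exact f.map_source hfa
  · intro x hx
    obtain ⟨e', he'⟩ := exists_hasFDerivAt_flowMap hg (f.symm (x, 0))
    have h1 : ContDiffAt ℝ ∞ f.symm (x, 0) := f.contDiffAt_symm hx he'
      (contDiff_flowMap hg).contDiffAt
    have h2 : ContDiffAt ℝ ∞ (fun x : F => (x, (0 : Curve F))) x :=
      (contDiff_id.prodMk contDiff_const).contDiffAt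
    exact (contDiffAt_snd.comp x (h1.comp x h2)).contDiffWithinAt
  · have h1 := f.left_inv hfa
    rw [hf, hz] at h1
    exact congrArg Prod.snd h1
  · intro x hx
    have h1 : flowMap g hg.continuous (f.symm (x, 0)) = (x, 0) := f.right_inv hx
    have h2 : (f.symm (x, 0)).1 = x := congrArg Prod.fst h1
    have h3 := congrArg Prod.snd h1
    simp only [flowMap, h2] at h3
    rw [sub_sub, sub_eq_zero] at h3
    exact h3

/-- Passage from the integral to the differential equation; it serves both the flow and its
linearization. -/
lemma hasDerivWithinAt_extend_of_eq {γ η : Curve F} {c : F} [CompleteSpace F]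
    (h : γ = constCM F c + integCM F η) :
    γ 0 = c ∧ ∀ t : I, HasDerivWithinAt (extend γ) (η t) (Icc 0 1) t := by
  constructor
  · rw [h]; simp [integCM_apply]
  · intro t
    have h1 : ∀ s ∈ Icc (0 : ℝ) 1, extend γ s = c + ∫ u in (0 : ℝ)..s, extend η u := by
      intro s hs
      rw [extend_of_mem γ hs, h]; simp [integCM_apply]
    have h2 : HasDerivAt (fun s => c + ∫ u in (0 : ℝ)..s, extend η u) (η t) t := by
      rw [← extend_coe η t]
      exact (intervalIntegral.integral_hasDerivAt_right
        ((continuous_extend η).intervalIntegrable _ _)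
        ((continuous_extend η).stronglyMeasurableAtFilter _ _)
        (continuous_extend η).continuousAt).const_add c
    exact h2.hasDerivWithinAt.congr h1 (h1 t t.2)

/-- A smooth function on an open set agrees near a compact subset with a globally smooth one. -/
lemma exists_contDiff_eqOn_nhds [FiniteDimensional ℝ F] {g : F → G} {D K : Set F}
    (hD : IsOpen D) (hg : ContDiffOn ℝ ∞ g D) (hK : IsCompact K) (hKD : K ⊆ D) :
    ∃ (g' : F → G) (O : Set F), ContDiff ℝ ∞ g' ∧ IsOpen O ∧ K ⊆ O ∧ O ⊆ D ∧ EqOn g' g O := by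
  have : ProperSpace F := FiniteDimensional.proper_real F
  obtain ⟨t, ht, hKt, htD⟩ := exists_compact_between hK hD hKD
  obtain ⟨χ, hχ1, hχ0, -⟩ := exists_contMDiffMap_one_nhds_of_subset_interior (n := (⊤ : ℕ∞)) 𝓘(ℝ, F)
    hK.isClosed hKt
  have hχs : ContDiff ℝ ∞ χ := χ.contMDiff.contDiff
  obtain ⟨O, hO, hKO, hOχ⟩ := eventually_nhdsSet_iff_exists.1 hχ1
  refine ⟨fun x => χ x • g x, O ∩ interior t, ?_, hO.inter isOpen_interior,
    subset_inter hKO hKt, fun x hx => htD (interior_subset hx.2),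
    fun x hx => by simp [hOχ x hx.1]⟩
  rw [contDiff_iff_contDiffAt]
  intro x
  by_cases hx : x ∈ t
  · exact hχs.contDiffAt.smul (hg.contDiffAt (hD.mem_nhds (htD hx)))
  · have : (fun x => χ x • g x) =ᶠ[𝓝 x] fun _ => 0 := by
      filter_upwards [ht.isClosed.isOpen_compl.mem_nhds hx] with y hy
      simp [hχ0 y hy]
    exact contDiffAt_const.congr_of_eventuallyEq this

/-- Smooth flow, for a unit of time, near a zero of a time-dependent vector field. The derivative
of the flow solves the linearized equation. -/
theorem exists_local_flow [FiniteDimensional ℝ F] {g : ℝ × F → F} {D : Set (ℝ × F)}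
    (hD : IsOpen D) (hg : ContDiffOn ℝ ∞ g D) {x₀ : F}
    (hmem : ∀ t ∈ Icc (0 : ℝ) 1, (t, x₀) ∈ D) (h0 : ∀ t ∈ Icc (0 : ℝ) 1, g (t, x₀) = 0) :
    ∃ (N : Set F) (Γ : F → Curve F), IsOpen N ∧ x₀ ∈ N ∧ ContDiffOn ℝ ∞ Γ N ∧
      Γ x₀ = constCM F x₀ ∧
      ∀ x ∈ N, Γ x 0 = x ∧ (∀ t : I, ((t : ℝ), Γ x t) ∈ D) ∧
        (∀ t : I, HasDerivWithinAt (extend (Γ x)) (g (t, Γ x t)) (Icc 0 1) t) ∧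
        ∀ w : F, fderiv ℝ Γ x w 0 = w ∧ ∀ t : I, HasDerivWithinAt (extend (fderiv ℝ Γ x w))
          (spaceDeriv g (t, Γ x t) (fderiv ℝ Γ x w t)) (Icc 0 1) t := by
  have : CompleteSpace F := FiniteDimensional.complete ℝ F
  set K : Set (ℝ × F) := Icc (0 : ℝ) 1 ×ˢ {x₀} with hK
  have hKc : IsCompact K := isCompact_Icc.prod isCompact_singleton
  have hKD : K ⊆ D := by
    rintro ⟨t, x⟩ ⟨ht, hx⟩
    rw [mem_singleton_iff] at hx
    simp only at hx ht
    subst hx; exact hmem t ht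
  -- Only the values near the segment `[0, 1] × {x₀}` matter. The field is replaced by a globally
  -- smooth one, and only those solutions are kept that stay where the two agree.
  obtain ⟨g', O, hg', hO, hKO, hOD, hgO⟩ := exists_contDiff_eqOn_nhds hD hg hKc hKD
  obtain ⟨N, Γ, hN, hxN, hΓ, hΓ0, hsol⟩ := exists_flow_aux hg' (x₀ := x₀) (fun t ht => by
    rw [hgO (hKO (mk_mem_prod ht rfl)), h0 t ht])
  obtain ⟨u, v, -, hv, hu1, hv1, huv⟩ := generalized_tube_lemma isCompact_Icc
    (isCompact_singleton (x := x₀)) hO hKO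
  obtain ⟨δ, hδ, hball⟩ := Metric.isOpen_iff.1 hv x₀ (hv1 rfl)
  have hN' : IsOpen (N ∩ Γ ⁻¹' Metric.ball (constCM F x₀) δ) :=
    hΓ.continuousOn.isOpen_inter_preimage hN Metric.isOpen_ball
  refine ⟨N ∩ Γ ⁻¹' Metric.ball (constCM F x₀) δ, Γ, hN', ⟨hxN, by
    rw [mem_preimage, hΓ0]; exact Metric.mem_ball_self hδ⟩, hΓ.mono inter_subset_left, hΓ0, ?_⟩
  rintro x ⟨hx, hxδ⟩
  have hmemO : ∀ t : I, ((t : ℝ), Γ x t) ∈ O := fun t => huv ⟨hu1 t.2, hball (by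
    have := (Curve.dist_apply_le (Γ x) (constCM F x₀) t).trans_lt hxδ
    simpa using this)⟩
  obtain ⟨h1, h2⟩ := hasDerivWithinAt_extend_of_eq (hsol x hx)
  refine ⟨h1, fun t => hOD (hmemO t), fun t => ?_, fun w => ?_⟩
  · have := h2 t
    rwa [Curve.map_apply, graphCM_apply, hgO (hmemO t)] at this
  · have hd : HasFDerivAt Γ (fderiv ℝ Γ x) x :=
      ((hΓ.contDiffAt (hN.mem_nhds hx)).differentiableAt (by simp)).hasFDerivAt
    -- Differentiating the integral equation in `x` shows that `fderiv ℝ Γ x w` solves the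
    -- linearized integral equation.
    have h3 : HasFDerivAt (fun x => constCM F x +
        integCM F ((graphCM (Γ x)).map g' hg'.continuous)) (constCM F + integCM F ∘L
        (applyCM F F ((graphCM (Γ x)).map (spaceDeriv g') (contDiff_spaceDeriv hg').continuous)) ∘L
        fderiv ℝ Γ x) x :=
      (constCM F).hasFDerivAt.add ((integCM F).hasFDerivAt.comp x
        (HasFDerivAt.comp x (hasFDerivAt_map_graph hg' (Γ x)) hd))
    have h4 := hd.unique (h3.congr_of_eventuallyEq (by
      filter_upwards [hN.mem_nhds hx] with y hy using hsol y hy))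
    have h5 : fderiv ℝ Γ x w = constCM F w + integCM F (applyCM F F
        ((graphCM (Γ x)).map (spaceDeriv g') (contDiff_spaceDeriv hg').continuous)
        (fderiv ℝ Γ x w)) := by
      conv_lhs => rw [h4]
      rfl
    obtain ⟨h6, h7⟩ := hasDerivWithinAt_extend_of_eq h5
    refine ⟨h6, fun t => ?_⟩
    have h8 := h7 t
    have h9 : spaceDeriv g' (t, Γ x t) = spaceDeriv g (t, Γ x t) := by
      rw [spaceDeriv, spaceDeriv, Filter.EventuallyEq.fderiv_eq (𝕜 := ℝ)
        (hgO.eventuallyEq_of_mem (hO.mem_nhds (hmemO t)))]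
    rwa [applyCM_apply, Curve.map_apply, graphCM_apply, h9] at h8

/-- Integrals over the unit interval of smooth functions are smooth in a parameter. -/
theorem contDiffAt_integral [FiniteDimensional ℝ F] [CompleteSpace G] {h : ℝ × F → G}
    {D : Set (ℝ × F)} (hD : IsOpen D) (hh : ContDiffOn ℝ ∞ h D) {x₀ : F}
    (hmem : ∀ t ∈ Icc (0 : ℝ) 1, (t, x₀) ∈ D) :
    ContDiffAt ℝ ∞ (fun x => ∫ s in (0 : ℝ)..1, h (s, x)) x₀ ∧
    ∀ w, fderiv ℝ (fun x => ∫ s in (0 : ℝ)..1, h (s, x)) x₀ w =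
      ∫ s in (0 : ℝ)..1, fderiv ℝ h (s, x₀) (0, w) := by
  have hKD : Icc (0 : ℝ) 1 ×ˢ {x₀} ⊆ D := by
    rintro ⟨t, x⟩ ⟨ht, hx⟩
    rw [mem_singleton_iff] at hx
    simp only at hx ht
    subst hx; exact hmem t ht
  obtain ⟨h', O, hh', hO, hKO, hOD, hhO⟩ := exists_contDiff_eqOn_nhds hD hh
    (isCompact_Icc.prod isCompact_singleton) hKD
  obtain ⟨u, v, -, hv, hu1, hv1, huv⟩ := generalized_tube_lemma isCompact_Icc
    (isCompact_singleton (x := x₀)) hO hKO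
  -- The integral is the value at time one of the integration operator, applied to a superposition
  -- along the constant curve `x`; each of these operators is smooth.
  let ev : Curve G →L[ℝ] G := LinearMap.mkContinuous
    { toFun := fun γ => γ 1, map_add' := fun _ _ => rfl, map_smul' := fun _ _ => rfl } 1
    (fun γ => by rw [one_mul]; exact γ.norm_coe_le_norm 1)
  have key : ∀ η : Curve G, ev (integCM G η) = ∫ s in (0 : ℝ)..1, extend η s := fun η => rfl
  have hev : (fun x => ∫ s in (0 : ℝ)..1, h (s, x)) =ᶠ[𝓝 x₀] fun x => ev (integCM G
      ((graphCM (constCM F x)).map h' hh'.continuous)) := by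
    filter_upwards [hv.mem_nhds (hv1 rfl)] with x hx
    rw [key]
    refine intervalIntegral.integral_congr fun s hs => ?_
    rw [uIcc_of_le zero_le_one] at hs
    simp only [extend_of_mem _ hs, Curve.map_apply, graphCM_apply, constCM_apply]
    exact (hhO (huv ⟨hu1 hs, hx⟩)).symm
  constructor
  · refine ContDiffAt.congr_of_eventuallyEq ?_ hev
    exact (ev.contDiff.comp ((integCM G).contDiff.comp ((contDiff_comp_left hh').comp
      (contDiff_graphCM.comp (constCM F).contDiff)))).contDiffAt
  · intro w
    have h3 := ev.hasFDerivAt.comp x₀ ((integCM G).hasFDerivAt.comp x₀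
        (HasFDerivAt.comp x₀ (hasFDerivAt_map_graph hh' (constCM F x₀)) (constCM F).hasFDerivAt))
    rw [(HasFDerivAt.congr_of_eventuallyEq h3 hev).fderiv]
    refine (key _).trans (intervalIntegral.integral_congr fun s hs => ?_)
    rw [uIcc_of_le zero_le_one] at hs
    simp only [extend_of_mem _ hs]
    change fderiv ℝ h' (s, x₀) (0, w) = _
    rw [Filter.EventuallyEq.fderiv_eq (𝕜 := ℝ) (hhO.eventuallyEq_of_mem (hO.mem_nhds (hKO (mk_mem_prod hs rfl))))]

end Flow

end
end LogSymp

namespace LogSymp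

noncomputable section

set_option linter.unusedSectionVars false
set_option maxSynthPendingDepth 3

/-! ### The log frame of a coordinate normal crossing divisor -/

section Frame

variable {d : ℕ} {σ : Type*} (κ : σ ↪ Fin d)

lemma logFrame_apply_range (x v : Model d) (s : σ) : logFrame κ x v (κ s) = x (κ s) * v (κ s) := by
  rw [logFrame, Matrix.ofLp_toEuclideanCLM, Matrix.mulVec_diagonal, if_pos (mem_range_self s)]

lemma logFrame_apply_of_notMem (x v : Model d) {j : Fin d} (hj : j ∉ range κ) :
    logFrame κ x v j = v j := by
  rw [logFrame, Matrix.ofLp_toEuclideanCLM, Matrix.mulVec_diagonal, if_neg hj, one_mul]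

/-- Two vectors agree if they agree at the coordinates in the range of `κ` and off it. -/
lemma ext_range {u v : Model d} (h1 : ∀ s, u (κ s) = v (κ s)) (h2 : ∀ j ∉ range κ, u j = v j) :
    u = v := by
  ext j
  by_cases hj : j ∈ range κ
  · obtain ⟨s, rfl⟩ := hj; exact h1 s
  · exact h2 j hj

/-- The derivative of the log frame, a symmetric bilinear map. -/
def frameMul : Model d →L[ℝ] Model d →L[ℝ] Model d :=
  LinearMap.toContinuousLinearMap
    { toFun := fun x => logFrame κ x - logFrame κ 0
      map_add' := fun x y => by
        ext v : 1
        refine ext_range κ (fun s => ?_) (fun j hj => ?_)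
        · simp [logFrame_apply_range]; ring
        · simp [logFrame_apply_of_notMem κ _ _ hj]
      map_smul' := fun c x => by
        ext v : 1
        refine ext_range κ (fun s => ?_) (fun j hj => ?_)
        · simp [logFrame_apply_range]; ring
        · simp [logFrame_apply_of_notMem κ _ _ hj] }

lemma frameMul_apply (x v : Model d) : frameMul κ x v = logFrame κ x v - logFrame κ 0 v := rfl

lemma logFrame_eq (x : Model d) : logFrame κ x = logFrame κ 0 + frameMul κ x := by
  ext v : 1
  simp [frameMul_apply]

lemma frameMul_apply_range (x v : Model d) (s : σ) : frameMul κ x v (κ s) = x (κ s) * v (κ s) := by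
  simp [frameMul_apply, logFrame_apply_range]

lemma frameMul_apply_of_notMem (x v : Model d) {j : Fin d} (hj : j ∉ range κ) :
    frameMul κ x v j = 0 := by
  simp [frameMul_apply, logFrame_apply_of_notMem κ _ _ hj]

lemma hasFDerivAt_logFrame (x : Model d) : HasFDerivAt (logFrame κ) (frameMul κ) x := by
  rw [funext (logFrame_eq κ)]
  exact (frameMul κ).hasFDerivAt.const_add _

lemma contDiff_logFrame : ContDiff ℝ ∞ (logFrame κ) := by
  rw [funext (logFrame_eq κ)]
  exact contDiff_const.add (frameMul κ).contDiff

/-- The projection of a point to the intersection of the coordinate hyperplanes. -/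
abbrev cproj : Model d →L[ℝ] Model d := logFrame κ 0

lemma cproj_apply_range (v : Model d) (s : σ) : cproj κ v (κ s) = 0 := by
  simp [cproj, logFrame_apply_range]

lemma cproj_apply_of_notMem (v : Model d) {j : Fin d} (hj : j ∉ range κ) : cproj κ v j = v j :=
  logFrame_apply_of_notMem κ _ _ hj

lemma cproj_cproj (v : Model d) : cproj κ (cproj κ v) = cproj κ v :=
  ext_range κ (fun s => by simp [cproj_apply_range])
    (fun j hj => by simp [cproj_apply_of_notMem κ _ hj])

lemma cproj_eq_self_iff {x : Model d} : cproj κ x = x ↔ ∀ s, x (κ s) = 0 := by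
  constructor
  · intro h s
    rw [← h, cproj_apply_range]
  · intro h
    exact ext_range κ (fun s => by rw [cproj_apply_range, h])
      (fun j hj => by simp [cproj_apply_of_notMem κ _ hj])

/-- On the intersection the anchor kills the normal frame vectors `x_s ∂_s` and becomes the
projection to the tangent directions of the intersection. -/
lemma logFrame_eq_cproj {x : Model d} (hx : cproj κ x = x) : logFrame κ x = cproj κ := by
  ext v : 1
  refine ext_range κ (fun s => ?_) (fun j hj => ?_)
  · rw [logFrame_apply_range, cproj_apply_range, (cproj_eq_self_iff κ).1 hx, zero_mul]
  · rw [logFrame_apply_of_notMem κ _ _ hj, cproj_apply_of_notMem κ _ hj]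

/-- The dilation of the coordinates in the range of `κ`. -/
def dil (r : ℝ) : Model d →L[ℝ] Model d :=
  cproj κ + r • (ContinuousLinearMap.id ℝ (Model d) - cproj κ)

lemma dil_apply (r : ℝ) (x : Model d) : dil κ r x = cproj κ x + r • (x - cproj κ x) := rfl

lemma dil_apply_range (r : ℝ) (x : Model d) (s : σ) : dil κ r x (κ s) = r * x (κ s) := by
  simp [dil_apply, cproj_apply_range]

lemma dil_apply_of_notMem (r : ℝ) (x : Model d) {j : Fin d} (hj : j ∉ range κ) :
    dil κ r x j = x j := by
  simp [dil_apply, cproj_apply_of_notMem κ _ hj]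

@[simp] lemma dil_one (x : Model d) : dil κ 1 x = x := by simp [dil_apply]

@[simp] lemma dil_zero (x : Model d) : dil κ 0 x = cproj κ x := by simp [dil_apply]

lemma cproj_dil (r : ℝ) (x : Model d) : cproj κ (dil κ r x) = cproj κ x :=
  ext_range κ (fun s => by simp [cproj_apply_range])
    (fun j hj => by simp [cproj_apply_of_notMem κ _ hj, dil_apply_of_notMem κ _ _ hj])

/-- The fields `x_s ∂_s` are invariant under dilation, so pulling a log form back by `dil κ r` just
composes its components with `dil κ r`. The relative Poincaré lemma below rests on this. -/
lemma dil_logFrame (r : ℝ) (x u : Model d) :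
    dil κ r (logFrame κ x u) = logFrame κ (dil κ r x) u :=
  ext_range κ (fun s => by simp [dil_apply_range, logFrame_apply_range, mul_assoc])
    (fun j hj => by simp [logFrame_apply_of_notMem κ _ _ hj, dil_apply_of_notMem κ _ _ hj])

/-- The same at `r = 0`. It is the reason why components extended constantly along the fibres again
belong to a closed log form. -/
lemma cproj_logFrame (x u : Model d) : cproj κ (logFrame κ x u) = logFrame κ (cproj κ x) u :=
  ext_range κ (fun s => by simp [logFrame_apply_range])
    (fun j hj => by simp [logFrame_apply_of_notMem κ _ _ hj])

open Classical in
/-- The sum of the frame vectors `x_j ∂_j`, in the log frame. -/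
def eulerVec : Model d := WithLp.toLp 2 fun j => if j ∈ range κ then 1 else 0

lemma eulerVec_apply_range (s : σ) : eulerVec κ (κ s) = 1 := by simp [eulerVec]

lemma eulerVec_apply_of_notMem {j : Fin d} (hj : j ∉ range κ) : eulerVec κ j = 0 := by
  have hj' : ¬ ∃ s, κ s = j := hj
  simp [eulerVec, hj']

/-- The generator of the dilations has constant log components, so contraction with it keeps log
forms smooth across the hyperplanes. -/
lemma logFrame_eulerVec (x : Model d) : logFrame κ x (eulerVec κ) = x - cproj κ x :=
  ext_range κ (fun s => by simp [logFrame_apply_range, eulerVec_apply_range])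
    (fun j hj => by simp [logFrame_apply_of_notMem κ _ _ hj, eulerVec_apply_of_notMem κ hj])

lemma norm_dil_le {r : ℝ} (hr : r ∈ Icc (0 : ℝ) 1) (x : Model d) : ‖dil κ r x‖ ≤ ‖x‖ := by
  rw [EuclideanSpace.norm_eq, EuclideanSpace.norm_eq]
  refine Real.sqrt_le_sqrt (Finset.sum_le_sum fun j _ => ?_)
  by_cases hj : j ∈ range κ
  · obtain ⟨s, rfl⟩ := hj
    rw [dil_apply_range, norm_mul, mul_pow]
    have h1 : ‖r‖ ≤ 1 := by rw [Real.norm_eq_abs, abs_of_nonneg hr.1]; exact hr.2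
    have h2 : ‖r‖ ^ 2 ≤ 1 := pow_le_one₀ (norm_nonneg _) h1
    nlinarith [sq_nonneg ‖x (κ s)‖]
  · rw [dil_apply_of_notMem κ _ _ hj]

/-- Dilations with `r ∈ [0, 1]` contract the norm and fix the centre. Charts are later restricted to
such balls to make integration over dilations possible. -/
lemma dil_mem_ball {x₀ : Model d} (hx₀ : cproj κ x₀ = x₀) {ρ r : ℝ} (hr : r ∈ Icc (0 : ℝ) 1)
    {x : Model d} (hx : x ∈ Metric.ball x₀ ρ) : dil κ r x ∈ Metric.ball x₀ ρ := by
  have h1 : dil κ r x₀ = x₀ := by simp [dil_apply, hx₀]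
  rw [mem_ball_iff_norm] at hx ⊢
  calc ‖dil κ r x - x₀‖ = ‖dil κ r (x - x₀)‖ := by rw [map_sub, h1]
    _ ≤ ‖x - x₀‖ := norm_dil_le κ hr _
    _ < ρ := hx

lemma cproj_mem_ball {x₀ : Model d} (hx₀ : cproj κ x₀ = x₀) {ρ : ℝ}
    {x : Model d} (hx : x ∈ Metric.ball x₀ ρ) : cproj κ x ∈ Metric.ball x₀ ρ := by
  rw [← dil_zero]; exact dil_mem_ball κ hx₀ (left_mem_Icc.2 zero_le_one) hx

end Frame

/-! ### The local Moser argument in the log frame -/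

/-- Bilinear forms on `ℝᵈ`. -/
abbrev Bil (d : ℕ) := Model d →L[ℝ] Model d →L[ℝ] ℝ

section Moser

variable {d : ℕ} {σ : Type*} (κ : σ ↪ Fin d)

/-- The components in the log frame of a closed log `2`-form near a point `x₀` of the intersection
of the coordinate hyperplanes. -/
structure IsLogClosed (x₀ : Model d) (ρ : ℝ) (g : Model d → Bil d) : Prop where
  center : cproj κ x₀ = x₀
  smooth : ContDiffOn ℝ ∞ g (Metric.ball x₀ ρ)
  alt : ∀ x ∈ Metric.ball x₀ ρ, ∀ u v, g x u v = - g x v u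
  closed : ∀ x ∈ Metric.ball x₀ ρ, ∀ u v w, fderiv ℝ g x (logFrame κ x u) v w
    - fderiv ℝ g x (logFrame κ x v) u w + fderiv ℝ g x (logFrame κ x w) u v = 0

/-- The difference of a log form with its model. -/
def moserDiff (g : Model d → Bil d) (x : Model d) : Bil d := g x - g (cproj κ x)

/-- `moserDiff` at `dil r x` divided by `r`. -/
def moserQuot (g : Model d → Bil d) (z : ℝ × Model d) : Bil d :=
  ∫ s in (0 : ℝ)..1, fderiv ℝ g (dil κ (z.1 * s) z.2) (z.2 - cproj κ z.2)

/-- A log primitive of `moserDiff`. -/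
def moserPrim (g : Model d → Bil d) (x : Model d) : Model d →L[ℝ] ℝ :=
  ∫ r in (0 : ℝ)..1, moserQuot κ g (r, x) (eulerVec κ)

/-- The path of log forms from the model to the given one. -/
def moserPath (g : Model d → Bil d) (t : ℝ) (x : Model d) : Bil d :=
  g (cproj κ x) + t • moserDiff κ g x

/-- The components in the log frame of the Moser vector field. -/
def moserVec (g : Model d → Bil d) (t : ℝ) (x : Model d) : Model d :=
  -((moserPath κ g t x).inverse (moserPrim κ g x))

/-- The Moser vector field. -/
def moserField (g : Model d → Bil d) (z : ℝ × Model d) : Model d :=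
  logFrame κ z.2 (moserVec κ g z.1 z.2)

variable {κ} {x₀ : Model d} {ρ : ℝ} {g : Model d → Bil d}

lemma contDiffOn_moserDiff (hg : IsLogClosed κ x₀ ρ g) :
    ContDiffOn ℝ ∞ (moserDiff κ g) (Metric.ball x₀ ρ) :=
  hg.smooth.sub (hg.smooth.comp (cproj κ).contDiff.contDiffOn
    fun _ hx => cproj_mem_ball κ hg.center hx)

lemma fderiv_comp_cproj (hg : IsLogClosed κ x₀ ρ g) {x : Model d} (hx : x ∈ Metric.ball x₀ ρ)
    (w : Model d) :
    fderiv ℝ (fun x => g (cproj κ x)) x w = fderiv ℝ g (cproj κ x) (cproj κ w) := by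
  have h1 : DifferentiableAt ℝ g (cproj κ x) := (hg.smooth.contDiffAt
    (Metric.isOpen_ball.mem_nhds (cproj_mem_ball κ hg.center hx))).differentiableAt (by simp)
  have h2 := h1.hasFDerivAt.comp x (cproj κ).hasFDerivAt
  rw [show (fun x => g (cproj κ x)) = g ∘ (cproj κ) from rfl, h2.fderiv]
  rfl

lemma IsLogClosed.comp_cproj (hg : IsLogClosed κ x₀ ρ g) :
    IsLogClosed κ x₀ ρ (fun x => g (cproj κ x)) where
  center := hg.center
  smooth := hg.smooth.comp (cproj κ).contDiff.contDiffOn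
    fun _ hx => cproj_mem_ball κ hg.center hx
  alt := fun x hx => hg.alt _ (cproj_mem_ball κ hg.center hx)
  closed := fun x hx u v w => by
    simp only [fderiv_comp_cproj hg hx, cproj_logFrame]
    exact hg.closed _ (cproj_mem_ball κ hg.center hx) u v w

lemma IsLogClosed.differentiableAt (hg : IsLogClosed κ x₀ ρ g) {x : Model d}
    (hx : x ∈ Metric.ball x₀ ρ) : DifferentiableAt ℝ g x :=
  (hg.smooth.contDiffAt (Metric.isOpen_ball.mem_nhds hx)).differentiableAt (by simp)

lemma IsLogClosed.add_smul {g' : Model d → Bil d} (hg : IsLogClosed κ x₀ ρ g)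
    (hg' : IsLogClosed κ x₀ ρ g') (t : ℝ) : IsLogClosed κ x₀ ρ (fun x => g x + t • g' x) where
  center := hg.center
  smooth := hg.smooth.add (hg'.smooth.const_smul t)
  alt := fun x hx u v => by
    simp only [add_apply, smul_apply, smul_eq_mul]
    rw [hg.alt x hx, hg'.alt x hx]; ring
  closed := fun x hx u v w => by
    have h1 : fderiv ℝ (fun x => g x + t • g' x) x = fderiv ℝ g x + t • fderiv ℝ g' x :=
      ((hg.differentiableAt hx).hasFDerivAt.add
        ((hg'.differentiableAt hx).hasFDerivAt.const_smul t)).fderiv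
    have h2 := hg.closed x hx u v w
    have h3 := hg'.closed x hx u v w
    rw [h1]
    simp only [add_apply, smul_apply, smul_eq_mul]
    linear_combination h2 + t * h3

lemma isLogClosed_moserDiff (hg : IsLogClosed κ x₀ ρ g) : IsLogClosed κ x₀ ρ (moserDiff κ g) := by
  have := hg.add_smul hg.comp_cproj (-1)
  convert this using 2 with x
  rw [moserDiff, neg_one_smul, sub_eq_add_neg]

lemma isLogClosed_moserPath (hg : IsLogClosed κ x₀ ρ g) (t : ℝ) :
    IsLogClosed κ x₀ ρ (moserPath κ g t) :=
  hg.comp_cproj.add_smul (isLogClosed_moserDiff hg) t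

/-- The domain of `moserQuot`. -/
def quotDomain (κ : σ ↪ Fin d) (x₀ : Model d) (ρ : ℝ) : Set (ℝ × Model d) :=
  {z | z.2 ∈ Metric.ball x₀ ρ ∧ dil κ z.1 z.2 ∈ Metric.ball x₀ ρ}

lemma contDiff_dil : ContDiff ℝ ∞ (fun z : ℝ × Model d => dil κ z.1 z.2) := by
  simp only [dil_apply]
  exact ((cproj κ).contDiff.comp contDiff_snd).add
    (contDiff_fst.smul (contDiff_snd.sub ((cproj κ).contDiff.comp contDiff_snd)))

lemma isOpen_quotDomain : IsOpen (quotDomain κ x₀ ρ) :=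
  (Metric.isOpen_ball.preimage continuous_snd).inter
    (Metric.isOpen_ball.preimage contDiff_dil.continuous)

lemma mem_quotDomain (hx₀ : cproj κ x₀ = x₀) {r : ℝ} (hr : r ∈ Icc (0 : ℝ) 1) {x : Model d}
    (hx : x ∈ Metric.ball x₀ ρ) : (r, x) ∈ quotDomain κ x₀ ρ :=
  ⟨hx, dil_mem_ball κ hx₀ hr hx⟩

lemma dil_mul_mem_ball (hx₀ : cproj κ x₀ = x₀) {z : ℝ × Model d} (hz : z ∈ quotDomain κ x₀ ρ)
    {s : ℝ} (hs : s ∈ Icc (0 : ℝ) 1) : dil κ (z.1 * s) z.2 ∈ Metric.ball x₀ ρ := by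
  have := dil_mem_ball κ hx₀ hs hz.2
  convert this using 1
  exact ext_range κ (fun s => by simp [dil_apply_range]; ring)
    (fun j hj => by simp [dil_apply_of_notMem κ _ _ hj])

lemma contDiffOn_moserQuot (hg : IsLogClosed κ x₀ ρ g) :
    ContDiffOn ℝ ∞ (moserQuot κ g) (quotDomain κ x₀ ρ) := by
  intro z hz
  have hm : ContDiff ℝ ∞ (fun w : ℝ × (ℝ × Model d) => dil κ (w.2.1 * w.1) w.2.2) :=
    contDiff_dil.comp (f := fun w : ℝ × (ℝ × Model d) => (w.2.1 * w.1, w.2.2))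
      (by fun_prop)
  have hD : IsOpen {w : ℝ × (ℝ × Model d) | dil κ (w.2.1 * w.1) w.2.2 ∈ Metric.ball x₀ ρ} :=
    Metric.isOpen_ball.preimage hm.continuous
  refine (contDiffAt_integral (h := fun w : ℝ × (ℝ × Model d) =>
    fderiv ℝ g (dil κ (w.2.1 * w.1) w.2.2) (w.2.2 - cproj κ w.2.2)) hD ?_
    (fun t ht => dil_mul_mem_ball hg.center hz ht)).1.contDiffWithinAt
  have h1 : ContDiffOn ℝ ∞ (fderiv ℝ g) (Metric.ball x₀ ρ) :=
    hg.smooth.fderiv_of_isOpen Metric.isOpen_ball (by simp)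
  exact (h1.comp hm.contDiffOn fun w hw => hw).clm_apply
    (by fun_prop : ContDiff ℝ ∞ fun w : ℝ × (ℝ × Model d) => w.2.2 - cproj κ w.2.2).contDiffOn

/-- Hadamard's argument: integrate the derivative of `g` along `s ↦ dil κ (r s) x`, starting at the
projection of `x`. The integral defining the quotient is smooth also at `r = 0`. -/
lemma smul_moserQuot (hg : IsLogClosed κ x₀ ρ g) {z : ℝ × Model d}
    (hz : z ∈ quotDomain κ x₀ ρ) :
    z.1 • moserQuot κ g z = moserDiff κ g (dil κ z.1 z.2) := by
  have h1 : ∀ s ∈ uIcc (0 : ℝ) 1, HasDerivAt (fun s => g (dil κ (z.1 * s) z.2))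
      (z.1 • fderiv ℝ g (dil κ (z.1 * s) z.2) (z.2 - cproj κ z.2)) s := by
    intro s hs
    rw [uIcc_of_le zero_le_one] at hs
    have h2 : HasDerivAt (fun s => dil κ (z.1 * s) z.2) (z.1 • (z.2 - cproj κ z.2)) s := by
      simp only [dil_apply]
      have h3 : HasDerivAt (fun s : ℝ => z.1 * s) z.1 s := by
        simpa using (hasDerivAt_id s).const_mul z.1
      exact (h3.smul_const (z.2 - cproj κ z.2)).const_add _
    have := (hg.differentiableAt (dil_mul_mem_ball hg.center hz hs)).hasFDerivAt.comp_hasDerivAt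
      s h2
    rwa [map_smul] at this
  have hc : ContinuousOn (fun s => z.1 • fderiv ℝ g (dil κ (z.1 * s) z.2) (z.2 - cproj κ z.2))
      (uIcc 0 1) := by
    have h4 : ContinuousOn (fderiv ℝ g) (Metric.ball x₀ ρ) :=
      (hg.smooth.fderiv_of_isOpen (m := 0) Metric.isOpen_ball (by simp)).continuousOn
    have h5 : ContinuousOn (fun s => fderiv ℝ g (dil κ (z.1 * s) z.2)) (uIcc 0 1) := by
      refine h4.comp ?_ fun s hs => ?_
      · exact (contDiff_dil.continuous.comp
          (by fun_prop : Continuous fun s : ℝ => (z.1 * s, z.2))).continuousOn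
      · rw [uIcc_of_le zero_le_one] at hs
        exact dil_mul_mem_ball hg.center hz hs
    exact (h5.clm_apply continuousOn_const).const_smul z.1
  have := intervalIntegral.integral_eq_sub_of_hasDerivAt h1 hc.intervalIntegrable
  rw [intervalIntegral.integral_smul] at this
  rw [moserQuot, this, moserDiff, cproj_dil]
  simp

lemma contDiffAt_moserPrim (hg : IsLogClosed κ x₀ ρ g) {x : Model d} (hx : x ∈ Metric.ball x₀ ρ) :
    ContDiffAt ℝ ∞ (moserPrim κ g) x ∧ ∀ w, fderiv ℝ (moserPrim κ g) x w =
      ∫ r in (0 : ℝ)..1, fderiv ℝ (fun z => moserQuot κ g z (eulerVec κ)) (r, x) (0, w) :=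
  contDiffAt_integral (h := fun z => moserQuot κ g z (eulerVec κ)) isOpen_quotDomain
    ((contDiffOn_moserQuot hg).clm_apply contDiffOn_const)
    (fun _ ht => mem_quotDomain hg.center ht hx)

/-- `moserPrim` is a primitive of `moserDiff`. -/
theorem fderiv_moserPrim (hg : IsLogClosed κ x₀ ρ g) {x : Model d} (hx : x ∈ Metric.ball x₀ ρ)
    (u v : Model d) :
    fderiv ℝ (moserPrim κ g) x (logFrame κ x u) v - fderiv ℝ (moserPrim κ g) x (logFrame κ x v) u =
      moserDiff κ g x u v := by
  set T := moserDiff κ g with hT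
  have hTc := isLogClosed_moserDiff hg
  rw [(contDiffAt_moserPrim hg hx).2, (contDiffAt_moserPrim hg hx).2]
  have hsm : ContDiffOn ℝ ∞ (fun z => moserQuot κ g z (eulerVec κ)) (quotDomain κ x₀ ρ) :=
    (contDiffOn_moserQuot hg).clm_apply contDiffOn_const
  have hcont : ∀ w, ContinuousOn (fun r : ℝ =>
      fderiv ℝ (fun z => moserQuot κ g z (eulerVec κ)) (r, x) (0, w)) (uIcc 0 1) := by
    intro w
    have h4 := (hsm.fderiv_of_isOpen (m := 0) isOpen_quotDomain (by simp)).continuousOn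
    refine (h4.comp (by fun_prop : Continuous fun r : ℝ => (r, x)).continuousOn
      fun s hs => ?_).clm_apply continuousOn_const
    rw [uIcc_of_le zero_le_one] at hs
    exact mem_quotDomain hg.center hs hx
  have happ : ∀ w v : Model d, (∫ r in (0 : ℝ)..1,
      fderiv ℝ (fun z => moserQuot κ g z (eulerVec κ)) (r, x) (0, w)) v =
      ∫ r in (0 : ℝ)..1, fderiv ℝ (fun z => moserQuot κ g z (eulerVec κ)) (r, x) (0, w) v :=
    fun w v => ContinuousLinearMap.intervalIntegral_apply (hcont w).intervalIntegrable v
  have hcont' : ∀ w v, IntervalIntegrable (fun r : ℝ =>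
      fderiv ℝ (fun z => moserQuot κ g z (eulerVec κ)) (r, x) (0, w) v) MeasureTheory.volume 0 1 :=
    fun w v => ((hcont w).clm_apply continuousOn_const).intervalIntegrable
  rw [happ, happ, ← intervalIntegral.integral_sub (hcont' _ _) (hcont' _ _)]
  -- For `r > 0` the quotient is `r⁻¹ • T ∘ dil κ r`, and its derivative in `x` can be read off from
  -- that of `T`.
  have hderiv : ∀ r ∈ Ioc (0 : ℝ) 1, ∀ w, fderiv ℝ (fun z => moserQuot κ g z (eulerVec κ)) (r, x)
      (0, w) = r⁻¹ • fderiv ℝ T (dil κ r x) (dil κ r w) (eulerVec κ) := by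
    intro r hr w
    have hr' : r ∈ Icc (0 : ℝ) 1 := ⟨hr.1.le, hr.2⟩
    have hmem := mem_quotDomain hg.center hr' hx
    have h5 : HasFDerivAt (fun y : Model d => moserQuot κ g (r, y) (eulerVec κ))
        ((fderiv ℝ (fun z => moserQuot κ g z (eulerVec κ)) (r, x)) ∘L
          ContinuousLinearMap.inr ℝ ℝ (Model d)) x :=
      HasFDerivAt.comp x ((hsm.contDiffAt (isOpen_quotDomain.mem_nhds hmem)).differentiableAt
        (by simp)).hasFDerivAt (hasFDerivAt_prodMk_right r x)
    have h6 : HasFDerivAt (fun y : Model d => T (dil κ r y)) (fderiv ℝ T (dil κ r x) ∘L dil κ r) x :=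
      HasFDerivAt.comp x (hTc.differentiableAt (dil_mem_ball κ hg.center hr' hx)).hasFDerivAt
        (dil κ r).hasFDerivAt
    have h7 := (h6.const_smul r⁻¹).clm_apply (hasFDerivAt_const (eulerVec κ) x)
    have h8 : (fun y : Model d => moserQuot κ g (r, y) (eulerVec κ)) =ᶠ[𝓝 x]
        fun y => (r⁻¹ • T (dil κ r y)) (eulerVec κ) := by
      filter_upwards [Metric.isOpen_ball.mem_nhds hx] with y hy
      rw [hT, ← smul_moserQuot hg (mem_quotDomain hg.center hr' hy)]
      simp only [smul_smul]
      rw [inv_mul_cancel₀ hr.1.ne', one_smul]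
    have h9 := h5.unique (h7.congr_of_eventuallyEq h8)
    have h10 := congrArg (fun A : Model d →L[ℝ] (Model d →L[ℝ] ℝ) => A w) h9
    simpa using h10
  -- The radial derivative integrates to `T x`, since `T` vanishes at the projection of `x`.
  have hftc : ∫ r in (0 : ℝ)..1, fderiv ℝ T (dil κ r x) (x - cproj κ x) u v = T x u v := by
    have h1 : ∀ r ∈ uIcc (0 : ℝ) 1, HasDerivAt (fun r => T (dil κ r x) u v)
        (fderiv ℝ T (dil κ r x) (x - cproj κ x) u v) r := by
      intro r hr
      rw [uIcc_of_le zero_le_one] at hr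
      have h2 : HasDerivAt (fun s => dil κ s x) (x - cproj κ x) r := by
        simp only [dil_apply]
        have := ((hasDerivAt_id r).smul_const (x - cproj κ x)).const_add (cproj κ x)
        simpa using this
      have h3 := (hTc.differentiableAt
        (dil_mem_ball κ hg.center hr hx)).hasFDerivAt.comp_hasDerivAt r h2
      have h4 := (h3.clm_apply (hasDerivAt_const r u)).clm_apply (hasDerivAt_const r v)
      simpa using h4
    have hc : ContinuousOn (fun r => fderiv ℝ T (dil κ r x) (x - cproj κ x) u v) (uIcc 0 1) := by
      have h4 : ContinuousOn (fderiv ℝ T) (Metric.ball x₀ ρ) :=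
        (hTc.smooth.fderiv_of_isOpen (m := 0) Metric.isOpen_ball (by simp)).continuousOn
      refine (((h4.comp ?_ fun s hs => ?_).clm_apply continuousOn_const).clm_apply
        continuousOn_const).clm_apply continuousOn_const
      · exact (contDiff_dil.continuous.comp
          (by fun_prop : Continuous fun s : ℝ => (s, x))).continuousOn
      · rw [uIcc_of_le zero_le_one] at hs
        exact dil_mem_ball κ hg.center hs hx
    rw [intervalIntegral.integral_eq_sub_of_hasDerivAt h1 hc.intervalIntegrable]
    simp [hT, moserDiff, cproj_cproj]
  rw [← hftc]
  refine intervalIntegral.integral_congr_ae (Filter.Eventually.of_forall fun r hr => ?_)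
  rw [uIoc_of_le zero_le_one] at hr
  have hr' : r ∈ Icc (0 : ℝ) 1 := ⟨hr.1.le, hr.2⟩
  rw [hderiv r hr, hderiv r hr, dil_logFrame, dil_logFrame]
  -- Cartan's formula: closedness of `T`, with the Euler vector in the first slot, equates the
  -- exterior derivative of the contraction with the radial derivative of `T`. The factor `r` in the
  -- Euler field cancels the `r⁻¹` of the quotient.
  have hcl := hTc.closed _ (dil_mem_ball κ hg.center hr' hx) (eulerVec κ) u v
  have hJ : logFrame κ (dil κ r x) (eulerVec κ) = r • (x - cproj κ x) := by
    rw [logFrame_eulerVec, cproj_dil, dil_apply]; simp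
  rw [hJ, map_smul] at hcl
  simp only [smul_apply, smul_eq_mul] at hcl ⊢
  have hr0 : r ≠ 0 := hr.1.ne'
  field_simp
  linear_combination -hcl

end Moser

end
end LogSymp

namespace LogSymp

noncomputable section

set_option linter.unusedSectionVars false
set_option maxSynthPendingDepth 3

lemma hasFDerivAt_spaceDeriv {F G : Type} [NormedAddCommGroup F] [NormedSpace ℝ F]
    [NormedAddCommGroup G] [NormedSpace ℝ G] {f : ℝ × F → G} {t : ℝ} {x : F}
    (h : DifferentiableAt ℝ f (t, x)) :
    HasFDerivAt (fun y => f (t, y)) (spaceDeriv f (t, x)) x :=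
  HasFDerivAt.comp x h.hasFDerivAt (hasFDerivAt_prodMk_right t x)

lemma fderiv_clm_apply_of_eventuallyEq {F F' G : Type} [NormedAddCommGroup F] [NormedSpace ℝ F]
    [NormedAddCommGroup F'] [NormedSpace ℝ F'] [NormedAddCommGroup G] [NormedSpace ℝ G]
    {c : F → F' →L[ℝ] G} {u : F → F'} {u' : F →L[ℝ] F'} {w : F → G} {x : F}
    (hc : DifferentiableAt ℝ c x) (hu : HasFDerivAt u u' x) (hw : DifferentiableAt ℝ w x)
    (h : (fun y => c y (u y)) =ᶠ[𝓝 x] w) (a : F) :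
    fderiv ℝ c x a (u x) + c x (u' a) = fderiv ℝ w x a := by
  have h1 := (hc.hasFDerivAt.clm_apply hu).unique (hw.hasFDerivAt.congr_of_eventuallyEq h)
  rw [← h1]
  simp [add_comm]

/-! ### The Moser vector field and invariance along its flow -/

section Moser

variable {d : ℕ} {σ : Type*} {κ : σ ↪ Fin d} {x₀ : Model d} {ρ : ℝ} {g : Model d → Bil d}

/-- A closed log `2`-form for which the whole path to its model is non-degenerate. -/
structure IsMoserModel (κ : σ ↪ Fin d) (x₀ : Model d) (ρ : ℝ) (g : Model d → Bil d) : Prop where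
  logClosed : IsLogClosed κ x₀ ρ g
  nondegenerate : ∀ t ∈ Ioo (-1 : ℝ) 2, ∀ x ∈ Metric.ball x₀ ρ,
    ∃ e : Model d ≃L[ℝ] (Model d →L[ℝ] ℝ), (e : Model d →L[ℝ] (Model d →L[ℝ] ℝ)) = moserPath κ g t x

lemma exists_equiv_of_nondegenerate {B : Bil d} (h : ∀ v, (∀ w, B v w = 0) → v = 0) :
    ∃ e : Model d ≃L[ℝ] (Model d →L[ℝ] ℝ), (e : Model d →L[ℝ] (Model d →L[ℝ] ℝ)) = B := by
  have hinj : Function.Injective (B : Model d →ₗ[ℝ] (Model d →L[ℝ] ℝ)) := by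
    rw [← LinearMap.ker_eq_bot, LinearMap.ker_eq_bot']
    intro v hv
    exact h v fun w => by
      have := congrArg (fun l : Model d →L[ℝ] ℝ => l w) hv
      simpa using this
  have hdim : Module.finrank ℝ (Model d) = Module.finrank ℝ (Model d →L[ℝ] ℝ) := by
    rw [← (LinearMap.toContinuousLinearMap (𝕜 := ℝ) (E := Model d) (F' := ℝ)).finrank_eq]
    exact (Subspace.dual_finrank_eq (K := ℝ) (V := Model d)).symm
  refine ⟨(LinearEquiv.ofInjectiveOfFinrankEq (B : Model d →ₗ[ℝ] (Model d →L[ℝ] ℝ)) hinj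
    hdim).toContinuousLinearEquiv, ?_⟩
  ext v w
  rfl

lemma contDiffOn_moserPath (hg : IsLogClosed κ x₀ ρ g) :
    ContDiffOn ℝ ∞ (fun z : ℝ × Model d => moserPath κ g z.1 z.2)
      (univ ×ˢ Metric.ball x₀ ρ) :=
  (hg.comp_cproj.smooth.comp contDiff_snd.contDiffOn fun _ hz => hz.2).add
    (contDiff_fst.contDiffOn.smul
      ((contDiffOn_moserDiff hg).comp contDiff_snd.contDiffOn fun _ hz => hz.2))

lemma IsLogClosed.mono (hg : IsLogClosed κ x₀ ρ g) {ρ' : ℝ} (h : ρ' ≤ ρ) :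
    IsLogClosed κ x₀ ρ' g where
  center := hg.center
  smooth := hg.smooth.mono (Metric.ball_subset_ball h)
  alt := fun x hx => hg.alt x (Metric.ball_subset_ball h hx)
  closed := fun x hx => hg.closed x (Metric.ball_subset_ball h hx)

/-- At `x₀` the whole path is constant, equal to `g x₀`. Invertible maps form an open set, so the
tube lemma over a compact time interval gives a ball. The interval `(-1, 2)` is an open
neighbourhood of `[0, 1]` that is stable under the time reversal `t ↦ 1 - t`. -/
lemma exists_isMoserModel (hg : IsLogClosed κ x₀ ρ g) (hρ : 0 < ρ)
    (h : ∀ v, (∀ w, g x₀ v w = 0) → v = 0) : ∃ ρ', 0 < ρ' ∧ ρ' ≤ ρ ∧ IsMoserModel κ x₀ ρ' g := by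
  obtain ⟨e, he⟩ := exists_equiv_of_nondegenerate h
  have hopen : IsOpen ((univ ×ˢ Metric.ball x₀ ρ) ∩ (fun z : ℝ × Model d => moserPath κ g z.1 z.2) ⁻¹'
      (range ((↑) : (Model d ≃L[ℝ] (Model d →L[ℝ] ℝ)) → (Model d →L[ℝ] (Model d →L[ℝ] ℝ))))) :=
    (contDiffOn_moserPath hg).continuousOn.isOpen_inter_preimage
      (isOpen_univ.prod Metric.isOpen_ball) ContinuousLinearEquiv.isOpen
  obtain ⟨u, v, -, hv, hu1, hv1, huv⟩ := generalized_tube_lemma (isCompact_Icc (a := (-1 : ℝ)) (b := 2))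
    (isCompact_singleton (x := x₀)) hopen (by
      rintro ⟨t, x⟩ ⟨-, hx⟩
      rw [mem_singleton_iff] at hx
      simp only at hx
      subst hx
      refine ⟨⟨mem_univ _, Metric.mem_ball_self hρ⟩, e, ?_⟩
      rw [he]
      simp [moserPath, moserDiff, hg.center])
  obtain ⟨δ, hδ, hball⟩ := Metric.isOpen_iff.1 hv x₀ (hv1 rfl)
  refine ⟨min ρ δ, lt_min hρ hδ, min_le_left _ _, hg.mono (min_le_left _ _), fun t ht x hx => ?_⟩
  exact (huv (mk_mem_prod (hu1 ⟨ht.1.le, ht.2.le⟩)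
    (hball (Metric.ball_subset_ball (min_le_right _ _) hx)))).2

lemma contDiffOn_moserVec (hg : IsMoserModel κ x₀ ρ g) :
    ContDiffOn ℝ ∞ (fun z : ℝ × Model d => moserVec κ g z.1 z.2)
      (Ioo (-1) 2 ×ˢ Metric.ball x₀ ρ) := by
  rintro ⟨t, x⟩ ⟨ht, hx⟩
  obtain ⟨e, he⟩ := hg.nondegenerate t ht x hx
  have hmem : (univ ×ˢ Metric.ball x₀ ρ) ∈ 𝓝 (t, x) :=
    (isOpen_univ.prod Metric.isOpen_ball).mem_nhds ⟨mem_univ _, hx⟩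
  have h1 : ContDiffAt ℝ ∞ (fun z : ℝ × Model d => moserPath κ g z.1 z.2) (t, x) :=
    (contDiffOn_moserPath hg.logClosed).contDiffAt hmem
  have h2 : ContDiffAt ℝ ∞ ContinuousLinearMap.inverse (moserPath κ g t x) := by
    rw [← he]; exact contDiffAt_map_inverse e
  have h3 : ContDiffAt ℝ ∞ (fun z : ℝ × Model d => moserPrim κ g z.2) (t, x) :=
    (contDiffAt_moserPrim hg.logClosed hx).1.comp (t, x) contDiffAt_snd
  have h4 : ContDiffAt ℝ ∞ (fun z : ℝ × Model d => (moserPath κ g z.1 z.2).inverse) (t, x) :=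
    ContDiffAt.comp (t, x) (f := fun z : ℝ × Model d => moserPath κ g z.1 z.2)
      (g := ContinuousLinearMap.inverse) h2 h1
  exact (h4.clm_apply h3).neg.contDiffWithinAt

lemma contDiffOn_moserField (hg : IsMoserModel κ x₀ ρ g) :
    ContDiffOn ℝ ∞ (moserField κ g) (Ioo (-1) 2 ×ˢ Metric.ball x₀ ρ) :=
  ((contDiff_logFrame κ).comp contDiff_snd).contDiffOn.clm_apply (contDiffOn_moserVec hg)

lemma moserPath_moserVec (hg : IsMoserModel κ x₀ ρ g) {t : ℝ} (ht : t ∈ Ioo (-1 : ℝ) 2)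
    {x : Model d} (hx : x ∈ Metric.ball x₀ ρ) :
    moserPath κ g t x (moserVec κ g t x) = - moserPrim κ g x := by
  obtain ⟨e, he⟩ := hg.nondegenerate t ht x hx
  rw [moserVec, ← he, ContinuousLinearMap.inverse_equiv, map_neg]
  simp

lemma moserVec_unique (hg : IsMoserModel κ x₀ ρ g) {t : ℝ} (ht : t ∈ Ioo (-1 : ℝ) 2)
    {x : Model d} (hx : x ∈ Metric.ball x₀ ρ) {v : Model d}
    (hv : moserPath κ g t x v = - moserPrim κ g x) : v = moserVec κ g t x := by
  obtain ⟨e, he⟩ := hg.nondegenerate t ht x hx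
  rw [← moserPath_moserVec hg ht hx, ← he] at hv
  exact e.injective hv

lemma moserQuot_of_cproj_eq {x : Model d} (hx : cproj κ x = x) (r : ℝ) : moserQuot κ g (r, x) = 0 := by
  simp [moserQuot, hx]

/-- The quotient is linear in `x - cproj κ x`, so the primitive vanishes on the intersection; the
flow therefore fixes it pointwise. -/
lemma moserField_of_cproj_eq {x : Model d} (hx : cproj κ x = x) (t : ℝ) :
    moserField κ g (t, x) = 0 := by
  have : moserPrim κ g x = 0 := by
    simp [moserPrim, moserQuot_of_cproj_eq hx]
  simp [moserField, moserVec, this]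

lemma moserPrim_apply (hg : IsLogClosed κ x₀ ρ g) {x : Model d} (hx : x ∈ Metric.ball x₀ ρ)
    (v : Model d) : moserPrim κ g x v = ∫ r in (0 : ℝ)..1, moserQuot κ g (r, x) (eulerVec κ) v := by
  refine ContinuousLinearMap.intervalIntegral_apply (ContinuousOn.intervalIntegrable ?_) v
  refine ContinuousOn.clm_apply ?_ continuousOn_const
  refine (contDiffOn_moserQuot hg).continuousOn.comp
    (by fun_prop : Continuous fun r : ℝ => (r, x)).continuousOn fun s hs => ?_
  rw [uIcc_of_le zero_le_one] at hs
  exact mem_quotDomain hg.center hs hx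

attribute [local irreducible] moserQuot moserPrim moserVec

/-- The Moser vector field is natural. -/
theorem moserField_natural {σ' : Type*} {κ' : σ' ↪ Fin d} {x₀' : Model d} {ρ' : ℝ}
    {g' : Model d → Bil d} (hg : IsMoserModel κ x₀ ρ g) (hg' : IsMoserModel κ' x₀' ρ' g')
    {x y : Model d} (hx : x ∈ Metric.ball x₀ ρ) (hy : y ∈ Metric.ball x₀' ρ')
    (B : Model d ≃L[ℝ] Model d) (hB : B (eulerVec κ) = eulerVec κ')
    (hBL : ∀ v, B (logFrame κ x v) = logFrame κ' y (B v))
    (h : ∀ r ∈ Icc (0 : ℝ) 1, ∀ u v, g (dil κ r x) u v = g' (dil κ' r y) (B u) (B v))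
    {t : ℝ} (ht : t ∈ Ioo (-1 : ℝ) 2) :
    B (moserField κ g (t, x)) = moserField κ' g' (t, y) := by
  have h0 : ∀ u v, g (cproj κ x) u v = g' (cproj κ' y) (B u) (B v) := by
    simpa using h 0 (left_mem_Icc.2 zero_le_one)
  have h1 : ∀ u v, g x u v = g' y (B u) (B v) := by
    simpa using h 1 (right_mem_Icc.2 zero_le_one)
  have hd : ∀ r ∈ Icc (0 : ℝ) 1, ∀ u v, moserDiff κ g (dil κ r x) u v =
      moserDiff κ' g' (dil κ' r y) (B u) (B v) := by
    intro r hr u v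
    simp only [moserDiff, cproj_dil, sub_apply, h r hr, h0]
  have hp : ∀ v, moserPrim κ g x v = moserPrim κ' g' y (B v) := by
    intro v
    rw [moserPrim_apply hg.logClosed hx, moserPrim_apply hg'.logClosed hy]
    refine intervalIntegral.integral_congr_ae (Filter.Eventually.of_forall fun r hr => ?_)
    rw [uIoc_of_le zero_le_one] at hr
    have hr' : r ∈ Icc (0 : ℝ) 1 := ⟨hr.1.le, hr.2⟩
    -- Naturality is given for `moserDiff`, which is `r` times the quotient; it passes to the
    -- quotient by cancelling `r ≠ 0`, which is enough under the integral.
    have e1 := smul_moserQuot hg.logClosed (mem_quotDomain hg.logClosed.center hr' hx)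
    have e2 := smul_moserQuot hg'.logClosed (mem_quotDomain hg'.logClosed.center hr' hy)
    have e3 := hd r hr' (eulerVec κ) v
    simp only at e1 e2
    rw [← e1, ← e2, hB] at e3
    simp only [smul_apply, smul_eq_mul] at e3
    exact mul_left_cancel₀ hr.1.ne' e3
  have hv : B (moserVec κ g t x) = moserVec κ' g' t y := by
    refine moserVec_unique hg' ht hy ?_
    ext w
    obtain ⟨w, rfl⟩ := B.surjective w
    have h2 := congrArg (fun l : Model d →L[ℝ] ℝ => l w) (moserPath_moserVec hg ht hx)
    have h3 := hd 1 (right_mem_Icc.2 zero_le_one) (moserVec κ g t x) w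
    simp only [dil_one] at h3
    simp only [moserPath, add_apply, smul_apply, smul_eq_mul, neg_apply, h0, h3, hp] at h2 ⊢
    exact h2
  rw [moserField, moserField, hBL, hv]

/-- The components in the log frame of a vector at a point off the coordinate hyperplanes. -/
def logInv (κ : σ ↪ Fin d) (x v : Model d) : Model d :=
  logFrame κ (WithLp.toLp 2 fun j => (x j)⁻¹) v

lemma logInv_apply_range (x v : Model d) (s : σ) : logInv κ x v (κ s) = (x (κ s))⁻¹ * v (κ s) := by
  simp [logInv, logFrame_apply_range]

lemma logInv_apply_of_notMem (x v : Model d) {j : Fin d} (hj : j ∉ range κ) :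
    logInv κ x v j = v j := logFrame_apply_of_notMem κ _ _ hj

lemma logFrame_logInv {x : Model d} (hx : ∀ s, x (κ s) ≠ 0) (v : Model d) :
    logFrame κ x (logInv κ x v) = v :=
  ext_range κ (fun s => by rw [logFrame_apply_range, logInv_apply_range,
    mul_inv_cancel_left₀ (hx s)])
    (fun j hj => by rw [logFrame_apply_of_notMem κ _ _ hj, logInv_apply_of_notMem _ _ hj])

lemma logInv_logFrame {x : Model d} (hx : ∀ s, x (κ s) ≠ 0) (v : Model d) :
    logInv κ x (logFrame κ x v) = v :=
  ext_range κ (fun s => by rw [logInv_apply_range, logFrame_apply_range,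
    inv_mul_cancel_left₀ (hx s)])
    (fun j hj => by rw [logInv_apply_of_notMem _ _ hj, logFrame_apply_of_notMem κ _ _ hj])

lemma eqOn_zero_deriv {G : Type*} [NormedAddCommGroup G] [NormedSpace ℝ G] {f : ℝ → G}
    (h : ∀ t ∈ Icc (0 : ℝ) 1, HasDerivWithinAt f 0 (Icc 0 1) t) : ∀ t ∈ Icc (0 : ℝ) 1, f t = f 0 := by
  refine constant_of_derivWithin_zero (fun t ht => (h t ht).differentiableWithinAt)
    fun t ht => ?_
  have ht' : t ∈ Icc (0 : ℝ) 1 := ⟨ht.1, ht.2.le⟩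
  exact (h t ht').derivWithin (uniqueDiffOn_Icc zero_lt_one t ht')

/-- The product of `f` with `exp (-∫ q)` is constant. Applied to the coordinates `x_s` along the
Moser flow, this shows that the flow respects the hyperplanes and their complements. -/
lemma exists_eq_mul_of_hasDerivWithinAt {f q : ℝ → ℝ} (hq : ContinuousOn q (Icc 0 1))
    (h : ∀ t ∈ Icc (0 : ℝ) 1, HasDerivWithinAt f (f t * q t) (Icc 0 1) t) :
    ∀ t ∈ Icc (0 : ℝ) 1, ∃ c : ℝ, 0 < c ∧ f t = c * f 0 := by
  set q' : ℝ → ℝ := IccExtend zero_le_one ((Icc (0 : ℝ) 1).domRestrict q)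
  have hq' : Continuous q' := (continuousOn_iff_continuous_domRestrict.1 hq).Icc_extend'
  have hqq : ∀ t ∈ Icc (0 : ℝ) 1, q' t = q t := fun t ht => by
    simp only [q', IccExtend_of_mem zero_le_one _ ht, domRestrict_apply]
  set Q : ℝ → ℝ := fun t => ∫ s in (0 : ℝ)..t, q' s
  have hQ : ∀ t, HasDerivAt Q (q' t) t := fun t => intervalIntegral.integral_hasDerivAt_right
    (hq'.intervalIntegrable _ _) (hq'.stronglyMeasurableAtFilter _ _) hq'.continuousAt
  have h1 : ∀ t ∈ Icc (0 : ℝ) 1, HasDerivWithinAt (fun t => f t * Real.exp (- Q t)) 0 (Icc 0 1) t := by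
    intro t ht
    have := (h t ht).mul ((hQ t).neg.exp.hasDerivWithinAt (s := Icc 0 1))
    refine this.congr_deriv ?_
    rw [hqq t ht]; ring
  intro t ht
  have h2 := eqOn_zero_deriv h1 t ht
  have h3 : Q 0 = 0 := by simp [Q]
  refine ⟨Real.exp (Q t), Real.exp_pos _, ?_⟩
  simp only [h3, neg_zero, Real.exp_zero, mul_one] at h2
  rw [← h2, Real.exp_neg]
  field_simp

lemma hasDerivWithinAt_apply {f : ℝ → Model d} {f' : Model d} {s : Set ℝ} {t : ℝ}
    (h : HasDerivWithinAt f f' s t) (j : Fin d) : HasDerivWithinAt (fun t => f t j) (f' j) s t :=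
  (EuclideanSpace.proj j : Model d →L[ℝ] ℝ).hasFDerivAt.comp_hasDerivWithinAt t h

lemma hasDerivWithinAt_of_apply {f : ℝ → Model d} {f' : Model d} {s : Set ℝ} {t : ℝ}
    (h : ∀ j, HasDerivWithinAt (fun t => f t j) (f' j) s t) : HasDerivWithinAt f f' s t := by
  rw [hasDerivWithinAt_iff_hasFDerivWithinAt, hasFDerivWithinAt_euclidean]
  intro j
  refine (h j).hasFDerivWithinAt.congr_fderiv ?_
  ext
  simp

/-- The defining equation of the Moser field, contraction of the path equals minus the primitive,
differentiated in the space variable. -/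
lemma fderiv_moserPath_moserVec (hg : IsMoserModel κ x₀ ρ g) {t : ℝ} (ht : t ∈ Ioo (-1 : ℝ) 2)
    {x : Model d} (hx : x ∈ Metric.ball x₀ ρ) (u v : Model d) :
    fderiv ℝ (moserPath κ g t) x u (moserVec κ g t x) v +
      moserPath κ g t x (spaceDeriv (fun z => moserVec κ g z.1 z.2) (t, x) u) v =
      - fderiv ℝ (moserPrim κ g) x u v := by
  have hmem : Ioo (-1 : ℝ) 2 ×ˢ Metric.ball x₀ ρ ∈ 𝓝 (t, x) :=
    (isOpen_Ioo.prod Metric.isOpen_ball).mem_nhds ⟨ht, hx⟩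
  have hvec := hasFDerivAt_spaceDeriv (f := fun z : ℝ × Model d => moserVec κ g z.1 z.2)
    (((contDiffOn_moserVec hg).contDiffAt hmem).differentiableAt (by simp))
  have h2 : (fun y => moserPath κ g t y (moserVec κ g t y)) =ᶠ[𝓝 x] fun y => - moserPrim κ g y := by
    filter_upwards [Metric.isOpen_ball.mem_nhds hx] with y hy
    exact moserPath_moserVec hg ht hy
  have hd : DifferentiableAt ℝ (moserPrim κ g) x :=
    ((contDiffAt_moserPrim hg.logClosed hx).1).differentiableAt (by simp)
  have hp := (isLogClosed_moserPath hg.logClosed t).differentiableAt hx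
  have hn : DifferentiableAt ℝ (fun y => - moserPrim κ g y) x := hd.fun_neg
  have h3 := fderiv_clm_apply_of_eventuallyEq hp hvec hn h2 u
  have h4 := congrArg (fun l : Model d →L[ℝ] ℝ => l v) h3
  rw [show fderiv ℝ (fun y => - moserPrim κ g y) x = - fderiv ℝ (moserPrim κ g) x from
    fderiv_fun_neg] at h4
  exact h4

lemma spaceDeriv_moserField (hg : IsMoserModel κ x₀ ρ g) {t : ℝ} (ht : t ∈ Ioo (-1 : ℝ) 2)
    {x : Model d} (hx : x ∈ Metric.ball x₀ ρ) (u : Model d) :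
    spaceDeriv (moserField κ g) (t, x) u = frameMul κ u (moserVec κ g t x) +
      logFrame κ x (spaceDeriv (fun z => moserVec κ g z.1 z.2) (t, x) u) := by
  have hmem : Ioo (-1 : ℝ) 2 ×ˢ Metric.ball x₀ ρ ∈ 𝓝 (t, x) :=
    (isOpen_Ioo.prod Metric.isOpen_ball).mem_nhds ⟨ht, hx⟩
  have hvec := hasFDerivAt_spaceDeriv (f := fun z : ℝ × Model d => moserVec κ g z.1 z.2)
    (((contDiffOn_moserVec hg).contDiffAt hmem).differentiableAt (by simp))
  have hfield := hasFDerivAt_spaceDeriv (f := moserField κ g)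
    (((contDiffOn_moserField hg).contDiffAt hmem).differentiableAt (by simp))
  have h2 : HasFDerivAt (fun y => moserField κ g (t, y)) _ x :=
    (hasFDerivAt_logFrame κ x).clm_apply hvec
  rw [hfield.unique h2]
  simp [add_comm]

/-- A solution of the Moser equation, with two solutions of the linearized equation along it. -/
theorem moser_coord {γ : ℝ → Model d} (hg : IsMoserModel κ x₀ ρ g)
    (hγ : ∀ t ∈ Icc (0 : ℝ) 1, γ t ∈ Metric.ball x₀ ρ ∧
      HasDerivWithinAt γ (moserField κ g (t, γ t)) (Icc 0 1) t) (s : σ) :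
    ∀ t ∈ Icc (0 : ℝ) 1, ∃ c : ℝ, 0 < c ∧ γ t (κ s) = c * γ 0 (κ s) := by
  have hγc : ContinuousOn γ (Icc 0 1) := fun t ht => (hγ t ht).2.continuousWithinAt
  refine exists_eq_mul_of_hasDerivWithinAt (q := fun t => moserVec κ g t (γ t) (κ s)) ?_
    fun t ht => ?_
  · have h1 : ContinuousOn (fun t => moserVec κ g t (γ t)) (Icc 0 1) :=
      (contDiffOn_moserVec hg).continuousOn.comp (continuousOn_id.prodMk hγc)
        fun t ht => ⟨Icc_subset_Ioo (by norm_num) (by norm_num) ht, (hγ t ht).1⟩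
    exact (EuclideanSpace.proj (κ s) : Model d →L[ℝ] ℝ).continuous.comp_continuousOn h1
  · have := hasDerivWithinAt_apply (hγ t ht).2 (κ s)
    rwa [moserField, logFrame_apply_range] at this

/-- This is `d/dt (φ_t^* G_t) = 0`, evaluated on two vectors transported by the linearized flow. By
closedness the Lie derivative of `G_t` along the field is the exterior derivative of its
contraction, which is minus `moserDiff` and cancels the time derivative of the path. Log components
make sense along the curve because it stays off the hyperplanes (`moser_coord`). -/
theorem moser_invariance {γ A B : ℝ → Model d} (hg : IsMoserModel κ x₀ ρ g)
    (hγ : ∀ t ∈ Icc (0 : ℝ) 1, γ t ∈ Metric.ball x₀ ρ ∧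
      HasDerivWithinAt γ (moserField κ g (t, γ t)) (Icc 0 1) t)
    (hA : ∀ t ∈ Icc (0 : ℝ) 1,
      HasDerivWithinAt A (spaceDeriv (moserField κ g) (t, γ t) (A t)) (Icc 0 1) t)
    (hB : ∀ t ∈ Icc (0 : ℝ) 1,
      HasDerivWithinAt B (spaceDeriv (moserField κ g) (t, γ t) (B t)) (Icc 0 1) t)
    (hnz : ∀ s, γ 0 (κ s) ≠ 0) :
    g (γ 1) (logInv κ (γ 1) (A 1)) (logInv κ (γ 1) (B 1)) =
      g (cproj κ (γ 0)) (logInv κ (γ 0) (A 0)) (logInv κ (γ 0) (B 0)) := by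
  have hIoo : ∀ t ∈ Icc (0 : ℝ) 1, t ∈ Ioo (-1 : ℝ) 2 := fun t ht =>
    ⟨by linarith [ht.1], by linarith [ht.2]⟩
  have hnz' : ∀ t ∈ Icc (0 : ℝ) 1, ∀ s, γ t (κ s) ≠ 0 := by
    intro t ht s
    obtain ⟨c, hc, h⟩ := moser_coord hg hγ s t ht
    rw [h]; exact mul_ne_zero hc.ne' (hnz s)
  -- In log components the derivative of the frame along the curve cancels against the derivative of
  -- the frame in the field; only the derivative of `moserVec` survives.
  have hlin : ∀ {A : ℝ → Model d}, (∀ t ∈ Icc (0 : ℝ) 1,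
      HasDerivWithinAt A (spaceDeriv (moserField κ g) (t, γ t) (A t)) (Icc 0 1) t) →
      ∀ t ∈ Icc (0 : ℝ) 1, HasDerivWithinAt (fun t => logInv κ (γ t) (A t))
        (spaceDeriv (fun z => moserVec κ g z.1 z.2) (t, γ t) (A t)) (Icc 0 1) t := by
    intro A hA t ht
    have hA' := hA t ht
    rw [spaceDeriv_moserField hg (hIoo t ht) (hγ t ht).1] at hA'
    refine hasDerivWithinAt_of_apply fun j => ?_
    have h1 := hasDerivWithinAt_apply hA' j
    by_cases hj : j ∈ range κ
    · obtain ⟨s, rfl⟩ := hj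
      simp only [logInv_apply_range]
      have h2 := hasDerivWithinAt_apply (hγ t ht).2 (κ s)
      refine ((h2.inv (hnz' t ht s)).mul h1).congr_deriv ?_
      simp only [moserField, PiLp.add_apply, logFrame_apply_range, frameMul_apply_range,
        Pi.inv_apply]
      have := hnz' t ht s
      field_simp
      ring
    · simp only [logInv_apply_of_notMem _ _ hj]
      refine h1.congr_deriv ?_
      simp only [PiLp.add_apply, logFrame_apply_of_notMem _ _ _ hj, frameMul_apply_of_notMem _ _ _ hj,
        zero_add]
  set a := fun t => logInv κ (γ t) (A t)
  set b := fun t => logInv κ (γ t) (B t)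
  have hLa : ∀ t ∈ Icc (0 : ℝ) 1, logFrame κ (γ t) (a t) = A t := fun t ht =>
    logFrame_logInv (hnz' t ht) _
  have hLb : ∀ t ∈ Icc (0 : ℝ) 1, logFrame κ (γ t) (b t) = B t := fun t ht =>
    logFrame_logInv (hnz' t ht) _
  have key : ∀ t ∈ Icc (0 : ℝ) 1, HasDerivWithinAt (fun t => moserPath κ g t (γ t) (a t) (b t)) 0
      (Icc 0 1) t := by
    intro t ht
    obtain ⟨hmem, hγ'⟩ := hγ t ht
    have hT := ((isLogClosed_moserDiff hg.logClosed).differentiableAt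
      hmem).hasFDerivAt.comp_hasDerivWithinAt t hγ'
    have hP := (hg.logClosed.comp_cproj.differentiableAt
      hmem).hasFDerivAt.comp_hasDerivWithinAt t hγ'
    have hG : HasDerivWithinAt (fun t => moserPath κ g t (γ t))
        (moserDiff κ g (γ t) + fderiv ℝ (moserPath κ g t) (γ t) (moserField κ g (t, γ t)))
        (Icc 0 1) t := by
      have h1 := hP.add ((hasDerivWithinAt_id t (Icc 0 1)).smul hT)
      refine h1.congr_deriv ?_
      have h2 : fderiv ℝ (moserPath κ g t) (γ t) =
          fderiv ℝ (fun x => g (cproj κ x)) (γ t) + t • fderiv ℝ (moserDiff κ g) (γ t) :=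
        ((hg.logClosed.comp_cproj.differentiableAt hmem).hasFDerivAt.add
          (((isLogClosed_moserDiff hg.logClosed).differentiableAt hmem).hasFDerivAt.const_smul
            t)).fderiv
      rw [h2]
      simp only [Function.comp_apply, id_eq, one_smul, add_apply, smul_apply]
      abel
    refine ((hG.clm_apply (hlin hA t ht)).clm_apply (hlin hB t ht)).congr_deriv ?_
    have e1 := fderiv_moserPath_moserVec hg (hIoo t ht) hmem (A t) (b t)
    have e2 := fderiv_moserPath_moserVec hg (hIoo t ht) hmem (B t) (a t)
    have hcl := isLogClosed_moserPath hg.logClosed t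
    have e3 := hcl.closed _ hmem (moserVec κ g t (γ t)) (a t) (b t)
    have e4 := fderiv_moserPrim hg.logClosed hmem (a t) (b t)
    have e5 := hcl.alt _ hmem (a t) (spaceDeriv (fun z => moserVec κ g z.1 z.2) (t, γ t) (B t))
    rw [hLa t ht, hLb t ht] at e3 e4
    simp only [add_apply] at e1 e2 e3 e4 e5 ⊢
    change _ = _
    have e6 : moserField κ g (t, γ t) = logFrame κ (γ t) (moserVec κ g t (γ t)) := rfl
    rw [e6]
    linarith
  have h1 := eqOn_zero_deriv key 1 (right_mem_Icc.2 zero_le_one)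
  simpa [moserPath, moserDiff, a, b] using h1

end Moser

end
end LogSymp

namespace LogSymp

noncomputable section

set_option linter.unusedSectionVars false
set_option maxSynthPendingDepth 3

/-! ### Log forms in Euclidean space -/

section Dense

variable {d : ℕ} {σ : Type*} [Finite σ] (κ : σ ↪ Fin d)

lemma dense_setOf_forall_ne_zero : Dense {x : Model d | ∀ s, x (κ s) ≠ 0} := by
  have h : ∀ s, Dense {x : Model d | x (κ s) ≠ 0} ∧ IsOpen {x : Model d | x (κ s) ≠ 0} := by
    intro s
    have hsurj : Function.Surjective (EuclideanSpace.proj (κ s) : Model d →L[ℝ] ℝ) := fun c =>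
      ⟨EuclideanSpace.single (κ s) c, by simp⟩
    have hcont : Continuous fun x : Model d => x (κ s) :=
      (EuclideanSpace.proj (κ s) : Model d →L[ℝ] ℝ).continuous
    refine ⟨(dense_compl_singleton (0 : ℝ)).preimage
      ((EuclideanSpace.proj (κ s) : Model d →L[ℝ] ℝ).isOpenMap hsurj), ?_⟩
    exact isOpen_compl_singleton.preimage hcont
  rw [Set.ofPred_forall]
  exact dense_iInter_of_isOpen (fun s => (h s).2) fun s => (h s).1

/-- Identities between log components are verified off the hyperplanes, where they are identities of
ordinary forms, and extend to the hyperplanes by density. All statements about values on `X` are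
reached in this way. -/
lemma eqOn_of_forall_ne_zero {G : Type*} [TopologicalSpace G] [T2Space G] {f g : Model d → G}
    {O : Set (Model d)} (hO : IsOpen O) (hf : ContinuousOn f O) (hg : ContinuousOn g O)
    (h : ∀ x ∈ O, (∀ s, x (κ s) ≠ 0) → f x = g x) : EqOn f g O := by
  have h1 : EqOn f g (O ∩ {x : Model d | ∀ s, x (κ s) ≠ 0}) := fun x hx => h x hx.1 hx.2
  exact h1.of_subset_closure hf hg inter_subset_left
    ((dense_setOf_forall_ne_zero κ).open_subset_closure_inter hO)

end Dense

/-! ### Forms of degree one and two as covectors and bilinear forms -/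

section ToBil

variable {d : ℕ}

/-- Alternating `2`-forms as bilinear forms. -/
def toBil : (Model d [⋀^Fin 2]→L[ℝ] ℝ) →L[ℝ] Bil d :=
  (ContinuousLinearMap.compL ℝ (Model d)
    (ContinuousMultilinearMap ℝ (fun _ : Fin 1 => Model d) ℝ) (Model d →L[ℝ] ℝ)
      ((continuousMultilinearCurryFin1 ℝ (Model d) ℝ).toContinuousLinearEquiv :
        ContinuousMultilinearMap ℝ (fun _ : Fin 1 => Model d) ℝ →L[ℝ] (Model d →L[ℝ] ℝ))) ∘L
    ((continuousMultilinearCurryLeftEquiv ℝ (fun _ : Fin 2 => Model d) ℝ).toContinuousLinearEquiv :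
      ContinuousMultilinearMap ℝ (fun _ : Fin 2 => Model d) ℝ →L[ℝ]
        (Model d →L[ℝ] ContinuousMultilinearMap ℝ (fun _ : Fin 1 => Model d) ℝ)) ∘L
    (ContinuousAlternatingMap.toContinuousMultilinearMapCLM ℝ)

lemma toBil_apply (θ : Model d [⋀^Fin 2]→L[ℝ] ℝ) (u v : Model d) : toBil θ u v = θ ![u, v] := by
  change θ (Fin.cons u _) = _
  congr 1
  ext i : 1
  refine Fin.cases rfl (fun j => ?_) i
  fin_cases j
  rfl

lemma toBil_swap (θ : Model d [⋀^Fin 2]→L[ℝ] ℝ) (u v : Model d) :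
    toBil θ u v = - toBil θ v u := by
  rw [toBil_apply, toBil_apply]
  have h := θ.toAlternatingMap.map_swap ![v, u] (show (0 : Fin 2) ≠ 1 by decide)
  have e : ![v, u] ∘ Equiv.swap (0 : Fin 2) 1 = ![u, v] := by ext i : 1; fin_cases i <;> rfl
  rw [e] at h
  exact h

/-- Alternating `1`-forms as covectors. -/
def toCov : (Model d [⋀^Fin 1]→L[ℝ] ℝ) →L[ℝ] (Model d →L[ℝ] ℝ) :=
  ((continuousMultilinearCurryFin1 ℝ (Model d) ℝ).toContinuousLinearEquiv :
        ContinuousMultilinearMap ℝ (fun _ : Fin 1 => Model d) ℝ →L[ℝ] (Model d →L[ℝ] ℝ)) ∘L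
    (ContinuousAlternatingMap.toContinuousMultilinearMapCLM ℝ)

lemma toCov_apply (θ : Model d [⋀^Fin 1]→L[ℝ] ℝ) (u : Model d) : toCov θ u = θ ![u] := by
  change θ (Fin.snoc _ u) = _
  congr 1
  ext i : 1
  fin_cases i
  rfl

lemma toCov_toOneForm (α : Model d →L[ℝ] ℝ) : toCov (toOneForm α) = α := by
  ext v
  rw [toCov_apply]
  simp [toOneForm]

lemma toOneForm_toCov (θ : Model d [⋀^Fin 1]→L[ℝ] ℝ) : toOneForm (toCov θ) = θ := by
  ext v
  have : v = ![v 0] := by ext i : 1; fin_cases i; rfl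
  rw [this, ← toCov_apply, toCov_toOneForm, toCov_apply]

lemma toOneForm_apply (α : Model d →L[ℝ] ℝ) (v : Fin 1 → Model d) : toOneForm α v = α (v 0) := by
  simp [toOneForm]

lemma toBil_injective : Function.Injective (toBil (d := d)) := by
  intro θ θ' h
  ext v
  have : v = ![v 0, v 1] := by ext i : 1; fin_cases i <;> rfl
  rw [this, ← toBil_apply, ← toBil_apply, h]

lemma toBil_wedge (α : Model d →L[ℝ] ℝ) (β : Model d [⋀^Fin 1]→L[ℝ] ℝ) (u v : Model d) :
    toBil (wedge α β) u v = α u * toCov β v - α v * toCov β u := by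
  rw [toBil_apply, wedge, ContinuousAlternatingMap.alternatizeUncurryFin_apply, Fin.sum_univ_two]
  have e0 : (0 : Fin 2).removeNth ![u, v] = ![v] := by ext i : 1; fin_cases i; rfl
  have e1 : (1 : Fin 2).removeNth ![u, v] = ![u] := by ext i : 1; fin_cases i; rfl
  rw [e0, e1, toCov_apply, toCov_apply]
  simp
  ring

lemma toBil_compContinuousLinearMap (θ : Model d [⋀^Fin 2]→L[ℝ] ℝ) (A : Model d →L[ℝ] Model d)
    (u v : Model d) : toBil (θ.compContinuousLinearMap A) u v = toBil θ (A u) (A v) := by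
  rw [toBil_apply, toBil_apply, ContinuousAlternatingMap.compContinuousLinearMap_apply]
  congr 1
  ext i : 1
  fin_cases i <;> rfl

lemma toCov_compContinuousLinearMap (θ : Model d [⋀^Fin 1]→L[ℝ] ℝ) (A : Model d →L[ℝ] Model d)
    (u : Model d) : toCov (θ.compContinuousLinearMap A) u = toCov θ (A u) := by
  rw [toCov_apply, toCov_apply, ContinuousAlternatingMap.compContinuousLinearMap_apply]
  congr 1
  ext i : 1
  fin_cases i; rfl

lemma extDeriv_apply_two (θ : Model d → Model d [⋀^Fin 1]→L[ℝ] ℝ) (x u v : Model d) :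
    toBil (extDeriv θ x) u v = toCov (fderiv ℝ θ x u) v - toCov (fderiv ℝ θ x v) u := by
  rw [toBil_apply, extDeriv, ContinuousAlternatingMap.alternatizeUncurryFin_apply, Fin.sum_univ_two]
  have e0 : (0 : Fin 2).removeNth ![u, v] = ![v] := by ext i : 1; fin_cases i; rfl
  have e1 : (1 : Fin 2).removeNth ![u, v] = ![u] := by ext i : 1; fin_cases i; rfl
  rw [e0, e1, toCov_apply, toCov_apply]
  simp
  ring

lemma fderiv_toCov {θ : Model d → Model d [⋀^Fin 1]→L[ℝ] ℝ} {x : Model d}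
    (h : DifferentiableAt ℝ θ x) (w : Model d) :
    fderiv ℝ (fun y => toCov (θ y)) x w = toCov (fderiv ℝ θ x w) := by
  rw [show (fun y => toCov (θ y)) = toCov ∘ θ from rfl,
    fderiv_comp x toCov.differentiableAt h, ContinuousLinearMap.fderiv]
  rfl

lemma fderiv_toBil {θ : Model d → Model d [⋀^Fin 2]→L[ℝ] ℝ} {x : Model d}
    (h : DifferentiableAt ℝ θ x) (w : Model d) :
    fderiv ℝ (fun y => toBil (θ y)) x w = toBil (fderiv ℝ θ x w) := by
  rw [show (fun y => toBil (θ y)) = toBil ∘ θ from rfl,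
    fderiv_comp x toBil.differentiableAt h, ContinuousLinearMap.fderiv]
  rfl

lemma toBil_extDeriv {θ : Model d → Model d [⋀^Fin 1]→L[ℝ] ℝ} {x : Model d}
    (h : DifferentiableAt ℝ θ x) (u v : Model d) : toBil (extDeriv θ x) u v =
      fderiv ℝ (fun y => toCov (θ y)) x u v - fderiv ℝ (fun y => toCov (θ y)) x v u := by
  rw [extDeriv_apply_two, fderiv_toCov h, fderiv_toCov h]

lemma extDeriv_apply_three {θ : Model d → Model d [⋀^Fin 2]→L[ℝ] ℝ} {x : Model d}
    (h : DifferentiableAt ℝ θ x) (u v w : Model d) : extDeriv θ x ![u, v, w] =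
      fderiv ℝ (fun y => toBil (θ y)) x u v w - fderiv ℝ (fun y => toBil (θ y)) x v u w +
        fderiv ℝ (fun y => toBil (θ y)) x w u v := by
  rw [extDeriv, ContinuousAlternatingMap.alternatizeUncurryFin_apply, Fin.sum_univ_three,
    fderiv_toBil h, fderiv_toBil h, fderiv_toBil h, toBil_apply, toBil_apply, toBil_apply]
  have e0 : (0 : Fin 3).removeNth ![u, v, w] = ![v, w] := by ext i : 1; fin_cases i <;> rfl
  have e1 : (1 : Fin 3).removeNth ![u, v, w] = ![u, w] := by ext i : 1; fin_cases i <;> rfl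
  have e2 : (2 : Fin 3).removeNth ![u, v, w] = ![u, v] := by ext i : 1; fin_cases i <;> rfl
  rw [e0, e1, e2]
  simp
  ring

end ToBil


/-! ### Hadamard's lemma for coordinate subspaces -/

section Hadamard

variable {d : ℕ} {x₀ : Model d} {ρ : ℝ}

/-- Hadamard's lemma for functions vanishing on a coordinate subspace. -/
lemma exists_hadamard {σ : Type*} (κ : σ ↪ Fin d) (hx₀ : cproj κ x₀ = x₀) {F : Model d → ℝ}
    (hF : ContDiffOn ℝ ∞ F (Metric.ball x₀ ρ))
    (h0 : ∀ x ∈ Metric.ball x₀ ρ, cproj κ x = x → F x = 0) :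
    ∃ h : Model d → (Model d →L[ℝ] ℝ), ContDiffOn ℝ ∞ h (Metric.ball x₀ ρ) ∧
      ∀ x ∈ Metric.ball x₀ ρ, F x = h x (x - cproj κ x) := by
  obtain ⟨F', hF', hFd⟩ : ∃ F' : Model d → Model d →L[ℝ] ℝ,
      ContDiffOn ℝ ∞ F' (Metric.ball x₀ ρ) ∧ ∀ x ∈ Metric.ball x₀ ρ, HasFDerivAt F (F' x) x :=
    ⟨fderiv ℝ F, hF.fderiv_of_isOpen Metric.isOpen_ball (by simp), fun x hx =>
      ((hF.contDiffAt (Metric.isOpen_ball.mem_nhds hx)).differentiableAt (by simp)).hasFDerivAt⟩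
  obtain ⟨D, hDo, hsub, hD⟩ : ∃ D : Set (ℝ × Model d), IsOpen D ∧
      (∀ z ∈ D, dil κ z.1 z.2 ∈ Metric.ball x₀ ρ) ∧
      ∀ x ∈ Metric.ball x₀ ρ, ∀ t ∈ Icc (0 : ℝ) 1, (t, x) ∈ D :=
    ⟨(fun z : ℝ × Model d => dil κ z.1 z.2) ⁻¹' Metric.ball x₀ ρ,
      Metric.isOpen_ball.preimage (contDiff_dil (κ := κ)).continuous, fun z hz => hz,
      fun x hx t ht => dil_mem_ball κ hx₀ ht hx⟩
  have hsm : ContDiffOn ℝ ∞ (fun z : ℝ × Model d => F' (dil κ z.1 z.2)) D :=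
    hF'.comp (contDiff_dil (κ := κ)).contDiffOn hsub
  refine ⟨fun x => ∫ s in (0 : ℝ)..1, F' (dil κ s x), fun x hx =>
    (contDiffAt_integral (h := fun z : ℝ × Model d => F' (dil κ z.1 z.2)) hDo hsm
      (hD x hx)).1.contDiffWithinAt, fun x hx => ?_⟩
  have hc : ContinuousOn (fun r => F' (dil κ r x)) (uIcc (0 : ℝ) 1) :=
    hsm.continuousOn.comp (f := fun r : ℝ => (r, x))
      (by fun_prop : Continuous fun r : ℝ => (r, x)).continuousOn fun s hs => by
      rw [uIcc_of_le zero_le_one] at hs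
      exact hD x hx s hs
  have h1 : ∀ r ∈ uIcc (0 : ℝ) 1, HasDerivAt (fun r => F (dil κ r x))
      (F' (dil κ r x) (x - cproj κ x)) r := by
    intro r hr
    rw [uIcc_of_le zero_le_one] at hr
    have h2 : HasDerivAt (fun s => dil κ s x) (x - cproj κ x) r := by
      simp only [dil_apply]
      have := ((hasDerivAt_id r).smul_const (x - cproj κ x)).const_add (cproj κ x)
      simpa using this
    exact (hFd _ (dil_mem_ball κ hx₀ hr hx)).comp_hasDerivAt r h2
  have h3 : IntervalIntegrable (fun r => F' (dil κ r x) (x - cproj κ x)) MeasureTheory.volume 0 1 :=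
    (hc.clm_apply continuousOn_const).intervalIntegrable
  have h4 := intervalIntegral.integral_eq_sub_of_hasDerivAt h1 h3
  rw [ContinuousLinearMap.intervalIntegral_apply hc.intervalIntegrable, h4, dil_one, dil_zero,
    h0 _ (cproj_mem_ball κ hx₀ hx) (cproj_cproj κ x), sub_zero]

/-- Hadamard's lemma for a function vanishing on a coordinate hyperplane. -/
lemma exists_eq_coord_mul (j : Fin d) (hx₀ : x₀ j = 0) {F : Model d → ℝ}
    (hF : ContDiffOn ℝ ∞ F (Metric.ball x₀ ρ)) (h0 : ∀ x ∈ Metric.ball x₀ ρ, x j = 0 → F x = 0) :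
    ∃ h : Model d → ℝ, ContDiffOn ℝ ∞ h (Metric.ball x₀ ρ) ∧
      ∀ x ∈ Metric.ball x₀ ρ, F x = x j * h x := by
  set κ : Unit ↪ Fin d := ⟨fun _ => j, fun _ _ _ => rfl⟩
  have hκ : ∀ x : Model d, x - cproj κ x = x j • eulerVec κ := fun x =>
    ext_range κ (fun s => by
      have : κ s = j := rfl
      simp only [PiLp.sub_apply, PiLp.smul_apply, cproj_apply_range, eulerVec_apply_range]
      simp [this])
      (fun i hi => by simp [cproj_apply_of_notMem _ _ hi, eulerVec_apply_of_notMem _ hi])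
  obtain ⟨h, hh, hF'⟩ := exists_hadamard κ ((cproj_eq_self_iff κ).2 fun _ => hx₀) hF
    (fun x hx hx' => h0 x hx ((cproj_eq_self_iff κ).1 hx' ()))
  refine ⟨fun x => h x (eulerVec κ), hh.clm_apply contDiffOn_const, fun x hx => ?_⟩
  rw [hF' x hx, hκ, map_smul, smul_eq_mul]

lemma fderiv_coord_mul {j : Fin d} {F h : Model d → ℝ} {x : Model d}
    (hh : DifferentiableAt ℝ h x) (hF : F =ᶠ[𝓝 x] fun x => x j * h x) (v : Model d) :
    fderiv ℝ F x v = v j * h x + x j * fderiv ℝ h x v := by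
  have h1 : HasFDerivAt (fun x : Model d => x j) (EuclideanSpace.proj j : Model d →L[ℝ] ℝ) x :=
    (EuclideanSpace.proj j : Model d →L[ℝ] ℝ).hasFDerivAt
  rw [((h1.mul hh.hasFDerivAt).congr_of_eventuallyEq hF).fderiv]
  simp
  ring

end Hadamard

/-! ### Coordinate changes in log frames -/

section LogDeriv

variable {d : ℕ} {σ : Type*} {κ : σ ↪ Fin d}

/-- The first-order part of the change of log frames. -/
structure IsLogDeriv {σ : Type*} (κ κ₁ : σ ↪ Fin d) (ψ : Model d → Model d) (O : Set (Model d))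
    (A : Model d → Model d →L[ℝ] Model d) : Prop where
  smooth : ContDiffOn ℝ ∞ A O
  fderiv_logFrame : ∀ x ∈ O, ∀ v, fderiv ℝ ψ x (logFrame κ x v) = logFrame κ₁ (ψ x) (A x v)
  single : ∀ x ∈ O, cproj κ x = x → ∀ s,
    A x (EuclideanSpace.single (κ s) 1) = EuclideanSpace.single (κ₁ s) 1

/-- Coordinate changes that preserve a normal crossing divisor act on log frames. -/
theorem exists_isLogDeriv [Finite σ] {κ₁ : σ ↪ Fin d} {ψ : Model d → Model d} {O : Set (Model d)}
    (hO : IsOpen O) {x₀ : Model d} (hx₀ : x₀ ∈ O) (hc : cproj κ x₀ = x₀) (hψ : ContDiffOn ℝ ∞ ψ O)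
    (h0 : ∀ x ∈ O, ∀ s, x (κ s) = 0 → ψ x (κ₁ s) = 0)
    (hinj : Function.Surjective (fderiv ℝ ψ x₀)) :
    ∃ O' ⊆ O, IsOpen O' ∧ x₀ ∈ O' ∧ ∃ A, IsLogDeriv κ κ₁ ψ O' A := by
  have := Fintype.ofFinite σ
  obtain ⟨ρ, hρ, hball⟩ := Metric.isOpen_iff.1 hO x₀ hx₀
  have hx₀s : ∀ s, x₀ (κ s) = 0 := (cproj_eq_self_iff κ).1 hc
  have hproj : ∀ j, ContDiffOn ℝ ∞ (fun x => ψ x j) (Metric.ball x₀ ρ) := fun j =>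
    (EuclideanSpace.proj j : Model d →L[ℝ] ℝ).contDiff.comp_contDiffOn (hψ.mono hball)
  -- Since `ψ` maps the hyperplane `x_(κ s) = 0` into the hyperplane of `κ₁ s`, its coordinate is
  -- divisible: `ψ_(κ₁ s) = x_(κ s) h_s`.
  choose h hh hψh using fun s => exists_eq_coord_mul (κ s) (hx₀s s) (hproj (κ₁ s))
    (fun x hx => h0 x (hball hx) s)
  have hψd : ∀ x ∈ Metric.ball x₀ ρ, DifferentiableAt ℝ ψ x := fun x hx =>
    (hψ.contDiffAt (hO.mem_nhds (hball hx))).differentiableAt (by simp)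
  have hrow : ∀ x ∈ Metric.ball x₀ ρ, ∀ v s, fderiv ℝ ψ x v (κ₁ s) =
      v (κ s) * h s x + x (κ s) * fderiv ℝ (h s) x v := by
    intro x hx v s
    have h1 := fderiv_coord_mul (((hh s).contDiffAt
      (Metric.isOpen_ball.mem_nhds hx)).differentiableAt (by simp))
      (Filter.eventuallyEq_of_mem (Metric.isOpen_ball.mem_nhds hx) (hψh s)) v
    rw [← h1]
    have h2 : HasFDerivAt (fun x => ψ x (κ₁ s)) _ x :=
      (EuclideanSpace.proj (κ₁ s) : Model d →L[ℝ] ℝ).hasFDerivAt.comp x (hψd x hx).hasFDerivAt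
    rw [h2.fderiv]
    rfl
  -- Otherwise the row of the derivative at `x₀` that belongs to `κ₁ s` would vanish, against
  -- surjectivity.
  have hne : ∀ s, h s x₀ ≠ 0 := by
    intro s hs
    obtain ⟨v, hv⟩ := hinj (EuclideanSpace.single (κ₁ s) 1)
    have := hrow x₀ (Metric.mem_ball_self hρ) v s
    rw [hv, hs, hx₀s] at this
    simp at this
  set O' := Metric.ball x₀ ρ ∩ ⋂ s, (Metric.ball x₀ ρ ∩ h s ⁻¹' {0}ᶜ) with hO'
  have hO'o : IsOpen O' := Metric.isOpen_ball.inter (isOpen_iInter_of_finite fun s =>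
    (hh s).continuousOn.isOpen_inter_preimage Metric.isOpen_ball isOpen_compl_singleton)
  have hO'b : O' ⊆ Metric.ball x₀ ρ := inter_subset_left
  have hO'h : ∀ x ∈ O', ∀ s, h s x ≠ 0 := fun x hx s => (mem_iInter.1 hx.2 s).2
  -- The row of `κ₁ s` is the logarithmic derivative `dx_s / x_s + dh_s / h_s`, which is smooth in
  -- the frame; the remaining rows are those of the ordinary derivative applied to the frame.
  set A : Model d → Model d →L[ℝ] Model d := fun x => cproj κ₁ ∘L (fderiv ℝ ψ x ∘L logFrame κ x) +
    ∑ s, ((EuclideanSpace.proj (κ s) : Model d →L[ℝ] ℝ) +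
      (h s x)⁻¹ • (fderiv ℝ (h s) x ∘L logFrame κ x)).smulRight (EuclideanSpace.single (κ₁ s) 1)
  have hA1 : ∀ x v s, A x v (κ₁ s) = v (κ s) + (h s x)⁻¹ * fderiv ℝ (h s) x (logFrame κ x v) := by
    intro x v s
    simp only [A, add_apply, PiLp.add_apply, ContinuousLinearMap.comp_apply, cproj_apply_range,
      sum_apply, ContinuousLinearMap.smulRight_apply, PiLp.smul_apply, smul_apply, smul_eq_mul,
      WithLp.ofLp_sum, Finset.sum_apply]
    rw [Finset.sum_eq_single s]
    · simp
    · intro t _ ht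
      simp [ht.symm]
    · simp
  have hA2 : ∀ x v j, j ∉ range κ₁ → A x v j = fderiv ℝ ψ x (logFrame κ x v) j := by
    intro x v j hj
    simp only [A, add_apply, PiLp.add_apply, ContinuousLinearMap.comp_apply,
      cproj_apply_of_notMem _ _ hj, sum_apply, ContinuousLinearMap.smulRight_apply,
      PiLp.smul_apply, smul_eq_mul, WithLp.ofLp_sum, Finset.sum_apply]
    rw [add_eq_left]
    refine Finset.sum_eq_zero fun s _ => ?_
    have : j ≠ κ₁ s := fun e => hj ⟨s, e.symm⟩
    simp [this]
  refine ⟨O', hO'b.trans hball, hO'o, ⟨Metric.mem_ball_self hρ, mem_iInter.2 fun s =>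
    ⟨Metric.mem_ball_self hρ, hne s⟩⟩, A, ?_, ?_, ?_⟩
  · have hL := (contDiff_logFrame κ).contDiffOn (s := O')
    have hψ' : ContDiffOn ℝ ∞ (fderiv ℝ ψ) O' :=
      (hψ.mono (hO'b.trans hball)).fderiv_of_isOpen hO'o (by simp)
    have hh' : ∀ s, ContDiffOn ℝ ∞ (fderiv ℝ (h s)) O' := fun s =>
      ((hh s).mono hO'b).fderiv_of_isOpen hO'o (by simp)
    refine (contDiffOn_const.clm_comp (hψ'.clm_comp hL)).add (ContDiffOn.sum fun s _ => ?_)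
    exact (contDiffOn_const.add ((((hh s).mono hO'b).inv fun x hx => hO'h x hx s).smul
      ((hh' s).clm_comp hL))).smulRight contDiffOn_const
  · intro x hx v
    refine ext_range κ₁ (fun s => ?_) fun j hj => ?_
    · rw [hrow x (hO'b hx), logFrame_apply_range, logFrame_apply_range, hA1, hψh s x (hO'b hx)]
      have := hO'h x hx s
      field_simp
    · rw [logFrame_apply_of_notMem _ _ _ hj, hA2 _ _ _ hj]
  · intro x hx hcx s
    have h1 : logFrame κ x (EuclideanSpace.single (κ s) 1) = 0 := by
      rw [logFrame_eq_cproj κ hcx]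
      refine ext_range κ (fun t => by simp [cproj_apply_range]) fun j hj => ?_
      rw [cproj_apply_of_notMem _ _ hj]
      have : j ≠ κ s := fun e => hj ⟨s, e.symm⟩
      simp [this]
    refine ext_range κ₁ (fun t => ?_) fun j hj => ?_
    · rw [hA1, h1]
      by_cases e : t = s
      · simp [e]
      · simp [e]
    · rw [hA2 _ _ _ hj, h1]
      have : j ≠ κ₁ s := fun e => hj ⟨s, e.symm⟩
      simp [this]

/-- A vector killed by `A x` has tangential part killed by the derivative of `ψ`, hence zero; what
remains is a combination of normal frame vectors, and `A x` maps these to the normal frame vectors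
of the other chart. -/
lemma IsLogDeriv.injective [Finite σ] {κ₁ : σ ↪ Fin d} {ψ : Model d → Model d}
    {O : Set (Model d)} {A : Model d → Model d →L[ℝ] Model d} (hA : IsLogDeriv κ κ₁ ψ O A)
    {x : Model d} (hx : x ∈ O) (hc : cproj κ x = x) (hinj : Function.Injective (fderiv ℝ ψ x)) :
    Function.Injective (A x) := by
  have := Fintype.ofFinite σ
  rw [injective_iff_map_eq_zero]
  intro v hv
  have h1 := hA.fderiv_logFrame x hx v
  rw [hv, map_zero] at h1
  have h2 : cproj κ v = 0 := by
    rw [← logFrame_eq_cproj κ hc]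
    exact (injective_iff_map_eq_zero _).1 hinj _ h1
  have h3 : v = ∑ s, v (κ s) • EuclideanSpace.single (κ s) (1 : ℝ) := by
    refine ext_range κ (fun t => ?_) fun j hj => ?_
    · simp only [WithLp.ofLp_sum, Finset.sum_apply, PiLp.smul_apply]
      rw [Finset.sum_eq_single t]
      · simp
      · intro s _ hs; simp [hs.symm]
      · simp
    · rw [← cproj_apply_of_notMem κ v hj, h2]
      simp only [WithLp.ofLp_sum, Finset.sum_apply, PiLp.smul_apply]
      refine (Finset.sum_eq_zero fun s _ => ?_).symm
      have : j ≠ κ s := fun e => hj ⟨s, e.symm⟩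
      simp [this]
  have h4 := hv
  rw [h3, map_sum] at h4
  simp only [map_smul, hA.single x hx hc] at h4
  refine ext_range κ (fun t => ?_) fun j hj => ?_
  · have h5 := congrArg (fun w : Model d => w (κ₁ t)) h4
    simp only [WithLp.ofLp_sum, Finset.sum_apply, PiLp.smul_apply] at h5
    rw [Finset.sum_eq_single t] at h5
    · simpa using h5
    · intro s _ hs; simp [hs.symm]
    · simp
  · rw [← cproj_apply_of_notMem κ v hj, h2]

end LogDeriv

/-! ### Closedness in log components -/

section Closed

variable {d : ℕ} {σ : Type*} [Finite σ] {κ : σ ↪ Fin d}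

/-- The log components of a closed form satisfy the equation of `IsLogClosed`. -/
theorem isLogClosed_of_extDeriv_eq_zero {x₀ : Model d} {ρ : ℝ} (hc : cproj κ x₀ = x₀)
    {g : Model d → Bil d} (hg : ContDiffOn ℝ ∞ g (Metric.ball x₀ ρ))
    {θ : Model d → Model d [⋀^Fin 2]→L[ℝ] ℝ}
    (hθ : ∀ x ∈ Metric.ball x₀ ρ, (∀ s, x (κ s) ≠ 0) → ContDiffAt ℝ ∞ θ x ∧ extDeriv θ x = 0)
    (h : ∀ x ∈ Metric.ball x₀ ρ, (∀ s, x (κ s) ≠ 0) → ∀ u v,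
      g x u v = toBil (θ x) (logFrame κ x u) (logFrame κ x v)) :
    IsLogClosed κ x₀ ρ g where
  center := hc
  smooth := hg
  alt := by
    intro x hx u v
    refine eqOn_of_forall_ne_zero κ (f := fun x => g x u v) (g := fun x => - g x v u)
      Metric.isOpen_ball
      ((hg.continuousOn.clm_apply continuousOn_const).clm_apply continuousOn_const)
      ((hg.continuousOn.clm_apply continuousOn_const).clm_apply continuousOn_const).neg
      (fun y hy hy' => ?_) hx
    rw [h y hy hy', h y hy hy', toBil_swap]
  closed := by
    intro x hx u v w
    have hg' : ContinuousOn (fderiv ℝ g) (Metric.ball x₀ ρ) :=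
      (hg.fderiv_of_isOpen (m := 0) Metric.isOpen_ball (by simp)).continuousOn
    have hterm : ∀ a b c : Model d, ContinuousOn (fun x => fderiv ℝ g x (logFrame κ x a) b c)
        (Metric.ball x₀ ρ) := fun a b c =>
      ((hg'.clm_apply ((contDiff_logFrame κ).continuous.continuousOn.clm_apply
        continuousOn_const)).clm_apply continuousOn_const).clm_apply continuousOn_const
    refine eqOn_of_forall_ne_zero κ (f := fun x => fderiv ℝ g x (logFrame κ x u) v w
      - fderiv ℝ g x (logFrame κ x v) u w + fderiv ℝ g x (logFrame κ x w) u v) (g := fun x => 0)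
      Metric.isOpen_ball (((hterm u v w).sub (hterm v u w)).add (hterm w u v)) continuousOn_const
      (fun y hy hy' => ?_) hx
    obtain ⟨hs, hd⟩ := hθ y hy hy'
    have hθd : DifferentiableAt ℝ θ y := hs.differentiableAt (by simp)
    have hB : DifferentiableAt ℝ (fun y => toBil (θ y)) y := toBil.differentiableAt.comp y hθd
    have hopen : IsOpen {x : Model d | ∀ s, x (κ s) ≠ 0} := by
      rw [Set.ofPred_forall]
      exact isOpen_iInter_of_finite fun s => isOpen_compl_singleton.preimage
        (EuclideanSpace.proj (κ s) : Model d →L[ℝ] ℝ).continuous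
    have hgd : DifferentiableAt ℝ g y :=
      (hg.contDiffAt (Metric.isOpen_ball.mem_nhds hy)).differentiableAt (by simp)
    -- The derivative of the components is that of the form plus one term for the derivative of the
    -- frame in each slot.
    have hder : ∀ z a b : Model d, fderiv ℝ g y z a b =
        fderiv ℝ (fun y => toBil (θ y)) y z (logFrame κ y a) (logFrame κ y b) +
        toBil (θ y) (frameMul κ z a) (logFrame κ y b) +
        toBil (θ y) (logFrame κ y a) (frameMul κ z b) := by
      intro z a b
      have h1 := (hgd.hasFDerivAt.clm_apply (hasFDerivAt_const a y)).clm_apply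
        (hasFDerivAt_const b y)
      have h2 := (hB.hasFDerivAt.clm_apply ((hasFDerivAt_logFrame κ y).clm_apply
        (hasFDerivAt_const a y))).clm_apply ((hasFDerivAt_logFrame κ y).clm_apply
        (hasFDerivAt_const b y))
      have h3 : (fun x => g x a b) =ᶠ[𝓝 y]
          fun x => toBil (θ x) (logFrame κ x a) (logFrame κ x b) := by
        filter_upwards [Metric.isOpen_ball.mem_nhds hy, hopen.mem_nhds hy'] with x hx hx'
        exact h x hx hx' a b
      have h4 := congrArg (fun l : Model d →L[ℝ] ℝ => l z)
        (h1.unique (h2.congr_of_eventuallyEq h3))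
      simp at h4
      rw [h4]
      ring
    have h5 := extDeriv_apply_three hθd (logFrame κ y u) (logFrame κ y v) (logFrame κ y w)
    rw [hd] at h5
    -- The frame fields commute, so the terms with derivatives of the frame cancel and no bracket
    -- terms remain.
    have hcomm : ∀ a b, frameMul κ (logFrame κ y a) b = frameMul κ (logFrame κ y b) a := fun a b =>
      ext_range κ (fun s => by simp only [frameMul_apply_range, logFrame_apply_range]; ring)
        fun j hj => by simp only [frameMul_apply_of_notMem _ _ _ hj]
    have h6 := toBil_swap (θ y) (frameMul κ (logFrame κ y u) v) (logFrame κ y w)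
    have h7 := toBil_swap (θ y) (frameMul κ (logFrame κ y u) w) (logFrame κ y v)
    have h8 := toBil_swap (θ y) (frameMul κ (logFrame κ y v) w) (logFrame κ y u)
    simp only [hder]
    rw [hcomm v u, hcomm w u, hcomm w v]
    have h9 : (0 : Model d [⋀^Fin 3]→L[ℝ] ℝ)
        ![logFrame κ y u, logFrame κ y v, logFrame κ y w] = 0 := rfl
    linarith

end Closed

end
end LogSymp

namespace LogSymp

noncomputable section

set_option linter.unusedSectionVars false
set_option maxSynthPendingDepth 3

/-! ### Differential forms in charts -/

section Charts

variable {d k : ℕ} {M : Type*} [TopologicalSpace M] [ChartedSpace (Model d) M]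
  [IsManifold (𝓡 d) ∞ M] {e e' : OpenPartialHomeomorph M (Model d)}

lemma minSmoothness_two_le : minSmoothness ℝ 2 ≤ ∞ := by
  rw [minSmoothness_of_isRCLikeNormedField]
  exact WithTop.coe_le_coe.2 (le_top : (2 : ℕ∞) ≤ ⊤)

/-- The differential of a map into the model space. -/
def dmap (Y : M → Model d) (p : M) : Model d →L[ℝ] Model d := mfderiv (𝓡 d) (𝓡 d) Y p

/-- The differential of a map from the model space. -/
def dpar (Y : Model d → M) (x : Model d) : Model d →L[ℝ] Model d := mfderiv (𝓡 d) (𝓡 d) Y x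

lemma chart_mdiff (he : e ∈ IsManifold.maximalAtlas (𝓡 d) ∞ M) {p : M} (hp : p ∈ e.source) :
    MDifferentiableAt (𝓡 d) (𝓡 d) e p :=
  (contMDiffAt_of_mem_maximalAtlas he hp).mdifferentiableAt (by simp)

lemma chart_symm_mdiff (he : e ∈ IsManifold.maximalAtlas (𝓡 d) ∞ M) {x : Model d}
    (hx : x ∈ e.target) : MDifferentiableAt (𝓡 d) (𝓡 d) e.symm x :=
  (contMDiffAt_symm_of_mem_maximalAtlas he hx).mdifferentiableAt (by simp)

lemma dmap_dpar (he : e ∈ IsManifold.maximalAtlas (𝓡 d) ∞ M) {x : Model d} (hx : x ∈ e.target)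
    (v : Model d) : dmap e (e.symm x) (dpar e.symm x v) = v := by
  have h1 : mfderiv (𝓡 d) (𝓡 d) (e ∘ e.symm) x = _ :=
    mfderiv_comp x (chart_mdiff he (e.map_target hx)) (chart_symm_mdiff he hx)
  have h2 : (e ∘ e.symm) =ᶠ[𝓝 x] id :=
    Filter.eventuallyEq_of_mem (e.open_target.mem_nhds hx) fun y hy => e.right_inv hy
  rw [h2.mfderiv_eq, mfderiv_id] at h1
  exact (congrArg (fun l : Model d →L[ℝ] Model d => l v) h1).symm

lemma dpar_dmap (he : e ∈ IsManifold.maximalAtlas (𝓡 d) ∞ M) {p : M} (hp : p ∈ e.source)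
    (v : Model d) : dpar e.symm (e p) (dmap e p v) = v := by
  have h1 : mfderiv (𝓡 d) (𝓡 d) (e.symm ∘ e) p = _ :=
    mfderiv_comp p (chart_symm_mdiff he (e.map_source hp)) (chart_mdiff he hp)
  have h2 : (e.symm ∘ e) =ᶠ[𝓝 p] id :=
    Filter.eventuallyEq_of_mem (e.open_source.mem_nhds hp) fun y hy => e.left_inv hy
  rw [h2.mfderiv_eq, mfderiv_id] at h1
  exact (congrArg (fun l : Model d →L[ℝ] Model d => l v) h1).symm

/-- The domain of the coordinate change from `e` to `e'`. -/
def overlap (e e' : OpenPartialHomeomorph M (Model d)) : Set (Model d) :=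
  e.target ∩ e.symm ⁻¹' e'.source

lemma isOpen_overlap : IsOpen (overlap e e') :=
  e.symm.continuousOn.isOpen_inter_preimage e.open_target e'.open_source

lemma contDiffOn_comp_symm {F : Type*} [NormedAddCommGroup F] [NormedSpace ℝ F] {f : M → F}
    {V : Set M} (he : e ∈ IsManifold.maximalAtlas (𝓡 d) ∞ M)
    (hf : ContMDiffOn (𝓡 d) 𝓘(ℝ, F) ∞ f V) :
    ContDiffOn ℝ ∞ (f ∘ e.symm) (e.target ∩ e.symm ⁻¹' V) :=
  (hf.comp ((contMDiffOn_symm_of_mem_maximalAtlas he).mono inter_subset_left)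
    fun _ hx => hx.2).contDiffOn

lemma contDiffOn_transition (he : e ∈ IsManifold.maximalAtlas (𝓡 d) ∞ M)
    (he' : e' ∈ IsManifold.maximalAtlas (𝓡 d) ∞ M) :
    ContDiffOn ℝ ∞ (e' ∘ e.symm) (overlap e e') :=
  contDiffOn_comp_symm he (contMDiffOn_of_mem_maximalAtlas he')

lemma fderiv_transition (he : e ∈ IsManifold.maximalAtlas (𝓡 d) ∞ M)
    (he' : e' ∈ IsManifold.maximalAtlas (𝓡 d) ∞ M) {x : Model d} (hx : x ∈ overlap e e')
    (v : Model d) : fderiv ℝ (e' ∘ e.symm) x v = dmap e' (e.symm x) (dpar e.symm x v) := by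
  have h1 : mfderiv (𝓡 d) (𝓡 d) (e' ∘ e.symm) x = _ :=
    mfderiv_comp x (chart_mdiff he' hx.2) (chart_symm_mdiff he hx.1)
  have h2 : mfderiv (𝓡 d) (𝓡 d) (e' ∘ e.symm) x = fderiv ℝ (e' ∘ e.symm) x := mfderiv_eq_fderiv
  rw [h2] at h1
  exact congrArg (fun l : Model d →L[ℝ] Model d => l v) h1

lemma transition_mem_overlap {x : Model d} (hx : x ∈ overlap e e') :
    e' (e.symm x) ∈ overlap e' e :=
  ⟨e'.map_source hx.2, by
    rw [mem_preimage, e'.left_inv hx.2]; exact e.map_target hx.1⟩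

lemma dpar_transition (he : e ∈ IsManifold.maximalAtlas (𝓡 d) ∞ M)
    (he' : e' ∈ IsManifold.maximalAtlas (𝓡 d) ∞ M) {x : Model d} (hx : x ∈ overlap e e')
    (v : Model d) : dpar e'.symm (e' (e.symm x)) (fderiv ℝ (e' ∘ e.symm) x v) = dpar e.symm x v := by
  rw [fderiv_transition he he' hx, dpar_dmap he' hx.2]

/-- The derivative of a coordinate change is invertible. -/
def transitionEquiv (he : e ∈ IsManifold.maximalAtlas (𝓡 d) ∞ M)
    (he' : e' ∈ IsManifold.maximalAtlas (𝓡 d) ∞ M) {x : Model d} (hx : x ∈ overlap e e') :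
    Model d ≃L[ℝ] Model d :=
  ContinuousLinearEquiv.equivOfInverse (fderiv ℝ (e' ∘ e.symm) x)
    (fderiv ℝ (e ∘ e'.symm) (e' (e.symm x)))
    (fun v => by
      rw [fderiv_transition he' he (transition_mem_overlap hx), dpar_transition he he' hx,
        e'.left_inv hx.2, dmap_dpar he hx.1])
    (fun v => by
      rw [fderiv_transition he he' hx, fderiv_transition he' he (transition_mem_overlap hx),
        e'.left_inv hx.2]
      have h1 := dpar_dmap he (e.map_target hx.1) (dpar e'.symm (e' (e.symm x)) v)
      rw [e.right_inv hx.1] at h1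
      rw [h1]
      have h2 := dmap_dpar he' (e'.map_source hx.2) v
      rwa [e'.left_inv hx.2] at h2)

lemma inChart_transition (he : e ∈ IsManifold.maximalAtlas (𝓡 d) ∞ M)
    (he' : e' ∈ IsManifold.maximalAtlas (𝓡 d) ∞ M) (Ω : DForm d M k) {x : Model d}
    (hx : x ∈ overlap e e') : inChart e Ω x =
      (inChart e' Ω ((e' ∘ e.symm) x)).compContinuousLinearMap (fderiv ℝ (e' ∘ e.symm) x) := by
  ext v
  have h2 : (inChart e' Ω ((e' ∘ e.symm) x)) = (Ω (e.symm x)).compContinuousLinearMap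
      (dpar e'.symm (e' (e.symm x))) := by
    simp only [inChart, Function.comp_apply]
    rw [e'.left_inv hx.2]
    rfl
  rw [h2]
  change Ω (e.symm x) (fun i => dpar e.symm x (v i)) = Ω (e.symm x) (fun i =>
    dpar e'.symm (e' (e.symm x)) (fderiv ℝ (e' ∘ e.symm) x (v i)))
  simp only [dpar_transition he he' hx]

/-- Pullback is polynomial in the linear map. The statement is taken from multilinear maps and
brought back by a linear left inverse of the inclusion of alternating maps, which exists in finite
dimension. -/
lemma contDiff_compContinuousLinearMap : ContDiff ℝ ∞
    (fun p : (Model d [⋀^Fin k]→L[ℝ] ℝ) × (Model d →L[ℝ] Model d) =>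
      p.1.compContinuousLinearMap p.2) := by
  have : FiniteDimensional ℝ (ContinuousMultilinearMap ℝ (fun _ : Fin k => Model d) ℝ) :=
    FiniteDimensional.of_injective (ContinuousMultilinearMap.toMultilinearMapLinear :
      ContinuousMultilinearMap ℝ (fun _ : Fin k => Model d) ℝ →ₗ[ℝ] _) ContinuousMultilinearMap.toMultilinearMap_injective
  obtain ⟨T, hTa⟩ : ∃ T : (Model d [⋀^Fin k]→L[ℝ] ℝ) →L[ℝ]
      ContinuousMultilinearMap ℝ (fun _ : Fin k => Model d) ℝ,
      ∀ θ, T θ = θ.toContinuousMultilinearMap :=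
    ⟨ContinuousAlternatingMap.toContinuousMultilinearMapCLM ℝ, fun _ => rfl⟩
  have hT : Function.Injective T.toLinearMap := fun θ θ' h =>
    ContinuousAlternatingMap.toContinuousMultilinearMap_injective
      (by rw [← hTa, ← hTa]; exact h)
  obtain ⟨r, hr⟩ := LinearMap.exists_leftInverse_of_injective T.toLinearMap
    (LinearMap.ker_eq_bot.2 hT)
  have h1 : ContDiff ℝ ∞ (fun p : (Model d [⋀^Fin k]→L[ℝ] ℝ) × (Model d →L[ℝ] Model d) =>
      ContinuousMultilinearMap.compContinuousLinearMapContinuousMultilinear ℝ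
        (fun _ : Fin k => Model d) (fun _ => Model d) ℝ (fun _ => p.2) (T p.1)) :=
    ((ContinuousMultilinearMap.contDiff _).comp (contDiff_pi.2 fun _ => contDiff_snd)).clm_apply
      (T.contDiff.comp contDiff_fst)
  have h2 := (LinearMap.toContinuousLinearMap r).contDiff.comp h1
  convert h2 using 1
  funext p
  refine (LinearMap.congr_fun hr (p.1.compContinuousLinearMap p.2)).symm.trans ?_
  change r (T _) = r _
  simp only [hTa]
  rfl

lemma inChart_contDiffAt_transition (he : e ∈ IsManifold.maximalAtlas (𝓡 d) ∞ M)
    (he' : e' ∈ IsManifold.maximalAtlas (𝓡 d) ∞ M) {Ω : DForm d M k} {x : Model d}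
    (hx : x ∈ overlap e e') (h : ContDiffAt ℝ ∞ (inChart e' Ω) (e' (e.symm x))) :
    ContDiffAt ℝ ∞ (inChart e Ω) x := by
  have hψ := contDiffOn_transition he he'
  have h1 : ContDiffAt ℝ ∞ (e' ∘ e.symm) x := hψ.contDiffAt (isOpen_overlap.mem_nhds hx)
  have h2 : ContDiffAt ℝ ∞ (fderiv ℝ (e' ∘ e.symm)) x :=
    (hψ.fderiv_of_isOpen isOpen_overlap (by simp)).contDiffAt (isOpen_overlap.mem_nhds hx)
  have h3 : ContDiffAt ℝ ∞ (fun x => inChart e' Ω ((e' ∘ e.symm) x)) x :=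
    ContDiffAt.comp x (g := inChart e' Ω) h h1
  refine (contDiff_compContinuousLinearMap.contDiffAt.comp x (h3.prodMk h2)).congr_of_eventuallyEq ?_
  filter_upwards [isOpen_overlap.mem_nhds hx] with y hy
  exact inChart_transition he he' Ω hy

/-- Smoothness of a form at a point. -/
def SmoothAt (Ω : DForm d M k) (p : M) : Prop :=
  ContDiffAt ℝ ∞ (inChart (chartAt (Model d) p) Ω) (chartAt (Model d) p p)

lemma smoothAt_iff (he : e ∈ IsManifold.maximalAtlas (𝓡 d) ∞ M) {Ω : DForm d M k} {p : M}
    (hp : p ∈ e.source) : SmoothAt Ω p ↔ ContDiffAt ℝ ∞ (inChart e Ω) (e p) := by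
  have hc : chartAt (Model d) p ∈ IsManifold.maximalAtlas (𝓡 d) ∞ M :=
    IsManifold.chart_mem_maximalAtlas p
  have hpc := mem_chart_source (Model d) p
  constructor
  · intro h
    refine inChart_contDiffAt_transition he hc ⟨e.map_source hp, ?_⟩ ?_
    · rwa [mem_preimage, e.left_inv hp]
    · rwa [e.left_inv hp]
  · intro h
    refine inChart_contDiffAt_transition hc he ⟨OpenPartialHomeomorph.map_source _ hpc, ?_⟩ ?_
    · rwa [mem_preimage, OpenPartialHomeomorph.left_inv _ hpc]
    · rwa [OpenPartialHomeomorph.left_inv _ hpc]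

lemma IsSmoothForm.contDiffAt {Ω : DForm d M k} (h : IsSmoothForm Ω)
    (he : e ∈ IsManifold.maximalAtlas (𝓡 d) ∞ M) {x : Model d} (hx : x ∈ e.target) :
    ContDiffAt ℝ ∞ (inChart e Ω) x := by
  have := (smoothAt_iff he (e.map_target hx)).1 (h (e.symm x))
  rwa [e.right_inv hx] at this

/-- The exterior derivative may be computed in any chart. -/
lemma inChart_extD (he : e ∈ IsManifold.maximalAtlas (𝓡 d) ∞ M) {Ω : DForm d M k} {x : Model d}
    (hx : x ∈ e.target) (h : ContDiffAt ℝ ∞ (inChart e Ω) x) :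
    inChart e (extD Ω) x = extDeriv (inChart e Ω) x := by
  set p := e.symm x with hp
  set c := chartAt (Model d) p
  have hc : c ∈ IsManifold.maximalAtlas (𝓡 d) ∞ M := IsManifold.chart_mem_maximalAtlas p
  have hpc : p ∈ c.source := mem_chart_source (Model d) p
  have hov : x ∈ overlap e c := ⟨hx, hpc⟩
  have h' : ContDiffAt ℝ ∞ (inChart c Ω) (c p) :=
    (smoothAt_iff he (e.map_target hx)).2 (by rwa [e.right_inv hx])
  have hψ := contDiffOn_transition he hc
  have h1 : ContDiffAt ℝ ∞ (c ∘ e.symm) x := hψ.contDiffAt (isOpen_overlap.mem_nhds hov)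
  have h2 : inChart e Ω =ᶠ[𝓝 x] fun y =>
      (inChart c Ω ((c ∘ e.symm) y)).compContinuousLinearMap (fderiv ℝ (c ∘ e.symm) y) := by
    filter_upwards [isOpen_overlap.mem_nhds hov] with y hy
    exact inChart_transition he hc Ω hy
  have h3 : DifferentiableAt ℝ (inChart c Ω) ((c ∘ e.symm) x) := h'.differentiableAt (by simp)
  rw [h2.extDeriv_eq, extDeriv_pullback h3 h1 minSmoothness_two_le]
  ext v
  change extDeriv (inChart c Ω) (c p) (fun i => dmap c p (dpar e.symm x (v i))) =
    extDeriv (inChart c Ω) (c p) (fun i => fderiv ℝ (c ∘ e.symm) x (v i))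
  simp only [fderiv_transition he hc hov]
  rfl

lemma eq_zero_of_inChart (he : e ∈ IsManifold.maximalAtlas (𝓡 d) ∞ M) {Ω : DForm d M k} {p : M}
    (hp : p ∈ e.source) (h : inChart e Ω (e p) = 0) : Ω p = 0 := by
  ext v
  have h1 := congrArg (fun θ : Model d [⋀^Fin k]→L[ℝ] ℝ => θ fun i => dmap e p (v i)) h
  change Ω (e.symm (e p)) (fun i => dpar e.symm (e p) (dmap e p (v i))) = 0 at h1
  simp only [dpar_dmap he hp] at h1
  rwa [e.left_inv hp] at h1

/-- At each point `extD` is computed in that point's own chart. Near `p` it agrees with the exterior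
derivative in the single chart at `p`, where smoothness is visible. -/
lemma smoothAt_extD {Ω : DForm d M k} {p : M} (h : ∀ᶠ q in 𝓝 p, SmoothAt Ω q) :
    SmoothAt (extD Ω) p := by
  set c := chartAt (Model d) p
  have hc : c ∈ IsManifold.maximalAtlas (𝓡 d) ∞ M := IsManifold.chart_mem_maximalAtlas p
  have hpc : p ∈ c.source := mem_chart_source (Model d) p
  obtain ⟨V, hV, hVo, hpV⟩ := eventually_nhds_iff.1 h
  set O := c.target ∩ c.symm ⁻¹' V
  have hO : IsOpen O := c.symm.continuousOn.isOpen_inter_preimage c.open_target hVo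
  have hpO : c p ∈ O := ⟨c.map_source hpc, by rwa [mem_preimage, c.left_inv hpc]⟩
  have h1 : ∀ x ∈ O, ContDiffAt ℝ ∞ (inChart c Ω) x := fun x hx => by
    have := (smoothAt_iff hc (c.map_target hx.1)).1 (hV _ hx.2)
    rwa [c.right_inv hx.1] at this
  have h2 : ContDiffOn ℝ ∞ (inChart c Ω) O := fun x hx => (h1 x hx).contDiffWithinAt
  have h3 : ContDiffOn ℝ ∞ (extDeriv (inChart c Ω)) O :=
    (ContinuousAlternatingMap.alternatizeUncurryFinCLM ℝ (Model d) ℝ).contDiff.comp_contDiffOn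
      (h2.fderiv_of_isOpen hO (by simp))
  refine ((h3.contDiffAt (hO.mem_nhds hpO)).congr_of_eventuallyEq ?_ :)
  filter_upwards [hO.mem_nhds hpO] with x hx
  exact inChart_extD hc hx.1 (h1 x hx)

lemma extD_extD {Ω : DForm d M k} {p : M} (h : ∀ᶠ q in 𝓝 p, SmoothAt Ω q) :
    extD (extD Ω) p = 0 := by
  set c := chartAt (Model d) p
  have hc : c ∈ IsManifold.maximalAtlas (𝓡 d) ∞ M := IsManifold.chart_mem_maximalAtlas p
  have hpc : p ∈ c.source := mem_chart_source (Model d) p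
  refine eq_zero_of_inChart hc hpc ?_
  have h0 : ContDiffAt ℝ ∞ (inChart c (extD Ω)) (c p) := smoothAt_extD h
  rw [inChart_extD hc (c.map_source hpc) h0]
  obtain ⟨V, hV, hVo, hpV⟩ := eventually_nhds_iff.1 h
  set O := c.target ∩ c.symm ⁻¹' V
  have hO : IsOpen O := c.symm.continuousOn.isOpen_inter_preimage c.open_target hVo
  have hpO : c p ∈ O := ⟨c.map_source hpc, by rwa [mem_preimage, c.left_inv hpc]⟩
  have h1 : ∀ x ∈ O, ContDiffAt ℝ ∞ (inChart c Ω) x := fun x hx => by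
    have := (smoothAt_iff hc (c.map_target hx.1)).1 (hV _ hx.2)
    rwa [c.right_inv hx.1] at this
  have h2 : inChart c (extD Ω) =ᶠ[𝓝 (c p)] extDeriv (inChart c Ω) := by
    filter_upwards [hO.mem_nhds hpO] with x hx
    exact inChart_extD hc hx.1 (h1 x hx)
  rw [h2.extDeriv_eq]
  exact extDeriv_extDeriv_apply (h1 _ hpO) minSmoothness_two_le

/-! #### Functions -/

lemma dfun_dpar {f : M → ℝ} (he : e ∈ IsManifold.maximalAtlas (𝓡 d) ∞ M) {x : Model d}
    (hx : x ∈ e.target) (hf : MDifferentiableAt (𝓡 d) 𝓘(ℝ, ℝ) f (e.symm x)) (v : Model d) :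
    dfun f (e.symm x) (dpar e.symm x v) = fderiv ℝ (f ∘ e.symm) x v := by
  have h1 : mfderiv (𝓡 d) 𝓘(ℝ, ℝ) (f ∘ e.symm) x = _ :=
    mfderiv_comp x hf (chart_symm_mdiff he hx)
  have h2 : mfderiv (𝓡 d) 𝓘(ℝ, ℝ) (f ∘ e.symm) x = fderiv ℝ (f ∘ e.symm) x := mfderiv_eq_fderiv
  rw [h2] at h1
  exact (congrArg (fun l : Model d →L[ℝ] ℝ => l v) h1).symm

lemma toCov_inChart (Ω : DForm d M 1) (x v : Model d) :
    toCov (inChart e Ω x) v = toCov (Ω (e.symm x)) (dpar e.symm x v) :=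
  toCov_compContinuousLinearMap _ _ _

lemma toBil_inChart (Ω : DForm d M 2) (x u v : Model d) :
    toBil (inChart e Ω x) u v = toBil (Ω (e.symm x)) (dpar e.symm x u) (dpar e.symm x v) :=
  toBil_compContinuousLinearMap _ _ _ _

lemma inChart_dfun {f : M → ℝ} (he : e ∈ IsManifold.maximalAtlas (𝓡 d) ∞ M) {x : Model d}
    (hx : x ∈ e.target) (hf : MDifferentiableAt (𝓡 d) 𝓘(ℝ, ℝ) f (e.symm x)) :
    inChart e (fun q => toOneForm (dfun f q)) x = toOneForm (fderiv ℝ (f ∘ e.symm) x) := by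
  rw [← toOneForm_toCov (inChart e _ x)]
  congr 1
  ext v
  rw [toCov_inChart, toCov_toOneForm, dfun_dpar he hx hf]

end Charts

end
end LogSymp

namespace LogSymp

noncomputable section

set_option linter.unusedSectionVars false
set_option maxSynthPendingDepth 3

/-! ### Constructing charts and functions -/

section Construct

variable {d k : ℕ} {M : Type*} [TopologicalSpace M] [ChartedSpace (Model d) M]
  [IsManifold (𝓡 d) ∞ M] {e e' : OpenPartialHomeomorph M (Model d)}

lemma restr_mem_maximalAtlas (he : e ∈ IsManifold.maximalAtlas (𝓡 d) ∞ M) {V : Set M}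
    (hV : IsOpen V) : e.restrOpen V hV ∈ IsManifold.maximalAtlas (𝓡 d) ∞ M := by
  refine OpenPartialHomeomorph.mem_maximalAtlas_of_contMDiffOn _ ?_ ?_
  · exact (contMDiffOn_of_mem_maximalAtlas he).mono fun x hx => by
      rw [OpenPartialHomeomorph.restrOpen_source] at hx
      exact hx.1
  · exact (contMDiffOn_symm_of_mem_maximalAtlas he).mono fun x hx => hx.1

/-- Functions with injective differential form a chart. -/
theorem exists_chart {Y : M → Model d} {V : Set M} (hV : IsOpen V) {a : M} (ha : a ∈ V)
    (hY : ContMDiffOn (𝓡 d) (𝓡 d) ∞ Y V) (hinj : ∀ v, dmap Y a v = 0 → v = 0) :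
    ∃ e ∈ IsManifold.maximalAtlas (𝓡 d) ∞ M, a ∈ e.source ∧ e.source ⊆ V ∧
      ∀ u ∈ e.source, e u = Y u := by
  set c := chartAt (Model d) a
  have hc : c ∈ IsManifold.maximalAtlas (𝓡 d) ∞ M := IsManifold.chart_mem_maximalAtlas a
  have hac : a ∈ c.source := mem_chart_source (Model d) a
  set F : Model d → Model d := Y ∘ c.symm with hFdef
  set O := c.target ∩ c.symm ⁻¹' V
  have hO : IsOpen O := c.symm.continuousOn.isOpen_inter_preimage c.open_target hV
  have haO : c a ∈ O := ⟨c.map_source hac, by rwa [mem_preimage, c.left_inv hac]⟩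
  have hF : ContDiffOn ℝ ∞ F O := contDiffOn_comp_symm hc hY
  have hFd : ∀ x ∈ O, HasFDerivAt F (fderiv ℝ F x) x := fun x hx =>
    ((hF.contDiffAt (hO.mem_nhds hx)).differentiableAt (by simp)).hasFDerivAt
  have hF' : ContinuousOn (fderiv ℝ F) O := (hF.fderiv_of_isOpen (m := 0) hO (by simp)).continuousOn
  -- Restricting to the points with invertible derivative makes the inverse smooth on the whole
  -- target, as required of a chart, and not only at the image of `a`.
  set O₂ := O ∩ fderiv ℝ F ⁻¹' range ((↑) : (Model d ≃L[ℝ] Model d) → Model d →L[ℝ] Model d)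
  have hO₂ : IsOpen O₂ := hF'.isOpen_inter_preimage hO ContinuousLinearEquiv.isOpen
  have hinj' : Function.Injective (fderiv ℝ F (c a)) := by
    rw [injective_iff_map_eq_zero]
    intro v hv
    have h1 : mfderiv (𝓡 d) (𝓡 d) F (c a) = _ := mfderiv_comp (c a) (by
      rw [c.left_inv hac]
      exact (hY.contMDiffAt (hV.mem_nhds ha)).mdifferentiableAt (by simp))
      (chart_symm_mdiff hc (c.map_source hac))
    have h2 : mfderiv (𝓡 d) (𝓡 d) F (c a) = fderiv ℝ F (c a) := mfderiv_eq_fderiv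
    rw [h2, c.left_inv hac] at h1
    have h3 : fderiv ℝ F (c a) v = dmap Y a (dpar c.symm (c a) v) :=
      congrArg (fun l : Model d →L[ℝ] Model d => l v) h1
    have h4 := hinj _ (h3.symm.trans hv)
    have h5 := dmap_dpar hc (c.map_source hac) v
    rw [h4, map_zero] at h5
    exact h5.symm
  obtain ⟨E, hE⟩ : ∃ E : Model d ≃L[ℝ] Model d, (E : Model d →L[ℝ] Model d) = fderiv ℝ F (c a) :=
    ⟨(LinearEquiv.ofInjectiveEndo (fderiv ℝ F (c a) : Model d →ₗ[ℝ] Model d)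
      hinj').toContinuousLinearEquiv, by ext v; rfl⟩
  have haF : ContDiffAt ℝ ∞ F (c a) := hF.contDiffAt (hO.mem_nhds haO)
  have haE : HasFDerivAt F (E : Model d →L[ℝ] Model d) (c a) := by rw [hE]; exact hFd _ haO
  set Φ := (haF.toOpenPartialHomeomorph F haE (by simp)).restrOpen O₂ hO₂
  have hΦs : Φ.source ⊆ O₂ := fun x hx => by
    rw [OpenPartialHomeomorph.restrOpen_source] at hx
    exact hx.2
  have hΦa : c a ∈ Φ.source := by
    rw [OpenPartialHomeomorph.restrOpen_source]
    exact ⟨haF.mem_toOpenPartialHomeomorph_source haE (by simp), haO, E, hE⟩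
  have hΦF : ∀ x, Φ x = F x := fun x => rfl
  have hsrc : ∀ u ∈ (c.trans Φ).source, u ∈ c.source ∧ c u ∈ Φ.source := fun u hu => by
    rw [OpenPartialHomeomorph.trans_source] at hu
    exact hu
  have hsV : ∀ u ∈ (c.trans Φ).source, u ∈ V := fun u hu => by
    have := (hΦs (hsrc u hu).2).1.2
    rwa [mem_preimage, c.left_inv (hsrc u hu).1] at this
  have hval : ∀ u ∈ (c.trans Φ).source, (c.trans Φ) u = Y u := fun u hu => by
    rw [OpenPartialHomeomorph.coe_trans, Function.comp_apply, hΦF, hFdef, Function.comp_apply,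
      c.left_inv (hsrc u hu).1]
  refine ⟨c.trans Φ, ?_, ?_, hsV, hval⟩
  · refine OpenPartialHomeomorph.mem_maximalAtlas_of_contMDiffOn _
      ((hY.mono hsV).congr hval) ?_
    have h1 : ContDiffOn ℝ ∞ Φ.symm Φ.target := fun y hy => by
      have hx := hΦs (Φ.map_target hy)
      obtain ⟨E', hE'⟩ := hx.2
      refine (Φ.contDiffAt_symm (f₀' := E') hy ?_ ?_).contDiffWithinAt
      · rw [hE']; exact hFd _ hx.1
      · exact hF.contDiffAt (hO.mem_nhds hx.1)
    refine (contMDiffOn_symm_of_mem_maximalAtlas hc).comp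
      (h1.contMDiffOn.mono fun y hy => ?_) fun y hy => ?_
    · rw [OpenPartialHomeomorph.trans_target] at hy; exact hy.1
    · rw [OpenPartialHomeomorph.trans_target] at hy; exact hy.2
  · rw [OpenPartialHomeomorph.trans_source]
    exact ⟨hac, hΦa⟩

variable [T2Space M] [SecondCountableTopology M]

lemma sigmaCompact_of_charted (d : ℕ) (M : Type*) [TopologicalSpace M] [ChartedSpace (Model d) M]
    [SecondCountableTopology M] : SigmaCompactSpace M :=
  have : LocallyCompactSpace M := ChartedSpace.locallyCompactSpace (Model d) M
  inferInstance

lemma normal_of_charted (d : ℕ) (M : Type*) [TopologicalSpace M] [ChartedSpace (Model d) M]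
    [T2Space M] [SecondCountableTopology M] : NormalSpace M :=
  have : LocallyCompactSpace M := ChartedSpace.locallyCompactSpace (Model d) M
  inferInstance

lemma exists_open_closure_subset (d : ℕ) {M : Type*} [TopologicalSpace M] [ChartedSpace (Model d) M]
    [T2Space M] [SecondCountableTopology M] {X O : Set M} (hX : IsClosed X) (hO : IsOpen O)
    (h : X ⊆ O) : ∃ N, IsOpen N ∧ X ⊆ N ∧ closure N ⊆ O :=
  have := normal_of_charted d M
  normal_exists_closure_subset hX hO h

/-- Local solutions of a convex condition near a closed set may be glued. -/
theorem exists_contMDiff_near {F : Type*} [NormedAddCommGroup F] [NormedSpace ℝ F] {X : Set M}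
    (hX : IsClosed X) {T : M → Set F} (hT : ∀ u, Convex ℝ (T u))
    (h : ∀ q ∈ X, ∃ V, IsOpen V ∧ q ∈ V ∧ ∃ f : M → F, ContMDiffOn (𝓡 d) 𝓘(ℝ, F) ∞ f V ∧
      ∀ u ∈ V, f u ∈ T u) :
    ∃ f : M → F, ContMDiff (𝓡 d) 𝓘(ℝ, F) ∞ f ∧ ∃ N, IsOpen N ∧ X ⊆ N ∧ ∀ u ∈ N, f u ∈ T u := by
  have := sigmaCompact_of_charted d M
  choose! V hV hqV f hf hfT using h
  obtain ⟨N, hN, hXN, hNO⟩ := exists_open_closure_subset d hX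
    (isOpen_biUnion fun q hq => hV q hq : IsOpen (⋃ q ∈ X, V q))
    (fun q hq => mem_biUnion hq (hqV q hq))
  classical
  -- Off the closure of `N` the condition is dropped, since no local solutions are available there.
  obtain ⟨g, hg⟩ := exists_contMDiffMap_forall_mem_convex_of_local (𝓡 d) (n := (⊤ : ℕ∞))
    (t := fun u => if u ∈ closure N then T u else univ)
    (fun u => by split_ifs; exacts [hT u, convex_univ]) (fun u => by
      by_cases hu : u ∈ closure N
      · obtain ⟨q, hq, huq⟩ := mem_iUnion₂.1 (hNO hu)
        refine ⟨V q, (hV q hq).mem_nhds huq, f q, hf q hq, fun y hy => ?_⟩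
        split_ifs
        exacts [hfT q hq y hy, mem_univ _]
      · refine ⟨(closure N)ᶜ, isClosed_closure.isOpen_compl.mem_nhds hu, fun _ => 0,
          contMDiffOn_const, fun y hy => ?_⟩
        rw [if_neg hy]; exact mem_univ _)
  refine ⟨g, g.contMDiff, N, hN, hXN, fun u hu => ?_⟩
  have := hg u
  rwa [if_pos (subset_closure hu)] at this

/-- A function that is smooth near a closed set agrees there with a global one. -/
lemma exists_contMDiff_eqOn {F : Type*} [NormedAddCommGroup F] [NormedSpace ℝ F] {X V : Set M}
    (hX : IsClosed X) (hV : IsOpen V) (hXV : X ⊆ V) {f : M → F}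
    (hf : ContMDiffOn (𝓡 d) 𝓘(ℝ, F) ∞ f V) :
    ∃ g : M → F, ContMDiff (𝓡 d) 𝓘(ℝ, F) ∞ g ∧ ∃ N, IsOpen N ∧ X ⊆ N ∧ ∀ u ∈ N, g u = f u :=
  exists_contMDiff_near (T := fun u => {f u}) hX (fun _ => convex_singleton _) fun q hq =>
    ⟨V, hV, hXV hq, f, hf, fun _ _ => rfl⟩

lemma exists_cutoff (d : ℕ) {M : Type*} [TopologicalSpace M] [ChartedSpace (Model d) M]
    [IsManifold (𝓡 d) ∞ M] [T2Space M] [SecondCountableTopology M] {X V : Set M}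
    (hX : IsClosed X) (hV : IsOpen V) (hXV : X ⊆ V) :
    ∃ χ : M → ℝ, ContMDiff (𝓡 d) 𝓘(ℝ, ℝ) ∞ χ ∧ (∃ N, IsOpen N ∧ X ⊆ N ∧ ∀ u ∈ N, χ u = 1) ∧
      ∀ q ∉ V, ∀ᶠ u in 𝓝 q, χ u = 0 := by
  have := sigmaCompact_of_charted d M
  have := normal_of_charted d M
  obtain ⟨N, hN, hXN, hNO⟩ := exists_open_closure_subset d hX hV hXV
  obtain ⟨χ, h1, h0, -⟩ := exists_contMDiffMap_one_nhds_of_subset_interior (𝓡 d) (n := (⊤ : ℕ∞))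
    (s := X) (t := closure N) hX (hXN.trans (interior_maximal subset_closure hN))
  refine ⟨χ, χ.contMDiff, ?_, fun q hq => ?_⟩
  · obtain ⟨N', hN', hX', h'⟩ := eventually_nhdsSet_iff_exists.1 h1
    exact ⟨N', hN', hX', h'⟩
  · filter_upwards [isClosed_closure.isOpen_compl.mem_nhds fun h => hq (hNO h)] with u hu
    exact h0 u hu

end Construct

end
end LogSymp

namespace LogSymp

noncomputable section

set_option linter.unusedSectionVars false
set_option maxSynthPendingDepth 3

/-! ### Flows on a manifold -/

section Flows

variable {d : ℕ} {M : Type*} [TopologicalSpace M] [ChartedSpace (Model d) M]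
  [IsManifold (𝓡 d) ∞ M] {e : OpenPartialHomeomorph M (Model d)}

/-- The coordinate expression of a time-dependent vector field. -/
def fieldInChart (e : OpenPartialHomeomorph M (Model d)) (v : ℝ → M → Model d)
    (z : ℝ × Model d) : Model d :=
  dmap e (e.symm z.2) (v z.1 (e.symm z.2))

/-- A chart in which the time-dependent vector field `v` is smooth. -/
structure IsFlowChart (N : Set M) (v : ℝ → M → Model d) (e : OpenPartialHomeomorph M (Model d)) :
    Prop where
  mem_atlas : e ∈ IsManifold.maximalAtlas (𝓡 d) ∞ M
  subset : e.source ⊆ N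
  smooth : ContDiffOn ℝ ∞ (fieldInChart e v) (Ioo (-1) 2 ×ˢ e.target)

/-- A time-dependent vector field that is smooth on `N`. -/
def IsFlowField (N : Set M) (v : ℝ → M → Model d) : Prop :=
  ∀ q ∈ N, ∃ e, IsFlowChart N v e ∧ q ∈ e.source

/-- `γ` is an integral curve of `v` in `N` on the unit interval. -/
def IsSol (N : Set M) (v : ℝ → M → Model d) (γ : ℝ → M) : Prop :=
  ∀ t ∈ Icc (0 : ℝ) 1, γ t ∈ N ∧ HasMFDerivWithinAt 𝓘(ℝ, ℝ) (𝓡 d) γ (Icc 0 1) t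
    ((1 : ℝ →L[ℝ] ℝ).smulRight (v t (γ t)))

variable {N : Set M} {v : ℝ → M → Model d} {γ γ' : ℝ → M}

lemma IsSol.continuousOn (h : IsSol N v γ) : ContinuousOn γ (Icc 0 1) :=
  fun t ht => (h t ht).2.continuousWithinAt

lemma IsSol.hasDerivWithinAt_chart (h : IsSol N v γ)
    (he : e ∈ IsManifold.maximalAtlas (𝓡 d) ∞ M) {t : ℝ} (ht : t ∈ Icc (0 : ℝ) 1)
    (hs : γ t ∈ e.source) :
    HasDerivWithinAt (e ∘ γ) (fieldInChart e v (t, e (γ t))) (Icc 0 1) t := by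
  have h1 := (chart_mdiff he hs).hasMFDerivAt.comp_hasMFDerivWithinAt t (h t ht).2
  have h2 : HasFDerivWithinAt (e ∘ γ) (dmap e (γ t) ∘L (1 : ℝ →L[ℝ] ℝ).smulRight (v t (γ t)))
    (Icc 0 1) t := h1.hasFDerivWithinAt
  refine h2.hasDerivWithinAt.congr_deriv ?_
  simp only [fieldInChart, e.left_inv hs]
  change dmap e (γ t) ((1 : ℝ) • v t (γ t)) = _
  rw [one_smul]

lemma IsSol.hasDerivWithinAt_fun (h : IsSol N v γ) {f : M → ℝ} {t : ℝ} (ht : t ∈ Icc (0 : ℝ) 1)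
    (hf : MDifferentiableAt (𝓡 d) 𝓘(ℝ, ℝ) f (γ t)) :
    HasDerivWithinAt (f ∘ γ) (dfun f (γ t) (v t (γ t))) (Icc 0 1) t := by
  have h1 := hf.hasMFDerivAt.comp_hasMFDerivWithinAt t (h t ht).2
  have h2 : HasFDerivWithinAt (f ∘ γ) (dfun f (γ t) ∘L (1 : ℝ →L[ℝ] ℝ).smulRight (v t (γ t)))
    (Icc 0 1) t := h1.hasFDerivWithinAt
  refine h2.hasDerivWithinAt.congr_deriv ?_
  change dfun f (γ t) ((1 : ℝ) • v t (γ t)) = _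
  rw [one_smul]

lemma isSol_of_chart (he : e ∈ IsManifold.maximalAtlas (𝓡 d) ∞ M) (hN : e.source ⊆ N)
    {c : ℝ → Model d} (h : ∀ t ∈ Icc (0 : ℝ) 1, c t ∈ e.target ∧
      HasDerivWithinAt c (fieldInChart e v (t, c t)) (Icc 0 1) t) :
    IsSol N v (fun t => e.symm (c t)) := by
  intro t ht
  obtain ⟨h1, h2⟩ := h t ht
  refine ⟨hN (e.map_target h1), ?_⟩
  have h3 := (chart_symm_mdiff he h1).hasMFDerivAt.comp_hasMFDerivWithinAt t
    h2.hasFDerivWithinAt.hasMFDerivWithinAt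
  refine h3.congr_mfderiv (ContinuousLinearMap.ext fun (r : ℝ) => ?_)
  have h4 := dpar_dmap he (e.map_target h1) (v t (e.symm (c t)))
  rw [e.right_inv h1] at h4
  change dpar e.symm (c t) (r • fieldInChart e v (t, c t)) = r • v t (e.symm (c t))
  rw [map_smul, fieldInChart, h4]

/-- Integral curves are determined by their starting point. -/
theorem IsSol.unique [T2Space M] (hv : IsFlowField N v) (h : IsSol N v γ) (h' : IsSol N v γ')
    (h0 : γ 0 = γ' 0) : ∀ t ∈ Icc (0 : ℝ) 1, γ t = γ' t := by
  have hcl : IsClosed ({t | γ t = γ' t} ∩ Icc 0 1) := by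
    rw [inter_comm]
    have hc := h.continuousOn.prodMk h'.continuousOn
    exact hc.preimage_isClosed_of_isClosed isClosed_Icc isClosed_diagonal
  -- The times of agreement form a closed set, and local uniqueness for the Lipschitz coordinate
  -- expression extends agreement to the right of each of its points.
  refine hcl.Icc_subset_of_forall_mem_nhdsWithin h0 fun t ⟨ht, ht1⟩ => ?_
  have ht' : t ∈ Icc (0 : ℝ) 1 := ⟨ht1.1, ht1.2.le⟩
  obtain ⟨e, he, hqe⟩ := hv (γ t) (h t ht').1
  have hqe' : γ' t ∈ e.source := by rw [← show γ t = γ' t from ht]; exact hqe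
  have htI : t ∈ Ioo (-1 : ℝ) 2 := ⟨by linarith [ht1.1], by linarith [ht1.2]⟩
  obtain ⟨K, s, hs, hK⟩ := ((he.smooth.contDiffAt ((isOpen_Ioo.prod e.open_target).mem_nhds
    (mk_mem_prod htI (e.map_source hqe)))).of_le
      (by simp : (1 : WithTop ℕ∞) ≤ ∞)).exists_lipschitzOnWith
  obtain ⟨s₁, hs₁, s₂, hs₂, hs12⟩ := mem_nhds_prod_iff.1 hs
  have key : ∀ {γ : ℝ → M}, IsSol N v γ → γ t ∈ e.source → s₂ ∈ 𝓝 (e (γ t)) →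
      ∀ᶠ r in 𝓝[≥] t, r ∈ Icc (0 : ℝ) 1 ∧ γ r ∈ e.source ∧ e (γ r) ∈ s₂ := by
    intro γ h hq h2
    have hI : Icc (0 : ℝ) 1 ∈ 𝓝[≥] t := mem_of_superset (Icc_mem_nhdsGE ht1.2)
      (Icc_subset_Icc_left ht1.1)
    have h3 : Tendsto γ (𝓝[≥] t) (𝓝 (γ t)) :=
      (h t ht').2.continuousWithinAt.mono_of_mem_nhdsWithin hI
    filter_upwards [hI, h3 (e.open_source.mem_nhds hq),
      ((e.continuousAt hq).tendsto.comp h3) h2] with r h4 h5 h6 using ⟨h4, h5, h6⟩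
  have hev : ∀ᶠ r in 𝓝[≥] t, (r ∈ s₁) ∧ (r ∈ Icc (0 : ℝ) 1 ∧ γ r ∈ e.source ∧ e (γ r) ∈ s₂) ∧
      (r ∈ Icc (0 : ℝ) 1 ∧ γ' r ∈ e.source ∧ e (γ' r) ∈ s₂) :=
    Filter.Eventually.and (mem_nhdsWithin_of_mem_nhds hs₁) ((key h hqe hs₂).and (key h' hqe'
      (by rw [← show γ t = γ' t from ht]; exact hs₂)))
  obtain ⟨b, hb, hbs⟩ := mem_nhdsGE_iff_exists_Icc_subset.1 hev
  have hder : ∀ {γ : ℝ → M}, IsSol N v γ → (∀ r ∈ Icc t b, r ∈ Icc (0 : ℝ) 1 ∧ γ r ∈ e.source) →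
      ContinuousOn (e ∘ γ) (Icc t b) ∧ ∀ r ∈ Ico t b, HasDerivWithinAt (e ∘ γ)
        (fieldInChart e v (r, (e ∘ γ) r)) (Ici r) r := by
    intro γ h hγ
    have h1 : ∀ r ∈ Icc t b, HasDerivWithinAt (e ∘ γ) (fieldInChart e v (r, (e ∘ γ) r))
        (Icc t b) r := fun r hr => (h.hasDerivWithinAt_chart he.mem_atlas (hγ r hr).1
          (hγ r hr).2).mono fun x hx => (hγ x hx).1
    exact ⟨fun r hr => (h1 r hr).continuousWithinAt, fun r hr =>
      (h1 r ⟨hr.1, hr.2.le⟩).mono_of_mem_nhdsWithin (mem_of_superset (Icc_mem_nhdsGE hr.2)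
        (Icc_subset_Icc_left hr.1))⟩
  obtain ⟨hc1, hd1⟩ := hder h fun r hr => ⟨(hbs hr).2.1.1, (hbs hr).2.1.2.1⟩
  obtain ⟨hc2, hd2⟩ := hder h' fun r hr => ⟨(hbs hr).2.1.1, (hbs hr).2.2.2.1⟩
  have huniq := ODE_solution_unique_of_mem_Icc_right (v := fun r x => fieldInChart e v (r, x))
    (s := fun _ => s₂) (K := K) (fun r hr => by
      rw [lipschitzOnWith_iff_dist_le_mul]
      intro x hx y hy
      have hr1 := (hbs (⟨hr.1, hr.2.le⟩ : r ∈ Icc t b)).1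
      have := (lipschitzOnWith_iff_dist_le_mul.1 hK) (r, x) (hs12 ⟨hr1, hx⟩) (r, y)
        (hs12 ⟨hr1, hy⟩)
      simpa [Prod.dist_eq] using this)
    hc1 hd1 (fun r hr => (hbs ⟨hr.1, hr.2.le⟩).2.1.2.2)
    hc2 hd2 (fun r hr => (hbs ⟨hr.1, hr.2.le⟩).2.2.2.2)
    (by rw [Function.comp_apply, Function.comp_apply, show γ t = γ' t from ht])
  refine mem_of_superset (Ioc_mem_nhdsGT hb) fun r hr => ?_
  have hr' : r ∈ Icc t b := ⟨hr.1.le, hr.2⟩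
  exact e.injOn (hbs hr').2.1.2.1 (hbs hr').2.2.2.1 (huniq hr')

/-- Time reversal. -/
def revField (v : ℝ → M → Model d) (t : ℝ) (u : M) : Model d := - v (1 - t) u

lemma IsFlowChart.rev (h : IsFlowChart N v e) : IsFlowChart N (revField v) e where
  mem_atlas := h.mem_atlas
  subset := h.subset
  smooth := by
    have h1 : ContDiffOn ℝ ∞ (fun z : ℝ × Model d => - fieldInChart e v (1 - z.1, z.2))
        (Ioo (-1) 2 ×ˢ e.target) :=
      (h.smooth.comp (((contDiff_const.sub contDiff_fst).prodMk contDiff_snd).contDiffOn)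
        fun z hz => ⟨⟨by linarith [hz.1.2], by linarith [hz.1.1]⟩, hz.2⟩).neg
    refine h1.congr fun z _ => ?_
    simp [fieldInChart, revField]

lemma IsFlowField.rev (h : IsFlowField N v) : IsFlowField N (revField v) := fun q hq =>
  let ⟨e, he, hqe⟩ := h q hq
  ⟨e, he.rev, hqe⟩

lemma IsSol.rev (h : IsSol N v γ) : IsSol N (revField v) (fun t => γ (1 - t)) := by
  intro t ht
  have ht' : 1 - t ∈ Icc (0 : ℝ) 1 := ⟨by linarith [ht.2], by linarith [ht.1]⟩
  refine ⟨(h _ ht').1, ?_⟩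
  have h1 : HasDerivWithinAt (fun t : ℝ => 1 - t) (-1) (Icc 0 1) t :=
    ((hasDerivAt_id t).const_sub 1).hasDerivWithinAt
  have h2 := (h _ ht').2.comp t (u := Icc (0 : ℝ) 1) (f := fun t : ℝ => 1 - t)
    h1.hasFDerivWithinAt.hasMFDerivWithinAt
    fun s hs => ⟨by linarith [hs.2], by linarith [hs.1]⟩
  refine h2.congr_mfderiv (ContinuousLinearMap.ext fun (r : ℝ) => ?_)
  change (r • (-1 : ℝ)) • v (1 - t) (γ (1 - t)) = r • (- v (1 - t) (γ (1 - t)))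
  simp

open Classical in
/-- The time one map. -/
def flowEnd (N : Set M) (v : ℝ → M → Model d) (u : M) : M :=
  if h : ∃ γ, IsSol N v γ ∧ γ 0 = u then h.choose 1 else u

lemma flowEnd_eq [T2Space M] (hv : IsFlowField N v) (h : IsSol N v γ) :
    flowEnd N v (γ 0) = γ 1 := by
  have h1 : ∃ γ', IsSol N v γ' ∧ γ' 0 = γ 0 := ⟨γ, h, rfl⟩
  rw [flowEnd, dif_pos h1]
  exact IsSol.unique hv h1.choose_spec.1 h h1.choose_spec.2 1 (right_mem_Icc.2 zero_le_one)

/-- A reversed integral curve solves the reversed field, so the reversed time-one map undoes the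
original one wherever integral curves exist. This gives injectivity near a possibly non-compact `X`
without estimates. -/
lemma flowEnd_rev [T2Space M] (hv : IsFlowField N v) (h : IsSol N v γ) :
    flowEnd N (revField v) (γ 1) = γ 0 := by
  have := flowEnd_eq hv.rev h.rev
  simpa using this

/-- The local flow near a zero of the field. -/
theorem IsFlowChart.exists_local_flow (he : IsFlowChart N v e) {q : M} (hq : q ∈ e.source)
    (h0 : ∀ t ∈ Icc (0 : ℝ) 1, v t q = 0) :
    ∃ (O : Set (Model d)) (Γ : Model d → Curve (Model d)), IsOpen O ∧ e q ∈ O ∧ ContDiffOn ℝ ∞ Γ O ∧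
      ∀ x ∈ O, extend (Γ x) 0 = x ∧ (∀ t ∈ Icc (0 : ℝ) 1, extend (Γ x) t ∈ e.target ∧
        HasDerivWithinAt (extend (Γ x)) (fieldInChart e v (t, extend (Γ x) t)) (Icc 0 1) t) ∧
        ∀ w : Model d, extend (fderiv ℝ Γ x w) 0 = w ∧ ∀ t ∈ Icc (0 : ℝ) 1,
          HasDerivWithinAt (extend (fderiv ℝ Γ x w)) (spaceDeriv (fieldInChart e v)
            (t, extend (Γ x) t) (extend (fderiv ℝ Γ x w) t)) (Icc 0 1) t := by
  obtain ⟨O, Γ, hO, hqO, hΓ, -, h⟩ := LogSymp.exists_local_flow (isOpen_Ioo.prod e.open_target)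
    he.smooth (x₀ := e q) (fun t ht => ⟨Icc_subset_Ioo (by norm_num) (by norm_num) ht,
      e.map_source hq⟩) (fun t ht => by simp [fieldInChart, e.left_inv hq, h0 t ht])
  refine ⟨O, Γ, hO, hqO, hΓ, fun x hx => ?_⟩
  obtain ⟨h1, h2, h3, h4⟩ := h x hx
  have hex : ∀ (δ : Curve (Model d)) {t : ℝ} (ht : t ∈ Icc (0 : ℝ) 1), extend δ t = δ ⟨t, ht⟩ :=
    fun δ t ht => extend_of_mem δ ht
  refine ⟨?_, fun t ht => ?_, fun w => ⟨?_, fun t ht => ?_⟩⟩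
  · rw [hex _ (left_mem_Icc.2 zero_le_one)]; exact h1
  · rw [hex _ ht]
    exact ⟨(h2 ⟨t, ht⟩).2, h3 ⟨t, ht⟩⟩
  · rw [hex _ (left_mem_Icc.2 zero_le_one)]; exact (h4 w).1
  · rw [hex _ ht, hex _ ht]
    exact (h4 w).2 ⟨t, ht⟩

end Flows

end
end LogSymp

namespace LogSymp

noncomputable section

set_option linter.unusedSectionVars false
set_option maxSynthPendingDepth 3

/-! ### Tubular neighbourhoods of transverse zero sets -/

section Tubular

variable {d : ℕ} {M : Type*} [TopologicalSpace M] [ChartedSpace (Model d) M]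
  [IsManifold (𝓡 d) ∞ M] {σ : Type} [Fintype σ] {f : σ → M → ℝ}
  {e e' : OpenPartialHomeomorph M (Model d)} {κ κ' : σ ↪ Fin d}

/-- A chart among whose coordinates are the functions `f s`. -/
structure IsFunChart (f : σ → M → ℝ) (e : OpenPartialHomeomorph M (Model d)) (κ : σ ↪ Fin d) :
    Prop where
  mem_atlas : e ∈ IsManifold.maximalAtlas (𝓡 d) ∞ M
  coord : ∀ u ∈ e.source, ∀ s, e u (κ s) = f s u

lemma IsFunChart.contMDiffOn (h : IsFunChart f e κ) (s : σ) :
    ContMDiffOn (𝓡 d) 𝓘(ℝ, ℝ) ∞ (f s) e.source := by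
  have h1 : ContMDiffOn (𝓡 d) 𝓘(ℝ, ℝ) ∞ ((EuclideanSpace.proj (κ s) : Model d →L[ℝ] ℝ) ∘ e)
      e.source := (EuclideanSpace.proj (κ s) : Model d →L[ℝ] ℝ).contMDiff.comp_contMDiffOn
        (contMDiffOn_of_mem_maximalAtlas h.mem_atlas)
  exact h1.congr fun u hu => (h.coord u hu s).symm

lemma IsFunChart.mdifferentiableAt (h : IsFunChart f e κ) (s : σ) {u : M} (hu : u ∈ e.source) :
    MDifferentiableAt (𝓡 d) 𝓘(ℝ, ℝ) (f s) u :=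
  ((h.contMDiffOn s).contMDiffAt (e.open_source.mem_nhds hu)).mdifferentiableAt (by simp)

lemma IsFunChart.dfun_dpar (h : IsFunChart f e κ) {x : Model d} (hx : x ∈ e.target) (s : σ)
    (v : Model d) : dfun (f s) (e.symm x) (dpar e.symm x v) = v (κ s) := by
  rw [LogSymp.dfun_dpar h.mem_atlas hx (h.mdifferentiableAt s (e.map_target hx))]
  have h1 : f s ∘ e.symm =ᶠ[𝓝 x] (EuclideanSpace.proj (κ s) : Model d →L[ℝ] ℝ) := by
    filter_upwards [e.open_target.mem_nhds hx] with y hy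
    rw [Function.comp_apply, ← h.coord _ (e.map_target hy), e.right_inv hy]
    rfl
  rw [h1.fderiv_eq, ContinuousLinearMap.fderiv]
  rfl

lemma IsFunChart.dmap_apply (h : IsFunChart f e κ) {u : M} (hu : u ∈ e.source) (s : σ)
    (v : Model d) : dmap e u v (κ s) = dfun (f s) u v := by
  have := h.dfun_dpar (e.map_source hu) s (dmap e u v)
  rw [e.left_inv hu, dpar_dmap h.mem_atlas hu] at this
  exact this.symm

lemma IsFunChart.restr (h : IsFunChart f e κ) {V : Set M} (hV : IsOpen V) :
    IsFunChart f (e.restrOpen V hV) κ where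
  mem_atlas := restr_mem_maximalAtlas h.mem_atlas hV
  coord := fun u hu => by
    rw [OpenPartialHomeomorph.restrOpen_source] at hu
    exact h.coord u hu.1

open Classical in
/-- Vector fields near `X` that are dual to the functions `f s`. -/
theorem exists_dual_fields [T2Space M] [SecondCountableTopology M] {X : Set M} (hX : IsClosed X)
    (hf : ∀ a ∈ X, ∃ (e : OpenPartialHomeomorph M (Model d)) (κ : σ ↪ Fin d), IsFunChart f e κ ∧
      a ∈ e.source) :
    ∃ (N : Set M) (V : σ → M → Model d), IsOpen N ∧ X ⊆ N ∧
      (∀ e ∈ IsManifold.maximalAtlas (𝓡 d) ∞ M, ∀ s,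
        ContDiffOn ℝ ∞ (fun x => dmap e (e.symm x) (V s (e.symm x))) e.target) ∧
      ∀ u ∈ N, ∀ s t, dfun (f t) u (V s u) = if t = s then 1 else 0 := by
  have := sigmaCompact_of_charted d M
  choose E κ hE haE using fun a : X => hf a a.2
  obtain ⟨N, hN, hXN, hNO⟩ := exists_open_closure_subset d hX
    (isOpen_iUnion fun a => (E a).open_source) (fun a ha => mem_iUnion.2 ⟨⟨a, ha⟩, haE ⟨a, ha⟩⟩)
  obtain ⟨ρ, hρ⟩ := SmoothPartitionOfUnity.exists_isSubordinate (𝓡 d) isClosed_closure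
    (fun a : X => (E a).source) (fun a => (E a).open_source) hNO
  -- An average of coordinate fields of charts that contain the `f s` among their coordinates.
  -- Duality is preserved by the averaging because it is an affine, hence convex, condition.
  set V : σ → M → Model d := fun s u => ∑ᶠ a : X, ρ a u •
    dpar (E a).symm (E a u) (EuclideanSpace.single (κ a s) 1) with hV
  refine ⟨N, V, hN, hXN, fun e he s x hx => ?_, fun u hu s t => ?_⟩
  · have hu : e.symm x ∈ e.source := e.map_target hx
    have h1 : ContMDiffAt (𝓡 d) 𝓘(ℝ, Model d) ∞ (fun u => ∑ᶠ a : X, ρ a u •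
        dmap e u (dpar (E a).symm (E a u) (EuclideanSpace.single (κ a s) 1))) (e.symm x) := by
      refine ρ.contMDiffAt_finsum (n := (⊤ : ℕ∞)) fun a ha => ?_
      have hua : e.symm x ∈ (E a).source := hρ a ha
      have hEa := (hE a).mem_atlas
      have hmem : E a (e.symm x) ∈ overlap (E a) e :=
        ⟨(E a).map_source hua, by rwa [mem_preimage, (E a).left_inv hua]⟩
      have h2 : ContDiffAt ℝ ∞ (fun y => fderiv ℝ (e ∘ (E a).symm) y
          (EuclideanSpace.single (κ a s) 1)) (E a (e.symm x)) :=
        (((contDiffOn_transition hEa he).fderiv_of_isOpen isOpen_overlap (by simp)).contDiffAt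
          (isOpen_overlap.mem_nhds hmem)).clm_apply contDiffAt_const
      refine (h2.contMDiffAt.comp _ (contMDiffAt_of_mem_maximalAtlas hEa hua)).congr_of_eventuallyEq ?_
      filter_upwards [e.open_source.mem_nhds hu, (E a).open_source.mem_nhds hua] with u h3 h4
      have h5 : E a u ∈ overlap (E a) e :=
        ⟨(E a).map_source h4, by rwa [mem_preimage, (E a).left_inv h4]⟩
      rw [Function.comp_apply, fderiv_transition hEa he h5, (E a).left_inv h4]
    have h3 := (h1.comp x (contMDiffAt_symm_of_mem_maximalAtlas he hx)).contDiffAt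
    refine (h3.congr_of_eventuallyEq ?_).contDiffWithinAt
    refine Filter.Eventually.of_forall fun y => ?_
    simp only [Function.comp_apply, hV]
    have hfin : (Function.support fun a : X => ρ a (e.symm y) • dpar (E a).symm (E a (e.symm y))
        (EuclideanSpace.single (κ a s) 1)).Finite :=
      (ρ.locallyFinite.point_finite (e.symm y)).subset fun a ha h0 => ha (by
        change ρ a (e.symm y) • _ = (0 : Model d)
        rw [show ρ a (e.symm y) = 0 from h0, zero_smul])
    have h4 := (dmap e (e.symm y) : Model d →+ Model d).map_finsum hfin
    refine h4.trans (finsum_congr fun a => ?_)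
    exact map_smul (dmap e (e.symm y)) _ _
  · have hconv : Convex ℝ {v : Model d | ∀ t, dfun (f t) u v = if t = s then 1 else 0} := by
      intro v hv w hw a b _ _ hab t
      rw [map_add, map_smul, map_smul, hv t, hw t]
      split_ifs <;> simp [hab]
    refine ρ.finsum_smul_mem_convex (g := fun (a : X) u => dpar (E a).symm (E a u)
      (EuclideanSpace.single (κ a s) 1)) (subset_closure hu) (fun a ha => ?_) hconv t
    have hua : u ∈ (E a).source := hρ a (subset_tsupport _ ha)
    intro t
    have h1 := (hE a).dfun_dpar ((E a).map_source hua) t (EuclideanSpace.single (κ a s) 1)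
    rw [(E a).left_inv hua] at h1
    rw [h1]
    simp

end Tubular

end
end LogSymp

namespace LogSymp

noncomputable section

set_option linter.unusedSectionVars false
set_option maxSynthPendingDepth 3

/-- Evaluation of curves. -/
def Curve.eval {F : Type} [NormedAddCommGroup F] [NormedSpace ℝ F] (t : Icc (0 : ℝ) 1) :
    Curve F →L[ℝ] F :=
  LinearMap.mkContinuous
    { toFun := fun γ => γ t, map_add' := fun _ _ => rfl, map_smul' := fun _ _ => rfl } 1
    fun γ => by rw [one_mul]; exact γ.norm_coe_le_norm t

lemma Curve.eval_apply {F : Type} [NormedAddCommGroup F] [NormedSpace ℝ F] (t : Icc (0 : ℝ) 1)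
    (γ : Curve F) : Curve.eval t γ = γ t := rfl

/-! ### The tube obtained from the flow of dual fields -/

section Tubular

variable {d : ℕ} {M : Type*} [TopologicalSpace M] [ChartedSpace (Model d) M]
  [IsManifold (𝓡 d) ∞ M] {σ : Type} [Fintype σ] {f : σ → M → ℝ}
  {e e' : OpenPartialHomeomorph M (Model d)} {κ κ' : σ ↪ Fin d}

/-- The linear combination of vector fields with constant coefficients. -/
def combField (V : σ → M → Model d) (p : σ → ℝ) (_ : ℝ) (u : M) : Model d := ∑ s, p s • V s u

lemma fieldInChart_combField (V : σ → M → Model d) (p : σ → ℝ) (t : ℝ) (x : Model d) :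
    fieldInChart e (combField V p) (t, x) = ∑ s, p s • dmap e (e.symm x) (V s (e.symm x)) := by
  simp [fieldInChart, combField, map_sum]

variable {V : σ → M → Model d} {N : Set M}

lemma isFlowChart_combField (he : e ∈ IsManifold.maximalAtlas (𝓡 d) ∞ M) (hN : e.source ⊆ N)
    (hV : ∀ s, ContDiffOn ℝ ∞ (fun x => dmap e (e.symm x) (V s (e.symm x))) e.target)
    (p : σ → ℝ) : IsFlowChart N (combField V p) e where
  mem_atlas := he
  subset := hN
  smooth := by
    have h1 : ContDiffOn ℝ ∞ (fun z : ℝ × Model d =>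
        ∑ s, p s • dmap e (e.symm z.2) (V s (e.symm z.2))) (Ioo (-1 : ℝ) 2 ×ˢ e.target) :=
      ContDiffOn.sum fun s _ => contDiffOn_const.fun_smul
        ((hV s).comp (f := Prod.snd) contDiff_snd.contDiffOn fun z hz => hz.2)
    exact h1.congr fun z _ => fieldInChart_combField V p z.1 z.2

/-- Smooth dependence of the flow of `combField V p` on `p` and the starting point. -/
theorem exists_param_flow (he : e ∈ IsManifold.maximalAtlas (𝓡 d) ∞ M) (hN : e.source ⊆ N)
    (hV : ∀ s, ContDiffOn ℝ ∞ (fun x => dmap e (e.symm x) (V s (e.symm x))) e.target) {q : M}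
    (hq : q ∈ e.source) :
    ∃ (O : Set ((σ → ℝ) × Model d)) (Φ : (σ → ℝ) × Model d → Model d), IsOpen O ∧ (0, e q) ∈ O ∧
      ContDiffOn ℝ ∞ Φ O ∧ ∀ z ∈ O, z.2 ∈ e.target ∧ Φ z ∈ e.target ∧
        ∃ γ, IsSol N (combField V z.1) γ ∧ γ 0 = e.symm z.2 ∧ γ 1 = e.symm (Φ z) := by
  set w : σ → Model d → Model d := fun s x => dmap e (e.symm x) (V s (e.symm x)) with hw
  -- The parameter becomes part of the state, with zero velocity. Then `(0, e q)` is a zero of the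
  -- extended field, and smooth dependence on the parameter is smooth dependence on the initial
  -- value.
  set g : ℝ × ((σ → ℝ) × Model d) → (σ → ℝ) × Model d := fun z => (0, ∑ s, z.2.1 s • w s z.2.2)
    with hg
  have hgs : ContDiffOn ℝ ∞ g (univ ×ˢ (univ ×ˢ e.target)) := by
    refine contDiffOn_const.prodMk (ContDiffOn.sum fun s _ => ContDiffOn.fun_smul ?_ ?_)
    · exact ((contDiff_apply ℝ ℝ s).comp (contDiff_fst.comp contDiff_snd)).contDiffOn
    · exact (hV s).comp (contDiff_snd.comp contDiff_snd).contDiffOn fun z hz => hz.2.2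
  obtain ⟨O, Γ, hO, hqO, hΓ, -, h⟩ := exists_local_flow
    (isOpen_univ.prod (isOpen_univ.prod e.open_target)) hgs (x₀ := ((0 : σ → ℝ), e q))
    (fun t _ => ⟨mem_univ _, mem_univ _, e.map_source hq⟩) (fun t _ => by simp [hg])
  refine ⟨O, fun z => (Curve.eval 1 (Γ z)).2, hO, hqO, ?_, fun z hz => ?_⟩
  · exact contDiff_snd.comp_contDiffOn ((Curve.eval 1).contDiff.comp_contDiffOn hΓ)
  · obtain ⟨h0, h1, h2, -⟩ := h z hz
    have h1' : ∀ t ∈ Icc (0 : ℝ) 1, (extend (Γ z) t).2 ∈ e.target := fun t ht => by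
      rw [extend_of_mem _ ht]; exact (h1 ⟨t, ht⟩).2.2
    have h2' : ∀ t ∈ Icc (0 : ℝ) 1, HasDerivWithinAt (extend (Γ z)) (g (t, extend (Γ z) t))
        (Icc 0 1) t := fun t ht => by
      have := h2 ⟨t, ht⟩
      rwa [← extend_of_mem _ ht] at this
    have hz0 : extend (Γ z) 0 = z := by rw [extend_of_mem _ (left_mem_Icc.2 zero_le_one)]; exact h0
    have hz1 : extend (Γ z) 1 = Γ z 1 := by
      rw [extend_of_mem _ (right_mem_Icc.2 zero_le_one)]; rfl
    have hp : ∀ t ∈ Icc (0 : ℝ) 1, (extend (Γ z) t).1 = z.1 := by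
      intro t ht
      have h3 := eqOn_zero_deriv (f := fun t => (extend (Γ z) t).1)
        (fun t ht => (h2' t ht).fst) t ht
      rw [h3, hz0]
    refine ⟨?_, ?_, fun t => e.symm (extend (Γ z) t).2, ?_, ?_, ?_⟩
    · have := h1' 0 (left_mem_Icc.2 zero_le_one)
      rwa [hz0] at this
    · have := h1' 1 (right_mem_Icc.2 zero_le_one)
      rwa [hz1] at this
    · refine isSol_of_chart he hN fun t ht => ⟨h1' t ht, ?_⟩
      rw [fieldInChart_combField, ← hp t ht]
      exact (h2' t ht).snd
    · simp only [hz0]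
    · simp only [hz1]; rfl

/-- By duality `f s` grows at the constant rate `p s`. With `p s = - f s u` the flow from `u`
reaches the common zero set at time one. -/
lemma IsSol.dual_apply {γ : ℝ → M} {p : σ → ℝ} (hγ : IsSol N (combField V p) γ)
    (hf : ∀ u ∈ N, ∀ t, MDifferentiableAt (𝓡 d) 𝓘(ℝ, ℝ) (f t) u) [DecidableEq σ]
    (hdual : ∀ u ∈ N, ∀ s t, dfun (f t) u (V s u) = if t = s then 1 else 0) (s : σ) :
    f s (γ 1) = f s (γ 0) + p s := by
  have h1 : ∀ t ∈ Icc (0 : ℝ) 1, HasDerivWithinAt (fun t => f s (γ t) - t * p s) 0 (Icc 0 1) t := by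
    intro t ht
    have h2 := hγ.hasDerivWithinAt_fun ht (hf _ (hγ t ht).1 s)
    have h3 : dfun (f s) (γ t) (combField V p t (γ t)) = p s := by
      rw [combField, map_sum, Finset.sum_eq_single s]
      · rw [map_smul, hdual _ (hγ t ht).1]; simp
      · intro r _ hr
        rw [map_smul, hdual _ (hγ t ht).1, if_neg hr.symm, smul_zero]
      · simp
    rw [h3] at h2
    exact (h2.sub ((hasDerivWithinAt_id t _).mul_const (p s))).congr_deriv (by simp)
  have h4 := eqOn_zero_deriv h1 1 (right_mem_Icc.2 zero_le_one)
  simp only [one_mul, zero_mul, sub_zero] at h4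
  linarith

/-- A function chart on a ball centred on `X` in which the projection `π` is the coordinate
projection. -/
structure IsTubChart (f : σ → M → ℝ) (π : M → M) (e : OpenPartialHomeomorph M (Model d))
    (κ : σ ↪ Fin d) (x₀ : Model d) (ρ : ℝ) : Prop where
  funChart : IsFunChart f e κ
  pos : 0 < ρ
  center : cproj κ x₀ = x₀
  target_eq : e.target = Metric.ball x₀ ρ
  proj : ∀ u ∈ e.source, π u ∈ e.source ∧ e (π u) = cproj κ (e u)

/-- A tubular neighbourhood of `X`, covered by tubular charts. -/
structure IsTube (f : σ → M → ℝ) (X N : Set M) (π : M → M) : Prop where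
  isOpen : IsOpen N
  subset : X ⊆ N
  proj_mem : ∀ u ∈ N, π u ∈ X
  proj_eq : ∀ u ∈ X, π u = u
  zero : ∀ u ∈ X, ∀ s, f s u = 0
  mem_of_zero : ∀ u ∈ N, (∀ s, f s u = 0) → u ∈ X
  injective : ∀ u ∈ N, ∀ u' ∈ N, π u = π u' → (∀ s, f s u = f s u') → u = u'
  chart : ∀ u ∈ N, ∃ (e : OpenPartialHomeomorph M (Model d)) (κ : σ ↪ Fin d) (x₀ : Model d) (ρ : ℝ),
    IsTubChart f π e κ x₀ ρ ∧ e.source ⊆ N ∧ u ∈ e.source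
  small_chart : ∀ a ∈ X, ∀ O, IsOpen O → a ∈ O → ∃ (e : OpenPartialHomeomorph M (Model d))
    (κ : σ ↪ Fin d) (ρ : ℝ), IsTubChart f π e κ (e a) ρ ∧ e.source ⊆ N ∩ O ∧ a ∈ e.source

lemma sum_single_apply_range (κ : σ ↪ Fin d) (c : σ → ℝ) (t : σ) :
    (∑ s, c s • EuclideanSpace.single (κ s) (1 : ℝ) : Model d) (κ t) = c t := by
  classical
  simp only [WithLp.ofLp_sum, Finset.sum_apply, PiLp.smul_apply]
  rw [Finset.sum_eq_single t]
  · simp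
  · intro s _ hs; simp [hs.symm]
  · simp

lemma cproj_sum_single (κ : σ ↪ Fin d) (c : σ → ℝ) :
    cproj κ (∑ s, c s • EuclideanSpace.single (κ s) (1 : ℝ) : Model d) = 0 := by
  rw [map_sum]
  refine Finset.sum_eq_zero fun s _ => ?_
  refine ext_range κ (fun t => by simp [cproj_apply_range]) fun j hj => ?_
  rw [cproj_apply_of_notMem _ _ hj]
  have : j ≠ κ s := fun e => hj ⟨s, e.symm⟩
  simp [this]

/-- New coordinates: the `f s` in the directions of `κ`, and the `e`-coordinates of `π u` in the
others. At `a` the differential is injective, since in the chart `e` it leaves the coordinates `κ s`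
unchanged and is the identity on vectors along `X`, where `π` is the identity. -/
lemma exists_tubChart {X N' : Set M} {π : M → M} (hN' : IsOpen N')
    (hπ : ∀ u ∈ N', π u ∈ X) (hπs : ContMDiffOn (𝓡 d) (𝓡 d) ∞ π N') (hπX : ∀ u ∈ X, π u = u)
    (hXN : X ⊆ N') (hX0 : ∀ u ∈ X, ∀ s, f s u = 0)
    (h0X : ∀ u ∈ N', (∀ s, f s u = 0) → u ∈ X) (he : IsFunChart f e κ) {a : M} (ha : a ∈ X)
    (hae : a ∈ e.source) {O : Set M} (hO : IsOpen O) (haO : a ∈ O) :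
    ∃ (e₁ : OpenPartialHomeomorph M (Model d)) (ρ : ℝ),
      IsTubChart f π e₁ κ (e₁ a) ρ ∧ e₁.source ⊆ N' ∩ O ∧ a ∈ e₁.source := by
  set Y : M → Model d := fun u => e (π u) + ∑ s, f s u • EuclideanSpace.single (κ s) (1 : ℝ)
    with hY
  set V := (N' ∩ π ⁻¹' e.source) ∩ (e.source ∩ O)
  have hV : IsOpen V := (hπs.continuousOn.isOpen_inter_preimage hN' e.open_source).inter
    (e.open_source.inter hO)
  have haV : a ∈ V := ⟨⟨hXN ha, by rwa [mem_preimage, hπX a ha]⟩, hae, haO⟩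
  have hYs : ContMDiffOn (𝓡 d) (𝓡 d) ∞ Y V := by
    have h1 : ContMDiffOn (𝓡 d) (𝓡 d) ∞ (fun u => e (π u)) V :=
      (contMDiffOn_of_mem_maximalAtlas he.mem_atlas).comp (hπs.mono fun u hu => hu.1.1)
        fun u hu => hu.1.2
    have h2 : ∀ s, ContMDiffOn (𝓡 d) (𝓡 d) ∞
        (fun u => f s u • (EuclideanSpace.single (κ s) (1 : ℝ) : Model d)) V := fun s =>
      ((he.contMDiffOn s).mono fun u hu => hu.2.1).smul contMDiffOn_const
    refine ContMDiffOn.add h1 (contMDiffOn_finsetSum fun s _ => h2 s)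
  have hfix : ∀ u ∈ V, cproj κ (e (π u)) = e (π u) := fun u hu =>
    (cproj_eq_self_iff κ).2 fun s => by rw [he.coord _ hu.1.2, hX0 _ (hπ u hu.1.1)]
  have hYP : ∀ u ∈ V, cproj κ (Y u) = e (π u) := fun u hu => by
    simp only [hY]
    rw [map_add, hfix u hu, cproj_sum_single, add_zero]
  have hYf : ∀ u ∈ V, ∀ s, Y u (κ s) = f s u := fun u hu s => by
    simp only [hY, PiLp.add_apply]
    rw [sum_single_apply_range, ← hfix u hu, cproj_apply_range, zero_add]
  have hea : cproj κ (e a) = e a := by rw [← hπX a ha]; exact hfix a haV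
  have hinj : ∀ v, dmap Y a v = 0 → v = 0 := by
    intro v hv
    set F := Y ∘ e.symm
    set w := dmap e a v
    set O' := e.target ∩ e.symm ⁻¹' V
    have hO' : IsOpen O' := e.symm.continuousOn.isOpen_inter_preimage e.open_target hV
    have haO' : e a ∈ O' := ⟨e.map_source hae, by rwa [mem_preimage, e.left_inv hae]⟩
    have hFs : ContDiffOn ℝ ∞ F O' := contDiffOn_comp_symm he.mem_atlas hYs
    have hFd : HasFDerivAt F (fderiv ℝ F (e a)) (e a) :=
      ((hFs.contDiffAt (hO'.mem_nhds haO')).differentiableAt (by simp)).hasFDerivAt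
    have h0 : fderiv ℝ F (e a) w = 0 := by
      have h1 : mfderiv (𝓡 d) (𝓡 d) F (e a) = _ := mfderiv_comp (e a) (by
        rw [e.left_inv hae]
        exact (hYs.contMDiffAt (hV.mem_nhds haV)).mdifferentiableAt (by simp))
        (chart_symm_mdiff he.mem_atlas (e.map_source hae))
      have h2 : mfderiv (𝓡 d) (𝓡 d) F (e a) = fderiv ℝ F (e a) := mfderiv_eq_fderiv
      rw [h2, e.left_inv hae] at h1
      have h3 : fderiv ℝ F (e a) w = dmap Y a (dpar e.symm (e a) w) :=
        congrArg (fun l : Model d →L[ℝ] Model d => l w) h1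
      rw [h3, dpar_dmap he.mem_atlas hae, hv]
    have hw : cproj κ w = w := (cproj_eq_self_iff κ).2 fun s => by
      have h1 : HasFDerivAt (fun x => F x (κ s)) _ (e a) :=
        (EuclideanSpace.proj (κ s) : Model d →L[ℝ] ℝ).hasFDerivAt.comp (e a) hFd
      have h2 : HasFDerivAt (fun x : Model d => x (κ s))
          (EuclideanSpace.proj (κ s) : Model d →L[ℝ] ℝ) (e a) :=
        (EuclideanSpace.proj (κ s) : Model d →L[ℝ] ℝ).hasFDerivAt
      have h3 : (fun x => F x (κ s)) =ᶠ[𝓝 (e a)] fun x : Model d => x (κ s) := by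
        filter_upwards [hO'.mem_nhds haO'] with x hx
        change Y (e.symm x) (κ s) = _
        rw [hYf _ hx.2, ← he.coord _ hx.2.2.1, e.right_inv hx.1]
      have h4 := congrArg (fun l : Model d →L[ℝ] ℝ => l w) (h1.unique (h2.congr_of_eventuallyEq h3))
      change (fderiv ℝ F (e a) w) (κ s) = w (κ s) at h4
      rw [← h4, h0]
      simp
    have hPw : cproj κ (fderiv ℝ F (e a) (cproj κ w)) = cproj κ w := by
      have h1 : HasFDerivAt (fun x => F (cproj κ x)) (fderiv ℝ F (e a) ∘L cproj κ) (e a) :=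
        HasFDerivAt.comp (e a) (by rwa [hea]) (cproj κ).hasFDerivAt
      have h2 : HasFDerivAt (fun x => cproj κ (F (cproj κ x))) _ (e a) :=
        (cproj κ).hasFDerivAt.comp (e a) h1
      have h3 : (fun x => cproj κ (F (cproj κ x))) =ᶠ[𝓝 (e a)] cproj κ := by
        have h4 : cproj κ ⁻¹' O' ∈ 𝓝 (e a) :=
          (hO'.preimage (cproj κ).continuous).mem_nhds (by rwa [mem_preimage, hea])
        filter_upwards [h4] with x hx
        have h5 : e.symm (cproj κ x) ∈ X := h0X _ hx.2.1.1 fun s => by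
          rw [← he.coord _ hx.2.2.1, e.right_inv hx.1, cproj_apply_range]
        change cproj κ (Y (e.symm (cproj κ x))) = _
        rw [hYP _ hx.2, hπX _ h5, e.right_inv hx.1]
      exact congrArg (fun l : Model d →L[ℝ] Model d => l w)
        (h2.unique ((cproj κ).hasFDerivAt.congr_of_eventuallyEq h3))
    rw [hw, h0, map_zero] at hPw
    rw [← dpar_dmap he.mem_atlas hae v]
    change dpar e.symm (e a) w = 0
    rw [← hPw, map_zero]
  obtain ⟨e₀, he₀, hae₀, hsV, heY⟩ := exists_chart hV haV hYs hinj
  obtain ⟨ρ, hρ, hball⟩ := Metric.isOpen_iff.1 e₀.open_target (e₀ a) (e₀.map_source hae₀)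
  have hSo : IsOpen (e₀.source ∩ e₀ ⁻¹' Metric.ball (e₀ a) ρ) :=
    e₀.continuousOn.isOpen_inter_preimage e₀.open_source Metric.isOpen_ball
  have hcen : cproj κ (e₀ a) = e₀ a := by
    rw [heY a hae₀]
    refine (cproj_eq_self_iff κ).2 fun s => ?_
    rw [hYf a haV, hX0 a ha]
  have hsrc : ∀ u, u ∈ (e₀.restrOpen _ hSo).source ↔ u ∈ e₀.source ∧ e₀ u ∈ Metric.ball (e₀ a) ρ := by
    intro u
    rw [OpenPartialHomeomorph.restrOpen_source]
    exact ⟨fun h => h.2, fun h => ⟨h.1, h⟩⟩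
  refine ⟨e₀.restrOpen _ hSo, ρ, ⟨⟨restr_mem_maximalAtlas he₀ hSo, fun u hu s => ?_⟩, hρ, hcen, ?_,
    fun u hu => ?_⟩, fun u hu => ?_, (hsrc a).2 ⟨hae₀, Metric.mem_ball_self hρ⟩⟩
  · have hu' := ((hsrc u).1 hu).1
    change e₀ u (κ s) = _
    rw [heY u hu', hYf u (hsV hu')]
  · ext y
    constructor
    · intro hy
      have h1 := (e₀.restrOpen _ hSo).map_target hy
      have h2 := ((hsrc _).1 h1).2
      have h3 : e₀ ((e₀.restrOpen _ hSo).symm y) = y := (e₀.restrOpen _ hSo).right_inv hy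
      rwa [h3] at h2
    · intro hy
      have h1 : e₀.symm y ∈ (e₀.restrOpen _ hSo).source :=
        (hsrc _).2 ⟨e₀.map_target (hball hy), by rwa [e₀.right_inv (hball hy)]⟩
      have h2 := (e₀.restrOpen _ hSo).map_source h1
      change e₀ (e₀.symm y) ∈ _ at h2
      rwa [e₀.right_inv (hball hy)] at h2
  · obtain ⟨hu1, hu2⟩ := (hsrc u).1 hu
    have hPy : cproj κ (e₀ u) ∈ Metric.ball (e₀ a) ρ := cproj_mem_ball κ hcen hu2
    -- The point with the base coordinates of `u` and fibre coordinates zero lies on `X`; comparing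
    -- it with `π u` in the chart `e` shows that they coincide.
    set u' := e₀.symm (cproj κ (e₀ u)) with hu'
    have h1 : u' ∈ e₀.source := e₀.map_target (hball hPy)
    have h2 : Y u' = cproj κ (e₀ u) := by rw [← heY u' h1]; exact e₀.right_inv (hball hPy)
    have h3 : u' ∈ X := h0X u' (hsV h1).1.1 fun s => by
      rw [← hYf u' (hsV h1), h2, cproj_apply_range]
    have h4 : u' = π u := by
      refine e.injOn (hsV h1).2.1 (hsV hu1).1.2 ?_
      rw [← hYP u (hsV hu1), ← heY u hu1, ← h2, ← hπX u' h3, ← hYP u' (hsV h1), hπX u' h3, h2,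
        cproj_cproj]
    rw [← h4]
    refine ⟨(hsrc _).2 ⟨h1, ?_⟩, ?_⟩
    · rw [heY u' h1, h2]; exact hPy
    · change e₀ u' = cproj κ (e₀ u)
      rw [heY u' h1, h2]
  · have := hsV ((hsrc u).1 hu).1
    exact ⟨this.1.1, this.2.2⟩

/-- Let `π u` be the end of the flow from `u` with constant coefficients `- f s u`. The reversed
flow, with the same coefficients, recovers `u` from `π u` and the numbers `f s u`, so `(π, f)` is
injective on the whole neighbourhood. -/
theorem exists_tube [T2Space M] [SecondCountableTopology M] {X N₀ : Set M} (hX : IsClosed X)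
    (hN₀ : IsOpen N₀) (hXN₀ : X ⊆ N₀) (hX0 : ∀ u ∈ X, ∀ s, f s u = 0)
    (h0X : ∀ u ∈ N₀, (∀ s, f s u = 0) → u ∈ X)
    (hfs : ∀ s, ContMDiffOn (𝓡 d) 𝓘(ℝ, ℝ) ∞ (f s) N₀)
    (hf : ∀ a ∈ X, ∃ (e : OpenPartialHomeomorph M (Model d)) (κ : σ ↪ Fin d), IsFunChart f e κ ∧
      a ∈ e.source) :
    ∃ (N : Set M) (π : M → M), N ⊆ N₀ ∧ IsTube (d := d) f X N π := by
  classical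
  obtain ⟨N₁', V, hN₁', hXN₁', hVs, hdual'⟩ := exists_dual_fields hX hf
  set N₁ := N₁' ∩ N₀
  have hN₁ : IsOpen N₁ := hN₁'.inter hN₀
  have hXN₁ : X ⊆ N₁ := subset_inter hXN₁' hXN₀
  have hdual : ∀ u ∈ N₁, ∀ s t, dfun (f t) u (V s u) = if t = s then 1 else 0 :=
    fun u hu => hdual' u hu.1
  have hfd : ∀ u ∈ N₁, ∀ t, MDifferentiableAt (𝓡 d) 𝓘(ℝ, ℝ) (f t) u := fun u hu t =>
    ((hfs t).contMDiffAt (hN₀.mem_nhds hu.2)).mdifferentiableAt (by simp)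
  have hch : ∀ q ∈ N₁, ∃ e ∈ IsManifold.maximalAtlas (𝓡 d) ∞ M, e.source ⊆ N₁ ∧ q ∈ e.source := by
    intro q hq
    refine ⟨_, restr_mem_maximalAtlas (IsManifold.chart_mem_maximalAtlas q) hN₁, ?_, ?_⟩
    · rw [OpenPartialHomeomorph.restrOpen_source]; exact inter_subset_right
    · rw [OpenPartialHomeomorph.restrOpen_source]; exact ⟨mem_chart_source (Model d) q, hq⟩
  have hflow : ∀ p, IsFlowField N₁ (combField V p) := fun p q hq => by
    obtain ⟨e, he, hs, hqe⟩ := hch q hq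
    exact ⟨e, isFlowChart_combField he hs (fun s => hVs e he s) p, hqe⟩
  set π : M → M := fun u => flowEnd N₁ (combField V fun s => - f s u) u with hπ
  have hloc : ∀ q ∈ X, ∃ B, IsOpen B ∧ q ∈ B ∧ B ⊆ N₁ ∧ ContMDiffOn (𝓡 d) (𝓡 d) ∞ π B ∧
      ∀ u ∈ B, π u ∈ X ∧ flowEnd N₁ (revField (combField V fun s => - f s u)) (π u) = u := by
    intro q hq
    obtain ⟨e, he, hs, hqe⟩ := hch q (hXN₁ hq)
    obtain ⟨O, Φ, hO, hqO, hΦ, h⟩ := exists_param_flow he hs (fun s => hVs e he s) hqe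
    set P : M → (σ → ℝ) × Model d := fun u => (fun s => - f s u, e u) with hP
    have hPs : ContMDiffOn (𝓡 d) 𝓘(ℝ, (σ → ℝ) × Model d) ∞ P e.source := by
      refine ContMDiffOn.prodMk_space (contMDiffOn_pi_space.2 fun s => ?_)
        (contMDiffOn_of_mem_maximalAtlas he)
      exact ((hfs s).mono (hs.trans inter_subset_right)).neg
    have hBo : IsOpen (e.source ∩ P ⁻¹' O) :=
      hPs.continuousOn.isOpen_inter_preimage e.open_source hO
    have hsol : ∀ u ∈ e.source ∩ P ⁻¹' O, π u = e.symm (Φ (P u)) ∧ π u ∈ N₁ ∧ (∀ s, f s (π u) = 0) ∧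
        flowEnd N₁ (revField (combField V fun s => - f s u)) (π u) = u := by
      rintro u ⟨hu, huO⟩
      obtain ⟨-, h2, γ, hγ, hγ0, hγ1⟩ := h _ huO
      have hγ0' : γ 0 = u := by rw [hγ0]; exact e.left_inv hu
      have hπu : π u = γ 1 := by
        have := flowEnd_eq (hflow _) hγ
        rw [hγ0'] at this
        exact this
      refine ⟨hπu.trans hγ1, ?_, fun s => ?_, ?_⟩
      · rw [hπu]; exact (hγ 1 (right_mem_Icc.2 zero_le_one)).1
      · rw [hπu, hγ.dual_apply hfd hdual s, hγ0']; simp [hP]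
      · rw [hπu]
        exact (flowEnd_rev (hflow _) hγ).trans hγ0'
    refine ⟨e.source ∩ P ⁻¹' O, hBo, ⟨hqe, ?_⟩, fun u hu => hs hu.1, ?_, fun u hu => ?_⟩
    · have : P q = (0, e q) := by
        simp only [hP, Prod.mk.injEq, and_true]
        funext s
        simp [hX0 q hq s]
      rw [mem_preimage, this]; exact hqO
    · have h3 : ContMDiffOn (𝓡 d) (𝓡 d) ∞ (e.symm ∘ (Φ ∘ P)) (e.source ∩ P ⁻¹' O) :=
        (contMDiffOn_symm_of_mem_maximalAtlas he).comp
          (hΦ.contMDiffOn.comp (hPs.mono inter_subset_left) fun u hu => hu.2)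
          fun u hu => (h _ hu.2).2.1
      exact h3.congr fun u hu => (hsol u hu).1
    · obtain ⟨-, h1, h2, h3⟩ := hsol u hu
      exact ⟨h0X _ h1.2 h2, h3⟩
  choose B hB hqB hBN hπs hBπ using fun q : X => hloc q q.2
  set N' := ⋃ q, B q
  have hN' : IsOpen N' := isOpen_iUnion hB
  have hXN' : X ⊆ N' := fun q hq => mem_iUnion.2 ⟨⟨q, hq⟩, hqB _⟩
  have hN'N : N' ⊆ N₁ := iUnion_subset hBN
  have hπ' : ∀ u ∈ N', π u ∈ X ∧
      flowEnd N₁ (revField (combField V fun s => - f s u)) (π u) = u := fun u hu => by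
    obtain ⟨q, hq⟩ := mem_iUnion.1 hu
    exact hBπ q u hq
  have hπs' : ContMDiffOn (𝓡 d) (𝓡 d) ∞ π N' := fun u hu => by
    obtain ⟨q, hq⟩ := mem_iUnion.1 hu
    exact ((hπs q).contMDiffAt ((hB q).mem_nhds hq)).contMDiffWithinAt
  have hinj : ∀ u ∈ N', ∀ u' ∈ N', π u = π u' → (∀ s, f s u = f s u') → u = u' := by
    intro u hu u' hu' h1 h2
    rw [← (hπ' u hu).2, ← (hπ' u' hu').2, h1]
    simp only [h2]
  have hπX : ∀ u ∈ X, π u = u := fun u hu => by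
    obtain ⟨q, hq⟩ := mem_iUnion.1 (hXN' hu)
    have h1 := hπ' u (hXN' hu)
    have h2 := hπ' (π u) (hXN' h1.1)
    have hconst : IsSol N₁ (combField V 0) fun _ => u := fun t ht => ⟨hXN₁ hu, by
      have h3 : combField V 0 t u = 0 := by simp [combField]
      rw [h3]
      refine (hasMFDerivWithinAt_const (c := u) (x := t) (s := Icc (0 : ℝ) 1)).congr_mfderiv ?_
      exact (ContinuousLinearMap.smulRight_zero _).symm⟩
    have h4 := flowEnd_eq (hflow 0) hconst
    have h5 : (fun s => - f s u) = 0 := by funext s; simp [hX0 u hu s]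
    simp only [hπ, h5]
    exact h4
  have hchart : ∀ a ∈ X, ∀ O, IsOpen O → a ∈ O → ∃ (e : OpenPartialHomeomorph M (Model d))
      (κ : σ ↪ Fin d) (ρ : ℝ), IsTubChart f π e κ (e a) ρ ∧ e.source ⊆ N' ∩ O ∧ a ∈ e.source := by
    intro a ha O hO haO
    obtain ⟨e, κ, he, hae⟩ := hf a ha
    obtain ⟨e₁, ρ, h1, h2, h3⟩ := exists_tubChart hN' (fun u hu => (hπ' u hu).1) hπs' hπX hXN' hX0
      (fun u hu => h0X u (hN'N hu).2) he ha hae hO haO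
    exact ⟨e₁, κ, ρ, h1, h2, h3⟩
  -- The tube is cut down to a union of tubular charts, so that each of its points, not only those
  -- of `X`, lies in one.
  choose E K R hE1 hE2 hE3 using fun a : X => hchart a a.2 univ isOpen_univ (mem_univ _)
  have hEN : ∀ a, (E a).source ⊆ ⋃ a, (E a).source := fun a => subset_iUnion (fun a => (E a).source) a
  have hNN' : (⋃ a, (E a).source) ⊆ N' := iUnion_subset fun a => (hE2 a).trans inter_subset_left
  have hXE : X ⊆ ⋃ a, (E a).source := fun a ha => mem_iUnion.2 ⟨⟨a, ha⟩, hE3 _⟩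
  have hNo : IsOpen (⋃ a, (E a).source) := isOpen_iUnion fun a => (E a).open_source
  refine ⟨⋃ a, (E a).source, π, hNN'.trans (hN'N.trans inter_subset_right), hNo, hXE,
    fun u hu => (hπ' u (hNN' hu)).1, hπX, hX0, fun u hu => h0X u (hN'N (hNN' hu)).2,
    fun u hu u' hu' => hinj u (hNN' hu) u' (hNN' hu'), fun u hu => ?_, fun a ha O hO haO => ?_⟩
  · obtain ⟨a, ha⟩ := mem_iUnion.1 hu
    exact ⟨E a, K a, _, R a, hE1 a, hEN a, ha⟩
  · obtain ⟨e, κ, ρ, h1, h2, h3⟩ := hchart a ha _ (hO.inter hNo) ⟨haO, hXE ha⟩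
    exact ⟨e, κ, ρ, h1, fun u hu => ⟨(h2 hu).2.2, (h2 hu).2.1⟩, h3⟩

end Tubular

end
end LogSymp

namespace LogSymp

noncomputable section

set_option linter.unusedSectionVars false
set_option maxSynthPendingDepth 3

/-! ### The Moser flow on a tubular neighbourhood -/

section MoserTube

variable {d : ℕ} {M : Type*} [TopologicalSpace M] [ChartedSpace (Model d) M]
  [IsManifold (𝓡 d) ∞ M] {σ : Type} [Fintype σ] {f : σ → M → ℝ} {X N : Set M} {π : M → M}
  {e e' : OpenPartialHomeomorph M (Model d)} {κ κ' : σ ↪ Fin d} {x₀ x₀' : Model d} {ρ ρ' : ℝ}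
  {Ω : DForm d M 2} {g g' : Model d → Bil d}

lemma IsTubChart.cproj_mem (h : IsTubChart f π e κ x₀ ρ) {x : Model d} (hx : x ∈ e.target) {r : ℝ}
    (hr : r ∈ Icc (0 : ℝ) 1) : dil κ r x ∈ e.target := by
  rw [h.target_eq] at hx ⊢
  exact dil_mem_ball κ h.center hr hx

lemma IsTubChart.proj_symm (h : IsTubChart f π e κ x₀ ρ) {x : Model d} (hx : x ∈ e.target) :
    π (e.symm x) = e.symm (cproj κ x) := by
  obtain ⟨h1, h2⟩ := h.proj _ (e.map_target hx)
  rw [e.right_inv hx] at h2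
  rw [← h2, e.left_inv h1]

lemma IsTubChart.transition_apply_range (h : IsTubChart f π e κ x₀ ρ)
    (h' : IsTubChart f π e' κ' x₀' ρ') {x : Model d} (hx : x ∈ overlap e e') (s : σ) :
    (e' ∘ e.symm) x (κ' s) = x (κ s) := by
  rw [Function.comp_apply, h'.funChart.coord _ hx.2, ← h.funChart.coord _ (e.map_target hx.1),
    e.right_inv hx.1]

/-- The two dilated points have the same projection and the same values of `f`, so injectivity of
the tube identifies them: fibrewise dilation does not depend on the tubular chart. -/
lemma IsTubChart.transition_dil (hN : IsTube (d := d) f X N π) (h : IsTubChart f π e κ x₀ ρ)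
    (h' : IsTubChart f π e' κ' x₀' ρ') (hs : e.source ⊆ N) (hs' : e'.source ⊆ N) {x : Model d}
    (hx : x ∈ overlap e e') {r : ℝ} (hr : r ∈ Icc (0 : ℝ) 1) :
    dil κ r x ∈ overlap e e' ∧
      (e' ∘ e.symm) (dil κ r x) = dil κ' r ((e' ∘ e.symm) x) := by
  have hy : (e' ∘ e.symm) x ∈ e'.target := e'.map_source hx.2
  have hx1 := h.cproj_mem hx.1 hr
  have hy1 := h'.cproj_mem hy hr
  have key : e.symm (dil κ r x) = e'.symm (dil κ' r ((e' ∘ e.symm) x)) := by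
    refine hN.injective _ (hs (e.map_target hx1)) _ (hs' (e'.map_target hy1)) ?_ fun s => ?_
    · rw [h.proj_symm hx1, h'.proj_symm hy1, cproj_dil, cproj_dil, ← h.proj_symm hx.1,
        ← h'.proj_symm hy, Function.comp_apply, e'.left_inv hx.2]
    · rw [← h.funChart.coord _ (e.map_target hx1), ← h'.funChart.coord _ (e'.map_target hy1),
        e.right_inv hx1, e'.right_inv hy1, dil_apply_range, dil_apply_range,
        h.transition_apply_range h' hx]
  refine ⟨⟨hx1, ?_⟩, ?_⟩
  · rw [mem_preimage, key]; exact e'.map_target hy1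
  · rw [Function.comp_apply, key, e'.right_inv hy1]

lemma hasFDerivAt_transition (he : e ∈ IsManifold.maximalAtlas (𝓡 d) ∞ M)
    (he' : e' ∈ IsManifold.maximalAtlas (𝓡 d) ∞ M) {x : Model d} (hx : x ∈ overlap e e') :
    HasFDerivAt (e' ∘ e.symm) (fderiv ℝ (e' ∘ e.symm) x) x :=
  (((contDiffOn_transition he he').contDiffAt (isOpen_overlap.mem_nhds hx)).differentiableAt
    (by simp)).hasFDerivAt

lemma IsTubChart.fderiv_transition_range (h : IsTubChart f π e κ x₀ ρ)
    (h' : IsTubChart f π e' κ' x₀' ρ') {x : Model d} (hx : x ∈ overlap e e') (v : Model d) (s : σ) :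
    fderiv ℝ (e' ∘ e.symm) x v (κ' s) = v (κ s) := by
  have h1 : HasFDerivAt (fun x => (e' ∘ e.symm) x (κ' s)) _ x :=
    (EuclideanSpace.proj (κ' s) : Model d →L[ℝ] ℝ).hasFDerivAt.comp x
      (hasFDerivAt_transition h.funChart.mem_atlas h'.funChart.mem_atlas hx)
  have h2 : HasFDerivAt (fun x : Model d => x (κ s)) (EuclideanSpace.proj (κ s) : Model d →L[ℝ] ℝ)
      x := (EuclideanSpace.proj (κ s) : Model d →L[ℝ] ℝ).hasFDerivAt
  have h3 : (fun x => (e' ∘ e.symm) x (κ' s)) =ᶠ[𝓝 x] fun x : Model d => x (κ s) := by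
    filter_upwards [isOpen_overlap.mem_nhds hx] with y hy
    exact h.transition_apply_range h' hy s
  exact congrArg (fun l : Model d →L[ℝ] ℝ => l v) (h1.unique (h2.congr_of_eventuallyEq h3))

lemma IsTubChart.cproj_fderiv_transition (hN : IsTube (d := d) f X N π)
    (h : IsTubChart f π e κ x₀ ρ) (h' : IsTubChart f π e' κ' x₀' ρ') (hs : e.source ⊆ N)
    (hs' : e'.source ⊆ N) {x : Model d} (hx : x ∈ overlap e e') (v : Model d) :
    cproj κ' (fderiv ℝ (e' ∘ e.symm) x v) = fderiv ℝ (e' ∘ e.symm) (cproj κ x) (cproj κ v) := by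
  have hdil : ∀ y ∈ overlap e e', cproj κ y ∈ overlap e e' ∧
      (e' ∘ e.symm) (cproj κ y) = cproj κ' ((e' ∘ e.symm) y) := fun y hy => by
    simpa using h.transition_dil hN h' hs hs' hy (left_mem_Icc.2 zero_le_one)
  have h1 := (cproj κ').hasFDerivAt.comp x
    (hasFDerivAt_transition h.funChart.mem_atlas h'.funChart.mem_atlas hx)
  have h2 := (hasFDerivAt_transition h.funChart.mem_atlas h'.funChart.mem_atlas
    (hdil x hx).1).comp x (cproj κ).hasFDerivAt
  have h3 : (cproj κ' ∘ (e' ∘ e.symm)) =ᶠ[𝓝 x] (e' ∘ e.symm) ∘ cproj κ := by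
    filter_upwards [isOpen_overlap.mem_nhds hx] with y hy
    exact (hdil y hy).2.symm
  exact congrArg (fun l : Model d →L[ℝ] Model d => l v) (h1.unique (h2.congr_of_eventuallyEq h3))

/-- In base and fibre coordinates a transition has the form `(y, t) ↦ (ψ y, t)`, so its derivative
is constant along the fibres. -/
lemma IsTubChart.fderiv_transition_dil (hN : IsTube (d := d) f X N π)
    (h : IsTubChart f π e κ x₀ ρ) (h' : IsTubChart f π e' κ' x₀' ρ') (hs : e.source ⊆ N)
    (hs' : e'.source ⊆ N) {x : Model d} (hx : x ∈ overlap e e') {r : ℝ} (hr : r ∈ Icc (0 : ℝ) 1)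
    (v : Model d) : fderiv ℝ (e' ∘ e.symm) (dil κ r x) v = fderiv ℝ (e' ∘ e.symm) x v := by
  have hx' := (h.transition_dil hN h' hs hs' hx hr).1
  refine ext_range κ' (fun s => ?_) fun j hj => ?_
  · rw [h.fderiv_transition_range h' hx', h.fderiv_transition_range h' hx]
  · rw [← cproj_apply_of_notMem κ' _ hj, ← cproj_apply_of_notMem κ' (fderiv ℝ (e' ∘ e.symm) x v) hj,
      h.cproj_fderiv_transition hN h' hs hs' hx', h.cproj_fderiv_transition hN h' hs hs' hx,
      cproj_dil]

lemma cproj_logFrame_self (κ : σ ↪ Fin d) (x v : Model d) :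
    cproj κ (logFrame κ x v) = cproj κ v := by
  rw [cproj_logFrame, logFrame_eq_cproj κ (cproj_cproj κ x)]

/-- For a transition `(y, t) ↦ (ψ y, t)` the matrix in the log frames equals the ordinary
derivative. -/
lemma IsTubChart.fderiv_transition_logFrame (hN : IsTube (d := d) f X N π)
    (h : IsTubChart f π e κ x₀ ρ) (h' : IsTubChart f π e' κ' x₀' ρ') (hs : e.source ⊆ N)
    (hs' : e'.source ⊆ N) {x : Model d} (hx : x ∈ overlap e e') (v : Model d) :
    fderiv ℝ (e' ∘ e.symm) x (logFrame κ x v) =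
      logFrame κ' ((e' ∘ e.symm) x) (fderiv ℝ (e' ∘ e.symm) x v) := by
  refine ext_range κ' (fun s => ?_) fun j hj => ?_
  · rw [h.fderiv_transition_range h' hx, logFrame_apply_range, logFrame_apply_range,
      h.fderiv_transition_range h' hx, h.transition_apply_range h' hx]
  · rw [logFrame_apply_of_notMem _ _ _ hj, ← cproj_apply_of_notMem κ' _ hj,
      ← cproj_apply_of_notMem κ' (fderiv ℝ (e' ∘ e.symm) x v) hj,
      h.cproj_fderiv_transition hN h' hs hs' hx, h.cproj_fderiv_transition hN h' hs hs' hx,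
      cproj_logFrame_self]

lemma IsTubChart.fderiv_transition_eulerVec (hN : IsTube (d := d) f X N π)
    (h : IsTubChart f π e κ x₀ ρ) (h' : IsTubChart f π e' κ' x₀' ρ') (hs : e.source ⊆ N)
    (hs' : e'.source ⊆ N) {x : Model d} (hx : x ∈ overlap e e') :
    fderiv ℝ (e' ∘ e.symm) x (eulerVec κ) = eulerVec κ' := by
  refine ext_range κ' (fun s => ?_) fun j hj => ?_
  · rw [h.fderiv_transition_range h' hx, eulerVec_apply_range, eulerVec_apply_range]
  · have h0 : cproj κ (eulerVec κ) = 0 := ext_range κ (fun s => by simp [cproj_apply_range])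
      fun j hj => by simp [cproj_apply_of_notMem _ _ hj, eulerVec_apply_of_notMem _ hj]
    rw [← cproj_apply_of_notMem κ' _ hj, h.cproj_fderiv_transition hN h' hs hs' hx, h0, map_zero,
      eulerVec_apply_of_notMem _ hj]
    simp

/-- A tubular chart together with log components of `Ω` to which the Moser flow applies. -/
structure IsMoserChart (Ω : DForm d M 2) (f : σ → M → ℝ) (N : Set M) (π : M → M)
    (e : OpenPartialHomeomorph M (Model d)) (κ : σ ↪ Fin d) (x₀ : Model d) (ρ : ℝ)
    (g : Model d → Bil d) : Prop where
  tub : IsTubChart f π e κ x₀ ρ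
  subset : e.source ⊆ N
  model : IsMoserModel κ x₀ ρ g
  expr : ∀ x ∈ e.target, (∀ s, x (κ s) ≠ 0) → ∀ u v,
    g x u v = toBil (inChart e Ω x) (logFrame κ x u) (logFrame κ x v)

lemma IsMoserChart.transition (hN : IsTube (d := d) f X N π) (h : IsMoserChart Ω f N π e κ x₀ ρ g)
    (h' : IsMoserChart Ω f N π e' κ' x₀' ρ' g') {x : Model d} (hx : x ∈ overlap e e')
    (u v : Model d) : g x u v = g' ((e' ∘ e.symm) x) (fderiv ℝ (e' ∘ e.symm) x u)
      (fderiv ℝ (e' ∘ e.symm) x v) := by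
  have hψ := contDiffOn_transition h.tub.funChart.mem_atlas h'.tub.funChart.mem_atlas
  have hψ' : ContinuousOn (fderiv ℝ (e' ∘ e.symm)) (overlap e e') :=
    (hψ.fderiv_of_isOpen (m := 0) isOpen_overlap (by simp)).continuousOn
  have hg : ContinuousOn g (overlap e e') := h.model.logClosed.smooth.continuousOn.mono
    fun y hy => by rw [← h.tub.target_eq]; exact hy.1
  have hg' : ContinuousOn (fun y => g' ((e' ∘ e.symm) y)) (overlap e e') :=
    h'.model.logClosed.smooth.continuousOn.comp hψ.continuousOn fun y hy => by
      rw [← h'.tub.target_eq]; exact e'.map_source hy.2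
  refine eqOn_of_forall_ne_zero κ (f := fun x => g x u v) (g := fun x => g' ((e' ∘ e.symm) x)
    (fderiv ℝ (e' ∘ e.symm) x u) (fderiv ℝ (e' ∘ e.symm) x v)) isOpen_overlap
    ((hg.clm_apply continuousOn_const).clm_apply continuousOn_const)
    ((hg'.clm_apply (hψ'.clm_apply continuousOn_const)).clm_apply
      (hψ'.clm_apply continuousOn_const)) (fun y hy hy' => ?_) hx
  have hy2 : ∀ s, (e' ∘ e.symm) y (κ' s) ≠ 0 := fun s => by
    rw [h.tub.transition_apply_range h'.tub hy]; exact hy' s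
  rw [h.expr y hy.1 hy', h'.expr ((e' ∘ e.symm) y) (e'.map_source hy.2) hy2,
    inChart_transition h.tub.funChart.mem_atlas h'.tub.funChart.mem_atlas Ω hy,
    toBil_compContinuousLinearMap, h.tub.fderiv_transition_logFrame hN h'.tub h.subset h'.subset hy,
    h.tub.fderiv_transition_logFrame hN h'.tub h.subset h'.subset hy]

lemma IsMoserChart.moserField_transition (hN : IsTube (d := d) f X N π)
    (h : IsMoserChart Ω f N π e κ x₀ ρ g) (h' : IsMoserChart Ω f N π e' κ' x₀' ρ' g')
    {x : Model d} (hx : x ∈ overlap e e') {t : ℝ} (ht : t ∈ Ioo (-1 : ℝ) 2) :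
    fderiv ℝ (e' ∘ e.symm) x (moserField κ g (t, x)) = moserField κ' g' (t, (e' ∘ e.symm) x) := by
  refine moserField_natural h.model h'.model (by rw [← h.tub.target_eq]; exact hx.1)
    (by rw [← h'.tub.target_eq]; exact e'.map_source hx.2)
    (transitionEquiv h.tub.funChart.mem_atlas h'.tub.funChart.mem_atlas hx)
    (h.tub.fderiv_transition_eulerVec hN h'.tub h.subset h'.subset hx)
    (fun v => h.tub.fderiv_transition_logFrame hN h'.tub h.subset h'.subset hx v)
    (fun r hr u v => ?_) ht
  obtain ⟨h1, h2⟩ := h.tub.transition_dil hN h'.tub h.subset h'.subset hx hr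
  rw [h.transition hN h' h1, h2, h.tub.fderiv_transition_dil hN h'.tub h.subset h'.subset hx hr,
    h.tub.fderiv_transition_dil hN h'.tub h.subset h'.subset hx hr]
  rfl

/-- The points in the domain of some Moser chart. -/
def moserDomain (Ω : DForm d M 2) (f : σ → M → ℝ) (N : Set M) (π : M → M) : Set M :=
  {u | ∃ (e : OpenPartialHomeomorph M (Model d)) (κ : σ ↪ Fin d) (x₀ : Model d) (ρ : ℝ)
    (g : Model d → Bil d), IsMoserChart Ω f N π e κ x₀ ρ g ∧ u ∈ e.source}

open Classical in
/-- The Moser vector field on the tubular neighbourhood. -/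
def moserGlobal (Ω : DForm d M 2) (f : σ → M → ℝ) (N : Set M) (π : M → M) (t : ℝ) (u : M) :
    Model d :=
  if h : ∃ w : ((OpenPartialHomeomorph M (Model d) × (σ ↪ Fin d)) × Model d × ℝ) ×
      (Model d → Bil d),
      IsMoserChart Ω f N π w.1.1.1 w.1.1.2 w.1.2.1 w.1.2.2 w.2 ∧ u ∈ w.1.1.1.source then
    dpar h.choose.1.1.1.symm (h.choose.1.1.1 u)
      (moserField h.choose.1.1.2 h.choose.2 (t, h.choose.1.1.1 u)) else 0

/-- `moserGlobal` is defined by an arbitrary choice of chart at each point; naturality makes the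
choice immaterial, so in every Moser chart the field is the local one. -/
lemma IsMoserChart.fieldInChart_moserGlobal (hN : IsTube (d := d) f X N π)
    (h : IsMoserChart Ω f N π e κ x₀ ρ g) {t : ℝ} (ht : t ∈ Ioo (-1 : ℝ) 2) {x : Model d}
    (hx : x ∈ e.target) :
    fieldInChart e (moserGlobal Ω f N π) (t, x) = moserField κ g (t, x) := by
  have hex : ∃ w : ((OpenPartialHomeomorph M (Model d) × (σ ↪ Fin d)) × Model d × ℝ) ×
      (Model d → Bil d), IsMoserChart Ω f N π w.1.1.1 w.1.1.2 w.1.2.1 w.1.2.2 w.2 ∧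
        e.symm x ∈ w.1.1.1.source := ⟨(((e, κ), x₀, ρ), g), h, e.map_target hx⟩
  simp only [fieldInChart, moserGlobal, dif_pos hex]
  obtain ⟨h1, h2⟩ := hex.choose_spec
  generalize hex.choose = w at h1 h2
  have hov : x ∈ overlap e w.1.1.1 := ⟨hx, h2⟩
  have hov' := transition_mem_overlap hov
  have h3 := h1.moserField_transition hN h hov' ht
  rw [fderiv_transition h1.tub.funChart.mem_atlas h.tub.funChart.mem_atlas hov',
    w.1.1.1.left_inv h2] at h3
  rw [h3, Function.comp_apply, w.1.1.1.left_inv h2, e.right_inv hx]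

lemma IsMoserChart.isFlowChart (hN : IsTube (d := d) f X N π)
    (h : IsMoserChart Ω f N π e κ x₀ ρ g) :
    IsFlowChart (moserDomain Ω f N π) (moserGlobal Ω f N π) e where
  mem_atlas := h.tub.funChart.mem_atlas
  subset := fun _ hu => ⟨e, κ, x₀, ρ, g, h, hu⟩
  smooth := by
    have h1 := contDiffOn_moserField h.model
    rw [← h.tub.target_eq] at h1
    exact h1.congr fun z hz => h.fieldInChart_moserGlobal hN hz.1 hz.2

lemma isFlowField_moserGlobal (hN : IsTube (d := d) f X N π) :
    IsFlowField (moserDomain Ω f N π) (moserGlobal Ω f N π) := fun _ hu =>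
  let ⟨e, _, _, _, _, h, hue⟩ := hu
  ⟨e, h.isFlowChart hN, hue⟩

lemma moserGlobal_eq_zero (hN : IsTube (d := d) f X N π) (h : IsMoserChart Ω f N π e κ x₀ ρ g)
    {a : M} (ha : a ∈ X) (hae : a ∈ e.source) {t : ℝ} (ht : t ∈ Icc (0 : ℝ) 1) :
    moserGlobal Ω f N π t a = 0 := by
  have h1 := h.fieldInChart_moserGlobal hN (Icc_subset_Ioo (by norm_num) (by norm_num) ht)
    (e.map_source hae)
  rw [moserField_of_cproj_eq ((cproj_eq_self_iff κ).2 fun s => by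
    rw [h.tub.funChart.coord _ hae, hN.zero a ha]), fieldInChart, e.left_inv hae] at h1
  rw [← dpar_dmap h.tub.funChart.mem_atlas hae (moserGlobal Ω f N π t a)]
  simp only [h1, map_zero]

end MoserTube

end
end LogSymp

namespace LogSymp

noncomputable section

set_option linter.unusedSectionVars false
set_option maxSynthPendingDepth 3

/-! ### The Moser theorem on a tubular neighbourhood -/

section MoserTheorem

variable {d : ℕ} {M : Type*} [TopologicalSpace M] [ChartedSpace (Model d) M]
  [IsManifold (𝓡 d) ∞ M] {σ : Type} [Fintype σ] {f : σ → M → ℝ} {X N : Set M} {π : M → M}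
  {e : OpenPartialHomeomorph M (Model d)} {κ : σ ↪ Fin d} {x₀ : Model d} {ρ : ℝ}
  {Ω : DForm d M 2} {g : Model d → Bil d} {v : ℝ → M → Model d}

lemma revField_revField (v : ℝ → M → Model d) : revField (revField v) = v := by
  funext t u
  simp [revField]

lemma inChart_pullback (he : e ∈ IsManifold.maximalAtlas (𝓡 d) ∞ M) {k : ℕ} (Θ : DForm d M k)
    {φ : M → M} {Ψ : Model d → Model d} {x : Model d} (hx : x ∈ e.target)
    (hΨx : Ψ x ∈ e.target) (hΨ : DifferentiableAt ℝ Ψ x)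
    (hφ : MDifferentiableAt (𝓡 d) (𝓡 d) φ (e.symm x))
    (h : ∀ᶠ y in 𝓝 x, φ (e.symm y) = e.symm (Ψ y)) :
    inChart e (pullback φ Θ) x = (inChart e Θ (Ψ x)).compContinuousLinearMap (fderiv ℝ Ψ x) := by
  have h1 : mfderiv (𝓡 d) (𝓡 d) (φ ∘ e.symm) x =
      (mfderiv (𝓡 d) (𝓡 d) φ (e.symm x)).comp (mfderiv (𝓡 d) (𝓡 d) e.symm x) :=
    mfderiv_comp x hφ (chart_symm_mdiff he hx)
  have h2 : mfderiv (𝓡 d) (𝓡 d) (e.symm ∘ Ψ) x =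
      (mfderiv (𝓡 d) (𝓡 d) e.symm (Ψ x)).comp (mfderiv (𝓡 d) (𝓡 d) Ψ x) :=
    mfderiv_comp x (chart_symm_mdiff he hΨx) hΨ.mdifferentiableAt
  have h3 : mfderiv (𝓡 d) (𝓡 d) (φ ∘ e.symm) x = mfderiv (𝓡 d) (𝓡 d) (e.symm ∘ Ψ) x :=
    Filter.EventuallyEq.mfderiv_eq h
  rw [h1, h2, mfderiv_eq_fderiv] at h3
  have h4 : φ (e.symm x) = e.symm (Ψ x) := h.self_of_nhds
  ext w
  change Θ (φ (e.symm x)) (fun i => mfderiv (𝓡 d) (𝓡 d) φ (e.symm x)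
    (mfderiv (𝓡 d) (𝓡 d) e.symm x (w i))) = Θ (e.symm (Ψ x)) (fun i =>
      mfderiv (𝓡 d) (𝓡 d) e.symm (Ψ x) (fderiv ℝ Ψ x (w i)))
  have h5 : ∀ i, (mfderiv (𝓡 d) (𝓡 d) φ (e.symm x)
      (mfderiv (𝓡 d) (𝓡 d) e.symm x (w i)) : Model d) =
        mfderiv (𝓡 d) (𝓡 d) e.symm (Ψ x) (fderiv ℝ Ψ x (w i)) := fun i =>
    congrArg (fun l : Model d →L[ℝ] Model d => l (w i)) h3
  have h6 : (fun i => (mfderiv (𝓡 d) (𝓡 d) φ (e.symm x)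
      (mfderiv (𝓡 d) (𝓡 d) e.symm x (w i)) : Model d)) = (fun i =>
        (mfderiv (𝓡 d) (𝓡 d) e.symm (Ψ x) (fderiv ℝ Ψ x (w i)) : Model d)) := funext h5
  have h7 : Θ (φ (e.symm x)) = Θ (e.symm (Ψ x)) := by rw [h4]
  exact (congrArg (Θ (φ (e.symm x))) h6).trans (by rw [h7])

/-- Uniqueness of integral curves identifies the globally chosen time-one map and its reversal with
the smooth local flow in a chart around a zero of the field. The linearized solutions are recorded
because they compute the derivative of this map. -/
theorem IsFlowChart.exists_flowEnd [T2Space M] (hv : IsFlowField N v) (he : IsFlowChart N v e)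
    {q : M} (hq : q ∈ e.source) (h0 : ∀ t ∈ Icc (0 : ℝ) 1, v t q = 0) :
    ∃ (O : Set (Model d)) (Ψ : Model d → Model d), IsOpen O ∧ e q ∈ O ∧ O ⊆ e.target ∧
      ContDiffOn ℝ ∞ Ψ O ∧ ∀ x ∈ O, ∃ γ : ℝ → Model d, γ 0 = x ∧ γ 1 = Ψ x ∧
        flowEnd N v (e.symm x) = e.symm (Ψ x) ∧ flowEnd N (revField v) (e.symm (Ψ x)) = e.symm x ∧
        (∀ t ∈ Icc (0 : ℝ) 1, γ t ∈ e.target ∧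
          HasDerivWithinAt γ (fieldInChart e v (t, γ t)) (Icc 0 1) t) ∧
        ∀ w, ∃ A : ℝ → Model d, A 0 = w ∧ A 1 = fderiv ℝ Ψ x w ∧ ∀ t ∈ Icc (0 : ℝ) 1,
          HasDerivWithinAt A (spaceDeriv (fieldInChart e v) (t, γ t) (A t)) (Icc 0 1) t := by
  obtain ⟨O, Γ, hO, hqO, hΓ, h⟩ := he.exists_local_flow hq h0
  have h1 : (1 : ℝ) ∈ Icc (0 : ℝ) 1 := right_mem_Icc.2 zero_le_one
  refine ⟨O ∩ e.target, fun x => Curve.eval ⟨1, h1⟩ (Γ x), hO.inter e.open_target,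
    ⟨hqO, e.map_source hq⟩, inter_subset_right, ?_, fun x hx => ?_⟩
  · exact (Curve.eval (F := Model d) ⟨1, h1⟩).contDiff.comp_contDiffOn (hΓ.mono inter_subset_left)
  have hev : ∀ δ : Curve (Model d), extend δ 1 = Curve.eval ⟨1, h1⟩ δ := fun δ => by
    rw [Curve.eval_apply, extend_of_mem δ h1]
  obtain ⟨h2, h3, h4⟩ := h x hx.1
  have hsol : IsSol N v (fun t => e.symm (extend (Γ x) t)) := isSol_of_chart he.mem_atlas he.subset h3
  have e1 := flowEnd_eq hv hsol
  have e2 := flowEnd_rev hv hsol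
  simp only [h2, hev] at e1 e2
  refine ⟨extend (Γ x), h2, hev _, e1, e2, h3, fun w => ⟨extend (fderiv ℝ Γ x w), (h4 w).1, ?_,
    (h4 w).2⟩⟩
  have hd : HasFDerivAt (fun x => Curve.eval ⟨1, h1⟩ (Γ x)) _ x :=
    (Curve.eval (F := Model d) ⟨1, h1⟩).hasFDerivAt.comp x
      (((hΓ.contDiffAt (hO.mem_nhds hx.1)).differentiableAt (by simp)).hasFDerivAt)
  rw [hd.fderiv, hev]
  rfl

lemma contMDiffOn_of_chart (he : e ∈ IsManifold.maximalAtlas (𝓡 d) ∞ M) {φ : M → M}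
    {Ψ : Model d → Model d} {O : Set (Model d)} (hΨ : ContDiffOn ℝ ∞ Ψ O)
    (hΨO : ∀ x ∈ O, Ψ x ∈ e.target) (h : ∀ x ∈ O, φ (e.symm x) = e.symm (Ψ x)) :
    ContMDiffOn (𝓡 d) (𝓡 d) ∞ φ (e.source ∩ e ⁻¹' O) := by
  have h1 : ContMDiffOn (𝓡 d) (𝓡 d) ∞ (e.symm ∘ Ψ ∘ e) (e.source ∩ e ⁻¹' O) :=
    (contMDiffOn_symm_of_mem_maximalAtlas he).comp (hΨ.contMDiffOn.comp
      ((contMDiffOn_of_mem_maximalAtlas he).mono inter_subset_left) fun u hu => hu.2)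
      fun u hu => hΨO _ hu.2
  refine h1.congr fun u hu => ?_
  rw [← e.left_inv hu.1, h _ hu.2]
  simp [e.left_inv hu.1]

/-- By `moser_coord` the values `f s` at the end point are positive multiples of the initial ones,
so zeros correspond. The pullback is `moser_invariance` along the curve through `e u`, with the
linearized solutions that start at frame vectors. -/
lemma IsMoserChart.exists_flow [T2Space M] (hN : IsTube (d := d) f X N π)
    (h : IsMoserChart Ω f N π e κ x₀ ρ g) {a : M} (ha : a ∈ X) (hae : a ∈ e.source) :
    ∃ B : Set M, IsOpen B ∧ a ∈ B ∧ B ⊆ e.source ∧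
      ContMDiffOn (𝓡 d) (𝓡 d) ∞ (flowEnd (moserDomain Ω f N π) (moserGlobal Ω f N π)) B ∧
      ∀ u ∈ B, flowEnd (moserDomain Ω f N π) (moserGlobal Ω f N π) u ∈ e.source ∧
        flowEnd (moserDomain Ω f N π) (revField (moserGlobal Ω f N π))
          (flowEnd (moserDomain Ω f N π) (moserGlobal Ω f N π) u) = u ∧
        (∀ s, f s (flowEnd (moserDomain Ω f N π) (moserGlobal Ω f N π) u) = 0 ↔ f s u = 0) ∧
        ((∀ s, f s u ≠ 0) → ∀ w w', toBil (inChart e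
          (pullback (flowEnd (moserDomain Ω f N π) (moserGlobal Ω f N π)) Ω) (e u))
            (logFrame κ (e u) w) (logFrame κ (e u) w') = g (cproj κ (e u)) w w') := by
  have he := h.tub.funChart.mem_atlas
  obtain ⟨O, Ψ, hO, haO, hOe, hΨ, hf⟩ := (h.isFlowChart hN).exists_flowEnd
    (isFlowField_moserGlobal hN) hae fun t ht => moserGlobal_eq_zero hN h ha hae ht
  set φ := flowEnd (moserDomain Ω f N π) (moserGlobal Ω f N π)
  have hIoo : ∀ t ∈ Icc (0 : ℝ) 1, t ∈ Ioo (-1 : ℝ) 2 := fun t ht =>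
    ⟨by linarith [ht.1], by linarith [ht.2]⟩
  have h1 : (1 : ℝ) ∈ Icc (0 : ℝ) 1 := right_mem_Icc.2 zero_le_one
  have hΨO : ∀ x ∈ O, Ψ x ∈ e.target := fun x hx => by
    obtain ⟨γ, -, h2, -, -, h3, -⟩ := hf x hx
    rw [← h2]; exact (h3 1 h1).1
  have hφe : ∀ x ∈ O, φ (e.symm x) = e.symm (Ψ x) := fun x hx => by
    obtain ⟨γ, -, -, h2, -⟩ := hf x hx
    exact h2
  have hBo : IsOpen (e.source ∩ e ⁻¹' O) := e.isOpen_inter_preimage hO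
  have hsm := contMDiffOn_of_chart he hΨ hΨO hφe
  refine ⟨e.source ∩ e ⁻¹' O, hBo, ⟨hae, haO⟩, inter_subset_left, hsm, fun u hu => ?_⟩
  obtain ⟨γ, hγ0, hγ1, h2, h3, h4, h5⟩ := hf (e u) hu.2
  rw [e.left_inv hu.1] at h2 h3
  have hφu : φ u = e.symm (Ψ (e u)) := h2
  have hγ : ∀ t ∈ Icc (0 : ℝ) 1, γ t ∈ Metric.ball x₀ ρ ∧
      HasDerivWithinAt γ (moserField κ g (t, γ t)) (Icc 0 1) t := fun t ht => by
    obtain ⟨h6, h7⟩ := h4 t ht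
    rw [h.fieldInChart_moserGlobal hN (hIoo t ht) h6] at h7
    exact ⟨by rwa [← h.tub.target_eq], h7⟩
  have hφs : φ u ∈ e.source := by rw [hφu]; exact e.map_target (hΨO _ hu.2)
  have hlin : ∀ {A : ℝ → Model d}, (∀ t ∈ Icc (0 : ℝ) 1, HasDerivWithinAt A (spaceDeriv
      (fieldInChart e (moserGlobal Ω f N π)) (t, γ t) (A t)) (Icc 0 1) t) →
      ∀ t ∈ Icc (0 : ℝ) 1, HasDerivWithinAt A (spaceDeriv (moserField κ g) (t, γ t) (A t))
        (Icc 0 1) t := fun hA t ht => by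
    have h6 : fieldInChart e (moserGlobal Ω f N π) =ᶠ[𝓝 (t, γ t)] moserField κ g := by
      filter_upwards [(isOpen_Ioo.prod e.open_target).mem_nhds ⟨hIoo t ht, (h4 t ht).1⟩] with z hz
      exact h.fieldInChart_moserGlobal hN hz.1 hz.2
    have h7 := hA t ht
    rwa [spaceDeriv, h6.fderiv_eq] at h7
  refine ⟨hφs, by rw [hφu]; exact h3, fun s => ?_, fun hnz w w' => ?_⟩
  · obtain ⟨c, hc, h6⟩ := moser_coord h.model hγ s 1 h1
    rw [← h.tub.funChart.coord _ hφs, ← h.tub.funChart.coord _ hu.1, hφu,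
      e.right_inv (hΨO _ hu.2), ← hγ1, h6, hγ0, mul_eq_zero]
    exact or_iff_right hc.ne'
  · have hnz0 : ∀ s, e u (κ s) ≠ 0 := fun s => by rw [h.tub.funChart.coord _ hu.1]; exact hnz s
    have hnz1 : ∀ s, Ψ (e u) (κ s) ≠ 0 := fun s => by
      obtain ⟨c, hc, h6⟩ := moser_coord h.model hγ s 1 h1
      rw [← hγ1, h6, hγ0]
      exact mul_ne_zero hc.ne' (hnz0 s)
    have hΨd : DifferentiableAt ℝ Ψ (e u) :=
      (hΨ.contDiffAt (hO.mem_nhds hu.2)).differentiableAt (by simp)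
    have hφd : MDifferentiableAt (𝓡 d) (𝓡 d) φ (e.symm (e u)) := by
      rw [e.left_inv hu.1]
      exact (hsm.contMDiffAt (hBo.mem_nhds hu)).mdifferentiableAt (by simp)
    have hev : ∀ᶠ y in 𝓝 (e u), φ (e.symm y) = e.symm (Ψ y) := by
      filter_upwards [hO.mem_nhds hu.2] with y hy using hφe y hy
    rw [inChart_pullback he Ω (hOe hu.2) (hΨO _ hu.2) hΨd hφd hev, toBil_compContinuousLinearMap]
    obtain ⟨A, hA0, hA1, hA⟩ := h5 (logFrame κ (e u) w)
    obtain ⟨A', hA'0, hA'1, hA'⟩ := h5 (logFrame κ (e u) w')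
    have key := moser_invariance h.model hγ (hlin hA) (hlin hA') (by rw [hγ0]; exact hnz0)
    rw [hγ0, hγ1, hA0, hA1, hA'0, hA'1, logInv_logFrame hnz0, logInv_logFrame hnz0,
      h.expr _ (hΨO _ hu.2) hnz1, logFrame_logInv hnz1, logFrame_logInv hnz1] at key
    exact key

/-- Time reversal is an involution on fields, so the local flow of the reversed field supplies a
smooth right inverse of the time-one map near `a`. -/
lemma IsMoserChart.exists_rev_flow [T2Space M] (hN : IsTube (d := d) f X N π)
    (h : IsMoserChart Ω f N π e κ x₀ ρ g) {a : M} (ha : a ∈ X) (hae : a ∈ e.source) :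
    ∃ B : Set M, IsOpen B ∧ a ∈ B ∧ ContMDiffOn (𝓡 d) (𝓡 d) ∞
        (flowEnd (moserDomain Ω f N π) (revField (moserGlobal Ω f N π))) B ∧
      ∀ u ∈ B, flowEnd (moserDomain Ω f N π) (moserGlobal Ω f N π)
          (flowEnd (moserDomain Ω f N π) (revField (moserGlobal Ω f N π)) u) = u := by
  have he := h.tub.funChart.mem_atlas
  obtain ⟨O, Ψ, hO, haO, hOe, hΨ, hf⟩ := (h.isFlowChart hN).rev.exists_flowEnd
    (isFlowField_moserGlobal hN).rev hae fun t ht => by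
      rw [revField, moserGlobal_eq_zero hN h ha hae ⟨by linarith [ht.2], by linarith [ht.1]⟩,
        neg_zero]
  have h1 : (1 : ℝ) ∈ Icc (0 : ℝ) 1 := right_mem_Icc.2 zero_le_one
  refine ⟨e.source ∩ e ⁻¹' O, e.isOpen_inter_preimage hO, ⟨hae, haO⟩,
    contMDiffOn_of_chart he hΨ (fun x hx => ?_) fun x hx => ?_, fun u hu => ?_⟩
  · obtain ⟨γ, -, h2, -, -, h3, -⟩ := hf x hx
    rw [← h2]; exact (h3 1 h1).1
  · obtain ⟨γ, -, -, h2, -⟩ := hf x hx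
    exact h2
  · obtain ⟨γ, -, -, h2, h3, -⟩ := hf (e u) hu.2
    rw [revField_revField, e.left_inv hu.1] at h3
    rw [e.left_inv hu.1] at h2
    rw [h2, h3]

/-- The Moser theorem: on a tubular neighbourhood, a closed log form that is non-degenerate along
`X` is equivalent to the form whose log components are constant along the fibres. -/
theorem exists_moser_equivalence [T2Space M] (hN : IsTube (d := d) f X N π)
    {Q : OpenPartialHomeomorph M (Model d) → (σ ↪ Fin d) → Prop}
    (hM : ∀ a ∈ X, ∃ (e : OpenPartialHomeomorph M (Model d)) (κ : σ ↪ Fin d) (x₀ : Model d) (ρ : ℝ)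
      (g : Model d → Bil d), IsMoserChart Ω f N π e κ x₀ ρ g ∧ Q e κ ∧ a ∈ e.source) :
    ∃ O : Set M, IsOpen O ∧ X ⊆ O ∧ O ⊆ N ∧ ∀ U : Set M, IsOpen U → U ⊆ O →
      ∃ φ : OpenPartialHomeomorph M M, φ.source = U ∧ ContMDiffOn (𝓡 d) (𝓡 d) ∞ φ U ∧
        ContMDiffOn (𝓡 d) (𝓡 d) ∞ φ.symm φ.target ∧ (∀ q ∈ X, φ q = q) ∧
        ∀ u ∈ U, φ u ∈ N ∧ (∀ s, f s (φ u) = 0 ↔ f s u = 0) ∧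
          ∃ (e : OpenPartialHomeomorph M (Model d)) (κ : σ ↪ Fin d) (x₀ : Model d) (ρ : ℝ)
            (g : Model d → Bil d), IsMoserChart Ω f N π e κ x₀ ρ g ∧ Q e κ ∧ u ∈ e.source ∧
            ((∀ s, f s u ≠ 0) → ∀ w w', toBil (inChart e (pullback φ Ω) (e u))
              (logFrame κ (e u) w) (logFrame κ (e u) w') = g (cproj κ (e u)) w w') := by
  choose e κ x₀ ρ g hMC hQ hae using fun a : X => hM a a.2
  choose B hB haB hBe hBs hBf using fun a : X => (hMC a).exists_flow hN a.2 (hae a)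
  choose B' hB' haB' hBs' hBf' using fun a : X => (hMC a).exists_rev_flow hN a.2 (hae a)
  set φ := flowEnd (moserDomain Ω f N π) (moserGlobal Ω f N π)
  set ψ := flowEnd (moserDomain Ω f N π) (revField (moserGlobal Ω f N π))
  have hφX : ∀ q ∈ X, φ q = q := fun q hq => by
    have hsol : IsSol (moserDomain Ω f N π) (moserGlobal Ω f N π) (fun _ => q) := fun t ht => by
      refine ⟨⟨_, _, _, _, _, hMC ⟨q, hq⟩, hae ⟨q, hq⟩⟩, ?_⟩
      rw [moserGlobal_eq_zero hN (hMC ⟨q, hq⟩) hq (hae ⟨q, hq⟩) ht]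
      refine (hasMFDerivWithinAt_const q _ _).congr_mfderiv ?_
      exact ContinuousLinearMap.ext fun (r : ℝ) => (smul_zero r).symm
    exact flowEnd_eq (isFlowField_moserGlobal hN) hsol
  have hsm : ContMDiffOn (𝓡 d) (𝓡 d) ∞ φ (⋃ a, B a) := fun u hu => by
    obtain ⟨a, ha⟩ := mem_iUnion.1 hu
    exact ((hBs a).contMDiffAt ((hB a).mem_nhds ha)).contMDiffWithinAt
  have hsm' : ContMDiffOn (𝓡 d) (𝓡 d) ∞ ψ (⋃ a, B' a) := fun u hu => by
    obtain ⟨a, ha⟩ := mem_iUnion.1 hu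
    exact ((hBs' a).contMDiffAt ((hB' a).mem_nhds ha)).contMDiffWithinAt
  have hBo : IsOpen (⋃ a, B a) := isOpen_iUnion hB
  have hBo' : IsOpen (⋃ a, B' a) := isOpen_iUnion hB'
  have hinv : ∀ u ∈ ⋃ a, B' a, φ (ψ u) = u := fun u hu => by
    obtain ⟨a, ha⟩ := mem_iUnion.1 hu
    exact hBf' a u ha
  -- On the sets `B a` the reversed flow is a left inverse, on the `B' a` a right inverse. Points of
  -- the first union that are mapped into the second have both, and this persists on every smaller
  -- open set.
  refine ⟨(⋃ a, B a) ∩ φ ⁻¹' (⋃ a, B' a), hsm.continuousOn.isOpen_inter_preimage hBo hBo',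
    fun a ha => ⟨mem_iUnion.2 ⟨⟨a, ha⟩, haB _⟩, ?_⟩, fun u hu => ?_, fun U hU hUO => ?_⟩
  · rw [mem_preimage, hφX a ha]
    exact mem_iUnion.2 ⟨⟨a, ha⟩, haB' _⟩
  · obtain ⟨a, ha⟩ := mem_iUnion.1 hu.1
    exact (hMC a).subset (hBe a ha)
  have hmem : ∀ u ∈ U, ∃ a : X, u ∈ B a := fun u hu => mem_iUnion.1 (hUO hu).1
  have hinv' : ∀ u ∈ U, ψ (φ u) = u := fun u hu => by
    obtain ⟨a, ha⟩ := hmem u hu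
    exact (hBf a u ha).2.1
  refine ⟨{ toFun := φ
            invFun := ψ
            source := U
            target := (⋃ a, B' a) ∩ ψ ⁻¹' U
            map_source' := fun u hu => ⟨(hUO hu).2, by rw [mem_preimage, hinv' u hu]; exact hu⟩
            map_target' := fun y hy => hy.2
            left_inv' := hinv'
            right_inv' := fun y hy => hinv y hy.1
            open_source := hU
            open_target := hsm'.continuousOn.isOpen_inter_preimage hBo' hU
            continuousOn_toFun := hsm.continuousOn.mono fun u hu => (hUO hu).1
            continuousOn_invFun := hsm'.continuousOn.mono inter_subset_left },
    rfl, hsm.mono fun u hu => (hUO hu).1, hsm'.mono inter_subset_left, hφX, fun u hu => ?_⟩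
  obtain ⟨a, ha⟩ := hmem u hu
  obtain ⟨h1, -, h3, h4⟩ := hBf a u ha
  exact ⟨(hMC a).subset h1, h3, e a, κ a, x₀ a, ρ a, g a, hMC a, hQ a, hBe a ha, h4⟩

end MoserTheorem

end
end LogSymp

namespace LogSymp

noncomputable section

set_option linter.unusedSectionVars false
set_option maxSynthPendingDepth 3

/-! ### Log expressions of forms -/

section LogExpr

variable {d k : ℕ} {M : Type*} [TopologicalSpace M] [ChartedSpace (Model d) M]
  [IsManifold (𝓡 d) ∞ M] {σ : Type} [Fintype σ] {Y : σ → Set M}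
  {e e₁ : OpenPartialHomeomorph M (Model d)} {κ κ₁ : σ ↪ Fin d}

lemma logFrame_congr {τ : Type*} {κ' : τ ↪ Fin d} (h : range κ = range κ') (x : Model d) :
    logFrame κ x = logFrame κ' x := by
  ext v : 1
  refine ext_range κ (fun s => ?_) fun j hj => ?_
  · obtain ⟨t, ht⟩ : κ s ∈ range κ' := h ▸ mem_range_self s
    rw [logFrame_apply_range, ← ht, logFrame_apply_range]
  · rw [logFrame_apply_of_notMem _ _ _ hj, logFrame_apply_of_notMem _ _ _ (h ▸ hj)]

/-- A chart in which the hypersurfaces `Y s` are distinct coordinate hyperplanes. -/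
structure IsCrossChart (Y : σ → Set M) (e : OpenPartialHomeomorph M (Model d)) (κ : σ ↪ Fin d) :
    Prop where
  mem_atlas : e ∈ IsManifold.maximalAtlas (𝓡 d) ∞ M
  mem_iff : ∀ q ∈ e.source, ∀ s, q ∈ Y s ↔ e q (κ s) = 0

/-- Adapted charts are indexed by the hypersurfaces through their centre, an index set that depends
on the point. Along `X` these are exactly the labelled ones, so `σ` can serve as a common index. -/
lemma IsAdaptedChart.exists_isCrossChart {ι : Type*} {Z : ι → Set M} {a : M}
    {κ₀ : {i // a ∈ Z i} ↪ Fin d} (h : IsAdaptedChart Z a e κ₀) {lab : σ → ι}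
    (hlab : Function.Injective lab) (ha : ∀ s, a ∈ Z (lab s))
    (hmax : ∀ i, a ∈ Z i → i ∈ range lab) :
    ∃ κ : σ ↪ Fin d, IsCrossChart (fun s => Z (lab s)) e κ ∧
      (∀ x, logFrame κ x = logFrame κ₀ x) ∧
      ∀ x ∈ e.target, (∀ s, x (κ s) ≠ 0) → e.symm x ∉ ⋃ i, Z i := by
  refine ⟨⟨fun s => κ₀ ⟨lab s, ha s⟩, fun s t hst => hlab (by
    simpa using congrArg Subtype.val (κ₀.injective hst))⟩, ⟨h.mem_atlas, fun q hq s => ?_⟩,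
    logFrame_congr ?_, fun x hx hx0 hZ => ?_⟩
  · exact h.mem_iff q hq ⟨lab s, ha s⟩
  · ext j
    constructor
    · rintro ⟨s, rfl⟩
      exact ⟨_, rfl⟩
    · rintro ⟨⟨i, hi⟩, rfl⟩
      obtain ⟨s, rfl⟩ := hmax i hi
      exact ⟨s, rfl⟩
  · obtain ⟨i, hi⟩ := mem_iUnion.1 hZ
    by_cases hai : a ∈ Z i
    · obtain ⟨s, rfl⟩ := hmax i hai
      have h1 := (h.mem_iff _ (e.map_target hx) ⟨lab s, hai⟩).1 hi
      rw [e.right_inv hx] at h1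
      exact hx0 s h1
    · exact h.not_mem _ (e.map_target hx) i hai hi

/-- `G` gives the log components of `Θ` over `O`. -/
structure HasLogExpr (Θ : DForm d M k) (e : OpenPartialHomeomorph M (Model d)) (κ : σ ↪ Fin d)
    (O : Set (Model d)) (G : Model d → Model d [⋀^Fin k]→L[ℝ] ℝ) : Prop where
  isOpen : IsOpen O
  subset : O ⊆ e.target
  smooth : ContDiffOn ℝ ∞ G O
  expr : ∀ x ∈ O, (∀ s, x (κ s) ≠ 0) → (inChart e Θ x).compContinuousLinearMap (logFrame κ x) = G x

variable {Θ : DForm d M k} {O O' : Set (Model d)} {G G' : Model d → Model d [⋀^Fin k]→L[ℝ] ℝ}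

lemma HasLogExpr.eqOn (h : HasLogExpr Θ e κ O G) (h' : HasLogExpr Θ e κ O' G') :
    EqOn G G' (O ∩ O') :=
  eqOn_of_forall_ne_zero κ (h.isOpen.inter h'.isOpen) (h.smooth.continuousOn.mono inter_subset_left)
    (h'.smooth.continuousOn.mono inter_subset_right) fun x hx hx0 => by
      rw [← h.expr x hx.1 hx0, ← h'.expr x hx.2 hx0]

lemma isUnit_logFrame {x : Model d} (hx : ∀ s, x (κ s) ≠ 0) :
    ∃ L : Model d ≃L[ℝ] Model d, (L : Model d →L[ℝ] Model d) = logFrame κ x := by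
  have h : Function.Bijective (logFrame κ x) := by
    refine Function.bijective_iff_has_inverse.2 ⟨logInv κ x, logInv_logFrame hx, logFrame_logInv hx⟩
  exact ⟨(LinearEquiv.ofBijective (logFrame κ x : Model d →ₗ[ℝ] Model d) h).toContinuousLinearEquiv,
    rfl⟩

/-- Off the hyperplanes the frame is invertible, and the form is recovered from its components by
the inverse frame. -/
lemma HasLogExpr.contDiffAt (h : HasLogExpr Θ e κ O G) {x : Model d} (hx : x ∈ O)
    (hx0 : ∀ s, x (κ s) ≠ 0) : ContDiffAt ℝ ∞ (inChart e Θ) x := by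
  obtain ⟨L, hL⟩ := isUnit_logFrame hx0
  have h1 : ContDiffAt ℝ ∞ (fun y => (logFrame κ y).inverse) x := by
    have h2 : ContDiffAt ℝ ∞ ContinuousLinearMap.inverse (logFrame κ x) := by
      rw [← hL]; exact contDiffAt_map_inverse L
    exact h2.comp x (contDiff_logFrame κ).contDiffAt
  have h3 : ContDiffAt ℝ ∞ (fun y => (G y).compContinuousLinearMap (logFrame κ y).inverse) x :=
    contDiff_compContinuousLinearMap.contDiffAt.comp x
      ((h.smooth.contDiffAt (h.isOpen.mem_nhds hx)).prodMk h1)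
  refine h3.congr_of_eventuallyEq ?_
  have h4 : ∀ᶠ y in 𝓝 x, ∀ s, y (κ s) ≠ 0 := eventually_all.2 fun s =>
    (EuclideanSpace.proj (κ s) : Model d →L[ℝ] ℝ).continuous.continuousAt.eventually_ne (hx0 s)
  filter_upwards [h.isOpen.mem_nhds hx, h4] with y hy hy0
  obtain ⟨L', hL'⟩ := isUnit_logFrame hy0
  rw [← h.expr y hy hy0, ← hL', ContinuousLinearMap.inverse_equiv]
  ext v
  simp [ContinuousAlternatingMap.compContinuousLinearMap_apply, Function.comp_def]

/-- Change of adapted charts. -/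
theorem HasLogExpr.transition (he₁ : IsCrossChart Y e₁ κ₁) (he : IsCrossChart Y e κ)
    (h : HasLogExpr Θ e₁ κ₁ O G) {a : M} (ha : a ∈ e.source) (ha₁ : a ∈ e₁.source) (haO : e₁ a ∈ O)
    (haY : ∀ s, a ∈ Y s) :
    ∃ (O' : Set (Model d)) (G' : Model d → Model d [⋀^Fin k]→L[ℝ] ℝ) (A : Model d →L[ℝ] Model d),
      HasLogExpr Θ e κ O' G' ∧ e a ∈ O' ∧ G' (e a) = (G (e₁ a)).compContinuousLinearMap A ∧
      Function.Injective A ∧ ∀ s, A (EuclideanSpace.single (κ s) 1) =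
        EuclideanSpace.single (κ₁ s) 1 := by
  have hψ := contDiffOn_transition he.mem_atlas he₁.mem_atlas
  set V := overlap e e₁ ∩ (e₁ ∘ e.symm) ⁻¹' O
  have hV : IsOpen V := hψ.continuousOn.isOpen_inter_preimage isOpen_overlap h.isOpen
  have haV : e a ∈ V := ⟨⟨e.map_source ha, by rwa [mem_preimage, e.left_inv ha]⟩, by
    rwa [mem_preimage, Function.comp_apply, e.left_inv ha]⟩
  have hc : cproj κ (e a) = e a :=
    (cproj_eq_self_iff κ).2 fun s => (he.mem_iff a ha s).1 (haY s)
  have hiff : ∀ x ∈ V, ∀ s, x (κ s) = 0 ↔ (e₁ ∘ e.symm) x (κ₁ s) = 0 := fun x hx s => by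
    have h1 := he.mem_iff _ (e.map_target hx.1.1) s
    rw [e.right_inv hx.1.1] at h1
    rw [← h1, he₁.mem_iff _ hx.1.2 s]
    rfl
  have hbij : Function.Bijective (fderiv ℝ (e₁ ∘ e.symm) (e a)) :=
    (transitionEquiv he.mem_atlas he₁.mem_atlas haV.1).bijective
  obtain ⟨O', hO'V, hO', haO', A, hA⟩ := exists_isLogDeriv hV haV hc (hψ.mono inter_subset_left)
    (fun x hx s => (hiff x hx s).1) hbij.surjective
  refine ⟨O', fun x => (G ((e₁ ∘ e.symm) x)).compContinuousLinearMap (A x), A (e a),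
    ⟨hO', fun x hx => (hO'V hx).1.1, ?_, fun x hx hx0 => ?_⟩, haO', ?_,
    hA.injective haO' hc hbij.injective, hA.single _ haO' hc⟩
  · exact contDiff_compContinuousLinearMap.comp_contDiffOn
      ((h.smooth.comp (hψ.mono fun x hx => (hO'V hx).1) fun x hx => (hO'V hx).2).prodMk hA.smooth)
  · have h1 := h.expr ((e₁ ∘ e.symm) x) (hO'V hx).2 fun s => by
      rw [Ne, ← hiff x (hO'V hx) s]; exact hx0 s
    simp only [← h1]
    rw [inChart_transition he.mem_atlas he₁.mem_atlas Θ (hO'V hx).1]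
    ext v
    simp only [ContinuousAlternatingMap.compContinuousLinearMap_apply]
    congr 1
    funext i
    exact hA.fderiv_logFrame x hx (v i)
  · simp only [Function.comp_apply, e.left_inv ha]

/-- At a point of all the `Y s` a change of adapted charts takes the normal frame vector of `s` to
that of the other chart. The component on it, the residue along `Y s`, is therefore independent of
the chart. -/
lemma toCov_single_eq {Θ : DForm d M 1} {G G' : Model d → Model d [⋀^Fin 1]→L[ℝ] ℝ}
    (he₁ : IsCrossChart Y e₁ κ₁) (he : IsCrossChart Y e κ)
    (h : HasLogExpr Θ e₁ κ₁ O G) (h' : HasLogExpr Θ e κ O' G') {a : M} (ha : a ∈ e.source)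
    (ha₁ : a ∈ e₁.source) (haO : e₁ a ∈ O) (haO' : e a ∈ O') (haY : ∀ s, a ∈ Y s) (s : σ) :
    toCov (G (e₁ a)) (EuclideanSpace.single (κ₁ s) 1) =
      toCov (G' (e a)) (EuclideanSpace.single (κ s) 1) := by
  obtain ⟨O'', G'', A, h1, h2, h3, -, h4⟩ := h.transition he₁ he ha ha₁ haO haY
  rw [h'.eqOn h1 ⟨haO', h2⟩, h3, toCov_compContinuousLinearMap, h4]

/-! ### Log forms and defining functions in charts around the intersection -/

section NormalCrossing

variable {ι : Type*} {Z : ι → Set M} {lab : σ → ι}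

lemma IsLogForm.exists_hasLogExpr {Θ : DForm d M k} (hΘ : IsLogForm Z Θ)
    (hlab : Function.Injective lab) {a : M} (ha : ∀ s, a ∈ Z (lab s))
    (hmax : ∀ i, a ∈ Z i → i ∈ range lab) (he : IsCrossChart (fun s => Z (lab s)) e κ)
    (hae : a ∈ e.source) :
    ∃ (O : Set (Model d)) (G : Model d → Model d [⋀^Fin k]→L[ℝ] ℝ),
      HasLogExpr Θ e κ O G ∧ e a ∈ O := by
  obtain ⟨e₁, κ₀, G₁, hA, hG⟩ := hΘ a
  obtain ⟨κ₁, h1, h2, h3⟩ := hA.exists_isCrossChart hlab ha hmax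
  have h4 : HasLogExpr Θ e₁ κ₁ e₁.target G₁ := ⟨e₁.open_target, Subset.rfl, hG.1,
    fun x hx hx0 => by rw [h2]; exact hG.2 x hx (h3 x hx hx0)⟩
  obtain ⟨O', G', -, h5, h6, -⟩ := h4.transition h1 he hae hA.mem_source
    (e₁.map_source hA.mem_source) ha
  exact ⟨O', G', h5, h6⟩

/-- Nondegeneracy is known in one adapted chart only. The change of log frames is injective, hence
surjective in equal finite dimension, so nondegeneracy passes to any other chart. -/
lemma IsLogSymplectic.exists_hasLogExpr {Ω : DForm d M 2} (hΩ : IsLogSymplectic Z Ω)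
    (hlab : Function.Injective lab) {a : M} (ha : ∀ s, a ∈ Z (lab s))
    (hmax : ∀ i, a ∈ Z i → i ∈ range lab) (he : IsCrossChart (fun s => Z (lab s)) e κ)
    (hae : a ∈ e.source) :
    ∃ (O : Set (Model d)) (G : Model d → Model d [⋀^Fin 2]→L[ℝ] ℝ),
      HasLogExpr Ω e κ O G ∧ e a ∈ O ∧ ∀ v, (∀ w, toBil (G (e a)) v w = 0) → v = 0 := by
  obtain ⟨e₁, κ₀, G₁, hA, hG, hnd⟩ := hΩ.log_nondegenerate a
  obtain ⟨κ₁, h1, h2, h3⟩ := hA.exists_isCrossChart hlab ha hmax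
  have h4 : HasLogExpr Ω e₁ κ₁ e₁.target G₁ := ⟨e₁.open_target, Subset.rfl, hG.1,
    fun x hx hx0 => by rw [h2]; exact hG.2 x hx (h3 x hx hx0)⟩
  obtain ⟨O', G', A, h5, h6, h7, h8, -⟩ := h4.transition h1 he hae hA.mem_source
    (e₁.map_source hA.mem_source) ha
  refine ⟨O', G', h5, h6, fun v hv => h8 ?_⟩
  rw [map_zero]
  refine hnd _ fun w => ?_
  obtain ⟨w, rfl⟩ := (LinearMap.injective_iff_surjective (f := (A : Model d →ₗ[ℝ] Model d))).1 h8 w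
  have := hv w
  rwa [h7, toBil_compContinuousLinearMap, toBil_apply] at this

lemma IsDefiningFunctionOn.isCrossChart {f : σ → M → ℝ} {W : Set M}
    (hf : ∀ s, IsDefiningFunctionOn (d := d) (Z (lab s)) W (f s)) (he : IsFunChart f e κ)
    (hs : e.source ⊆ W) : IsCrossChart (fun s => Z (lab s)) e κ :=
  ⟨he.mem_atlas, fun q hq s => by rw [(hf s).zero_iff q (hs hq), he.coord q hq]⟩

/-- Defining functions of normal crossing hypersurfaces are part of a coordinate system. -/
lemma IsDefiningFunctionOn.exists_isFunChart {f : σ → M → ℝ} {W : Set M}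
    (hf : ∀ s, IsDefiningFunctionOn (d := d) (Z (lab s)) W (f s)) (hW : IsOpen W)
    (he : IsCrossChart (fun s => Z (lab s)) e κ) {a : M} (hae : a ∈ e.source) (haW : a ∈ W)
    (ha : ∀ s, a ∈ Z (lab s)) :
    ∃ e', IsFunChart f e' κ ∧ a ∈ e'.source ∧ e'.source ⊆ W := by
  set Y : M → Model d := fun u => cproj κ (e u) + ∑ s, f s u • EuclideanSpace.single (κ s) (1 : ℝ)
    with hY
  have hYr : ∀ u s, Y u (κ s) = f s u := fun u s => by
    rw [hY]
    simp only [PiLp.add_apply]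
    rw [cproj_apply_range, sum_single_apply_range, zero_add]
  have hYn : ∀ u, cproj κ (Y u) = cproj κ (e u) := fun u => by
    rw [hY]
    simp only [map_add, cproj_cproj, cproj_sum_single, add_zero]
  have hV : IsOpen (e.source ∩ W) := e.open_source.inter hW
  have hYs : ContMDiffOn (𝓡 d) (𝓡 d) ∞ Y (e.source ∩ W) :=
    ((cproj κ).contMDiff.comp_contMDiffOn ((contMDiffOn_of_mem_maximalAtlas he.mem_atlas).mono
      inter_subset_left)).add (contMDiffOn_finsetSum fun s _ =>
        ((hf s).smooth.mono inter_subset_right).smul contMDiffOn_const)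
  have hx : e a ∈ e.target := e.map_source hae
  set O := e.target ∩ e.symm ⁻¹' (e.source ∩ W)
  have hO : IsOpen O := e.symm.continuousOn.isOpen_inter_preimage e.open_target hV
  have haO : e a ∈ O := ⟨hx, by rw [mem_preimage, e.left_inv hae]; exact ⟨hae, haW⟩⟩
  have hFs : ContDiffOn ℝ ∞ (Y ∘ e.symm) O := contDiffOn_comp_symm he.mem_atlas hYs
  have hFd : HasFDerivAt (Y ∘ e.symm) (fderiv ℝ (Y ∘ e.symm) (e a)) (e a) :=
    ((hFs.contDiffAt (hO.mem_nhds haO)).differentiableAt (by simp)).hasFDerivAt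
  have hYm : MDifferentiableAt (𝓡 d) (𝓡 d) Y (e.symm (e a)) := by
    rw [e.left_inv hae]
    exact (hYs.contMDiffAt (hV.mem_nhds ⟨hae, haW⟩)).mdifferentiableAt (by simp)
  have hchain : ∀ v, dmap Y a (dpar e.symm (e a) v) = fderiv ℝ (Y ∘ e.symm) (e a) v := fun v => by
    have h1 : mfderiv (𝓡 d) (𝓡 d) (Y ∘ e.symm) (e a) = _ :=
      mfderiv_comp (e a) hYm (chart_symm_mdiff he.mem_atlas hx)
    rw [mfderiv_eq_fderiv, e.left_inv hae] at h1
    exact (congrArg (fun l : Model d →L[ℝ] Model d => l v) h1).symm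
  obtain ⟨e', he', hae', hs', hY'⟩ := exists_chart hV ⟨hae, haW⟩ hYs fun v hv => by
    rw [← dpar_dmap he.mem_atlas hae v] at hv ⊢
    rw [hchain] at hv
    set w := dmap e a v with hw
    have h1 : cproj κ w = 0 := by
      have h2 : HasFDerivAt (cproj κ ∘ (Y ∘ e.symm)) _ (e a) :=
        (cproj κ).hasFDerivAt.comp (e a) hFd
      have h3 : (cproj κ ∘ (Y ∘ e.symm)) =ᶠ[𝓝 (e a)] cproj κ := by
        filter_upwards [e.open_target.mem_nhds hx] with y hy
        simp only [Function.comp_apply, hYn, e.right_inv hy]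
      have h4 := h2.unique ((cproj κ).hasFDerivAt.congr_of_eventuallyEq h3)
      have h5 := congrArg (fun l : Model d →L[ℝ] Model d => l w) h4
      simp only [ContinuousLinearMap.comp_apply, hv, map_zero] at h5
      exact h5.symm
    have h2 : ∀ s, w (κ s) = 0 := fun s => by
      have hfd : HasFDerivAt (fun y => Y (e.symm y) (κ s)) _ (e a) :=
        (EuclideanSpace.proj (κ s) : Model d →L[ℝ] ℝ).hasFDerivAt.comp (e a) hFd
      have hfw : ∀ w', fderiv ℝ (fun y => Y (e.symm y) (κ s)) (e a) w' =
          fderiv ℝ (Y ∘ e.symm) (e a) w' (κ s) := fun w' => by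
        rw [hfd.fderiv]
        rfl
      have hdf : ∀ w', fderiv ℝ (fun y => Y (e.symm y) (κ s)) (e a) w' =
          dfun (f s) a (dpar e.symm (e a) w') := fun w' => by
        have h6 := dfun_dpar (f := f s) he.mem_atlas hx (by
          rw [e.left_inv hae]
          exact ((hf s).smooth.contMDiffAt (hW.mem_nhds haW)).mdifferentiableAt (by simp)) w'
        rw [e.left_inv hae] at h6
        rw [h6]
        simp only [hYr]
        rfl
      obtain ⟨ρ, hρ, hball⟩ := Metric.isOpen_iff.1 hO (e a) haO
      -- Near `a`, the defining function is the coordinate of `κ s` times `h`, and `h` is nonzero at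
      -- `a` because the differential of the defining function is. So vectors killed by the
      -- differential of `Y` have no `κ s` component.
      obtain ⟨h, hh, hFh⟩ := exists_eq_coord_mul (κ s) (x₀ := e a) (ρ := ρ)
        ((he.mem_iff a hae s).1 (ha s)) (F := fun y => Y (e.symm y) (κ s))
        ((EuclideanSpace.proj (κ s) : Model d →L[ℝ] ℝ).contDiff.comp_contDiffOn (hFs.mono hball))
        (fun y hy hy0 => by
          have hyO := hball hy
          rw [hYr, ← (hf s).zero_iff _ hyO.2.2, he.mem_iff _ hyO.2.1, e.right_inv hyO.1]
          exact hy0)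
      have hhd : DifferentiableAt ℝ h (e a) :=
        (hh.contDiffAt (Metric.ball_mem_nhds _ hρ)).differentiableAt (by simp)
      have key := fderiv_coord_mul hhd (by
        filter_upwards [Metric.ball_mem_nhds (e a) hρ] with y hy using hFh y hy)
      have ha0 : e a (κ s) = 0 := (he.mem_iff a hae s).1 (ha s)
      have hne : h (e a) ≠ 0 := fun h0 => by
        refine (hf s).dfun_ne_zero a haW (ha s) (ContinuousLinearMap.ext fun v' => ?_)
        rw [← dpar_dmap he.mem_atlas hae v']
        refine (hdf _).symm.trans ?_
        rw [key, h0, ha0]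
        simp
      have h7 := key w
      rw [hfw, hv, ha0] at h7
      simpa [hne] using h7
    have h3 : w = 0 := ext_range κ (fun s => by rw [h2]; rfl) fun j hj => by
      rw [← cproj_apply_of_notMem κ w hj, h1]
    rw [h3, map_zero]
  exact ⟨e', ⟨he', fun u hu s => by rw [hY' u hu, hYr]⟩, hae', hs'.trans inter_subset_right⟩

end NormalCrossing

end LogExpr

end
end LogSymp

namespace LogSymp

noncomputable section

set_option linter.unusedSectionVars false
set_option maxSynthPendingDepth 3

/-! ### Moser charts, log potentials and residues -/

section Local

variable {d k : ℕ} {M : Type*} [TopologicalSpace M] [ChartedSpace (Model d) M]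
  [IsManifold (𝓡 d) ∞ M] {σ : Type} [Fintype σ] {f : σ → M → ℝ} {X N : Set M} {π : M → M}
  {e : OpenPartialHomeomorph M (Model d)} {κ : σ ↪ Fin d} {x₀ : Model d} {ρ ρ' : ℝ}
  {Ω : DForm d M 2} {Y : σ → Set M}

lemma IsTubChart.exists_restr (h : IsTubChart f π e κ x₀ ρ) (hρ' : 0 < ρ') (hle : ρ' ≤ ρ) :
    ∃ e' : OpenPartialHomeomorph M (Model d), IsTubChart f π e' κ x₀ ρ' ∧ e'.source ⊆ e.source ∧
      (∀ u ∈ e.source, e u ∈ Metric.ball x₀ ρ' → u ∈ e'.source) ∧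
      (∀ u, e' u = e u) ∧ ∀ x, e'.symm x = e.symm x := by
  have hb : Metric.ball x₀ ρ' ⊆ e.target := by
    rw [h.target_eq]; exact Metric.ball_subset_ball hle
  have hV : IsOpen (e.source ∩ e ⁻¹' Metric.ball x₀ ρ') :=
    e.isOpen_inter_preimage Metric.isOpen_ball
  have hs : (e.restrOpen _ hV).source = e.source ∩ e ⁻¹' Metric.ball x₀ ρ' := by
    rw [OpenPartialHomeomorph.restrOpen_source, ← inter_assoc, inter_self]
  refine ⟨e.restrOpen _ hV, ⟨h.funChart.restr hV, hρ', h.center, ?_, fun u hu => ?_⟩,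
    ?_, fun u hu hu' => ?_, fun u => rfl, fun x => rfl⟩
  · refine Subset.antisymm (fun x hx => ?_) fun x hx => ?_
    · have h1 := (e.restrOpen _ hV).map_target hx
      rw [hs] at h1
      have h2 := h1.2
      have h3 := (e.restrOpen _ hV).right_inv hx
      rw [mem_preimage] at h2
      rw [← h3]; exact h2
    · have h1 : e.symm x ∈ (e.restrOpen _ hV).source := by
        rw [hs]
        exact ⟨e.map_target (hb hx), by rwa [mem_preimage, e.right_inv (hb hx)]⟩
      have h2 := (e.restrOpen _ hV).map_source h1
      change e (e.symm x) ∈ _ at h2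
      rwa [e.right_inv (hb hx)] at h2
  · rw [hs] at hu ⊢
    obtain ⟨h1, h2⟩ := h.proj u hu.1
    refine ⟨⟨h1, ?_⟩, h2⟩
    rw [mem_preimage, h2]
    exact cproj_mem_ball κ h.center hu.2
  · rw [hs]; exact inter_subset_left
  · rw [hs]; exact ⟨hu, hu'⟩

lemma IsTube.cproj_eq (hN : IsTube (d := d) f X N π) (he : IsFunChart f e κ) {a : M} (ha : a ∈ X)
    (hae : a ∈ e.source) : cproj κ (e a) = e a :=
  (cproj_eq_self_iff κ).2 fun s => by rw [he.coord a hae, hN.zero a ha]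

lemma frameMul_logFrame_comm (x u v : Model d) :
    frameMul κ (logFrame κ x u) v = frameMul κ (logFrame κ x v) u :=
  ext_range κ (fun s => by simp only [frameMul_apply_range, logFrame_apply_range]; ring)
    fun j hj => by simp only [frameMul_apply_of_notMem _ _ _ hj]

lemma isOpen_setOf_forall_ne_zero (κ : σ ↪ Fin d) : IsOpen {x : Model d | ∀ s, x (κ s) ≠ 0} := by
  rw [Set.ofPred_forall]
  exact isOpen_iInter_of_finite fun s => isOpen_compl_singleton.preimage
    (EuclideanSpace.proj (κ s) : Model d →L[ℝ] ℝ).continuous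

/-- The exterior derivative of a `1`-form in log components. -/
lemma HasLogExpr.toBil_extDeriv {Θ : DForm d M 1} {O : Set (Model d)}
    {m : Model d → Model d [⋀^Fin 1]→L[ℝ] ℝ} (h : HasLogExpr Θ e κ O m) {x : Model d} (hx : x ∈ O)
    (hx0 : ∀ s, x (κ s) ≠ 0) (u v : Model d) :
    toBil (extDeriv (inChart e Θ) x) (logFrame κ x u) (logFrame κ x v) =
      toCov (fderiv ℝ m x (logFrame κ x u)) v - toCov (fderiv ℝ m x (logFrame κ x v)) u := by
  have hθ : DifferentiableAt ℝ (inChart e Θ) x := (h.contDiffAt hx hx0).differentiableAt (by simp)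
  have hm : DifferentiableAt ℝ m x :=
    (h.smooth.contDiffAt (h.isOpen.mem_nhds hx)).differentiableAt (by simp)
  have key : ∀ z w, toCov (fderiv ℝ m x z) w = toCov (fderiv ℝ (inChart e Θ) x z) (logFrame κ x w) +
      toCov (inChart e Θ x) (frameMul κ z w) := by
    intro z w
    have h1 : HasFDerivAt (fun y => toCov (m y) w) _ x :=
      (toCov.hasFDerivAt.comp x hm.hasFDerivAt).clm_apply (hasFDerivAt_const w x)
    have h2 : HasFDerivAt (fun y => toCov (inChart e Θ y) (logFrame κ y w)) _ x :=
      (toCov.hasFDerivAt.comp x hθ.hasFDerivAt).clm_apply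
        ((hasFDerivAt_logFrame κ x).clm_apply (hasFDerivAt_const w x))
    have h3 : (fun y => toCov (m y) w) =ᶠ[𝓝 x]
        fun y => toCov (inChart e Θ y) (logFrame κ y w) := by
      filter_upwards [h.isOpen.mem_nhds hx, (isOpen_setOf_forall_ne_zero κ).mem_nhds hx0]
        with y hy hy0
      rw [← h.expr y hy hy0, toCov_compContinuousLinearMap]
    have h4 := congrArg (fun l : Model d →L[ℝ] ℝ => l z) (h1.unique (h2.congr_of_eventuallyEq h3))
    simp at h4
    rw [h4]
    ring
  rw [extDeriv_apply_two, key, key, frameMul_logFrame_comm]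
  ring

/-- In a chart adapted to the hypersurface, a defining function is a multiple of a coordinate. -/
lemma IsDefiningFunctionOn.exists_eq_coord_mul {Z₁ V : Set M} {g : M → ℝ} {j : Fin d}
    (hg : IsDefiningFunctionOn (d := d) Z₁ V g) (hV : IsOpen V)
    (he : e ∈ IsManifold.maximalAtlas (𝓡 d) ∞ M) (hmem : ∀ q ∈ e.source, q ∈ Z₁ ↔ e q j = 0)
    {a : M} (haV : a ∈ V) (hae : a ∈ e.source) (ha : a ∈ Z₁) :
    ∃ V' : Set M, IsOpen V' ∧ a ∈ V' ∧ V' ⊆ e.source ∩ V ∧ ∃ h : M → ℝ,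
      ContMDiffOn (𝓡 d) 𝓘(ℝ, ℝ) ∞ h V' ∧ ∀ q ∈ V', h q ≠ 0 ∧ g q = e q j * h q := by
  have hx := e.map_source hae
  set O := e.target ∩ e.symm ⁻¹' V
  have hO : IsOpen O := e.symm.continuousOn.isOpen_inter_preimage e.open_target hV
  have haO : e a ∈ O := ⟨hx, by rwa [mem_preimage, e.left_inv hae]⟩
  have hF : ContDiffOn ℝ ∞ (g ∘ e.symm) O := contDiffOn_comp_symm he hg.smooth
  obtain ⟨ρ, hρ, hball⟩ := Metric.isOpen_iff.1 hO (e a) haO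
  have ha0 : e a j = 0 := (hmem a hae).1 ha
  obtain ⟨h, hh, hFh⟩ := LogSymp.exists_eq_coord_mul j ha0 (hF.mono hball) fun y hy hy0 => by
    have hyO := hball hy
    rw [Function.comp_apply, ← hg.zero_iff _ hyO.2, hmem _ (e.map_target hyO.1),
      e.right_inv hyO.1]
    exact hy0
  have hne : h (e a) ≠ 0 := fun h0 => by
    refine hg.dfun_ne_zero a haV ha (ContinuousLinearMap.ext fun (v : Model d) => ?_)
    have h1 := dfun_dpar (f := g) he hx (by
      rw [e.left_inv hae]
      exact (hg.smooth.contMDiffAt (hV.mem_nhds haV)).mdifferentiableAt (by simp)) (dmap e a v)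
    rw [e.left_inv hae, dpar_dmap he hae, fderiv_coord_mul
      ((hh.contDiffAt (Metric.ball_mem_nhds _ hρ)).differentiableAt (by simp))
      (by filter_upwards [Metric.ball_mem_nhds (e a) hρ] with y hy using hFh y hy), h0, ha0] at h1
    rw [h1]
    simp
  have hB : IsOpen (Metric.ball (e a) ρ ∩ h ⁻¹' {0}ᶜ) :=
    hh.continuousOn.isOpen_inter_preimage Metric.isOpen_ball isOpen_compl_singleton
  refine ⟨e.source ∩ e ⁻¹' (Metric.ball (e a) ρ ∩ h ⁻¹' {0}ᶜ), e.isOpen_inter_preimage hB,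
    ⟨hae, Metric.mem_ball_self hρ, hne⟩, fun q hq => ⟨hq.1, ?_⟩, h ∘ e, ?_, fun q hq => ⟨hq.2.2, ?_⟩⟩
  · have h1 := (hball hq.2.1).2
    rwa [mem_preimage, e.left_inv hq.1] at h1
  · exact hh.contMDiffOn.comp ((contMDiffOn_of_mem_maximalAtlas he).mono inter_subset_left)
      fun q hq => hq.2.1
  · have h1 := hFh _ hq.2.1
    rwa [Function.comp_apply, e.left_inv hq.1] at h1

variable [T2Space M] [SecondCountableTopology M]

/-- A log potential is `log |g|` up to a smooth function. -/
lemma IsLogPotential.exists_remainder {Z₁ W : Set M} {ℓ g : M → ℝ} (hℓ : IsLogPotential d Z₁ ℓ)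
    (hX : IsClosed X) (hXZ : X ⊆ Z₁) (hW : IsOpen W) (hXW : X ⊆ W)
    (hg : IsDefiningFunctionOn (d := d) Z₁ W g)
    (hch : ∀ a ∈ X, ∃ e ∈ IsManifold.maximalAtlas (𝓡 d) ∞ M, ∃ j : Fin d, a ∈ e.source ∧
      ∀ q ∈ e.source, q ∈ Z₁ ↔ e q j = 0) :
    ∃ H : M → ℝ, ContMDiff (𝓡 d) 𝓘(ℝ, ℝ) ∞ H ∧ ∃ N, IsOpen N ∧ X ⊆ N ∧ ∀ u ∈ N, u ∉ Z₁ →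
      ℓ u = Real.log (g u) + H u := by
  -- The condition fixes the value off `Z₁` and says nothing on `Z₁`. Locally `ℓ` is `log |f|`, and
  -- `f` and `g` are the same coordinate times nowhere zero functions, so the difference of
  -- logarithms extends smoothly.
  refine exists_contMDiff_near (T := fun u => {y | u ∉ Z₁ → ℓ u = Real.log (g u) + y}) hX
    (fun u => ?_) fun a ha => ?_
  · intro y hy y' hy' s t _ _ hst hu
    have h1 := hy hu
    have h2 := hy' hu
    rw [show y' = y by linarith, ← add_smul, hst, one_smul]
    exact h1
  · obtain ⟨e, he, j, hae, hmem⟩ := hch a ha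
    obtain ⟨V, f, hV, haV, hf, hℓf⟩ := hℓ.log_near a (hXZ ha)
    obtain ⟨V₁, hV₁, haV₁, hs₁, h₁, hh₁, hf₁⟩ := hf.exists_eq_coord_mul hV he hmem haV hae (hXZ ha)
    obtain ⟨V₂, hV₂, haV₂, hs₂, h₂, hh₂, hf₂⟩ :=
      hg.exists_eq_coord_mul hW he hmem (hXW ha) hae (hXZ ha)
    refine ⟨V₁ ∩ V₂, hV₁.inter hV₂, ⟨haV₁, haV₂⟩, fun q => Real.log (h₁ q) - Real.log (h₂ q), ?_, ?_⟩
    · have hlog : ∀ {h : M → ℝ} {V : Set M}, ContMDiffOn (𝓡 d) 𝓘(ℝ, ℝ) ∞ h V → (∀ q ∈ V, h q ≠ 0) →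
          ContMDiffOn (𝓡 d) 𝓘(ℝ, ℝ) ∞ (fun q => Real.log (h q)) V := fun hh h0 =>
        (Real.contDiffOn_log.contMDiffOn).comp hh fun q hq => h0 q hq
      exact (hlog (hh₁.mono inter_subset_left) fun q hq => (hf₁ q hq.1).1).sub
        (hlog (hh₂.mono inter_subset_right) fun q hq => (hf₂ q hq.2).1)
    · intro u hu huZ
      obtain ⟨h3, h4⟩ := hf₁ u hu.1
      obtain ⟨h5, h6⟩ := hf₂ u hu.2
      have h7 : e u j ≠ 0 := fun h0 => huZ ((hmem u (hs₁ hu.1).1).2 h0)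
      -- `Real.log` is even, so `Real.log (g u)` stands for `log |g u|` whatever the sign of `g u`.
      rw [hℓf u (hs₁ hu.1).2 huZ, Real.log_abs, h4, h6, Real.log_mul h7 h3, Real.log_mul h7 h5]
      ring

lemma IsLogPotential.exists_remainder_of_disjoint {Z₁ : Set M} {ℓ : M → ℝ}
    (hℓ : IsLogPotential d Z₁ ℓ) (hX : IsClosed X) (hZ : IsClosed Z₁) (hXZ : Disjoint X Z₁) :
    ∃ H : M → ℝ, ContMDiff (𝓡 d) 𝓘(ℝ, ℝ) ∞ H ∧ ∃ N, IsOpen N ∧ X ⊆ N ∧ ∀ u ∈ N, H u = ℓ u :=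
  exists_contMDiff_eqOn hX hZ.isOpen_compl (fun _ hu hu' => hXZ.le_bot ⟨hu, hu'⟩)
    fun u hu => (hℓ.smooth u hu).contMDiffWithinAt

/-- The residue of a log `1`-form along `Y s`, as a function whose values on `X` matter. -/
lemma exists_residue {Θ : DForm d M 1} (hX : IsClosed X) (hXY : ∀ a ∈ X, ∀ s, a ∈ Y s)
    (h : ∀ a ∈ X, ∃ (e : OpenPartialHomeomorph M (Model d)) (κ : σ ↪ Fin d) (O : Set (Model d))
      (m : Model d → Model d [⋀^Fin 1]→L[ℝ] ℝ), IsCrossChart Y e κ ∧ HasLogExpr Θ e κ O m ∧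
        a ∈ e.source ∧ e a ∈ O) (s : σ) :
    ∃ R : M → ℝ, ContMDiff (𝓡 d) 𝓘(ℝ, ℝ) ∞ R ∧ ∀ a ∈ X,
      ∀ (e : OpenPartialHomeomorph M (Model d)) (κ : σ ↪ Fin d) (O : Set (Model d))
        (m : Model d → Model d [⋀^Fin 1]→L[ℝ] ℝ), IsCrossChart Y e κ → HasLogExpr Θ e κ O m →
          a ∈ e.source → e a ∈ O → toCov (m (e a)) (EuclideanSpace.single (κ s) 1) = R a := by
  -- Convexity holds because at a point of `X` at most one value is allowed, that in any one chart;
  -- `toCov_single_eq` shows that this value works for all charts.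
  set T : M → Set ℝ := fun a => {y : ℝ | a ∈ X →
    ∀ (e : OpenPartialHomeomorph M (Model d)) (κ : σ ↪ Fin d) (O : Set (Model d))
      (m : Model d → Model d [⋀^Fin 1]→L[ℝ] ℝ), IsCrossChart Y e κ → HasLogExpr Θ e κ O m →
        a ∈ e.source → e a ∈ O → toCov (m (e a)) (EuclideanSpace.single (κ s) 1) = y}
  suffices h : ∃ R : M → ℝ, ContMDiff (𝓡 d) 𝓘(ℝ, ℝ) ∞ R ∧ ∃ N, IsOpen N ∧ X ⊆ N ∧
      ∀ u ∈ N, R u ∈ T u by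
    obtain ⟨R, hR, N, -, hXN, h1⟩ := h
    exact ⟨R, hR, fun a ha => h1 a (hXN ha) ha⟩
  refine exists_contMDiff_near hX (fun a => ?_) fun a ha => ?_
  · intro y hy y' hy' r t _ _ hrt ha e κ O m h1 h2 h3 h4
    have h5 := hy ha e κ O m h1 h2 h3 h4
    have h6 := hy' ha e κ O m h1 h2 h3 h4
    rw [← h5, ← h6, ← add_smul, hrt, one_smul]
  · obtain ⟨e, κ, O, m, he, hm, hae, haO⟩ := h a ha
    refine ⟨e.source ∩ e ⁻¹' O, e.isOpen_inter_preimage hm.isOpen, ⟨hae, haO⟩,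
      fun u => toCov (m (e u)) (EuclideanSpace.single (κ s) 1), ?_, ?_⟩
    · have h1 : ContDiffOn ℝ ∞ (fun x => toCov (m x) (EuclideanSpace.single (κ s) 1)) O :=
        (toCov.contDiff.comp_contDiffOn hm.smooth).clm_apply contDiffOn_const
      exact h1.contMDiffOn.comp ((contMDiffOn_of_mem_maximalAtlas he.mem_atlas).mono
        inter_subset_left) fun u hu => hu.2
    · intro u hu huX e' κ' O' m' he' hm' hue' huO'
      exact toCov_single_eq he' he hm' hm hu.1 hue' huO' hu.2 (hXY u huX) s

end Local

end
end LogSymp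

namespace LogSymp

noncomputable section

set_option linter.unusedSectionVars false
set_option maxSynthPendingDepth 3

/-! ### The restriction of a log `1`-form, extended along the fibres -/

section Restriction

variable {d k : ℕ} {M : Type*} [TopologicalSpace M] [ChartedSpace (Model d) M]
  [IsManifold (𝓡 d) ∞ M] {σ : Type} [Fintype σ] {f : σ → M → ℝ} {X N : Set M} {π : M → M}
  {e e' : OpenPartialHomeomorph M (Model d)} {κ κ' : σ ↪ Fin d} {x₀ x₀' : Model d} {ρ ρ' : ℝ}
  {Θ : DForm d M 1} {m m' : Model d → Model d [⋀^Fin 1]→L[ℝ] ℝ}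

/-- A tubular chart with log components of the `1`-form `Θ`. -/
structure IsLogTubChart (Θ : DForm d M 1) (f : σ → M → ℝ) (N : Set M) (π : M → M)
    (e : OpenPartialHomeomorph M (Model d)) (κ : σ ↪ Fin d) (x₀ : Model d) (ρ : ℝ)
    (m : Model d → Model d [⋀^Fin 1]→L[ℝ] ℝ) : Prop where
  tub : IsTubChart f π e κ x₀ ρ
  subset : e.source ⊆ N
  expr : HasLogExpr Θ e κ e.target m

lemma exists_isLogTubChart (hN : IsTube (d := d) f X N π)
    (hΘ : ∀ a ∈ X, ∀ (e : OpenPartialHomeomorph M (Model d)) (κ : σ ↪ Fin d), IsFunChart f e κ →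
      e.source ⊆ N → a ∈ e.source → ∃ (O : Set (Model d))
        (m : Model d → Model d [⋀^Fin 1]→L[ℝ] ℝ), HasLogExpr Θ e κ O m ∧ e a ∈ O)
    {a : M} (ha : a ∈ X) {V : Set M} (hV : IsOpen V) (haV : a ∈ V) :
    ∃ (e : OpenPartialHomeomorph M (Model d)) (κ : σ ↪ Fin d) (ρ : ℝ)
      (m : Model d → Model d [⋀^Fin 1]→L[ℝ] ℝ), IsLogTubChart Θ f N π e κ (e a) ρ m ∧
        a ∈ e.source ∧ e.source ⊆ V := by
  obtain ⟨e, κ, ρ, he, hes, hae⟩ := hN.small_chart a ha V hV haV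
  obtain ⟨O, m, hm, haO⟩ := hΘ a ha e κ he.funChart (hes.trans inter_subset_left) hae
  obtain ⟨ρ₁, hρ₁, hball⟩ := Metric.isOpen_iff.1 hm.isOpen (e a) haO
  obtain ⟨e', he', hs', hmem, h1, h2⟩ := he.exists_restr (lt_min hρ₁ he.pos) (min_le_right ρ₁ ρ)
  refine ⟨e', κ, min ρ₁ ρ, m, ⟨by rw [h1]; exact he', hs'.trans (hes.trans inter_subset_left),
    ⟨e'.open_target, Subset.rfl, hm.smooth.mono ?_, fun x hx hx0 => ?_⟩⟩,
    hmem a hae (Metric.mem_ball_self he'.pos), hs'.trans (hes.trans inter_subset_right)⟩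
  · rw [he'.target_eq]
    exact (Metric.ball_subset_ball (min_le_left _ _)).trans hball
  · rw [he'.target_eq] at hx
    rw [← hm.expr x (hball (Metric.ball_subset_ball (min_le_left _ _) hx)) hx0, inChart, inChart,
      h2, show (⇑e'.symm : Model d → M) = e.symm from funext h2]

lemma IsLogTubChart.exists_restr (h : IsLogTubChart Θ f N π e κ x₀ ρ m) (hρ' : 0 < ρ') (hle : ρ' ≤ ρ) :
    ∃ e' : OpenPartialHomeomorph M (Model d), IsLogTubChart Θ f N π e' κ x₀ ρ' m ∧
      e'.source ⊆ e.source ∧ (∀ u ∈ e.source, e u ∈ Metric.ball x₀ ρ' → u ∈ e'.source) ∧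
      (∀ u, e' u = e u) ∧ ∀ x, e'.symm x = e.symm x := by
  obtain ⟨e', he', hs', hmem, h1, h2⟩ := h.tub.exists_restr hρ' hle
  have hsub : e'.target ⊆ e.target := by
    rw [he'.target_eq, h.tub.target_eq]
    exact Metric.ball_subset_ball hle
  refine ⟨e', ⟨he', hs'.trans h.subset, ⟨e'.open_target, Subset.rfl, h.expr.smooth.mono hsub,
    fun x hx hx0 => ?_⟩⟩, hs', hmem, h1, h2⟩
  rw [← h.expr.expr x (hsub hx) hx0, inChart, inChart, h2,
    show (⇑e'.symm : Model d → M) = e.symm from funext h2]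

/-- A tubular chart is shrunk around `a`, first until both forms have log components on it, then
until the Moser path is nondegenerate on the ball. -/
theorem exists_isMoserChart {Ω : DForm d M 2} (hN : IsTube (d := d) f X N π)
    (hΩ : ∀ a ∈ X, ∀ (e : OpenPartialHomeomorph M (Model d)) (κ : σ ↪ Fin d), IsFunChart f e κ →
      e.source ⊆ N → a ∈ e.source → ∃ (O : Set (Model d))
        (G : Model d → Model d [⋀^Fin 2]→L[ℝ] ℝ), HasLogExpr Ω e κ O G ∧ e a ∈ O ∧
          ∀ v, (∀ w, toBil (G (e a)) v w = 0) → v = 0)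
    (hΘ : ∀ a ∈ X, ∀ (e : OpenPartialHomeomorph M (Model d)) (κ : σ ↪ Fin d), IsFunChart f e κ →
      e.source ⊆ N → a ∈ e.source → ∃ (O : Set (Model d))
        (m : Model d → Model d [⋀^Fin 1]→L[ℝ] ℝ), HasLogExpr Θ e κ O m ∧ e a ∈ O)
    (hcl : ∀ p ∈ N, (∀ s, f s p ≠ 0) → extD Ω p = 0) {a : M} (ha : a ∈ X) :
    ∃ (e : OpenPartialHomeomorph M (Model d)) (κ : σ ↪ Fin d) (x₀ : Model d) (ρ : ℝ)
      (g : Model d → Bil d), IsMoserChart Ω f N π e κ x₀ ρ g ∧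
        (∃ x₀ ρ m, IsLogTubChart Θ f N π e κ x₀ ρ m) ∧ a ∈ e.source := by
  obtain ⟨e, κ, ρ, m, he, hae, -⟩ := exists_isLogTubChart hN hΘ ha isOpen_univ (mem_univ a)
  obtain ⟨O, G, hG, haO, hnd⟩ := hΩ a ha e κ he.tub.funChart he.subset hae
  obtain ⟨ρ₁, hρ₁, hball⟩ := Metric.isOpen_iff.1 hG.isOpen (e a) haO
  have hcl' : IsLogClosed κ (e a) ρ₁ (fun x => toBil (G x)) := by
    refine isLogClosed_of_extDeriv_eq_zero he.tub.center
      (toBil.contDiff.comp_contDiffOn (hG.smooth.mono hball)) (θ := inChart e Ω)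
      (fun x hx hx0 => ?_) fun x hx hx0 u v => ?_
    · have hxe := hG.subset (hball hx)
      have h1 := hG.contDiffAt (hball hx) hx0
      refine ⟨h1, ?_⟩
      rw [← inChart_extD he.tub.funChart.mem_atlas hxe h1, inChart, hcl _ (he.subset (e.map_target hxe))
        fun s => by
          rw [← he.tub.funChart.coord _ (e.map_target hxe), e.right_inv hxe]; exact hx0 s]
      rfl
    · rw [← hG.expr x (hball hx) hx0, toBil_compContinuousLinearMap]
  obtain ⟨ρ₃, hρ₃, hle, hmodel⟩ := exists_isMoserModel (hcl'.mono (min_le_left ρ₁ ρ))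
    (lt_min hρ₁ he.tub.pos) hnd
  obtain ⟨e', he', hs', hmem, h1, h2⟩ := he.exists_restr hρ₃ (hle.trans (min_le_right _ _))
  refine ⟨e', κ, e a, ρ₃, _, ⟨he'.tub, he'.subset, hmodel, fun x hx hx0 u v => ?_⟩,
    ⟨_, _, _, he'⟩, hmem a hae (Metric.mem_ball_self hρ₃)⟩
  rw [he'.tub.target_eq] at hx
  rw [← hG.expr x (hball (Metric.ball_subset_ball (hle.trans (min_le_left _ _)) hx)) hx0, toBil_compContinuousLinearMap,
    toBil_inChart, toBil_inChart, h2, show (⇑e'.symm : Model d → M) = e.symm from funext h2]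

lemma IsLogTubChart.transition (hN : IsTube (d := d) f X N π) (h : IsLogTubChart Θ f N π e κ x₀ ρ m)
    (h' : IsLogTubChart Θ f N π e' κ' x₀' ρ' m') {x : Model d} (hx : x ∈ overlap e e')
    (w : Model d) : toCov (m x) w =
      toCov (m' ((e' ∘ e.symm) x)) (fderiv ℝ (e' ∘ e.symm) x w) := by
  have hψ := contDiffOn_transition h.tub.funChart.mem_atlas h'.tub.funChart.mem_atlas
  have hψ' : ContinuousOn (fderiv ℝ (e' ∘ e.symm)) (overlap e e') :=
    (hψ.fderiv_of_isOpen (m := 0) isOpen_overlap (by simp)).continuousOn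
  have hg : ContinuousOn (fun y => toCov (m y)) (overlap e e') :=
    toCov.continuous.comp_continuousOn (h.expr.smooth.continuousOn.mono fun y hy => hy.1)
  have hg' : ContinuousOn (fun y => toCov (m' ((e' ∘ e.symm) y))) (overlap e e') :=
    toCov.continuous.comp_continuousOn (h'.expr.smooth.continuousOn.comp hψ.continuousOn
      fun y hy => e'.map_source hy.2)
  refine eqOn_of_forall_ne_zero κ (f := fun x => toCov (m x) w)
    (g := fun x => toCov (m' ((e' ∘ e.symm) x)) (fderiv ℝ (e' ∘ e.symm) x w)) isOpen_overlap
    (hg.clm_apply continuousOn_const) (hg'.clm_apply (hψ'.clm_apply continuousOn_const))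
    (fun y hy hy' => ?_) hx
  have hy2 : ∀ s, (e' ∘ e.symm) y (κ' s) ≠ 0 := fun s => by
    rw [h.tub.transition_apply_range h'.tub hy]; exact hy' s
  rw [← h.expr.expr y hy.1 hy', ← h'.expr.expr ((e' ∘ e.symm) y) (e'.map_source hy.2) hy2,
    inChart_transition h.tub.funChart.mem_atlas h'.tub.funChart.mem_atlas Θ hy,
    toCov_compContinuousLinearMap, toCov_compContinuousLinearMap, toCov_compContinuousLinearMap,
    h.tub.fderiv_transition_logFrame hN h'.tub h.subset h'.subset hy]

open Classical in
/-- The `1`-form `π^* (Θ|_X)`. -/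
def fibreExt (Θ : DForm d M 1) (f : σ → M → ℝ) (N : Set M) (π : M → M) : DForm d M 1 := fun u =>
  if h : ∃ w : ((OpenPartialHomeomorph M (Model d) × (σ ↪ Fin d)) × Model d × ℝ) ×
      (Model d → Model d [⋀^Fin 1]→L[ℝ] ℝ),
      IsLogTubChart Θ f N π w.1.1.1 w.1.1.2 w.1.2.1 w.1.2.2 w.2 ∧ u ∈ w.1.1.1.source then
    toOneForm ((toCov (h.choose.2 (cproj h.choose.1.1.2 (h.choose.1.1.1 u)))).comp
      ((cproj h.choose.1.1.2).comp (dmap h.choose.1.1.1 u))) else 0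

/-- The components of `Θ` at projected points and the projected vectors transform compatibly between
tubular charts, so the chart chosen in `fibreExt` does not matter. -/
lemma IsLogTubChart.toCov_fibreExt (hN : IsTube (d := d) f X N π)
    (h : IsLogTubChart Θ f N π e κ x₀ ρ m) {x : Model d} (hx : x ∈ e.target) (v : Model d) :
    toCov (inChart e (fibreExt Θ f N π) x) v = toCov (m (cproj κ x)) (cproj κ v) := by
  have hex : ∃ w : ((OpenPartialHomeomorph M (Model d) × (σ ↪ Fin d)) × Model d × ℝ) ×
      (Model d → Model d [⋀^Fin 1]→L[ℝ] ℝ),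
      IsLogTubChart Θ f N π w.1.1.1 w.1.1.2 w.1.2.1 w.1.2.2 w.2 ∧
        e.symm x ∈ w.1.1.1.source := ⟨(((e, κ), x₀, ρ), m), h, e.map_target hx⟩
  rw [toCov_inChart]
  simp only [fibreExt, dif_pos hex, toCov_toOneForm]
  obtain ⟨h1, h2⟩ := hex.choose_spec
  generalize hex.choose = w at h1 h2
  have hov : x ∈ overlap e w.1.1.1 := ⟨hx, h2⟩
  have h0 : (0 : ℝ) ∈ Icc (0 : ℝ) 1 := left_mem_Icc.2 zero_le_one
  obtain ⟨h3, h4⟩ := h.tub.transition_dil hN h1.tub h.subset h1.subset hov h0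
  simp only [dil_zero] at h3 h4
  have h5 := h.transition hN h1 h3 (cproj κ v)
  rw [h4, ← h.tub.cproj_fderiv_transition hN h1.tub h.subset h1.subset hov,
    fderiv_transition h.tub.funChart.mem_atlas h1.tub.funChart.mem_atlas hov] at h5
  exact h5.symm

lemma IsLogTubChart.contDiffOn_fibreExt (hN : IsTube (d := d) f X N π)
    (h : IsLogTubChart Θ f N π e κ x₀ ρ m) :
    ContDiffOn ℝ ∞ (inChart e (fibreExt Θ f N π)) e.target := by
  have h1 : ContDiffOn ℝ ∞ (fun x => (m (cproj κ x)).compContinuousLinearMap (cproj κ)) e.target :=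
    contDiff_compContinuousLinearMap.comp_contDiffOn
      ((h.expr.smooth.comp (cproj κ).contDiff.contDiffOn fun x hx => by
        rw [← dil_zero]; exact h.tub.cproj_mem hx (left_mem_Icc.2 zero_le_one)).prodMk
        contDiffOn_const)
  refine h1.congr fun x hx => ?_
  rw [← toOneForm_toCov (inChart e _ x), ← toOneForm_toCov (ContinuousAlternatingMap.compContinuousLinearMap _ _)]
  congr 1
  ext v : 1
  rw [h.toCov_fibreExt hN hx, toCov_compContinuousLinearMap]

/-- Along `X` the tangential components of both forms agree, and tangential derivatives see nothing
else. Hence the tangential part of `dμ` is the exterior derivative of an ordinary smooth form. -/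
lemma IsLogTubChart.extDeriv_fibreExt (hN : IsTube (d := d) f X N π)
    (h : IsLogTubChart Θ f N π e κ x₀ ρ m) {x : Model d} (hx : x ∈ e.target)
    (hc : cproj κ x = x) (u v : Model d) :
    toBil (extDeriv (inChart e (fibreExt Θ f N π)) x) (cproj κ u) (cproj κ v) =
      toCov (fderiv ℝ m x (cproj κ u)) (cproj κ v) -
        toCov (fderiv ℝ m x (cproj κ v)) (cproj κ u) := by
  have hd : DifferentiableAt ℝ (inChart e (fibreExt Θ f N π)) x :=
    ((h.contDiffOn_fibreExt hN).contDiffAt (e.open_target.mem_nhds hx)).differentiableAt (by simp)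
  have hm : DifferentiableAt ℝ m (cproj κ x) := by
    rw [hc]
    exact (h.expr.smooth.contDiffAt (e.open_target.mem_nhds hx)).differentiableAt (by simp)
  have key : ∀ z w, toCov (fderiv ℝ (inChart e (fibreExt Θ f N π)) x (cproj κ z)) (cproj κ w) =
      toCov (fderiv ℝ m x (cproj κ z)) (cproj κ w) := by
    intro z w
    have h1 : HasFDerivAt (fun y => toCov (inChart e (fibreExt Θ f N π) y) (cproj κ w)) _ x :=
      (toCov.hasFDerivAt.comp x hd.hasFDerivAt).clm_apply (hasFDerivAt_const (cproj κ w) x)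
    have h2 : HasFDerivAt (fun y => toCov (m (cproj κ y)) (cproj κ w)) _ x :=
      (toCov.hasFDerivAt.comp x (hm.hasFDerivAt.comp x (cproj κ).hasFDerivAt)).clm_apply
        (hasFDerivAt_const (cproj κ w) x)
    have h3 : (fun y => toCov (inChart e (fibreExt Θ f N π) y) (cproj κ w)) =ᶠ[𝓝 x]
        fun y => toCov (m (cproj κ y)) (cproj κ w) := by
      filter_upwards [e.open_target.mem_nhds hx] with y hy
      rw [h.toCov_fibreExt hN hy, cproj_cproj]
    have h4 := congrArg (fun l : Model d →L[ℝ] ℝ => l (cproj κ z))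
      (h1.unique (h2.congr_of_eventuallyEq h3))
    simp [cproj_cproj, hc] at h4
    exact h4
  rw [extDeriv_apply_two, key, key]

end Restriction

/-! ### Forms along the intersection -/

section Tangent

variable {d k : ℕ} {M : Type*} [TopologicalSpace M] [ChartedSpace (Model d) M]
  [IsManifold (𝓡 d) ∞ M] {σ : Type} [Fintype σ] {X : Set M}
  {e : OpenPartialHomeomorph M (Model d)} {κ : σ ↪ Fin d}

/-- Functions that agree on `X` have the same derivatives along `X`. -/
lemma dfun_eq_of_eqOn (he : e ∈ IsManifold.maximalAtlas (𝓡 d) ∞ M)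
    (hX : ∀ x ∈ e.target, cproj κ x = x → e.symm x ∈ X) {p : M} (hp : p ∈ e.source)
    (hc : cproj κ (e p) = e p) {φ ψ : M → ℝ} (hφ : MDifferentiableAt (𝓡 d) 𝓘(ℝ, ℝ) φ p)
    (hψ : MDifferentiableAt (𝓡 d) 𝓘(ℝ, ℝ) ψ p) (h : ∀ᶠ q in 𝓝 p, q ∈ X → φ q = ψ q)
    (u : Model d) :
    dfun φ p (dpar e.symm (e p) (cproj κ u)) = dfun ψ p (dpar e.symm (e p) (cproj κ u)) := by
  have hx := e.map_source hp
  have hdiff : ∀ {χ : M → ℝ}, MDifferentiableAt (𝓡 d) 𝓘(ℝ, ℝ) χ p →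
      dfun χ p (dpar e.symm (e p) (cproj κ u)) = fderiv ℝ (χ ∘ e.symm ∘ cproj κ) (e p) u := by
    intro χ hχ
    have h1 := dfun_dpar (f := χ) he hx (by rwa [e.left_inv hp]) (cproj κ u)
    rw [e.left_inv hp] at h1
    have h2 : DifferentiableAt ℝ (χ ∘ e.symm) (e p) := by
      have h3 : MDifferentiableAt (𝓡 d) 𝓘(ℝ, ℝ) (χ ∘ e.symm) (e p) :=
        MDifferentiableAt.comp (e p) (by rwa [e.left_inv hp]) (chart_symm_mdiff he hx)
      exact h3.differentiableAt
    have h4 : HasFDerivAt ((χ ∘ e.symm) ∘ cproj κ)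
        ((fderiv ℝ (χ ∘ e.symm) (cproj κ (e p))).comp (cproj κ)) (e p) :=
      HasFDerivAt.comp (e p) (by rw [hc]; exact h2.hasFDerivAt) (cproj κ).hasFDerivAt
    rw [h1, show χ ∘ e.symm ∘ cproj κ = (χ ∘ e.symm) ∘ cproj κ from rfl, h4.fderiv, hc]
    rfl
  rw [hdiff hφ, hdiff hψ]
  have h1 : (φ ∘ e.symm ∘ cproj κ) =ᶠ[𝓝 (e p)] (ψ ∘ e.symm ∘ cproj κ) := by
    have h2 : Tendsto (fun x => e.symm (cproj κ x)) (𝓝 (e p)) (𝓝 p) := by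
      have h3 : ContinuousAt (fun x => e.symm (cproj κ x)) (e p) :=
        ContinuousAt.comp (g := e.symm) (by rw [hc]; exact e.symm.continuousAt hx)
          (cproj κ).continuous.continuousAt
      have h4 := h3.tendsto
      rwa [hc, e.left_inv hp] at h4
    have h5 : ∀ᶠ x in 𝓝 (e p), cproj κ x ∈ e.target :=
      (cproj κ).continuous.continuousAt.eventually_mem (e.open_target.mem_nhds (by rwa [hc]))
    filter_upwards [h2.eventually h, h5] with x hx1 hx2
    exact hx1 (hX _ hx2 (cproj_cproj κ x))
  rw [h1.fderiv_eq]

/-- Lets equalities of restrictions to a submanifold be applied to projected coordinate vectors; the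
converse inclusion is not needed. -/
lemma dpar_cproj_mem_tangentTo (he : e ∈ IsManifold.maximalAtlas (𝓡 d) ∞ M) {A : Set M}
    (hA : ∀ x ∈ e.target, cproj κ x = x → e.symm x ∈ A) {p : M} (hp : p ∈ e.source)
    (hc : cproj κ (e p) = e p) (u : Model d) :
    dpar e.symm (e p) (cproj κ u) ∈ tangentTo d A p := by
  intro φ hφ h0
  have h1 := dfun_eq_of_eqOn (ψ := fun _ => 0) he hA hp hc
    ((hφ p).mdifferentiableAt (by simp)) mdifferentiableAt_const
    (Eventually.of_forall fun q hq => h0 q hq) u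
  rw [h1, dfun, mfderiv_const]
  rfl

end Tangent

end
end LogSymp

namespace LogSymp

noncomputable section

set_option linter.unusedSectionVars false
set_option maxSynthPendingDepth 3

/-! ### Calculus of forms on a manifold -/

section Calculus

variable {d k : ℕ} {M : Type*} [TopologicalSpace M] [ChartedSpace (Model d) M]
  [IsManifold (𝓡 d) ∞ M] {e : OpenPartialHomeomorph M (Model d)}
  {Θ Θ' : DForm d M k} {p : M}

lemma tendsto_chart_symm {p : M} (hp : p ∈ e.source) : Tendsto e.symm (𝓝 (e p)) (𝓝 p) := by
  have := (e.symm.continuousAt (e.map_source hp)).tendsto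
  rwa [e.left_inv hp] at this

lemma inChart_congr (hp : p ∈ e.source) (h : ∀ᶠ q in 𝓝 p, Θ q = Θ' q) :
    inChart e Θ =ᶠ[𝓝 (e p)] inChart e Θ' := by
  filter_upwards [(tendsto_chart_symm hp).eventually h] with x hx
  rw [inChart, inChart, hx]

lemma inChart_add (Θ Θ' : DForm d M k) : inChart e (Θ + Θ') = inChart e Θ + inChart e Θ' := rfl

lemma inChart_sum {ι : Type*} (s : Finset ι) (Θ : ι → DForm d M k) :
    inChart e (∑ i ∈ s, Θ i) = ∑ i ∈ s, inChart e (Θ i) := by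
  classical
  induction s using Finset.induction_on with
  | empty => rfl
  | insert i s hi ih => rw [Finset.sum_insert hi, Finset.sum_insert hi, ← ih, inChart_add]

lemma inChart_smul (φ : M → ℝ) (Θ : DForm d M k) :
    inChart e (fun q => φ q • Θ q) = fun x => (φ ∘ e.symm) x • inChart e Θ x := rfl

lemma contDiffAt_comp_symm {φ : M → ℝ} (he : e ∈ IsManifold.maximalAtlas (𝓡 d) ∞ M)
    (hp : p ∈ e.source) (hφ : ContMDiffAt (𝓡 d) 𝓘(ℝ, ℝ) ∞ φ p) :
    ContDiffAt ℝ ∞ (φ ∘ e.symm) (e p) :=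
  (ContMDiffAt.comp (e p) (by rwa [e.left_inv hp])
    (contMDiffAt_symm_of_mem_maximalAtlas he (e.map_source hp))).contDiffAt

lemma SmoothAt.congr (h : SmoothAt Θ p) (h' : ∀ᶠ q in 𝓝 p, Θ' q = Θ q) : SmoothAt Θ' p :=
  ContDiffAt.congr_of_eventuallyEq h (inChart_congr (mem_chart_source _ p) h')

lemma SmoothAt.add (h : SmoothAt Θ p) (h' : SmoothAt Θ' p) : SmoothAt (Θ + Θ') p :=
  ContDiffAt.add h h'

lemma SmoothAt.const_smul (h : SmoothAt Θ p) (r : ℝ) : SmoothAt (r • Θ) p :=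
  ContDiffAt.const_smul r h

lemma SmoothAt.smul {φ : M → ℝ} (hφ : ContMDiffAt (𝓡 d) 𝓘(ℝ, ℝ) ∞ φ p) (h : SmoothAt Θ p) :
    SmoothAt (fun q => φ q • Θ q) p :=
  ContDiffAt.smul (contDiffAt_comp_symm (IsManifold.chart_mem_maximalAtlas p)
    (mem_chart_source _ p) hφ) h

lemma smoothAt_sum {ι : Type*} (s : Finset ι) {Θ : ι → DForm d M k}
    (h : ∀ i ∈ s, SmoothAt (Θ i) p) : SmoothAt (∑ i ∈ s, Θ i) p := by
  rw [SmoothAt, inChart_sum]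
  have h1 := ContDiffAt.sum (𝕜 := ℝ) (n := ∞) h
  refine h1.congr_of_eventuallyEq (Eventually.of_forall fun x => ?_)
  simp

lemma smoothAt_zero : SmoothAt (0 : DForm d M k) p := by
  have : inChart (chartAt (Model d) p) (0 : DForm d M k) = fun _ => 0 := rfl
  rw [SmoothAt, this]
  exact contDiffAt_const

lemma contDiff_toOneForm : ContDiff ℝ ∞ (toOneForm (d := d)) := by
  let L : (Model d →L[ℝ] ℝ) →ₗ[ℝ] (Model d [⋀^Fin 1]→L[ℝ] ℝ) :=
    { toFun := toOneForm
      map_add' := fun α β => by ext v; simp [toOneForm_apply]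
      map_smul' := fun r α => by ext v; simp [toOneForm_apply] }
  exact (LinearMap.toContinuousLinearMap L).contDiff

lemma smoothAt_dfun {φ : M → ℝ} (hφ : ∀ᶠ q in 𝓝 p, ContMDiffAt (𝓡 d) 𝓘(ℝ, ℝ) ∞ φ q) :
    SmoothAt (fun q => toOneForm (dfun (d := d) φ q)) p := by
  set c := chartAt (Model d) p
  have hc : c ∈ IsManifold.maximalAtlas (𝓡 d) ∞ M := IsManifold.chart_mem_maximalAtlas p
  have hp : p ∈ c.source := mem_chart_source _ p
  have h1 : ContDiffAt ℝ ∞ (fderiv ℝ (φ ∘ c.symm)) (c p) :=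
    (contDiffAt_comp_symm hc hp hφ.self_of_nhds).fderiv_right (by simp)
  refine (contDiff_toOneForm.contDiffAt.comp (c p) h1).congr_of_eventuallyEq ?_
  filter_upwards [(tendsto_chart_symm hp).eventually hφ,
    c.open_target.mem_nhds (c.map_source hp)] with x hx hxt
  exact inChart_dfun hc hxt (hx.mdifferentiableAt (by simp))

lemma extD_congr (h : ∀ᶠ q in 𝓝 p, Θ q = Θ' q) : extD Θ p = extD Θ' p := by
  rw [extD, extD, (inChart_congr (mem_chart_source _ p) h).extDeriv_eq]

lemma extD_add (h : SmoothAt Θ p) (h' : SmoothAt Θ' p) :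
    extD (Θ + Θ') p = extD Θ p + extD Θ' p := by
  rw [extD, inChart_add, extDeriv_add (ContDiffAt.differentiableAt h (by simp))
    (ContDiffAt.differentiableAt h' (by simp))]
  rfl

lemma extD_const_smul (r : ℝ) : extD (r • Θ) p = r • extD Θ p := by
  rw [extD, show inChart (chartAt (Model d) p) (r • Θ) = r • inChart (chartAt (Model d) p) Θ from rfl,
    extDeriv_smul]
  rfl

lemma extD_zero : extD (0 : DForm d M k) p = 0 := by
  have := extD_const_smul (Θ := (0 : DForm d M k)) (p := p) 0
  rwa [smul_zero, zero_smul] at this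

lemma extD_sum {ι : Type*} (s : Finset ι) {Θ : ι → DForm d M k}
    (h : ∀ i ∈ s, SmoothAt (Θ i) p) : extD (∑ i ∈ s, Θ i) p = ∑ i ∈ s, extD (Θ i) p := by
  classical
  induction s using Finset.induction_on with
  | empty => rw [Finset.sum_empty, Finset.sum_empty, extD_zero]
  | insert i s hi ih =>
    rw [Finset.sum_insert hi, Finset.sum_insert hi, extD_add (h i (Finset.mem_insert_self i s))
      (smoothAt_sum s fun j hj => h j (Finset.mem_insert_of_mem hj)),
      ih fun j hj => h j (Finset.mem_insert_of_mem hj)]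

lemma toBil_extD (Θ : DForm d M 1) (he : e ∈ IsManifold.maximalAtlas (𝓡 d) ∞ M)
    (hp : p ∈ e.source) (h : SmoothAt Θ p) (u v : Model d) :
    toBil (extD Θ p) u v = toBil (extDeriv (inChart e Θ) (e p)) (dmap e p u) (dmap e p v) := by
  rw [← inChart_extD he (e.map_source hp) ((smoothAt_iff he hp).1 h), toBil_inChart, e.left_inv hp,
    dpar_dmap he hp, dpar_dmap he hp]

lemma dfun_eq_fderiv {φ : M → ℝ} (he : e ∈ IsManifold.maximalAtlas (𝓡 d) ∞ M)
    (hp : p ∈ e.source) (hφ : MDifferentiableAt (𝓡 d) 𝓘(ℝ, ℝ) φ p) (v : Model d) :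
    dfun φ p v = fderiv ℝ (φ ∘ e.symm) (e p) (dmap e p v) := by
  have h1 := dfun_dpar (f := φ) he (e.map_source hp) (by rwa [e.left_inv hp]) (dmap e p v)
  rwa [e.left_inv hp, dpar_dmap he hp] at h1

lemma toCov_eq_inChart (Θ : DForm d M 1) (he : e ∈ IsManifold.maximalAtlas (𝓡 d) ∞ M)
    (hp : p ∈ e.source) (v : Model d) :
    toCov (Θ p) v = toCov (inChart e Θ (e p)) (dmap e p v) := by
  rw [toCov_inChart, e.left_inv hp, dpar_dmap he hp]

lemma toBil_extD_smul {Θ : DForm d M 1} {φ : M → ℝ} (hφ : ContMDiffAt (𝓡 d) 𝓘(ℝ, ℝ) ∞ φ p)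
    (h : SmoothAt Θ p) (u v : Model d) :
    toBil (extD (fun q => φ q • Θ q) p) u v =
      dfun φ p u * toCov (Θ p) v - dfun φ p v * toCov (Θ p) u + φ p * toBil (extD Θ p) u v := by
  set c := chartAt (Model d) p
  have hc : c ∈ IsManifold.maximalAtlas (𝓡 d) ∞ M := IsManifold.chart_mem_maximalAtlas p
  have hp : p ∈ c.source := mem_chart_source _ p
  have hφm := hφ.mdifferentiableAt (by simp : (∞ : WithTop ℕ∞) ≠ 0)
  have hd : DifferentiableAt ℝ (inChart c Θ) (c p) := ContDiffAt.differentiableAt h (by simp)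
  have hφd : DifferentiableAt ℝ (φ ∘ c.symm) (c p) :=
    (contDiffAt_comp_symm hc hp hφ).differentiableAt (by simp)
  have hfd : HasFDerivAt (fun x => (φ ∘ c.symm) x • inChart c Θ x) _ (c p) :=
    hφd.hasFDerivAt.smul hd.hasFDerivAt
  rw [toBil_extD _ hc hp (h.smul hφ), toBil_extD _ hc hp h, inChart_smul, extDeriv_apply_two,
    extDeriv_apply_two, hfd.fderiv, dfun_eq_fderiv hc hp hφm,
    dfun_eq_fderiv hc hp hφm, toCov_eq_inChart Θ hc hp, toCov_eq_inChart Θ hc hp]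
  simp [c.left_inv hp]
  ring

lemma extD_dfun {φ : M → ℝ} (hφ : ∀ᶠ q in 𝓝 p, ContMDiffAt (𝓡 d) 𝓘(ℝ, ℝ) ∞ φ q) :
    extD (fun q => toOneForm (dfun (d := d) φ q)) p = 0 := by
  set c := chartAt (Model d) p
  have hc : c ∈ IsManifold.maximalAtlas (𝓡 d) ∞ M := IsManifold.chart_mem_maximalAtlas p
  have hp : p ∈ c.source := mem_chart_source _ p
  refine toBil_injective (ContinuousLinearMap.ext fun u => ContinuousLinearMap.ext fun v => ?_)
  have h0 := contDiffAt_comp_symm hc hp hφ.self_of_nhds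
  have h1 : ContDiffAt ℝ ∞ (fderiv ℝ (φ ∘ c.symm)) (c p) := h0.fderiv_right (by simp)
  have h2 : inChart c (fun q => toOneForm (dfun (d := d) φ q)) =ᶠ[𝓝 (c p)]
      fun x => toOneForm (fderiv ℝ (φ ∘ c.symm) x) := by
    filter_upwards [(tendsto_chart_symm hp).eventually hφ,
      c.open_target.mem_nhds (c.map_source hp)] with x hx hxt
    exact inChart_dfun hc hxt (hx.mdifferentiableAt (by simp))
  have h3 : DifferentiableAt ℝ (fun x => toOneForm (fderiv ℝ (φ ∘ c.symm) x)) (c p) :=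
    ((contDiff_toOneForm.contDiffAt.comp (c p) h1).differentiableAt (by simp) :)
  rw [toBil_extD _ hc hp (smoothAt_dfun hφ), h2.extDeriv_eq, toBil_extDeriv h3]
  simp only [toCov_toOneForm]
  have h4 : IsSymmSndFDerivAt ℝ (φ ∘ c.symm) (c p) :=
    h0.isSymmSndFDerivAt minSmoothness_two_le
  rw [h4.eq, sub_self]
  simp

end Calculus

end
end LogSymp

namespace LogSymp

noncomputable section

set_option linter.unusedSectionVars false
set_option maxSynthPendingDepth 3

/-! ### The log components along the intersection -/

section Decomposition

variable {d : ℕ} {M : Type*} [TopologicalSpace M] [ChartedSpace (Model d) M]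
  [IsManifold (𝓡 d) ∞ M] {σ : Type} [Fintype σ] {ι : Type*} [Fintype ι]
  {lab : σ → ι} {f : σ → M → ℝ} {X N : Set M} {π : M → M}
  {e : OpenPartialHomeomorph M (Model d)} {κ : σ ↪ Fin d} {p : M}
  {Ω a : DForm d M 2} {b : ι → DForm d M 1} {c : ι → ι → M → ℝ} {H : ι → M → ℝ} {μ : DForm d M 1}

open Classical in
/-- `dH_i`, plus `df_s / f_s` if `s` is the label of `i`. -/
def logPart (lab : σ → ι) (f : σ → M → ℝ) (H : ι → M → ℝ) (i : ι) (p : M) : Model d →L[ℝ] ℝ :=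
  dfun (H i) p + ∑ s, if lab s = i then dlog (f s) p else 0

open Classical in
/-- The coefficient of the coordinate covector that belongs to the label `i`. -/
def labCoord (lab : σ → ι) (κ : σ ↪ Fin d) (i : ι) (u : Model d) : ℝ :=
  ∑ s, if lab s = i then u (κ s) else 0

lemma sum_labCoord (i : ι → ℝ) (u : Model d) :
    ∑ j, labCoord lab κ j u * i j = ∑ s, u (κ s) * i (lab s) := by
  classical
  simp only [labCoord, Finset.sum_mul]
  rw [Finset.sum_comm]
  refine Finset.sum_congr rfl fun s _ => ?_
  simp

/-- The decomposition of a closed log form near `X`, in terms of defining functions `f` of the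
hypersurfaces through `X`. -/
structure IsReducedDecomp (lab : σ → ι) (f : σ → M → ℝ) (X N : Set M) (Ω a : DForm d M 2)
    (b : ι → DForm d M 1) (c : ι → ι → M → ℝ) (H : ι → M → ℝ) (μ : DForm d M 1) : Prop where
  smooth_a : IsSmoothForm a
  smooth_b : ∀ i, IsSmoothForm (b i)
  smooth_H : ∀ i, ContMDiff (𝓡 d) 𝓘(ℝ, ℝ) ∞ (H i)
  antisymm : ∀ i j p, c j i p = - c i j p
  closed_b : ∀ p ∈ X, ∀ i, (∀ᶠ q in 𝓝 p, extD (b i) q = 0) ∨ ∀ᶠ q in 𝓝 p, H i q = 0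
  const : ∀ p ∈ X, ∀ i j, (∀ᶠ q in 𝓝 p, c i j q = c i j p) ∨
    (i ∉ range lab ∧ ∀ᶠ q in 𝓝 p, H i q = 0) ∨ (j ∉ range lab ∧ ∀ᶠ q in 𝓝 p, H j q = 0)
  formula : ∀ p ∈ N, (∀ s, f s p ≠ 0) → Ω p = a p + ∑ i, wedge (logPart lab f H i p) (b i p) +
    (1 / 2 : ℝ) • ∑ i, ∑ j, c i j p •
      wedge (logPart lab f H i p) (toOneForm (logPart lab f H j p)) + extD μ p

lemma logPart_eq_zero {i : ι} (hi : i ∉ range lab) (h : ∀ᶠ q in 𝓝 p, H i q = 0) :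
    ∀ᶠ q in 𝓝 p, logPart (d := d) lab f H i q = 0 := by
  filter_upwards [h.eventually_nhds] with q hq
  have h1 : dfun (d := d) (H i) q = 0 := by
    have h2 : mfderiv (𝓡 d) 𝓘(ℝ, ℝ) (H i) q = mfderiv (𝓡 d) 𝓘(ℝ, ℝ) (fun _ => (0 : ℝ)) q :=
      Filter.EventuallyEq.mfderiv_eq hq
    rw [dfun, h2, mfderiv_const]
    rfl
  rw [logPart, h1, zero_add]
  refine Finset.sum_eq_zero fun s _ => if_neg fun hs => hi ⟨s, hs⟩

/-- In the log frame the singular part `df_s / f_s` is the constant covector `u ↦ u (κ s)`, so every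
term of the decomposition extends smoothly to `X`. -/
lemma logPart_dpar (hH : ∀ i, ContMDiff (𝓡 d) 𝓘(ℝ, ℝ) ∞ (H i)) (he : IsFunChart f e κ)
    {x : Model d} (hx : x ∈ e.target) (hx0 : ∀ s, x (κ s) ≠ 0) (i : ι) (u : Model d) :
    logPart lab f H i (e.symm x) (dpar e.symm x (logFrame κ x u)) =
      fderiv ℝ (H i ∘ e.symm) x (logFrame κ x u) + labCoord lab κ i u := by
  classical
  rw [logPart, add_apply, dfun_dpar he.mem_atlas hx
    ((hH i _).mdifferentiableAt (by simp)), sum_apply, labCoord]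
  congr 1
  refine Finset.sum_congr rfl fun s _ => ?_
  split_ifs
  · rw [dlog, smul_apply, he.dfun_dpar hx, logFrame_apply_range,
      ← he.coord _ (e.map_target hx), e.right_inv hx, smul_eq_mul, inv_mul_cancel_left₀ (hx0 s)]
  · rfl

/-- The log components of `Ω` at the points of `X`. -/
theorem IsReducedDecomp.formula_at (h : IsReducedDecomp lab f X N Ω a b c H μ)
    (he : IsFunChart f e κ) (hes : e.source ⊆ N) (hpX : p ∈ X) (hp : p ∈ e.source)
    (hc : cproj κ (e p) = e p) {g : Model d → Bil d}
    {m : Model d → Model d [⋀^Fin 1]→L[ℝ] ℝ} (hg : ContinuousOn g e.target)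
    (hexpr : ∀ x ∈ e.target, (∀ s, x (κ s) ≠ 0) → ∀ u v,
      g x u v = toBil (inChart e Ω x) (logFrame κ x u) (logFrame κ x v))
    (hm : HasLogExpr μ e κ e.target m) (u v : Model d) :
    g (e p) u v =
      toBil (a p) (dpar e.symm (e p) (cproj κ u)) (dpar e.symm (e p) (cproj κ v)) +
      ∑ i, ((dfun (H i) p (dpar e.symm (e p) (cproj κ u)) + labCoord lab κ i u) *
          toCov (b i p) (dpar e.symm (e p) (cproj κ v)) -
        (dfun (H i) p (dpar e.symm (e p) (cproj κ v)) + labCoord lab κ i v) *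
          toCov (b i p) (dpar e.symm (e p) (cproj κ u))) +
      (1 / 2 : ℝ) * ∑ i, ∑ j, c i j p *
        ((dfun (H i) p (dpar e.symm (e p) (cproj κ u)) + labCoord lab κ i u) *
          (dfun (H j) p (dpar e.symm (e p) (cproj κ v)) + labCoord lab κ j v) -
        (dfun (H i) p (dpar e.symm (e p) (cproj κ v)) + labCoord lab κ i v) *
          (dfun (H j) p (dpar e.symm (e p) (cproj κ u)) + labCoord lab κ j u)) +
      (toCov (fderiv ℝ m (e p) (cproj κ u)) v - toCov (fderiv ℝ m (e p) (cproj κ v)) u) := by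
  have hx := e.map_source hp
  -- The coefficients may be frozen at `p`: where `c i j` is not known to be locally constant, one
  -- of the two factors vanishes near `p`.
  have hconst : ∀ᶠ q in 𝓝 p, ∀ i j, c i j q • wedge (logPart lab f H i q)
      (toOneForm (logPart lab f H j q)) = c i j p • wedge (d := d) (logPart lab f H i q)
      (toOneForm (logPart lab f H j q)) := by
    refine eventually_all.2 fun i => eventually_all.2 fun j => ?_
    rcases h.const p hpX i j with h1 | ⟨hi, h1⟩ | ⟨hj, h1⟩
    · filter_upwards [h1] with q hq
      rw [hq]
    · filter_upwards [logPart_eq_zero (d := d) (f := f) hi h1] with q hq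
      rw [hq]
      refine toBil_injective (ContinuousLinearMap.ext fun u => ContinuousLinearMap.ext fun v => ?_)
      simp [toBil_wedge]
    · filter_upwards [logPart_eq_zero (d := d) (f := f) hj h1] with q hq
      rw [hq]
      refine toBil_injective (ContinuousLinearMap.ext fun u => ContinuousLinearMap.ext fun v => ?_)
      simp [toBil_wedge, toCov_toOneForm]
  obtain ⟨V, hV, hVo, hpV⟩ := eventually_nhds_iff.1 hconst
  set O' := e.target ∩ e.symm ⁻¹' V
  have hO' : IsOpen O' := e.symm.continuousOn.isOpen_inter_preimage e.open_target hVo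
  have hpO' : e p ∈ O' := ⟨hx, by rwa [mem_preimage, e.left_inv hp]⟩
  set D : ι → Model d → Model d → ℝ := fun i x w =>
    fderiv ℝ (H i ∘ e.symm) x (logFrame κ x w) + labCoord lab κ i w with hD
  set B : ι → Model d → Model d → ℝ := fun i x w =>
    toCov (inChart e (b i) x) (logFrame κ x w) with hB
  have hL : ∀ w, ContinuousOn (fun x => logFrame κ x w) O' := fun w =>
    ((contDiff_logFrame κ).continuous.clm_apply continuous_const).continuousOn
  have hDc : ∀ i w, ContinuousOn (fun x => D i x w) O' := fun i w => by
    have h1 : ContDiffOn ℝ ∞ (H i ∘ e.symm) e.target := by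
      have := contDiffOn_comp_symm he.mem_atlas ((h.smooth_H i).contMDiffOn (s := univ))
      simpa using this
    exact ((((h1.fderiv_of_isOpen (m := 0) e.open_target (by simp)).continuousOn).mono
      fun y hy => hy.1).clm_apply (hL w)).add continuousOn_const
  have hBc : ∀ i w, ContinuousOn (fun x => B i x w) O' := fun i w =>
    (toCov.continuous.comp_continuousOn fun y hy =>
      ((h.smooth_b i).contDiffAt he.mem_atlas hy.1).continuousAt.continuousWithinAt).clm_apply
      (hL w)
  have hac : ContinuousOn (fun x => toBil (inChart e a x) (logFrame κ x u) (logFrame κ x v)) O' :=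
    ((toBil.continuous.comp_continuousOn fun y hy =>
      (h.smooth_a.contDiffAt he.mem_atlas hy.1).continuousAt.continuousWithinAt).clm_apply
      (hL u)).clm_apply (hL v)
  have hmc : ∀ w w', ContinuousOn (fun x => toCov (fderiv ℝ m x (logFrame κ x w)) w') O' :=
    fun w w' => (toCov.continuous.comp_continuousOn
      ((((hm.smooth.fderiv_of_isOpen (m := 0) hm.isOpen (by simp)).continuousOn).mono
        inter_subset_left).clm_apply (hL w))).clm_apply continuousOn_const
  have hgc : ContinuousOn (fun x => g x u v) O' :=
    ((hg.mono inter_subset_left).clm_apply continuousOn_const).clm_apply continuousOn_const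
  -- With frozen coefficients both sides are continuous up to the hyperplanes, so the identity off
  -- them can be evaluated at `e p`.
  have key : EqOn (fun x => g x u v) (fun x =>
      toBil (inChart e a x) (logFrame κ x u) (logFrame κ x v) +
      ∑ i, (D i x u * B i x v - D i x v * B i x u) +
      (1 / 2 : ℝ) * ∑ i, ∑ j, c i j p * (D i x u * D j x v - D i x v * D j x u) +
      (toCov (fderiv ℝ m x (logFrame κ x u)) v - toCov (fderiv ℝ m x (logFrame κ x v)) u)) O' := by
    refine eqOn_of_forall_ne_zero κ hO' hgc ?_ fun x hxO hx0 => ?_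
    · refine ((hac.add (continuousOn_finsetSum _ fun i _ => ?_)).add
        (continuousOn_const.mul (continuousOn_finsetSum _ fun i _ =>
          continuousOn_finsetSum _ fun j _ => ?_))).add ((hmc u v).sub (hmc v u))
      · exact ((hDc i u).mul (hBc i v)).sub ((hDc i v).mul (hBc i u))
      · exact continuousOn_const.mul (((hDc i u).mul (hDc j v)).sub ((hDc i v).mul (hDc j u)))
    · have hxe := hxO.1
      have hf0 : ∀ s, f s (e.symm x) ≠ 0 := fun s => by
        rw [← he.coord _ (e.map_target hxe), e.right_inv hxe]; exact hx0 s
      have h1 := h.formula (e.symm x) (hes (e.map_target hxe)) hf0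
      have h2 := hm.toBil_extDeriv hxO.1 hx0 u v
      rw [← inChart_extD he.mem_atlas hxe (hm.contDiffAt hxO.1 hx0), toBil_inChart] at h2
      simp only [hV _ hxO.2] at h1
      simp only [hexpr x hxO.1 hx0]
      rw [toBil_inChart, h1]
      simp only [map_add, map_sum, map_smul, add_apply,
        sum_apply, smul_apply, toBil_wedge,
        toCov_toOneForm, logPart_dpar h.smooth_H he hxe hx0, smul_eq_mul, h2, hD, hB, toBil_inChart,
        toCov_inChart]
  have h1 := key hpO'
  simp only [hD, hB, logFrame_eq_cproj κ hc, toBil_inChart, toCov_inChart] at h1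
  have h2 : ∀ i w, fderiv ℝ (H i ∘ e.symm) (e p) w = dfun (H i) p (dpar e.symm (e p) w) := by
    intro i w
    rw [← dfun_dpar he.mem_atlas hx ((h.smooth_H i _).mdifferentiableAt (by simp)), e.left_inv hp]
  simp only [h2, e.left_inv hp] at h1
  exact h1

end Decomposition

end
end LogSymp

namespace LogSymp

noncomputable section

set_option linter.unusedSectionVars false
set_option maxSynthPendingDepth 3

/-! ### The normal form of the components along the intersection -/

section Correction

variable {d : ℕ} {M : Type*} [TopologicalSpace M] [ChartedSpace (Model d) M]
  [IsManifold (𝓡 d) ∞ M] {σ : Type} [Fintype σ] {ι : Type*} [Fintype ι]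
  {lab : σ → ι} {f : σ → M → ℝ} {X N : Set M} {π : M → M}
  {e : OpenPartialHomeomorph M (Model d)} {κ : σ ↪ Fin d} {p : M} {x₀ : Model d} {ρ : ℝ}
  {Ω a : DForm d M 2} {b : ι → DForm d M 1} {c : ι → ι → M → ℝ} {H : ι → M → ℝ}
  {μ ν : DForm d M 1} {m : Model d → Model d [⋀^Fin 1]→L[ℝ] ℝ}

/-- The `1`-form `ν + ∑ H_i b_i + ½ ∑ c_ij H_i dH_j`. -/
def correction (ν : DForm d M 1) (b : ι → DForm d M 1) (c : ι → ι → M → ℝ) (H : ι → M → ℝ) :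
    DForm d M 1 := fun q => ν q + ∑ i, H i q • b i q +
  (1 / 2 : ℝ) • ∑ i, ∑ j, (c i j q * H i q) • toOneForm (dfun (H j) q)

/-- `correction` with the coefficients `c_ij` frozen at a point. -/
def frozenCorrection (ν : DForm d M 1) (b : ι → DForm d M 1) (c : ι → ι → ℝ) (H : ι → M → ℝ) :
    DForm d M 1 := ν + ∑ i, (fun q => H i q • b i q) +
  (1 / 2 : ℝ) • ∑ i, ∑ j, c i j • (fun q => H i q • toOneForm (dfun (H j) q) : DForm d M 1)

/-- If `c i j` is not locally constant at `p`, then `H i` or `H j` vanishes near `p`, and the term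
is zero with either coefficient. -/
lemma IsReducedDecomp.correction_eventuallyEq (h : IsReducedDecomp lab f X N Ω a b c H μ)
    (hp : p ∈ X) : ∀ᶠ q in 𝓝 p, correction ν b c H q =
      frozenCorrection ν b (fun i j => c i j p) H q := by
  have h1 : ∀ i j, ∀ᶠ q in 𝓝 p, (c i j q * H i q) • toOneForm (dfun (d := d) (H j) q) =
      c i j p • H i q • toOneForm (dfun (H j) q) := by
    intro i j
    rcases h.const p hp i j with h1 | ⟨-, h1⟩ | ⟨hj, h1⟩
    · filter_upwards [h1] with q hq
      rw [hq, mul_smul]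
    · filter_upwards [h1] with q hq
      simp [hq]
    · filter_upwards [h1.eventually_nhds] with q hq
      have h2 : dfun (d := d) (H j) q = 0 := by
        have h3 : mfderiv (𝓡 d) 𝓘(ℝ, ℝ) (H j) q = mfderiv (𝓡 d) 𝓘(ℝ, ℝ) (fun _ => (0 : ℝ)) q :=
          Filter.EventuallyEq.mfderiv_eq hq
        rw [dfun, h3, mfderiv_const]
        rfl
      have h3 : toOneForm (dfun (d := d) (H j) q) = 0 := by
        rw [h2]
        ext v
        rw [toOneForm_apply]
        rfl
      rw [h3, smul_zero, smul_zero, smul_zero]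
  filter_upwards [eventually_all.2 fun i => eventually_all.2 fun j => h1 i j] with q hq
  simp only [correction, frozenCorrection, Pi.add_apply, Finset.sum_apply, Pi.smul_apply, hq]

lemma IsReducedDecomp.smoothAt_terms (h : IsReducedDecomp lab f X N Ω a b c H μ) (q : M) :
    (∀ i, SmoothAt (fun q => H i q • b i q) q) ∧
      ∀ i j, SmoothAt (fun q => H i q • toOneForm (dfun (d := d) (H j) q)) q :=
  ⟨fun i => SmoothAt.smul (h.smooth_H i q) (h.smooth_b i q), fun i j =>
    SmoothAt.smul (h.smooth_H i q) (smoothAt_dfun (Eventually.of_forall fun q' => h.smooth_H j q'))⟩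

lemma IsReducedDecomp.smoothAt_frozenCorrection (h : IsReducedDecomp lab f X N Ω a b c H μ)
    (C : ι → ι → ℝ) {q : M} (hν : SmoothAt ν q) : SmoothAt (frozenCorrection ν b C H) q :=
  (hν.add (smoothAt_sum _ fun i _ => (h.smoothAt_terms q).1 i)).add
    ((smoothAt_sum _ fun i _ => smoothAt_sum _ fun j _ =>
      ((h.smoothAt_terms q).2 i j).const_smul _).const_smul _)

/-- The derivative of `∑ H_i b_i + ½ ∑ c_ij H_i dH_j` is the part of the decomposition without
singular factors: each `b_i` is closed near `p` unless `H_i` vanishes there, and the `c_ij` are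
frozen. -/
lemma IsReducedDecomp.toBil_extD_correction (h : IsReducedDecomp lab f X N Ω a b c H μ)
    (hp : p ∈ X) (hν : SmoothAt ν p) (u v : Model d) :
    toBil (extD (correction ν b c H) p) u v = toBil (extD ν p) u v +
      (∑ i, (dfun (H i) p u * toCov (b i p) v - dfun (H i) p v * toCov (b i p) u) +
      (1 / 2 : ℝ) * ∑ i, ∑ j, c i j p *
        (dfun (H i) p u * dfun (H j) p v - dfun (H i) p v * dfun (H j) p u)) := by
  obtain ⟨h1, h2⟩ := h.smoothAt_terms p
  have h3 := smoothAt_sum Finset.univ fun i (_ : i ∈ Finset.univ) => h1 i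
  have h4 : ∀ i, SmoothAt (∑ j, c i j p • (fun q => H i q • toOneForm (dfun (H j) q) :
      DForm d M 1)) p := fun i => smoothAt_sum _ fun j _ => (h2 i j).const_smul _
  have h5 : ∀ i, toBil (extD (fun q => H i q • b i q) p) u v =
      dfun (H i) p u * toCov (b i p) v - dfun (H i) p v * toCov (b i p) u := by
    intro i
    rw [toBil_extD_smul (h.smooth_H i p) (h.smooth_b i p)]
    rcases h.closed_b p hp i with h6 | h6
    · rw [h6.self_of_nhds]; simp
    · rw [h6.self_of_nhds]; simp
  rw [extD_congr (h.correction_eventuallyEq hp), frozenCorrection, extD_add (hν.add h3)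
    ((smoothAt_sum _ fun i _ => h4 i).const_smul _), extD_add hν h3, extD_const_smul,
    extD_sum _ fun i _ => h1 i, extD_sum _ fun i _ => h4 i]
  simp only [extD_sum _ fun j _ => (h2 _ j).const_smul _, extD_const_smul, map_add, map_sum,
    map_smul, add_apply, sum_apply, smul_apply, h5, smul_eq_mul,
    toBil_extD_smul (h.smooth_H _ p) (smoothAt_dfun (Eventually.of_forall fun q' => h.smooth_H _ q')),
    toCov_toOneForm, extD_dfun (Eventually.of_forall fun q' => h.smooth_H _ q'), map_zero,
    zero_apply, mul_zero, add_zero]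
  ring

variable [T2Space M] [SecondCountableTopology M]

/-- A smooth form that agrees with `correction` near `X`. -/
lemma IsReducedDecomp.exists_correction (h : IsReducedDecomp lab f X N Ω a b c H μ)
    (hX : IsClosed X) (hν : ∀ p ∈ X, ∀ᶠ q in 𝓝 p, SmoothAt ν q) :
    ∃ η : DForm d M 1, IsSmoothForm η ∧ ∀ p ∈ X, ∀ᶠ q in 𝓝 p, η q = correction ν b c H q := by
  have h1 : ∀ p ∈ X, ∀ᶠ q in 𝓝 p, SmoothAt (correction ν b c H) q := by
    intro p hp
    filter_upwards [(h.correction_eventuallyEq (ν := ν) hp).eventually_nhds, hν p hp] with q hq hq'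
    exact (h.smoothAt_frozenCorrection _ hq').congr hq
  set V := {q | ∀ᶠ q' in 𝓝 q, SmoothAt (correction ν b c H) q'}
  have hV : IsOpen V := isOpen_setOfPred_eventually_nhds
  obtain ⟨χ, hχ, ⟨N', hN', hXN', hχ1⟩, hχ0⟩ := exists_cutoff d hX hV (fun p hp => h1 p hp)
  refine ⟨fun q => χ q • correction ν b c H q, fun q => ?_, fun p hp => ?_⟩
  · by_cases hq : q ∈ V
    · exact SmoothAt.smul (hχ q) (Eventually.self_of_nhds hq)
    · refine smoothAt_zero.congr ?_
      filter_upwards [hχ0 q hq] with q' hq'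
      rw [hq', zero_smul]
      rfl
  · filter_upwards [hN'.mem_nhds (hXN' hp)] with q hq
    rw [hχ1 q hq, one_smul]

end Correction

/-! ### Algebra of the expansion of the decomposition -/

section Algebra

/-- Sorts the expansion into mixed, normal and tangential terms: `A` stands for normal components,
`h` for the `dH_i` and `β` for the `b_i` on tangential ones. Antisymmetry of `c` makes the two cross
terms of the double sum equal, which absorbs the factor `½`. -/
lemma decomposition_algebra {ι : Type*} [Fintype ι] {c : ι → ι → ℝ} (hc : ∀ i j, c j i = - c i j)
    (A A' h h' β β' : ι → ℝ) :
    ∑ i, ((h i + A i) * β' i - (h' i + A' i) * β i) +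
      (1 / 2 : ℝ) * ∑ i, ∑ j, c i j * ((h i + A i) * (h' j + A' j) - (h' i + A' i) * (h j + A j)) =
    (∑ i, A i * (β' i + ∑ j, c i j * h' j) - ∑ i, A' i * (β i + ∑ j, c i j * h j)) +
      (1 / 2 : ℝ) * (∑ i, A i * ∑ j, A' j * c i j - ∑ i, A' i * ∑ j, A j * c i j) +
      (∑ i, (h i * β' i - h' i * β i) +
        (1 / 2 : ℝ) * ∑ i, ∑ j, c i j * (h i * h' j - h' i * h j)) := by
  have hswap : ∀ x y : ι → ℝ, ∑ i, ∑ j, c i j * (x i * y j) = - ∑ i, ∑ j, c i j * (y i * x j) := by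
    intro x y
    rw [Finset.sum_comm, ← Finset.sum_neg_distrib]
    refine Finset.sum_congr rfl fun i _ => ?_
    rw [← Finset.sum_neg_distrib]
    refine Finset.sum_congr rfl fun j _ => ?_
    rw [hc]
    ring
  have h1 := hswap h A'
  have h2 := hswap h' A
  simp only [mul_add, mul_sub, add_mul, Finset.sum_add_distrib, Finset.sum_sub_distrib,
    Finset.mul_sum] at h1 h2 ⊢
  have h3 : ∀ x y : ι → ℝ, ∑ i, x i * ∑ j, c i j * y j = ∑ i, ∑ j, c i j * (x i * y j) :=
    fun x y => Finset.sum_congr rfl fun i _ => by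
      rw [Finset.mul_sum]; exact Finset.sum_congr rfl fun j _ => by ring
  have h4 : ∀ x y : ι → ℝ, ∑ i, x i * ∑ j, y j * c i j = ∑ i, ∑ j, c i j * (x i * y j) :=
    fun x y => Finset.sum_congr rfl fun i _ => by
      rw [Finset.mul_sum]; exact Finset.sum_congr rfl fun j _ => by ring
  simp only [← Finset.mul_sum, h3, h4]
  linarith

end Algebra

/-! ### Normal, mixed and tangential components along the intersection -/

section NormalAt

variable {d : ℕ} {M : Type*} [TopologicalSpace M] [ChartedSpace (Model d) M]
  [IsManifold (𝓡 d) ∞ M] {σ : Type} [Fintype σ] {ι : Type*} [Fintype ι]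
  {lab : σ → ι} {f : σ → M → ℝ} {X N : Set M} {π : M → M}
  {e : OpenPartialHomeomorph M (Model d)} {κ : σ ↪ Fin d} {p : M} {x₀ : Model d} {ρ : ℝ}
  {Ω a : DForm d M 2} {b : ι → DForm d M 1} {c : ι → ι → M → ℝ} {H : ι → M → ℝ}
  {μ : DForm d M 1} {m : Model d → Model d [⋀^Fin 1]→L[ℝ] ℝ}

lemma eq_cproj_add_sum (κ : σ ↪ Fin d) (v : Model d) :
    v = cproj κ v + ∑ s, v (κ s) • EuclideanSpace.single (κ s) (1 : ℝ) := by
  have h0 := cproj_sum_single κ (fun s => v (κ s))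
  refine ext_range κ (fun s => ?_) fun j hj => ?_
  · rw [PiLp.add_apply, sum_single_apply_range, cproj_apply_range, zero_add]
  · rw [PiLp.add_apply, cproj_apply_of_notMem κ v hj,
      ← cproj_apply_of_notMem κ (∑ s, v (κ s) • EuclideanSpace.single (κ s) (1 : ℝ)) hj, h0]
    simp

lemma IsTube.symm_mem (hN : IsTube (d := d) f X N π) (he : IsFunChart f e κ) (hes : e.source ⊆ N)
    {x : Model d} (hx : x ∈ e.target) (hc : cproj κ x = x) : e.symm x ∈ X :=
  hN.mem_of_zero _ (hes (e.map_target hx)) fun s => by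
    rw [← he.coord _ (e.map_target hx), e.right_inv hx]
    exact (cproj_eq_self_iff κ).1 hc s

lemma IsLogTubChart.smoothAt_fibreExt (hN : IsTube (d := d) f X N π)
    (h : IsLogTubChart μ f N π e κ x₀ ρ m) {q : M} (hq : q ∈ e.source) :
    SmoothAt (fibreExt μ f N π) q :=
  (smoothAt_iff h.tub.funChart.mem_atlas hq).2
    ((h.contDiffOn_fibreExt hN).contDiffAt (e.open_target.mem_nhds (e.map_source hq)))

/-- Frame vectors are split into normal and tangential parts. The mixed part of `dμ` contributes
`-dR_s` and that of the double sum `∑_j c_sj dH_j`, together `dF_s`; the tangential part of `dμ` is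
that of `d (fibreExt μ)`, which is contained in `dη`. -/
theorem IsReducedDecomp.normal_at (h : IsReducedDecomp lab f X N Ω a b c H μ)
    (hN : IsTube (d := d) f X N π) (hm : IsLogTubChart μ f N π e κ x₀ ρ m) (hpX : p ∈ X)
    (hp : p ∈ e.source) {g : Model d → Bil d} (hg : ContinuousOn g e.target)
    (hexpr : ∀ x ∈ e.target, (∀ s, x (κ s) ≠ 0) → ∀ u v,
      g x u v = toBil (inChart e Ω x) (logFrame κ x u) (logFrame κ x v))
    {R F : σ → M → ℝ} (hR : ∀ s, ContMDiff (𝓡 d) 𝓘(ℝ, ℝ) ∞ (R s))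
    (hRm : ∀ q ∈ X, q ∈ e.source → ∀ s, toCov (m (e q)) (EuclideanSpace.single (κ s) 1) = R s q)
    (hF : ∀ s, ContMDiff (𝓡 d) 𝓘(ℝ, ℝ) ∞ (F s))
    (hFR : ∀ q ∈ X, ∀ s, F s q = ∑ j, c (lab s) j q * H j q - R s q)
    {η : DForm d M 1} (hη : ∀ᶠ q in 𝓝 p, η q = correction (fibreExt μ f N π) b c H q)
    (u v : Model d) :
    g (e p) u v =
      (∑ s, u (κ s) * (toCov (b (lab s) p) (dpar e.symm (e p) (cproj κ v)) +
          dfun (F s) p (dpar e.symm (e p) (cproj κ v))) -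
        ∑ s, v (κ s) * (toCov (b (lab s) p) (dpar e.symm (e p) (cproj κ u)) +
          dfun (F s) p (dpar e.symm (e p) (cproj κ u)))) +
      (1 / 2 : ℝ) * (∑ s, u (κ s) * ∑ t, v (κ t) * c (lab s) (lab t) p -
        ∑ s, v (κ s) * ∑ t, u (κ t) * c (lab s) (lab t) p) +
      (toBil (a p) (dpar e.symm (e p) (cproj κ u)) (dpar e.symm (e p) (cproj κ v)) +
        toBil (extD η p) (dpar e.symm (e p) (cproj κ u)) (dpar e.symm (e p) (cproj κ v))) := by
  have he := hm.tub.funChart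
  have hx := e.map_source hp
  have hc : cproj κ (e p) = e p := hN.cproj_eq he hpX hp
  have hXe : ∀ x ∈ e.target, cproj κ x = x → e.symm x ∈ X :=
    fun x hx hc => hN.symm_mem he hm.subset hx hc
  have hdm : DifferentiableAt ℝ m (e p) :=
    (hm.expr.smooth.contDiffAt (e.open_target.mem_nhds hx)).differentiableAt (by simp)
  have hsmooth : ∀ {φ : M → ℝ}, ContMDiff (𝓡 d) 𝓘(ℝ, ℝ) ∞ φ →
      ∀ w, dfun φ p (dpar e.symm (e p) w) = fderiv ℝ (φ ∘ e.symm) (e p) w := by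
    intro φ hφ w
    have h1 := dfun_dpar (f := φ) he.mem_atlas hx ((hφ _).mdifferentiableAt (by simp)) w
    rwa [e.left_inv hp] at h1
  -- On `X` the normal component of `μ` is the residue `R s`, and equality on `X` suffices for
  -- derivatives along `X`.
  have hres : ∀ s w, toCov (fderiv ℝ m (e p) (cproj κ w)) (EuclideanSpace.single (κ s) 1) =
      dfun (R s) p (dpar e.symm (e p) (cproj κ w)) := by
    intro s w
    have hmd : MDifferentiableAt (𝓡 d) 𝓘(ℝ, ℝ)
        (fun q => toCov (m (e q)) (EuclideanSpace.single (κ s) 1)) p := by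
      have h1 : DifferentiableAt ℝ (fun x => toCov (m x) (EuclideanSpace.single (κ s) 1)) (e p) :=
        (toCov.differentiableAt.comp (e p) hdm).clm_apply (differentiableAt_const _)
      exact h1.mdifferentiableAt.comp p (chart_mdiff he.mem_atlas hp)
    rw [← dfun_eq_of_eqOn he.mem_atlas hXe hp hc hmd ((hR s p).mdifferentiableAt (by simp))
      (by filter_upwards [e.open_source.mem_nhds hp] with q hq hqX using hRm q hqX hq s)]
    have h1 := dfun_dpar (f := fun q => toCov (m (e q)) (EuclideanSpace.single (κ s) 1))
      he.mem_atlas hx (by rwa [e.left_inv hp]) (cproj κ w)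
    rw [e.left_inv hp] at h1
    rw [h1]
    have h2 : ((fun q => toCov (m (e q)) (EuclideanSpace.single (κ s) 1)) ∘ e.symm) =ᶠ[𝓝 (e p)]
        fun x => toCov (m x) (EuclideanSpace.single (κ s) 1) := by
      filter_upwards [e.open_target.mem_nhds hx] with y hy
      rw [Function.comp_apply, e.right_inv hy]
    have h3 : HasFDerivAt (fun x => toCov (m x) (EuclideanSpace.single (κ s) 1)) _ (e p) :=
      (toCov.hasFDerivAt.comp (e p) hdm.hasFDerivAt).clm_apply (hasFDerivAt_const _ (e p))
    rw [h2.fderiv_eq, h3.fderiv]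
    simp
  have hmv : ∀ w w', toCov (fderiv ℝ m (e p) (cproj κ w)) w' =
      toCov (fderiv ℝ m (e p) (cproj κ w)) (cproj κ w') +
        ∑ s, w' (κ s) * dfun (R s) p (dpar e.symm (e p) (cproj κ w)) := by
    intro w w'
    conv_lhs => rw [eq_cproj_add_sum κ w']
    simp only [map_add, map_sum, map_smul, hres, smul_eq_mul]
  -- `F s` is prescribed only on `X`; there it agrees near `p` with an expression with frozen
  -- coefficients, and only its tangential derivative is needed.
  have hFd : ∀ s w, dfun (F s) p (dpar e.symm (e p) (cproj κ w)) =
      ∑ j, c (lab s) j p * dfun (H j) p (dpar e.symm (e p) (cproj κ w)) -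
        dfun (R s) p (dpar e.symm (e p) (cproj κ w)) := by
    intro s w
    have h1 : ContMDiff (𝓡 d) 𝓘(ℝ, ℝ) ∞ (fun q => ∑ j, c (lab s) j p * H j q - R s q) :=
      (contMDiff_finsetSum fun j _ => contMDiff_const.mul (h.smooth_H j)).sub (hR s)
    have h2 : ∀ᶠ q in 𝓝 p, ∀ j, c (lab s) j q * H j q = c (lab s) j p * H j q := by
      refine eventually_all.2 fun j => ?_
      rcases h.const p hpX (lab s) j with h1 | ⟨hi, -⟩ | ⟨-, h1⟩
      · filter_upwards [h1] with q hq
        rw [hq]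
      · exact absurd (mem_range_self s) hi
      · filter_upwards [h1] with q hq
        rw [hq, mul_zero, mul_zero]
    rw [dfun_eq_of_eqOn he.mem_atlas hXe hp hc ((hF s p).mdifferentiableAt (by simp))
      ((h1 p).mdifferentiableAt (by simp)) (by
        filter_upwards [h2] with q hq hqX
        rw [hFR q hqX s]
        simp only [hq]), hsmooth h1, hsmooth (hR s)]
    simp only [hsmooth (h.smooth_H _)]
    have hd : ∀ {φ : M → ℝ}, ContMDiff (𝓡 d) 𝓘(ℝ, ℝ) ∞ φ →
        HasFDerivAt (φ ∘ e.symm) (fderiv ℝ (φ ∘ e.symm) (e p)) (e p) := fun hφ =>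
      ((contDiffAt_comp_symm he.mem_atlas hp (hφ p)).differentiableAt (by simp)).hasFDerivAt
    have h3 : HasFDerivAt ((fun q => ∑ j, c (lab s) j p * H j q - R s q) ∘ e.symm)
        ((∑ j, c (lab s) j p • fderiv ℝ (H j ∘ e.symm) (e p)) - fderiv ℝ (R s ∘ e.symm) (e p))
        (e p) :=
      (HasFDerivAt.fun_sum fun j _ => (hd (h.smooth_H j)).const_mul _).sub (hd (hR s))
    rw [h3.fderiv]
    simp
  have hη' : extD η p = extD (correction (fibreExt μ f N π) b c H) p := extD_congr hη
  have hν := hm.smoothAt_fibreExt hN hp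
  have hdd : ∀ w, dmap e p (dpar e.symm (e p) w) = w := fun w => by
    have h1 := dmap_dpar he.mem_atlas hx w
    rwa [e.left_inv hp] at h1
  rw [h.formula_at he hm.subset hpX hp hc hg hexpr hm.expr, hη', h.toBil_extD_correction hpX hν,
    toBil_extD _ he.mem_atlas hp hν, hdd, hdd, hm.extDeriv_fibreExt hN hx hc, hmv u v, hmv v u]
  have key := decomposition_algebra (c := fun i j => c i j p) (fun i j => h.antisymm i j p)
    (fun i => labCoord lab κ i u) (fun i => labCoord lab κ i v)
    (fun i => dfun (H i) p (dpar e.symm (e p) (cproj κ u)))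
    (fun i => dfun (H i) p (dpar e.symm (e p) (cproj κ v)))
    (fun i => toCov (b i p) (dpar e.symm (e p) (cproj κ u)))
    (fun i => toCov (b i p) (dpar e.symm (e p) (cproj κ v)))
  simp only [sum_labCoord] at key
  simp only [hFd]
  have hsum : ∀ w w' : Model d, ∑ s, w (κ s) * (toCov (b (lab s) p) (dpar e.symm (e p) (cproj κ w')) +
      (∑ j, c (lab s) j p * dfun (H j) p (dpar e.symm (e p) (cproj κ w')) -
        dfun (R s) p (dpar e.symm (e p) (cproj κ w')))) =
      ∑ s, w (κ s) * (toCov (b (lab s) p) (dpar e.symm (e p) (cproj κ w')) +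
        ∑ j, c (lab s) j p * dfun (H j) p (dpar e.symm (e p) (cproj κ w'))) -
      ∑ s, w (κ s) * dfun (R s) p (dpar e.symm (e p) (cproj κ w')) := by
    intro w w'
    rw [← Finset.sum_sub_distrib]
    exact Finset.sum_congr rfl fun s _ => by ring
  rw [hsum, hsum]
  linarith

end NormalAt

end
end LogSymp

namespace LogSymp

noncomputable section

set_option linter.unusedSectionVars false
set_option maxSynthPendingDepth 3

/-! ### Reduction of the decomposition of the class -/

section Reduction

variable {d : ℕ} {M : Type*} [TopologicalSpace M] [ChartedSpace (Model d) M]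
  [IsManifold (𝓡 d) ∞ M] {σ : Type} [Fintype σ] {ι : Type*} {Z : ι → Set M} {p : M}

lemma IsNormalCrossing.isClosed (hZ : IsNormalCrossing d Z) (i : ι) : IsClosed (Z i) := by
  refine isOpen_compl_iff.1 (isOpen_iff_mem_nhds.2 fun p hp => ?_)
  obtain ⟨e, κ, h⟩ := hZ p
  filter_upwards [e.open_source.mem_nhds h.mem_source] with q hq
  exact h.not_mem q hq i hp

lemma IsNormalCrossing.isClosed_inter (hZ : IsNormalCrossing d Z) (S : Set ι) :
    IsClosed (inter Z S) :=
  isClosed_biInter fun i _ => hZ.isClosed i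

/-- If `ℓ` vanished near `p`, then `log |f| = 0` with `0 < |f| < 1` off the hypersurface would be
impossible, so `f` would vanish near `p`, against `df ≠ 0`. Hence closedness of `b` and constancy of
`c` are available along `X` for the labelled hypersurfaces. -/
lemma IsLogPotential.mem_tsupport {Z₁ : Set M} {ℓ : M → ℝ} (hℓ : IsLogPotential d Z₁ ℓ)
    (hp : p ∈ Z₁) : p ∈ tsupport ℓ := by
  by_contra h
  have h0 := notMem_tsupport_iff_eventuallyEq.1 h
  obtain ⟨V, f, hV, hpV, hf, hℓf⟩ := hℓ.log_near p hp
  have hfp : f p = 0 := (hf.zero_iff p hpV).1 hp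
  have hfc : ContinuousAt f p := (hf.smooth.contMDiffAt (hV.mem_nhds hpV)).continuousAt
  have h1 : ∀ᶠ q in 𝓝 p, |f q| < 1 := by
    have h2 := hfc.abs
    exact h2.eventually_lt_const (by simp [hfp])
  have h2 : f =ᶠ[𝓝 p] fun _ => 0 := by
    filter_upwards [h0, h1, hV.mem_nhds hpV] with q hq hq1 hqV
    by_contra hne
    have h3 : q ∉ Z₁ := fun hqZ => hne ((hf.zero_iff q hqV).1 hqZ)
    have h4 := hℓf q hqV h3
    rw [hq] at h4
    exact (Real.log_neg (abs_pos.2 hne) hq1).ne h4.symm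
  refine hf.dfun_ne_zero p hpV hp ?_
  have h3 : mfderiv (𝓡 d) 𝓘(ℝ, ℝ) f p = mfderiv (𝓡 d) 𝓘(ℝ, ℝ) (fun _ => (0 : ℝ)) p :=
    Filter.EventuallyEq.mfderiv_eq h2
  rw [dfun, h3, mfderiv_const]
  rfl

lemma dfun_log_add {f H : M → ℝ} (hf : ContMDiffAt (𝓡 d) 𝓘(ℝ, ℝ) ∞ f p) (hf0 : f p ≠ 0)
    (hH : ContMDiffAt (𝓡 d) 𝓘(ℝ, ℝ) ∞ H p) :
    dfun (fun q => Real.log (f q) + H q) p = dlog (d := d) f p + dfun H p := by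
  set c := chartAt (Model d) p
  have hc : c ∈ IsManifold.maximalAtlas (𝓡 d) ∞ M := IsManifold.chart_mem_maximalAtlas p
  have hp : p ∈ c.source := mem_chart_source _ p
  have hd : ∀ {φ : M → ℝ}, ContMDiffAt (𝓡 d) 𝓘(ℝ, ℝ) ∞ φ p →
      HasFDerivAt (φ ∘ c.symm) (fderiv ℝ (φ ∘ c.symm) (c p)) (c p) := fun hφ =>
    ((contDiffAt_comp_symm hc hp hφ).differentiableAt (by simp)).hasFDerivAt
  have h1 : ContMDiffAt (𝓡 d) 𝓘(ℝ, ℝ) ∞ (fun q => Real.log (f q) + H q) p :=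
    ((Real.contDiffAt_log.2 hf0).contMDiffAt.comp p hf).add hH
  have h2 : HasFDerivAt ((fun q => Real.log (f q) + H q) ∘ c.symm) _ (c p) :=
    ((hd hf).log (by rwa [Function.comp_apply, c.left_inv hp])).add (hd hH)
  ext v
  rw [dfun_eq_fderiv hc hp (h1.mdifferentiableAt (by simp)), h2.fderiv, add_apply, add_apply, dlog,
    smul_apply, smul_apply, dfun_eq_fderiv hc hp (hf.mdifferentiableAt (by simp)),
    dfun_eq_fderiv hc hp (hH.mdifferentiableAt (by simp)), Function.comp_apply, c.left_inv hp]

variable [T2Space M] [SecondCountableTopology M]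

/-- A function that is locally smooth near a closed set agrees on it with a global smooth one. -/
lemma exists_contMDiff_eqOn_of_locally {X : Set M} (hX : IsClosed X) {ψ : M → ℝ}
    (h : ∀ p ∈ X, ∃ φ : M → ℝ, ContMDiff (𝓡 d) 𝓘(ℝ, ℝ) ∞ φ ∧ ∀ᶠ q in 𝓝 p, ψ q = φ q) :
    ∃ F : M → ℝ, ContMDiff (𝓡 d) 𝓘(ℝ, ℝ) ∞ F ∧ ∀ q ∈ X, F q = ψ q := by
  obtain ⟨F, hF, N, -, hXN, h1⟩ := exists_contMDiff_near (d := d) (T := fun q => {ψ q}) hX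
    (fun q => convex_singleton _) fun p hp => by
      obtain ⟨φ, hφ, hφp⟩ := h p hp
      obtain ⟨V, hV, hVo, hpV⟩ := eventually_nhds_iff.1 hφp
      exact ⟨V, hVo, hpV, φ, hφ.contMDiffOn, fun q hq => (hV q hq).symm⟩
  exact ⟨F, hF, fun q hq => h1 q (hXN hq)⟩

lemma IsDefiningFunctionOn.mul_exp {Z₁ W : Set M} {g u : M → ℝ}
    (hg : IsDefiningFunctionOn (d := d) Z₁ W g) (hW : IsOpen W)
    (hu : ContMDiff (𝓡 d) 𝓘(ℝ, ℝ) ∞ u) :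
    IsDefiningFunctionOn (d := d) Z₁ W (fun q => g q * Real.exp (u q)) where
  smooth := hg.smooth.mul ((Real.contDiff_exp.contMDiff.comp hu).contMDiffOn)
  zero_iff := fun q hq => by
    rw [hg.zero_iff q hq, mul_eq_zero, or_iff_left (Real.exp_pos _).ne']
  dfun_ne_zero := fun q hq hqZ h0 => by
    have hgq : g q = 0 := (hg.zero_iff q hq).1 hqZ
    refine hg.dfun_ne_zero q hq hqZ (ContinuousLinearMap.ext fun (v : Model d) => ?_)
    set c := chartAt (Model d) q
    have hc : c ∈ IsManifold.maximalAtlas (𝓡 d) ∞ M := IsManifold.chart_mem_maximalAtlas q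
    have hqc : q ∈ c.source := mem_chart_source _ q
    have hgs := hg.smooth.contMDiffAt (hW.mem_nhds hq)
    have hd : ∀ {φ : M → ℝ}, ContMDiffAt (𝓡 d) 𝓘(ℝ, ℝ) ∞ φ q →
        HasFDerivAt (φ ∘ c.symm) (fderiv ℝ (φ ∘ c.symm) (c q)) (c q) := fun hφ =>
      ((contDiffAt_comp_symm hc hqc hφ).differentiableAt (by simp)).hasFDerivAt
    have hs : ContMDiffAt (𝓡 d) 𝓘(ℝ, ℝ) ∞ (fun q => g q * Real.exp (u q)) q :=
      hgs.mul ((Real.contDiff_exp.contMDiff.comp hu) q)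
    have h1 : HasFDerivAt ((fun q => g q * Real.exp (u q)) ∘ c.symm) _ (c q) :=
      (hd hgs).mul (hd (hu q)).exp
    have h2 := congrArg (fun l : Model d →L[ℝ] ℝ => l v) h0
    simp only [dfun_eq_fderiv hc hqc (hs.mdifferentiableAt (by simp)), h1.fderiv] at h2
    simp [c.left_inv hqc, hgq] at h2
    rw [dfun_eq_fderiv hc hqc (hgs.mdifferentiableAt (by simp))]
    exact h2

variable [Fintype ι] {lab : σ → ι} {X W : Set M} {g : σ → M → ℝ}
  {Ω a : DForm d M 2} {b : ι → DForm d M 1} {c : ι → ι → M → ℝ}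

/-- The decomposition of the class near `X`, for all choices `g_s e^{u_s}` of defining functions. -/
theorem IsDecomposition.exists_isReducedDecomp (hZ : IsNormalCrossing d Z)
    (hdec : IsDecomposition Z Ω a b c) (hX : IsClosed X) (hlab : Function.Injective lab)
    (hXZ : ∀ q ∈ X, ∀ s, q ∈ Z (lab s)) (hmax : ∀ q ∈ X, ∀ i, q ∈ Z i → i ∈ range lab)
    (hW : IsOpen W) (hXW : X ⊆ W)
    (hg : ∀ s, IsDefiningFunctionOn (d := d) (Z (lab s)) W (g s)) :
    ∃ (μ : DForm d M 1) (R F : σ → M → ℝ) (N : Set M), IsLogForm Z μ ∧ IsOpen N ∧ X ⊆ N ∧ N ⊆ W ∧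
      (∀ q ∈ N, ∀ i, q ∈ Z i → i ∈ range lab) ∧
      (∀ s, ContMDiff (𝓡 d) 𝓘(ℝ, ℝ) ∞ (R s)) ∧
      (∀ s, ∀ q ∈ X, ∀ (e : OpenPartialHomeomorph M (Model d)) (κ : σ ↪ Fin d) (O : Set (Model d))
        (m : Model d → Model d [⋀^Fin 1]→L[ℝ] ℝ), IsCrossChart (fun s => Z (lab s)) e κ →
          HasLogExpr μ e κ O m → q ∈ e.source → e q ∈ O →
            toCov (m (e q)) (EuclideanSpace.single (κ s) 1) = R s q) ∧
      (∀ s, ContMDiff (𝓡 d) 𝓘(ℝ, ℝ) ∞ (F s)) ∧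
      ∀ u : σ → M → ℝ, (∀ s, ContMDiff (𝓡 d) 𝓘(ℝ, ℝ) ∞ (u s)) → ∃ H : ι → M → ℝ,
        IsReducedDecomp lab (fun s q => g s q * Real.exp (u s q)) X N Ω a b c H μ ∧
        ∀ q ∈ X, ∀ s, ∑ j, c (lab s) j q * H j q - R s q =
          F s q - ∑ t, c (lab s) (lab t) q * u t q := by
  classical
  obtain ⟨ha, -, hb, hanti, ℓ, μ, hℓ, hbcl, hcc, hμ, hform⟩ := hdec
  have hch : ∀ q ∈ X, ∃ (e : OpenPartialHomeomorph M (Model d)) (κ : σ ↪ Fin d),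
      IsCrossChart (fun s => Z (lab s)) e κ ∧ q ∈ e.source := fun q hq => by
    obtain ⟨e, κ₀, he⟩ := hZ q
    obtain ⟨κ, h1, -⟩ := he.exists_isCrossChart hlab (hXZ q hq) (hmax q hq)
    exact ⟨e, κ, h1, he.mem_source⟩
  -- The remainder is `ℓ_i - log |g_s|` for the label `i` of `s`, and `ℓ_i` itself for a
  -- hypersurface that misses `X`.
  have hrem : ∀ i, ∃ H : M → ℝ, ContMDiff (𝓡 d) 𝓘(ℝ, ℝ) ∞ H ∧ ∃ N, IsOpen N ∧ X ⊆ N ∧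
      ∀ u ∈ N, (∀ s, lab s = i → u ∉ Z i → ℓ i u = Real.log (g s u) + H u) ∧
        (i ∉ range lab → ℓ i u = H u) := by
    intro i
    by_cases hi : i ∈ range lab
    · obtain ⟨s, rfl⟩ := hi
      obtain ⟨H, hH, N, hN, hXN, h1⟩ := (hℓ (lab s)).exists_remainder hX
        (fun q hq => hXZ q hq s) hW hXW (hg s) fun q hq => by
          obtain ⟨e, κ, he, hqe⟩ := hch q hq
          exact ⟨e, he.mem_atlas, κ s, hqe, fun q' hq' => he.mem_iff q' hq' s⟩
      refine ⟨H, hH, N, hN, hXN, fun u hu => ⟨fun t ht => ?_, fun h => absurd (mem_range_self s) h⟩⟩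
      rw [hlab ht]
      exact h1 u hu
    · obtain ⟨H, hH, N, hN, hXN, h1⟩ := (hℓ i).exists_remainder_of_disjoint hX (hZ.isClosed i)
        (Set.disjoint_left.2 fun q hq hqZ => hi (hmax q hq i hqZ))
      exact ⟨H, hH, N, hN, hXN, fun u hu => ⟨fun s hs => absurd ⟨s, hs⟩ hi, fun _ => (h1 u hu).symm⟩⟩
  choose H₀ hH₀ N₀ hN₀ hXN₀ hH₀ℓ using hrem
  -- `b i` and `c i j` are controlled only near the supports of the `ℓ i`. Off the support of `ℓ i`
  -- the index is not a label and the remainder vanishes, so the uncontrolled coefficients are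
  -- multiplied by zero.
  have hH₀0 : ∀ q ∈ X, ∀ i, q ∉ tsupport (ℓ i) → i ∉ range lab ∧ ∀ᶠ q' in 𝓝 q, H₀ i q' = 0 := by
    intro q hq i hi
    have h1 : i ∉ range lab := by
      rintro ⟨s, rfl⟩
      exact hi ((hℓ (lab s)).mem_tsupport (hXZ q hq s))
    refine ⟨h1, ?_⟩
    filter_upwards [notMem_tsupport_iff_eventuallyEq.1 hi, (hN₀ i).mem_nhds (hXN₀ i hq)]
      with q' hq' hq'N
    rw [← (hH₀ℓ i q' hq'N).2 h1, hq']
    rfl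
  have hconst : ∀ q ∈ X, ∀ i j, (∀ᶠ q' in 𝓝 q, c i j q' = c i j q) ∨
      (i ∉ range lab ∧ ∀ᶠ q' in 𝓝 q, H₀ i q' = 0) ∨
        (j ∉ range lab ∧ ∀ᶠ q' in 𝓝 q, H₀ j q' = 0) := by
    intro q hq i j
    by_cases hi : q ∈ tsupport (ℓ i)
    · by_cases hj : q ∈ tsupport (ℓ j)
      · exact Or.inl (hcc i j q ⟨hi, hj⟩)
      · exact Or.inr (Or.inr (hH₀0 q hq j hj))
    · exact Or.inr (Or.inl (hH₀0 q hq i hi))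
  have hR := fun s => exists_residue (d := d) (Θ := μ) (Y := fun s => Z (lab s)) hX hXZ
    (fun q hq => by
      obtain ⟨e, κ, he, hqe⟩ := hch q hq
      obtain ⟨O, m, hm, hqO⟩ := hμ.exists_hasLogExpr hlab (hXZ q hq) (hmax q hq) he hqe
      exact ⟨e, κ, O, m, he, hm, hqe, hqO⟩) s
  choose R hRs hR using hR
  have hF := fun s => exists_contMDiff_eqOn_of_locally (d := d) hX
    (ψ := fun q => ∑ j, c (lab s) j q * H₀ j q - R s q) fun q hq => by
      refine ⟨fun q' => ∑ j, c (lab s) j q * H₀ j q' - R s q',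
        (contMDiff_finsetSum fun j _ => contMDiff_const.mul (hH₀ j)).sub (hRs s), ?_⟩
      have h2 : ∀ᶠ q' in 𝓝 q, ∀ j, c (lab s) j q' * H₀ j q' = c (lab s) j q * H₀ j q' := by
        refine eventually_all.2 fun j => ?_
        rcases hconst q hq (lab s) j with h1 | ⟨hi, -⟩ | ⟨-, h1⟩
        · filter_upwards [h1] with q' hq'
          rw [hq']
        · exact absurd (mem_range_self s) hi
        · filter_upwards [h1] with q' hq'
          rw [hq', mul_zero, mul_zero]
      filter_upwards [h2] with q' hq'
      simp only [hq']
  choose F hFs hF using hF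
  have hNopen : IsOpen ((⋂ i, N₀ i) ∩ W ∩ ⋂ i, {q | q ∈ Z i → i ∈ range lab}) := by
    refine ((isOpen_iInter_of_finite hN₀).inter hW).inter (isOpen_iInter_of_finite fun i => ?_)
    by_cases hi : i ∈ range lab
    · simp only [hi, imp_true_iff]
      exact isOpen_univ
    · simp only [hi, imp_false]
      exact (hZ.isClosed i).isOpen_compl
  refine ⟨μ, R, F, _, hμ, hNopen, fun q hq => ⟨⟨mem_iInter.2 fun i => hXN₀ i hq, hXW hq⟩,
    mem_iInter.2 fun i => hmax q hq i⟩, fun q hq => hq.1.2, fun q hq i => mem_iInter.1 hq.2 i, hRs,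
    hR, hFs, fun u hu => ?_⟩
  -- The factor `e^{u_s}` moves `u_s` from the remainder into the logarithm of the defining
  -- function, so `H₀` becomes `H₀ - U`. The data `μ`, `R`, `F` and the neighbourhood are already
  -- fixed, so `u` may later be chosen in terms of `F`.
  set U : ι → M → ℝ := Function.extend lab u (0 : ι → M → ℝ)
  have hUlab : ∀ s, U (lab s) = u s := fun s => hlab.extend_apply u _ s
  have hU0 : ∀ i, i ∉ range lab → U i = 0 := fun i hi =>
    Function.extend_apply' u (0 : ι → M → ℝ) i hi
  have hUs : ∀ i, ContMDiff (𝓡 d) 𝓘(ℝ, ℝ) ∞ (U i) := fun i => by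
    by_cases hi : i ∈ range lab
    · obtain ⟨s, rfl⟩ := hi
      rw [hUlab]; exact hu s
    · rw [hU0 i hi]; exact contMDiff_const
  have hH0 : ∀ {i : ι} {q : M}, i ∉ range lab → (∀ᶠ q' in 𝓝 q, H₀ i q' = 0) →
      ∀ᶠ q' in 𝓝 q, H₀ i q' - U i q' = 0 := fun hi h => by
    filter_upwards [h] with q' hq'
    rw [hq', hU0 _ hi]
    simp
  refine ⟨fun i q => H₀ i q - U i q, ⟨ha, hb, fun i => (hH₀ i).sub (hUs i), hanti,
    fun q hq i => ?_, fun q hq i j => ?_, fun q hq hf0 => ?_⟩, fun q hq s => ?_⟩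
  · by_cases hi : q ∈ tsupport (ℓ i)
    · exact Or.inl (hbcl i q hi)
    · obtain ⟨h1, h2⟩ := hH₀0 q hq i hi
      exact Or.inr (hH0 h1 h2)
  · rcases hconst q hq i j with h1 | ⟨hi, h1⟩ | ⟨hj, h1⟩
    · exact Or.inl h1
    · exact Or.inr (Or.inl ⟨hi, hH0 hi h1⟩)
    · exact Or.inr (Or.inr ⟨hj, hH0 hj h1⟩)
  · have hg0 : ∀ s, g s q ≠ 0 := fun s h0 => hf0 s (by simp only [h0, zero_mul])
    have hqN : ∀ i, q ∈ N₀ i := fun i => mem_iInter.1 hq.1.1 i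
    have hqZ : ∀ i, q ∉ Z i := fun i hi => by
      obtain ⟨s, rfl⟩ := mem_iInter.1 hq.2 i hi
      exact hg0 s (((hg s).zero_iff q hq.1.2).1 hi)
    have hlog : ∀ i, dfun (ℓ i) q = logPart (d := d) lab (fun s q => g s q * Real.exp (u s q))
        (fun i q => H₀ i q - U i q) i q := by
      intro i
      have hoff : ∀ᶠ q' in 𝓝 q, q' ∈ N₀ i ∧ q' ∉ Z i :=
        Filter.Eventually.and ((hN₀ i).mem_nhds (hqN i))
          ((hZ.isClosed i).isOpen_compl.mem_nhds (hqZ i))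
      by_cases hi : i ∈ range lab
      · obtain ⟨s, rfl⟩ := hi
        have h1 : ℓ (lab s) =ᶠ[𝓝 q] fun q => Real.log (g s q * Real.exp (u s q)) +
            (H₀ (lab s) q - U (lab s) q) := by
          filter_upwards [hoff, hNopen.mem_nhds hq] with q' hq' hq'N
          have hne : g s q' ≠ 0 := fun h0 => hq'.2 (((hg s).zero_iff q' hq'N.1.2).2 h0)
          rw [(hH₀ℓ (lab s) q' hq'.1).1 s rfl hq'.2, Real.log_mul hne (Real.exp_pos _).ne',
            Real.log_exp, hUlab]
          ring
        have h2 : dfun (d := d) (ℓ (lab s)) q = dfun (fun q => Real.log (g s q * Real.exp (u s q)) +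
            (H₀ (lab s) q - U (lab s) q)) q := Filter.EventuallyEq.mfderiv_eq h1
        rw [h2, dfun_log_add ((((hg s).mul_exp hW (hu s)).smooth).contMDiffAt
          (hW.mem_nhds hq.1.2)) (hf0 s) (((hH₀ (lab s)).sub (hUs (lab s))) q), logPart, add_comm,
          Finset.sum_eq_single s (fun t _ hts => if_neg fun h => hts (hlab h))
            (fun h => absurd (Finset.mem_univ s) h), if_pos rfl]
      · have h1 : ℓ i =ᶠ[𝓝 q] fun q => H₀ i q - U i q := by
          filter_upwards [hoff] with q' hq'
          rw [(hH₀ℓ i q' hq'.1).2 hi, hU0 i hi]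
          simp
        have h2 : dfun (d := d) (ℓ i) q = dfun (fun q => H₀ i q - U i q) q :=
          Filter.EventuallyEq.mfderiv_eq h1
        rw [h2, logPart, Finset.sum_eq_zero fun s _ => if_neg fun h => hi ⟨s, h⟩, add_zero]
    rw [hform q fun hqU => by
      obtain ⟨i, hi⟩ := mem_iUnion.1 hqU
      exact hqZ i hi]
    simp only [hlog]
  · rw [hF s q hq]
    have h1 : ∑ j, c (lab s) j q * U j q = ∑ t, c (lab s) (lab t) q * u t q := by
      have h2 : ∑ t, c (lab s) (lab t) q * u t q = ∑ t, c (lab s) (lab t) q * U (lab t) q :=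
        Finset.sum_congr rfl fun t _ => by rw [hUlab]
      rw [h2, ← Finset.sum_image (f := fun j => c (lab s) j q * U j q) (s := Finset.univ)
        fun t _ t' _ h => hlab h]
      refine (Finset.sum_subset (Finset.subset_univ _) fun j _ hj => ?_).symm
      have hj' : j ∉ range lab := fun ⟨t, ht⟩ => hj (Finset.mem_image.2 ⟨t, Finset.mem_univ t, ht⟩)
      rw [hU0 j hj']
      simp
    simp only [mul_sub, Finset.sum_sub_distrib, h1]
    ring

end Reduction

end
end LogSymp

namespace LogSymp

noncomputable section

set_option linter.unusedSectionVars false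
set_option maxSynthPendingDepth 3

/-! ### Trivialized tubular neighbourhoods -/

section Tubular

variable {d : ℕ} {M : Type*} [TopologicalSpace M] [ChartedSpace (Model d) M]
  [IsManifold (𝓡 d) ∞ M] {σ : Type} [Fintype σ] {ι : Type*} {lab : σ → ι} {h : σ → M → ℝ}
  {f : ι → M → ℝ} {X N : Set M} {π : M → M} {e : OpenPartialHomeomorph M (Model d)}
  {κ : σ ↪ Fin d} {x₀ : Model d} {ρ : ℝ}

lemma IsTubChart.contMDiffOn_proj (hc : IsTubChart h π e κ x₀ ρ) :
    ContMDiffOn (𝓡 d) (𝓡 d) ∞ π e.source := by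
  have h1 : ContMDiffOn (𝓡 d) (𝓡 d) ∞ (fun u => e.symm (cproj κ (e u))) e.source :=
    (contMDiffOn_symm_of_mem_maximalAtlas hc.funChart.mem_atlas).comp
      ((cproj κ).contMDiff.comp_contMDiffOn
        (contMDiffOn_of_mem_maximalAtlas hc.funChart.mem_atlas)) fun u hu => by
      have h2 := hc.proj u hu
      change cproj κ (e u) ∈ e.target
      rw [← h2.2]
      exact e.map_source h2.1
  refine h1.congr fun u hu => ?_
  have h2 := hc.proj u hu
  rw [← h2.2, e.left_inv h2.1]

lemma IsTube.contMDiffOn_proj (hN : IsTube (d := d) h X N π) : ContMDiffOn (𝓡 d) (𝓡 d) ∞ π N :=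
  fun u hu => by
    obtain ⟨e, κ, x₀, ρ, hc, -, hue⟩ := hN.chart u hu
    exact (hc.contMDiffOn_proj.contMDiffAt (e.open_source.mem_nhds hue)).contMDiffWithinAt

lemma IsTube.contMDiffOn_coord (hN : IsTube (d := d) h X N π) (s : σ) :
    ContMDiffOn (𝓡 d) 𝓘(ℝ, ℝ) ∞ (h s) N :=
  fun u hu => by
    obtain ⟨e, κ, x₀, ρ, hc, -, hue⟩ := hN.chart u hu
    exact ((hc.funChart.contMDiffOn s).contMDiffAt (e.open_source.mem_nhds hue)).contMDiffWithinAt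

lemma IsTubChart.eq_zero_of_mfderiv_proj (hc : IsTubChart h π e κ x₀ ρ) {u : M} (hu : u ∈ e.source)
    {w : Model d} (hπ : (mfderiv (𝓡 d) (𝓡 d) π u : Model d →L[ℝ] Model d) w = 0)
    (h0 : ∀ s, dfun (h s) u w = 0) : w = 0 := by
  have he := hc.funChart.mem_atlas
  have hπe := (hc.proj u hu).1
  have h1 : mfderiv (𝓡 d) (𝓡 d) (e ∘ π) u = _ := mfderiv_comp u (chart_mdiff he hπe)
    ((hc.contMDiffOn_proj.contMDiffAt (e.open_source.mem_nhds hu)).mdifferentiableAt (by simp))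
  have h2 : mfderiv (𝓡 d) (𝓡 d) (cproj κ ∘ e) u = _ := mfderiv_comp u
    ((cproj κ).differentiableAt (x := e u)).mdifferentiableAt (chart_mdiff he hu)
  have h3 : mfderiv (𝓡 d) (𝓡 d) (e ∘ π) u = mfderiv (𝓡 d) (𝓡 d) (cproj κ ∘ e) u :=
    Filter.EventuallyEq.mfderiv_eq (by
      filter_upwards [e.open_source.mem_nhds hu] with q hq
      exact (hc.proj q hq).2)
  rw [h1, h2, mfderiv_eq_fderiv, (cproj κ).hasFDerivAt.fderiv] at h3
  have h4 : (mfderiv (𝓡 d) (𝓡 d) e (π u) : Model d →L[ℝ] Model d)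
      ((mfderiv (𝓡 d) (𝓡 d) π u : Model d →L[ℝ] Model d) w) = cproj κ (dmap e u w) :=
    congrArg (fun l : Model d →L[ℝ] Model d => l w) h3
  rw [hπ, map_zero] at h4
  have h5 : dmap e u w = 0 := ext_range κ (fun s => by rw [hc.funChart.dmap_apply hu, h0]; rfl)
    fun j hj => by rw [← cproj_apply_of_notMem κ _ hj, ← h4]; rfl
  rw [← dpar_dmap he hu w, h5, map_zero]

/-- The admissible radii at a point form an interval and can locally be chosen constant, so a
partition of unity yields a continuous radius without compactness of `X`. -/
lemma IsTube.exists_radius [T2Space M] [SecondCountableTopology M]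
    (hN : IsTube (d := d) h X N π) (hX : IsClosed X) {O : Set M} (hO : IsOpen O) (hXO : X ⊆ O) :
    ∃ ε : M → ℝ, Continuous ε ∧ (∀ q, 0 < ε q) ∧ ∀ q ∈ X, ∀ τ : σ → ℝ, (∀ s, |τ s| < ε q) →
      ∃ u ∈ O, π u = q ∧ ∀ s, h s u = τ s := by
  have := sigmaCompact_of_charted d M
  set T : M → Set ℝ := fun q => {r | 0 < r ∧ (q ∈ X → ∀ τ : σ → ℝ, (∀ s, |τ s| < r) →
    ∃ u ∈ O, π u = q ∧ ∀ s, h s u = τ s)} with hT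
  have hconv : ∀ q, Convex ℝ (T q) := fun q => by
    refine Set.OrdConnected.convex ⟨fun r hr r' hr' x hx => ⟨hr.1.trans_le hx.1, fun hq τ hτ => ?_⟩⟩
    exact hr'.2 hq τ fun s => (hτ s).trans_le hx.2
  have hloc : ∀ q, ∃ r, ∀ᶠ y in 𝓝 q, r ∈ T y := by
    intro q
    by_cases hq : q ∈ X
    · obtain ⟨e, κ, ρ, hc, hs, hqe⟩ := hN.small_chart q hq O hO (hXO hq)
      have hpos := hc.pos
      have hcard : (0 : ℝ) ≤ Fintype.card σ := Nat.cast_nonneg _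
      -- Half of `ρ` bounds the distance of the base point from the centre; the other half is shared
      -- among the fibre coordinates. The `+ 1` covers an empty `σ`.
      refine ⟨ρ / 2 / (Fintype.card σ + 1), ?_⟩
      have h1 : ∀ᶠ y in 𝓝 q, e y ∈ Metric.ball (e q) (ρ / 2) :=
        (e.continuousAt hqe).eventually_mem (Metric.ball_mem_nhds _ (by linarith))
      filter_upwards [h1, e.open_source.mem_nhds hqe] with y hy hye
      refine ⟨by positivity, fun hyX τ hτ => ?_⟩
      have hyc : cproj κ (e y) = e y := (cproj_eq_self_iff κ).2 fun s => by
        rw [hc.funChart.coord y hye, hN.zero y hyX]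
      set t : Model d := ∑ s, τ s • EuclideanSpace.single (κ s) (1 : ℝ) with ht
      have hnorm : ‖t‖ ≤ ρ / 2 := by
        have h2 : ‖t‖ ≤ ∑ _s : σ, ρ / 2 / (Fintype.card σ + 1) := by
          refine norm_sum_le_of_le _ fun s _ => ?_
          rw [norm_smul]
          simpa using (hτ s).le
        refine h2.trans ?_
        rw [Finset.sum_const, Finset.card_univ, nsmul_eq_mul, mul_div_assoc', div_le_iff₀ (by linarith)]
        nlinarith
      have hmem : e y + t ∈ e.target := by
        rw [hc.target_eq, Metric.mem_ball, dist_eq_norm]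
        have h3 : ‖e y + t - e q‖ ≤ ‖e y - e q‖ + ‖t‖ := by
          rw [add_sub_right_comm]
          exact norm_add_le _ _
        rw [Metric.mem_ball, dist_eq_norm] at hy
        linarith
      refine ⟨e.symm (e y + t), (hs (e.map_target hmem)).2, ?_, fun s => ?_⟩
      · rw [hc.proj_symm hmem, map_add, cproj_sum_single, hyc, add_zero, e.left_inv hye]
      · rw [← hc.funChart.coord _ (e.map_target hmem), e.right_inv hmem, PiLp.add_apply,
          sum_single_apply_range, hc.funChart.coord y hye, hN.zero y hyX, zero_add]
    · refine ⟨1, ?_⟩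
      filter_upwards [hX.isOpen_compl.mem_nhds hq] with y hy
      exact ⟨one_pos, fun h => absurd h hy⟩
  obtain ⟨ε, hε⟩ := exists_contMDiffMap_forall_mem_convex_of_local_const (n := (⊤ : ℕ∞)) (𝓡 d)
    hconv hloc
  exact ⟨ε, ε.contMDiff.continuous, fun q => (hε q).1, fun q hq => (hε q).2 hq⟩

/-- Cutting `O` by `|f_s| < ε ∘ π` gives exactly the required box: the choice of `ε` provides
surjectivity, and the other properties restrict from the tube. -/
lemma IsTube.exists_isTubularNeighborhood [T2Space M] [SecondCountableTopology M]
    (hN : IsTube (d := d) (fun s => f (lab s)) X N π) (hX : IsClosed X) {O : Set M} (hO : IsOpen O)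
    (hXO : X ⊆ O) (hON : O ⊆ N) :
    ∃ (U : Set M) (ε : M → ℝ), U ⊆ O ∧
      IsTubularNeighborhood (d := d) X (range lab) f U π ε := by
  obtain ⟨ε, hεc, hε, hsurj⟩ := hN.exists_radius hX hO hXO
  have hπ := hN.contMDiffOn_proj
  have hfs := hN.contMDiffOn_coord
  have hop : IsOpen (O ∩ {u | ∀ s, |f (lab s) u| < ε (π u)}) := by
    refine isOpen_iff_mem_nhds.2 fun u hu => ?_
    have hn := hN.isOpen.mem_nhds (hON hu.1)
    refine inter_mem (hO.mem_nhds hu.1) (eventually_all.2 fun s => ?_)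
    exact (((hfs s).continuousOn.continuousAt hn).abs).eventually_lt
      (hεc.continuousAt.comp (hπ.continuousOn.continuousAt hn)) (hu.2 s)
  have hUN : O ∩ {u | ∀ s, |f (lab s) u| < ε (π u)} ⊆ N := fun u hu => hON hu.1
  refine ⟨_, ε, inter_subset_left, hop, fun q hq => ⟨hXO hq, fun s => ?_⟩, hπ.mono hUN, ?_,
    fun u hu => hN.proj_mem u (hUN hu), fun q hq => ⟨hN.proj_eq q hq, ?_⟩,
    ⟨hεc.continuousOn, fun q _ => hε q⟩, ?_, fun u hu u' hu' h1 h2 => ?_, fun q hq τ hτ => ?_,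
    fun u hu w hw hw0 => ?_⟩
  · rw [hN.zero q hq s, abs_zero]
    exact hε _
  · rintro _ ⟨s, rfl⟩
    exact (hfs s).mono hUN
  · rintro _ ⟨s, rfl⟩
    exact hN.zero q hq s
  · rintro u hu _ ⟨s, rfl⟩
    exact hu.2 s
  · exact hN.injective u (hUN hu) u' (hUN hu') h1 fun s => h2 _ (mem_range_self s)
  · obtain ⟨u, huO, h1, h2⟩ := hsurj q hq (fun s => τ (lab s)) fun s => hτ _ (mem_range_self s)
    refine ⟨u, ⟨huO, fun s => ?_⟩, h1, ?_⟩
    · rw [h1, h2]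
      exact hτ _ (mem_range_self s)
    · rintro _ ⟨s, rfl⟩
      exact h2 s
  · obtain ⟨e, κ, x₀, ρ, hc, -, hue⟩ := hN.chart u (hUN hu)
    exact hc.eq_zero_of_mfderiv_proj hue hw fun s => hw0 _ (mem_range_self s)

end Tubular

/-! ### The normal form in a tubular chart -/

section NormalForm

variable {d : ℕ} {M : Type*} [TopologicalSpace M] [ChartedSpace (Model d) M]
  [IsManifold (𝓡 d) ∞ M] {σ : Type} [Fintype σ] {f : σ → M → ℝ} {X N : Set M} {π : M → M}
  {e : OpenPartialHomeomorph M (Model d)} {κ : σ ↪ Fin d} {x₀ : Model d} {ρ : ℝ}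

lemma IsFunChart.dlog_dpar_logFrame (he : IsFunChart f e κ) {x : Model d} (hx : x ∈ e.target)
    (hx0 : ∀ s, x (κ s) ≠ 0) (s : σ) (w : Model d) :
    dlog (f s) (e.symm x) (dpar e.symm x (logFrame κ x w)) = w (κ s) := by
  rw [dlog, smul_apply, he.dfun_dpar hx, logFrame_apply_range, ← he.coord _ (e.map_target hx),
    e.right_inv hx, smul_eq_mul, inv_mul_cancel_left₀ (hx0 s)]

lemma IsTubChart.inChart_pullback_proj (hc : IsTubChart f π e κ x₀ ρ) {k : ℕ} (Θ : DForm d M k)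
    {x : Model d} (hx : x ∈ e.target) : inChart e (pullback π Θ) x =
      (inChart e Θ (cproj κ x)).compContinuousLinearMap (cproj κ) := by
  have hPx : cproj κ x ∈ e.target := by
    rw [← dil_zero]
    exact hc.cproj_mem hx (left_mem_Icc.2 zero_le_one)
  rw [inChart_pullback hc.funChart.mem_atlas Θ hx hPx (cproj κ).differentiableAt
    ((hc.contMDiffOn_proj.contMDiffAt
      (e.open_source.mem_nhds (e.map_target hx))).mdifferentiableAt (by simp)),
    (cproj κ).hasFDerivAt.fderiv]
  filter_upwards [e.open_target.mem_nhds hx] with y hy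
  exact hc.proj_symm hy

/-- The log components of the normal form in a tubular chart. -/
lemma IsTubChart.toBil_normalForm {k m : ℕ} {f : Fin k ⊕ (Fin k ⊕ Fin m) → M → ℝ}
    {κ : Fin k ⊕ (Fin k ⊕ Fin m) ↪ Fin d} (hc : IsTubChart f π e κ x₀ ρ) (c : Fin k → M → ℝ)
    (α : Fin m → DForm d M 1) (δ : DForm d M 2) {x : Model d} (hx : x ∈ e.target)
    (hx0 : ∀ s, x (κ s) ≠ 0) (u v : Model d) :
    toBil (inChart e (normalForm π c (fun i => f (.inl i)) (fun i => f (.inr (.inl i)))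
        (fun j => f (.inr (.inr j))) α δ) x) (logFrame κ x u) (logFrame κ x v) =
      ∑ i, c i (e.symm (cproj κ x)) *
        (u (κ (.inl i)) * v (κ (.inr (.inl i))) - v (κ (.inl i)) * u (κ (.inr (.inl i)))) +
      ∑ j, (u (κ (.inr (.inr j))) *
          toCov (α j (e.symm (cproj κ x))) (dpar e.symm (cproj κ x) (cproj κ v)) -
        v (κ (.inr (.inr j))) *
          toCov (α j (e.symm (cproj κ x))) (dpar e.symm (cproj κ x) (cproj κ u))) +
      toBil (δ (e.symm (cproj κ x))) (dpar e.symm (cproj κ x) (cproj κ u))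
        (dpar e.symm (cproj κ x) (cproj κ v)) := by
  have h1 : ∀ j w, toCov (pullback π (α j) (e.symm x)) (dpar e.symm x (logFrame κ x w)) =
      toCov (α j (e.symm (cproj κ x))) (dpar e.symm (cproj κ x) (cproj κ w)) := fun j w => by
    rw [← toCov_inChart, hc.inChart_pullback_proj _ hx, toCov_compContinuousLinearMap,
      cproj_logFrame_self, toCov_inChart]
  have h2 : toBil (pullback π δ (e.symm x)) (dpar e.symm x (logFrame κ x u))
      (dpar e.symm x (logFrame κ x v)) = toBil (δ (e.symm (cproj κ x)))
        (dpar e.symm (cproj κ x) (cproj κ u)) (dpar e.symm (cproj κ x) (cproj κ v)) := by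
    rw [← toBil_inChart, hc.inChart_pullback_proj _ hx, toBil_compContinuousLinearMap,
      cproj_logFrame_self, cproj_logFrame_self, toBil_inChart]
  rw [toBil_inChart, normalForm, map_add, map_add, add_apply, add_apply, add_apply, add_apply, h2,
    map_sum, map_sum, sum_apply, sum_apply, sum_apply, sum_apply]
  simp only [map_smul, smul_apply, toBil_wedge, toCov_toOneForm,
    hc.funChart.dlog_dpar_logFrame hx hx0, h1, hc.proj_symm hx, smul_eq_mul]

lemma eq_of_toBil_logFrame (he : e ∈ IsManifold.maximalAtlas (𝓡 d) ∞ M) {Θ Θ' : DForm d M 2}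
    {u : M} (hu : u ∈ e.source) (hx0 : ∀ s, e u (κ s) ≠ 0)
    (h : ∀ w w', toBil (inChart e Θ (e u)) (logFrame κ (e u) w) (logFrame κ (e u) w') =
      toBil (inChart e Θ' (e u)) (logFrame κ (e u) w) (logFrame κ (e u) w')) : Θ u = Θ' u := by
  refine toBil_injective (ContinuousLinearMap.ext fun v => ContinuousLinearMap.ext fun v' => ?_)
  have h1 := h (logInv κ (e u) (dmap e u v)) (logInv κ (e u) (dmap e u v'))
  rwa [logFrame_logInv hx0, logFrame_logInv hx0, toBil_inChart, toBil_inChart, dpar_dmap he hu,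
    dpar_dmap he hu, e.left_inv hu] at h1

/-- The pairing of log coordinates by a partitioned antisymmetric matrix. -/
lemma half_sum_pairing {k m : ℕ} {C : Fin k ⊕ (Fin k ⊕ Fin m) → Fin k ⊕ (Fin k ⊕ Fin m) → ℝ}
    (hC : ∀ s t, C t s = -C s t) (h1 : ∀ i t, t ≠ .inr (.inl i) → C (.inl i) t = 0)
    (h2 : ∀ i t, t ≠ .inl i → C (.inr (.inl i)) t = 0) (h3 : ∀ j t, C (.inr (.inr j)) t = 0)
    (u v : Fin k ⊕ (Fin k ⊕ Fin m) → ℝ) :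
    (1 / 2 : ℝ) * (∑ s, u s * ∑ t, v t * C s t - ∑ s, v s * ∑ t, u t * C s t) =
      ∑ i, C (.inl i) (.inr (.inl i)) *
        (u (.inl i) * v (.inr (.inl i)) - v (.inl i) * u (.inr (.inl i))) := by
  have key : ∀ u v : Fin k ⊕ (Fin k ⊕ Fin m) → ℝ, ∑ s, u s * ∑ t, v t * C s t =
      ∑ i, C (.inl i) (.inr (.inl i)) *
        (u (.inl i) * v (.inr (.inl i)) - v (.inl i) * u (.inr (.inl i))) := fun u v => by
    rw [Fintype.sum_sum_type, Fintype.sum_sum_type]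
    have e1 : ∀ i, ∑ t, v t * C (.inl i) t = v (.inr (.inl i)) * C (.inl i) (.inr (.inl i)) :=
      fun i => Finset.sum_eq_single _ (fun t _ ht => by rw [h1 i t ht, mul_zero])
        fun h => absurd (Finset.mem_univ _) h
    have e2 : ∀ i, ∑ t, v t * C (.inr (.inl i)) t = v (.inl i) * C (.inr (.inl i)) (.inl i) :=
      fun i => Finset.sum_eq_single _ (fun t _ ht => by rw [h2 i t ht, mul_zero])
        fun h => absurd (Finset.mem_univ _) h
    simp only [e1, e2, h3, mul_zero, Finset.sum_const_zero, add_zero, ← Finset.sum_add_distrib]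
    refine Finset.sum_congr rfl fun i _ => ?_
    rw [hC (.inl i) (.inr (.inl i))]
    ring
  rw [key u v, key v u, ← Finset.sum_sub_distrib, Finset.mul_sum]
  refine Finset.sum_congr rfl fun i _ => ?_
  ring

end NormalForm

end
end LogSymp

namespace LogSymp

noncomputable section

set_option linter.unusedSectionVars false
set_option maxSynthPendingDepth 3

/-! ### The normal form theorem -/

section Main

variable {d : ℕ} {M : Type*} [TopologicalSpace M] [ChartedSpace (Model d) M]
  [IsManifold (𝓡 d) ∞ M] {ι : Type*} [Fintype ι] {Z : ι → Set M} {X W : Set M} {Ω a : DForm d M 2}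
  {b : ι → DForm d M 1} {c : ι → ι → M → ℝ} {k m : ℕ} {lab : Fin k ⊕ (Fin k ⊕ Fin m) → ι}

lemma EqOnSubmanifold.mono {A B : Set M} {k : ℕ} {Θ Θ' : DForm d M k}
    (h : EqOnSubmanifold B Θ Θ') (hAB : A ⊆ B) : EqOnSubmanifold A Θ Θ' :=
  fun p hp v hv => h p (hAB hp) v fun i φ hφ hφ0 => hv i φ hφ fun q hq => hφ0 q (hAB hq)

lemma Cohomologous₁.mono {A B : Set M} {Θ Θ' : DForm d M 1} (h : Cohomologous₁ B Θ Θ')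
    (hAB : A ⊆ B) : Cohomologous₁ A Θ Θ' := by
  obtain ⟨φ, hφ, h⟩ := h
  exact ⟨φ, hφ, h.mono hAB⟩

/-- Division on `X` of smooth functions by nowhere zero locally constant functions. -/
lemma exists_contMDiff_mul_eqOn [T2Space M] [SecondCountableTopology M]
    (hX : IsClosed X) {C : Fin k → M → ℝ} (hC0 : ∀ i, ∀ p ∈ X, C i p ≠ 0)
    (hC : ∀ i, ∀ p ∈ X, ∀ᶠ q in 𝓝 p, C i q = C i p) {G : Fin k → M → ℝ}
    (hG : ∀ i, ContMDiff (𝓡 d) 𝓘(ℝ, ℝ) ∞ (G i)) :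
    ∃ u : Fin k → M → ℝ, (∀ i, ContMDiff (𝓡 d) 𝓘(ℝ, ℝ) ∞ (u i)) ∧
      ∀ i, ∀ p ∈ X, C i p * u i p = G i p := by
  have h1 := fun i => exists_contMDiff_eqOn_of_locally (d := d) hX (ψ := fun q => G i q / C i q)
    fun p hp => ⟨fun q => G i q / C i p, (hG i).div_const (C i p), by
      filter_upwards [hC i p hp] with q hq
      rw [hq]⟩
  choose u hu hu' using h1
  exact ⟨u, hu, fun i p hp => by rw [hu' i p hp, mul_div_cancel₀ _ (hC0 i p hp)]⟩

/-- The partition enters only through the block shape of `c` on `X` and the exactness on `X` of the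
`b` of paired labels. These make the equations for the exponents `u` solvable, after which the Moser
equivalence and the formula for the components on `X` are combined. -/
theorem exists_normalForm [T2Space M] [SecondCountableTopology M] (hZ : IsNormalCrossing d Z)
    (hΩ : IsLogSymplectic Z Ω) (hlab : Function.Injective lab) (hX : IsClosed X)
    (hXZ : ∀ q, q ∈ X ↔ ∀ s, q ∈ Z (lab s)) (hmax : ∀ q ∈ X, ∀ i, q ∈ Z i → i ∈ range lab)
    (hW : IsOpen W) (hXW : X ⊆ W) {g : ι → M → ℝ}
    (hg : ∀ s, IsDefiningFunctionOn (d := d) (Z (lab s)) W (g (lab s)))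
    (hdec : IsDecomposition Z Ω a b c)
    (hc0 : ∀ i, ∀ p ∈ X, c (lab (.inl i)) (lab (.inr (.inl i))) p ≠ 0)
    (hc1 : ∀ i t, t ≠ .inr (.inl i) → ∀ p ∈ X, c (lab (.inl i)) (lab t) p = 0)
    (hc2 : ∀ i t, t ≠ .inl i → ∀ p ∈ X, c (lab (.inr (.inl i))) (lab t) p = 0)
    (hc3 : ∀ j t, ∀ p ∈ X, c (lab (.inr (.inr j))) (lab t) p = 0)
    (hb1 : ∀ i, Cohomologous₁ X (b (lab (.inl i))) 0)
    (hb2 : ∀ i, Cohomologous₁ X (b (lab (.inr (.inl i)))) 0) :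
    ∃ (f : ι → M → ℝ) (U : Set M) (π : M → M) (ε : M → ℝ)
      (α : Fin m → DForm d M 1) (δ : DForm d M 2) (φ : OpenPartialHomeomorph M M),
      (∀ s, IsDefiningFunctionOn (d := d) (Z (lab s)) W (f (lab s))) ∧ U ⊆ W ∧
      IsTubularNeighborhood (d := d) X (range lab) f U π ε ∧
      (∀ j, IsSmoothForm (α j) ∧ IsClosedOn X (α j) ∧
        Cohomologous₁ X (α j) (b (lab (.inr (.inr j))))) ∧
      (IsSmoothForm δ ∧ IsClosedOn X δ ∧ Cohomologous₂ X δ a) ∧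
      φ.source = U ∧ (∀ q ∈ X, φ q = q) ∧
      IsLogSymplectomorphism Z φ Ω
        (normalForm π (fun i => c (lab (.inl i)) (lab (.inr (.inl i)))) (fun i => f (lab (.inl i)))
          (fun i => f (lab (.inr (.inl i)))) (fun j => f (lab (.inr (.inr j)))) α δ) := by
  classical
  obtain ⟨μ, R, F, N₀, hμ, hN₀, hXN₀, hN₀W, hN₀Z, hR, hRm, hF, hred⟩ :=
    hdec.exists_isReducedDecomp hZ hX hlab (fun q hq => (hXZ q).1 hq) hmax hW hXW hg
  obtain ⟨ha, hacl, hb, hanti, ℓ, -, hℓ, hbcl, hcc, -, -⟩ := hdec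
  have hbcl' : ∀ s, ∀ p ∈ X, extD (b (lab s)) p = 0 := fun s p hp =>
    (hbcl (lab s) p ((hℓ (lab s)).mem_tsupport ((hXZ p).1 hp s))).self_of_nhds
  have hcc' : ∀ s t, ∀ p ∈ X, ∀ᶠ q in 𝓝 p, c (lab s) (lab t) q = c (lab s) (lab t) p :=
    fun s t p hp => hcc _ _ p ⟨(hℓ (lab s)).mem_tsupport ((hXZ p).1 hp s),
      (hℓ (lab t)).mem_tsupport ((hXZ p).1 hp t)⟩
  choose h₁ hh₁ hb₁ using hb1
  choose h₂ hh₂ hb₂ using hb2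
  -- On `X`, `b_(x_i) = dh₁`. Requiring `F_(x_i) - c_(x_i y_i) u_(y_i) = -h₁` determines the
  -- exponent of the partner `y_i`; the equation of `y_i` below determines that of `x_i`.
  obtain ⟨u₂, hu₂, hu₂'⟩ := exists_contMDiff_mul_eqOn (d := d) hX hc0
    (fun i => hcc' _ _) (G := fun i q => F (.inl i) q + h₁ i q) fun i => (hF _).add (hh₁ i)
  obtain ⟨u₁, hu₁, hu₁'⟩ := exists_contMDiff_mul_eqOn (d := d) hX
    (C := fun i => c (lab (.inr (.inl i))) (lab (.inl i)))
    (fun i p hp => by rw [hanti]; exact neg_ne_zero.2 (hc0 i p hp))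
    (fun i => hcc' _ _) (G := fun i q => F (.inr (.inl i)) q + h₂ i q) fun i => (hF _).add (hh₂ i)
  set u : Fin k ⊕ (Fin k ⊕ Fin m) → M → ℝ := Sum.elim u₁ (Sum.elim u₂ fun _ _ => 0) with hu_def
  have hu : ∀ s, ContMDiff (𝓡 d) 𝓘(ℝ, ℝ) ∞ (u s) := by
    rintro (i | i | j)
    exacts [hu₁ i, hu₂ i, contMDiff_const]
  -- The new functions `F`: for paired labels `b + dF'` restricts to zero on `X`, for unpaired ones
  -- `F` is unchanged because their row of `c` vanishes on `X`.
  set F' : Fin k ⊕ (Fin k ⊕ Fin m) → M → ℝ := Sum.elim (fun i q => -h₁ i q)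
    (Sum.elim (fun i q => -h₂ i q) fun j => F (.inr (.inr j))) with hF'_def
  have hF' : ∀ s, ContMDiff (𝓡 d) 𝓘(ℝ, ℝ) ∞ (F' s) := by
    rintro (i | i | j)
    exacts [(hh₁ i).neg, (hh₂ i).neg, hF _]
  have hFF' : ∀ q ∈ X, ∀ s, F s q - ∑ t, c (lab s) (lab t) q * u t q = F' s q := by
    intro q hq s
    rcases s with i | i | j
    · rw [Finset.sum_eq_single (Sum.inr (Sum.inl i))
        (fun t _ ht => by rw [hc1 i t ht q hq, zero_mul])
        fun h => absurd (Finset.mem_univ _) h]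
      change _ - _ * u₂ i q = -h₁ i q
      rw [hu₂' i q hq]
      ring
    · rw [Finset.sum_eq_single (Sum.inl i)
        (fun t _ ht => by rw [hc2 i t ht q hq, zero_mul])
        fun h => absurd (Finset.mem_univ _) h]
      change _ - _ * u₁ i q = -h₂ i q
      rw [hu₁' i q hq]
      ring
    · rw [Finset.sum_eq_zero fun t _ => by rw [hc3 j t q hq, zero_mul], sub_zero]
      rfl
  obtain ⟨H, hH, hHF⟩ := hred u hu
  set f : ι → M → ℝ := fun i q => g i q * Real.exp (Function.extend lab u 0 i q)
  have hfu : (fun s => f (lab s)) = fun s q => g (lab s) q * Real.exp (u s q) := by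
    funext s q
    change g (lab s) q * Real.exp (Function.extend lab u 0 (lab s) q) = _
    rw [hlab.extend_apply]
  rw [← hfu] at hH
  have hf : ∀ s, IsDefiningFunctionOn (d := d) (Z (lab s)) W (f (lab s)) := fun s => by
    rw [show f (lab s) = _ from congrFun hfu s]
    exact (hg s).mul_exp hW (hu s)
  have hf0 : ∀ q ∈ W, ∀ s, q ∈ Z (lab s) ↔ f (lab s) q = 0 := fun q hq s => (hf s).zero_iff q hq
  have hch : ∀ p ∈ X, ∃ (e : OpenPartialHomeomorph M (Model d))
      (κ : Fin k ⊕ (Fin k ⊕ Fin m) ↪ Fin d), IsFunChart (fun s => f (lab s)) e κ ∧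
        p ∈ e.source := fun p hp => by
    obtain ⟨e, κ₀, he⟩ := hZ p
    obtain ⟨κ, h1, -⟩ := he.exists_isCrossChart hlab ((hXZ p).1 hp) (hmax p hp)
    obtain ⟨e', h2, h3, -⟩ := IsDefiningFunctionOn.exists_isFunChart hf hW h1 he.mem_source (hXW hp)
      ((hXZ p).1 hp)
    exact ⟨e', κ, h2, h3⟩
  obtain ⟨N, π, hNN₀, hN⟩ := exists_tube (d := d) (f := fun s => f (lab s)) hX hN₀ hXN₀
    (fun q hq s => (hf0 q (hXW hq) s).1 ((hXZ q).1 hq s))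
    (fun q hq h => (hXZ q).2 fun s => (hf0 q (hN₀W hq) s).2 (h s))
    (fun s => (hf s).smooth.mono hN₀W) hch
  have hNW : N ⊆ W := hNN₀.trans hN₀W
  have hNZ : ∀ q ∈ N, ∀ i, q ∈ Z i ↔ ∃ s, lab s = i ∧ f i q = 0 := fun q hq i => by
    constructor
    · intro hi
      obtain ⟨s, rfl⟩ := hN₀Z q (hNN₀ hq) i hi
      exact ⟨s, rfl, (hf0 q (hNW hq) s).1 hi⟩
    · rintro ⟨s, rfl, hs⟩
      exact (hf0 q (hNW hq) s).2 hs
  replace hH : IsReducedDecomp lab (fun s => f (lab s)) X N Ω a b c H μ :=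
    { hH with formula := fun p hp => hH.formula p (hNN₀ hp) }
  have hcross : ∀ (e : OpenPartialHomeomorph M (Model d)) (κ : Fin k ⊕ (Fin k ⊕ Fin m) ↪ Fin d),
      IsFunChart (fun s => f (lab s)) e κ → e.source ⊆ N →
        IsCrossChart (fun s => Z (lab s)) e κ := fun e κ he hs =>
    IsDefiningFunctionOn.isCrossChart hf he (hs.trans hNW)
  have hlogμ : ∀ p ∈ X, ∀ (e : OpenPartialHomeomorph M (Model d))
      (κ : Fin k ⊕ (Fin k ⊕ Fin m) ↪ Fin d), IsFunChart (fun s => f (lab s)) e κ → e.source ⊆ N →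
      p ∈ e.source → ∃ (O : Set (Model d)) (m : Model d → Model d [⋀^Fin 1]→L[ℝ] ℝ),
        HasLogExpr μ e κ O m ∧ e p ∈ O := fun p hp e κ he hs hpe =>
    hμ.exists_hasLogExpr hlab ((hXZ p).1 hp) (hmax p hp) (hcross e κ he hs) hpe
  have hmoser := fun p hp => exists_isMoserChart (a := p) hN
    (fun p hp e κ he hs hpe =>
      hΩ.exists_hasLogExpr hlab ((hXZ p).1 hp) (hmax p hp) (hcross e κ he hs) hpe) hlogμ
    (fun p hp hp0 => hΩ.closed p fun hpU => by
      obtain ⟨i, hi⟩ := mem_iUnion.1 hpU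
      obtain ⟨s, rfl, hs⟩ := (hNZ p hp i).1 hi
      exact hp0 s hs) hp
  -- The predicate `Q` ensures that the Moser chart describing the pullback also carries log
  -- components of `μ`, which the formula on `X` requires.
  obtain ⟨O, hO, hXO, hON, hφ⟩ := exists_moser_equivalence hN (Q := fun e κ => ∃ x₀ ρ m,
    IsLogTubChart μ (fun s => f (lab s)) N π e κ x₀ ρ m) hmoser
  obtain ⟨U, ε, hUO, hU⟩ := hN.exists_isTubularNeighborhood hX hO hXO hON
  obtain ⟨φ, hφs, hφ1, hφ2, hφX, hφU⟩ := hφ U hU.isOpen hUO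
  have hUN : U ⊆ N := hUO.trans hON
  obtain ⟨η, hη, hη'⟩ := hH.exists_correction hX (ν := fibreExt μ (fun s => f (lab s)) N π)
    fun p hp => by
      obtain ⟨e, κ, ρ, m, he, hpe, -⟩ := exists_isLogTubChart hN hlogμ hp isOpen_univ (mem_univ p)
      filter_upwards [e.open_source.mem_nhds hpe] with q hq
      exact he.smoothAt_fibreExt hN hq
  have hFe : ∀ (j : Fin m) p, ∀ᶠ q in 𝓝 p, ContMDiffAt (𝓡 d) 𝓘(ℝ, ℝ) ∞ (F (.inr (.inr j))) q :=
    fun j p => Eventually.of_forall fun q => hF _ q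
  have hηd : IsSmoothForm (extD η) := fun p => smoothAt_extD (Eventually.of_forall hη)
  -- The forms `α_j = b + dF` and `δ = a + dη` differ from the given ones by exact forms, so their
  -- classes on `X` are as required.
  refine ⟨f, U, π, ε, fun j => b (lab (.inr (.inr j))) +
    fun q => toOneForm (dfun (F (.inr (.inr j))) q), a + extD η, φ, hf, hUN.trans hNW, hU,
    fun j => ⟨fun p => SmoothAt.add (hb _ p) (smoothAt_dfun (hFe j p)), fun p hp v _ => ?_,
      F (.inr (.inr j)), hF _, fun p _ v _ => ?_⟩,
    ⟨fun p => SmoothAt.add (ha p) (hηd p), fun p _ v _ => ?_, η, hη, fun p _ v _ => ?_⟩,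
    hφs, hφX, hφs ▸ hφ1, hφ2, fun q hq i => ?_, fun q hq hqZ => ?_⟩
  · rw [extD_add (hb _ p) (smoothAt_dfun (hFe j p)), hbcl' _ p hp, extD_dfun (hFe j p), add_zero]
    rfl
  · rw [add_sub_cancel_left]
  · rw [extD_add (ha p) (hηd p), hacl, extD_extD (Eventually.of_forall hη), add_zero]
    rfl
  · rw [add_sub_cancel_left]
  · obtain ⟨h1, h2, -⟩ := hφU q (hφs ▸ hq)
    rw [hNZ _ h1, hNZ _ (hUN (hφs ▸ hq))]
    refine exists_congr fun s => and_congr_right fun hs => ?_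
    subst hs
    exact h2 s
  · have hqU : q ∈ U := hφs ▸ hq
    have hq0 : ∀ s, f (lab s) q ≠ 0 := fun s hs =>
      hqZ (mem_iUnion.2 ⟨_, (hNZ q (hUN hqU) _).2 ⟨s, rfl, hs⟩⟩)
    obtain ⟨-, -, e, κ, x₀, ρ, G, hM, ⟨x₁, ρ₁, m₁, hm⟩, hqe, hexp⟩ := hφU q hqU
    have he := hM.tub.funChart
    have hx := e.map_source hqe
    have hx0 : ∀ s, e q (κ s) ≠ 0 := fun s => by rw [he.coord q hqe]; exact hq0 s
    refine eq_of_toBil_logFrame he.mem_atlas hqe hx0 fun w w' => ?_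
    rw [hexp hq0, hM.tub.toBil_normalForm (f := fun s => f (lab s)) _ _ _ hx hx0]
    have hPx : cproj κ (e q) ∈ e.target := by
      rw [← dil_zero]
      exact hM.tub.cproj_mem hx (left_mem_Icc.2 zero_le_one)
    -- The components of the pullback at `q` are those of `Ω` at the projected point `p ∈ X`, where
    -- they are known.
    set p := e.symm (cproj κ (e q)) with hp_def
    have hpe : p ∈ e.source := e.map_target hPx
    have hpx : e p = cproj κ (e q) := e.right_inv hPx
    have hpX : p ∈ X := hN.symm_mem he hM.subset hPx (cproj_cproj κ _)
    have hgc : ContinuousOn G e.target := by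
      rw [hM.tub.target_eq]
      exact hM.model.logClosed.smooth.continuousOn
    have key := hH.normal_at hN hm hpX hpe hgc hM.expr hR
      (fun q hq hqe s => hRm s q hq e κ e.target m₁ (hcross e κ he hM.subset) hm.expr hqe
        (e.map_source hqe)) hF' (fun q hq s => by rw [← hFF' q hq s, hHF q hq s]) (hη' p hpX) w w'
    rw [hpx] at key
    have htan : ∀ v : Model d, dpar e.symm (cproj κ (e q)) (cproj κ v) ∈ tangentTo d X p :=
      fun v => by
        rw [← hpx]
        exact dpar_cproj_mem_tangentTo he.mem_atlas
          (fun x hx hc => hN.symm_mem he hM.subset hx hc) hpe (by rw [hpx, cproj_cproj]) v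
    -- The mixed terms of a paired label vanish: on vectors tangent to `X` the form `b` equals `dh`,
    -- and the corresponding `F'` is `-h`.
    have hres : ∀ (h : M → ℝ) (i : ι), ContMDiff (𝓡 d) 𝓘(ℝ, ℝ) ∞ h →
        EqOnSubmanifold X (b i - 0) (fun p => toOneForm (dfun h p)) → ∀ v,
        toCov (b i p) (dpar e.symm (cproj κ (e q)) (cproj κ v)) +
          dfun (fun q => -h q) p (dpar e.symm (cproj κ (e q)) (cproj κ v)) = 0 := by
      intro h i hh hbh v
      have h1 := hbh p hpX (fun _ => dpar e.symm (cproj κ (e q)) (cproj κ v)) fun _ => htan v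
      have h2 : dfun (fun q => -h q) p = -dfun (d := d) h p := mfderiv_neg (f := h)
      rw [sub_zero, toOneForm_apply] at h1
      rw [h2, neg_apply, ← h1, ← sub_eq_add_neg, ← toOneForm_toCov (b i p), toCov_toOneForm,
        toOneForm_apply, sub_self]
    rw [key, half_sum_pairing (C := fun s t => c (lab s) (lab t) p) (fun s t => hanti _ _ p)
      (fun i t ht => hc1 i t ht p hpX) (fun i t ht => hc2 i t ht p hpX) (fun j t => hc3 j t p hpX)
      (fun s => w (κ s)) (fun s => w' (κ s))]
    have e1 := fun i => hres (h₁ i) _ (hh₁ i) (hb₁ i)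
    have e2 := fun i => hres (h₂ i) _ (hh₂ i) (hb₂ i)
    simp only [Fintype.sum_sum_type, hF'_def, Sum.elim_inl, Sum.elim_inr, e1, e2, mul_zero,
      Finset.sum_const_zero, zero_add, Pi.add_apply, map_add, add_apply, toCov_toOneForm,
      Finset.sum_sub_distrib]
    ring

end Main

end
end LogSymp

theorem mainTheorem2 {d : ℕ} {M : Type*} [TopologicalSpace M] [T2Space M]
    [SecondCountableTopology M] [ChartedSpace (LogSymp.Model d) M] [IsManifold (𝓡 d) ∞ M]
    {ι : Type*} [Fintype ι] (Z : ι → Set M) (hZ : LogSymp.IsNormalCrossing d Z)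
    (Ω : LogSymp.DForm d M 2) (hΩ : LogSymp.IsLogSymplectic Z Ω)
    (hpart : LogSymp.IsPartitionable Z Ω)
    (S : Set ι) (hS : LogSymp.IsMaximalIntersection Z S)
    (W : Set M) (hW : IsOpen W) (hXW : LogSymp.inter Z S ⊆ W)
    (hdef : ∀ s ∈ S, ∃ f : M → ℝ, LogSymp.IsDefiningFunctionOn (d := d) (Z s) W f)
    (a : LogSymp.DForm d M 2) (b : ι → LogSymp.DForm d M 1) (c : ι → ι → M → ℝ)
    (hdec : LogSymp.IsDecomposition Z Ω a b c)
    (hc : ∀ s ∈ S, ∀ t ∈ S, ¬ LogSymp.VanishesOn (LogSymp.inter Z S) (c s t) →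
      ∀ p ∈ LogSymp.inter Z S, c s t p ≠ 0)
    {k m : ℕ} (x y : Fin k → ι) (z : Fin m → ι)
    (hΛ : LogSymp.IsSubpartition Z c S x y z) :
    ∃ (f : ι → M → ℝ) (U : Set M) (π : M → M) (ε : M → ℝ)
      (α : Fin m → LogSymp.DForm d M 1) (δ : LogSymp.DForm d M 2)
      (φ : OpenPartialHomeomorph M M),
      (∀ s ∈ S, LogSymp.IsDefiningFunctionOn (d := d) (Z s) W (f s)) ∧
      U ⊆ W ∧
      LogSymp.IsTubularNeighborhood (d := d) (LogSymp.inter Z S) S f U π ε ∧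
      (∀ j, LogSymp.IsSmoothForm (α j) ∧ LogSymp.IsClosedOn (LogSymp.inter Z S) (α j) ∧
        LogSymp.Cohomologous₁ (LogSymp.inter Z S) (α j) (b (z j))) ∧
      (LogSymp.IsSmoothForm δ ∧ LogSymp.IsClosedOn (LogSymp.inter Z S) δ ∧
        LogSymp.Cohomologous₂ (LogSymp.inter Z S) δ a) ∧
      φ.source = U ∧ (∀ q ∈ LogSymp.inter Z S, φ q = q) ∧
      LogSymp.IsLogSymplectomorphism Z φ Ω
        (LogSymp.normalForm π (fun i => c (x i) (y i)) (fun i => f (x i)) (fun i => f (y i))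
          (fun j => f (z j)) α δ) := by

  classical
  choose! g hg using hdef
  set lab := Sum.elim x (Sum.elim y z) with hlab_def
  have hrange : range lab = S := by rw [← image_univ]; exact hΛ.bij.image_eq
  have hlab : Function.Injective lab := injOn_univ.1 hΛ.bij.injOn
  have hmem : ∀ s, lab s ∈ S := fun s => hrange ▸ mem_range_self s
  have hXZ : ∀ q, q ∈ LogSymp.inter Z S ↔ ∀ s, q ∈ Z (lab s) := fun q => by
    rw [LogSymp.inter, mem_iInter₂, ← hrange]
    exact forall_mem_range
  have hXs : ∀ s t, LogSymp.inter Z S ⊆ Z (lab s) ∩ Z (lab t) :=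
    fun s t q hq => ⟨(hXZ q).1 hq s, (hXZ q).1 hq t⟩
  have hanti := hdec.2.2.2.1
  -- Non-vanishing on `X` implies non-vanishing on the larger set `Z_(x_i) ∩ Z_(y_i)`, where the
  -- condition of partitionability is formulated; its conclusions are then restricted back to `X`.
  have hpair : ∀ i, ¬ LogSymp.VanishesOn (Z (x i) ∩ Z (y i)) (c (x i) (y i)) := fun i h =>
    hΛ.pair i fun p hp => h p (hXs (.inl i) (.inr (.inl i)) hp)
  have hpart' := fun i => (hpart a b c hdec).2 _ _ (hpair i)
  have hmax : ∀ q ∈ LogSymp.inter Z S, ∀ i, q ∈ Z i → i ∈ range lab := fun q hq i hi => by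
    rw [hrange]
    by_contra hiS
    exact notMem_empty q ((hS.2 i hiS).subset ⟨hi, hq⟩)
  have key := LogSymp.exists_normalForm hZ hΩ hlab (hZ.isClosed_inter S) hXZ hmax hW hXW
    (fun s => hg _ (hmem s)) hdec
    (fun i => hc _ (hmem (.inl i)) _ (hmem (.inr (.inl i))) (hΛ.pair i))
    (fun i t ht p hp => (hpart' i).2.2.1 (lab t) (fun h => ht (hlab h)) p (hXs (.inl i) t hp))
    -- The condition bounds the column of `y_i`; antisymmetry turns it into a statement about the
    -- row.
    (fun i t ht p hp => by
      rw [hanti]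
      exact neg_eq_zero.2 ((hpart' i).2.2.2 (lab t) (fun h => ht (hlab h)) p
        (hXs t (.inr (.inl i)) hp)))
    (fun j t p hp => hΛ.unpaired j _ (hmem t) p hp)
    (fun i => (hpart' i).1.mono (hXs (.inl i) (.inr (.inl i))))
    (fun i => (hpart' i).2.1.mono (hXs (.inl i) (.inr (.inl i))))
  obtain ⟨f, U, π, ε, α, δ, φ, h1, h2, h3, h4⟩ := key
  rw [hrange] at h3
  refine ⟨f, U, π, ε, α, δ, φ, fun s hs => ?_, h2, h3, h4⟩
  obtain ⟨t, rfl⟩ : s ∈ range lab := hrange ▸ hs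
  exact h1 t
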